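/- **Setting.** Let $J$ be a finite non-empty category with $p$ objects and $q$ morphisms (identities included), and let $U$ be a totally ordered domain of data values, some of which are Dewey codes (finite sequences of naturals that address tree nodes). A *category of sets of shape $J$* is a functor $\mathcal C$ on $J$ that assigns to each object a finite set of data values and to each morphism a function. A relation over a set $A$ of objects is a set of tuples with one component in each object of $A$. *Algebra expressions in $J$* denote relations over sets of objects and are built from the objects by: image of a subset under a morphism; selection by $f(x)\,\theta\,g(y)$ or $f(x)\,\theta\,\alpha$, where $f,g$ are morphisms, $\alpha\in U$ and $\theta\in\{=,\neq,<,>,\le,\ge\}$; projection; reading a relation in union-compatible objects; union, intersection, difference; division; the pairs of elements of two different objects that are in the parent, ancestor or sibling relation of Dewey codes, or connected by a path, or by exactly $h$ hops, along a set $K\subseteq E$ of edges with source and target morphisms on $E$ (nodes are identified by their values, and every node reaches itself); and the limit $\{(x_X)_{X\in B}\mid f(x_X)=x_Y \text{ for all } f\colon X\to Y \text{ in } M\}$ of a set $B$ of objects and a set $M$ of morphisms between them, together with relationship objects $R_i$ over subsets of $B$ and their projections (so the restrictions of the tuple must lie in the $R_i$). An *algebra query* is a list of expressions, one for each target; its size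 $k$ is its number of operators, where an $h$-hop operator counts as $h+1$. *Calculus formulas* have one variable $x_X$ for each object $X$, which ranges over $X$ (a query that needs several variables over the same set uses several objects with that set). They are built from the atoms $x\in O$, $f(x)=y$, $f(x)\,\theta\,g(y)$, $f(x)\,\theta\,\alpha$, the tree relations, reachability and $h$-hop reachability between two different variables along the edges of an object $E$, by $\neg,\wedge,\vee,\exists,\forall$. A *calculus query* $\{T_1,\dots,T_m\mid\varphi\}$ has as answers the projections of the set of satisfying assignments of $\varphi$ to the sets $T_1,\dots,T_m$ of free variables; its size $k$ is the size of $\varphi$ (an $h$-hop atom counts as $h+1$) plus $m$. Machines are random access machines with addition and truncated subtraction of naturals and indirect addressing, and a read-only input. The elements of every object are numbered in an arbitrary way. In one step a machine can read the number of elements of an object, apply a morphism to an element, or test a comparison or tree relation between the values of two elements (or a comparison with a constant). Time is the number of steps. Space is the number of bits of the contents and numbers of all registers in use. The program may depend on $J$ and on the query, but not on $\mathcal C$. **Theorem.** 1. There is an absolute constant $c$ such that for every $J$ and $U$ and every calculus or algebra query of size $k$ there is a deterministic program that, for every $n\ge 1$ and every category $\mathcal C$ of sets of shape $J$ in which each object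 has at most $n$ elements, lists the answers to every target of the query, without repetition, within $c\cdot k\cdot q\cdot n^p$ steps. In particular, for a fixed query (data complexity) the time is $O(q\cdot n^p)$. 2. For every $J$ and $U$, every calculus or algebra query and each of its targets, the problem of deciding, given $\mathcal C$ and a tuple, whether the tuple belongs to the answer in $\mathcal C$ is in $\mathrm{NSPACE}[\log n]$: there are a nondeterministic program and a constant $c'$ such that the program has an accepting computation exactly on the answers, and no computation of it uses more than $c'(1+\log_2 n)$ bits if each object of $\mathcal C$ has at most $n\ge 1$ elements. -/

import Mathlib

open CategoryTheory

noncomputable section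

namespace CatQuery

/-! ### Data: a finite category whose objects are finite sets of data values -/

/-- A domain of data values: a total order (for the comparisons `=, ≠, <, >, ≤, ≥`), in which some
values are Dewey codes, that is, finite sequences of naturals that address nodes of a tree. -/
class DataDomain (U : Type) extends LinearOrder U where
  /-- The Dewey code that a value is, if it is one. -/
  dewey : U → Option (List ℕ)

/-- A category of finite sets of shape `J`: a functor from `J` to sets, in which the set attached to
every object is finite and is a set of data values. -/
structure Instance (J U : Type) [SmallCategory J] where
  /-- The sets and the functions between them. -/
  F : J ⥤ Type
  /-- Every set is finite. -/
  fin : ∀ X, Fintype (F.obj X)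
  /-- The elements of every set are data values. -/
  val : ∀ X, F.obj X ↪ U

attribute [instance] Instance.fin

/-- A morphism of `J` together with its source and target. -/
abbrev Mor (J : Type) [SmallCategory J] : Type := Σ X Y : J, (X ⟶ Y)

/-- The number of objects. -/
def numObjects (J : Type) [SmallCategory J] [FinCategory J] : ℕ := Fintype.card J

/-- The number of morphisms (identities included). -/
def numMorphisms (J : Type) [SmallCategory J] [FinCategory J] : ℕ := Fintype.card (Mor J)

section Tuples

variable {J U : Type} [SmallCategory J]

/-- A tuple with one component in each object of `A`. -/
abbrev Tuple (I : Instance J U) (A : Finset J) : Type := ∀ X : {X // X ∈ A}, I.F.obj X.1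

/-- The projection of a tuple to fewer components. -/
def Tuple.restrict {I : Instance J U} {A B : Finset J} (h : B ⊆ A) (t : Tuple I A) : Tuple I B :=
  fun X => t ⟨X.1, h X.2⟩

/-- Add the component `v` at `X`, overwriting the component at `X` if there is one. -/
def Tuple.set [DecidableEq J] {I : Instance J U} {A : Finset J} (t : Tuple I A) (X : J)
    (v : I.F.obj X) : Tuple I (insert X A) :=
  fun Y => if h : Y.1 = X then cast (congrArg I.F.obj h.symm) v else t ⟨Y.1, Finset.mem_of_mem_insert_of_ne Y.2 h⟩

end Tuples

/-! ### Predicates on data values -/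

/-- The comparison operators. -/
inductive Cmp where
  | eq | ne | lt | gt | le | ge

/-- The meaning of the comparison operators. -/
def Cmp.Holds {U : Type} [LinearOrder U] : Cmp → U → U → Prop
  | eq, u, v => u = v
  | ne, u, v => u ≠ v
  | lt, u, v => u < v
  | gt, u, v => u > v
  | le, u, v => u ≤ v
  | ge, u, v => u ≥ v

/-- The structural predicates on the nodes of a tree. -/
inductive TreeRel where
  | parent | ancestor | sibling

/-- The meaning of the structural predicates on Dewey codes. -/
def TreeRel.HoldsCode : TreeRel → List ℕ → List ℕ → Prop
  | parent, d, e => ∃ k, e = d ++ [k]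
  | ancestor, d, e => ∃ s, s ≠ [] ∧ e = d ++ s
  | sibling, d, e => d ≠ e ∧ ∃ s k l, d = s ++ [k] ∧ e = s ++ [l]

/-- The meaning of the structural predicates on data values: both are Dewey codes, and the codes are
in the relation. -/
def TreeRel.Holds {U : Type} [DataDomain U] (τ : TreeRel) (u v : U) : Prop :=
  ∃ d e, DataDomain.dewey u = some d ∧ DataDomain.dewey v = some e ∧ τ.HoldsCode d e

section Graph

variable {J U : Type} [SmallCategory J]

/-- The directed graph on data values given by a set `K` of edges with source and target maps. -/
def EdgeRel (I : Instance J U) {E V W : J} (src : E ⟶ V) (tgt : E ⟶ W) (K : Set (I.F.obj E))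
    (u v : U) : Prop :=
  ∃ e ∈ K, I.val V (I.F.map src e) = u ∧ I.val W (I.F.map tgt e) = v

/-- There is a walk with exactly `h` edges. -/
def Hops {α : Type} (r : α → α → Prop) : ℕ → α → α → Prop
  | 0, u, v => u = v
  | h + 1, u, w => ∃ v, Hops r h u v ∧ r v w

end Graph

/-! ### Categorical algebra -/

/-- Expressions of categorical algebra in the category `J`. `Alg J U A` holds the expressions whose
value is a relation with one component in each object of `A`. -/
inductive Alg (J U : Type) [SmallCategory J] [DecidableEq J] : Finset J → Type
  /-- An object of the category. -/
  | obj (X : J) : Alg J U {X}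
  /-- The image of a subset of `X` under a morphism. -/
  | map {X Y : J} (f : X ⟶ Y) (R : Alg J U {X}) : Alg J U {Y}
  /-- Selection by `f(x) θ g(y)`. -/
  | select {A : Finset J} {X Y X' Y' : J} (hX : X ∈ A) (hY : Y ∈ A) (f : X ⟶ X') (θ : Cmp)
      (g : Y ⟶ Y') (R : Alg J U A) : Alg J U A
  /-- Selection by `f(x) θ α`. -/
  | selectConst {A : Finset J} {X X' : J} (hX : X ∈ A) (f : X ⟶ X') (θ : Cmp) (α : U)
      (R : Alg J U A) : Alg J U A
  /-- Projection. -/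
  | project {A B : Finset J} (h : B ⊆ A) (R : Alg J U A) : Alg J U B
  /-- The tuples of `R`, read as tuples of union-compatible objects. -/
  | recast {A B : Finset J} (σ : {X // X ∈ B} ≃ {X // X ∈ A}) (R : Alg J U A) : Alg J U B
  /-- Union. -/
  | union {A : Finset J} (R S : Alg J U A) : Alg J U A
  /-- Intersection. -/
  | inter {A : Finset J} (R S : Alg J U A) : Alg J U A
  /-- Difference. -/
  | diff {A : Finset J} (R S : Alg J U A) : Alg J U A
  /-- Division `R[B] ÷ S[B]`. -/
  | div {A D B : Finset J} (hA : B ⊆ A) (hD : B ⊆ D) (R : Alg J U A) (S : Alg J U D) :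
      Alg J U (A \ B)
  /-- The pairs of elements of `R` and `S` in a tree relation (`getParent` for `TreeRel.parent`). -/
  | getTree {X Y : J} (hXY : X ≠ Y) (τ : TreeRel) (R : Alg J U {X}) (S : Alg J U {Y}) :
      Alg J U {X, Y}
  /-- The pairs of elements of `R` and `S` connected by a path of edges in `K`. -/
  | getReach {X Y E V W : J} (hXY : X ≠ Y) (src : E ⟶ V) (tgt : E ⟶ W) (R : Alg J U {X})
      (S : Alg J U {Y}) (K : Alg J U {E}) : Alg J U {X, Y}
  /-- The pairs of elements of `R` and `S` connected by `h` hops along edges in `K`. -/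
  | getnHop {X Y E V W : J} (hXY : X ≠ Y) (src : E ⟶ V) (tgt : E ⟶ W) (h : ℕ)
      (R : Alg J U {X}) (S : Alg J U {Y}) (K : Alg J U {E}) : Alg J U {X, Y}
  /-- The limit of the category whose objects are the objects in `B` and the relationship objects
  `R i`, and whose morphisms are those in `M` and the projections of the `R i` to their
  components. -/
  | lim (B : Finset J) (M : Finset (Mor J)) (hM : ∀ m ∈ M, m.1 ∈ B ∧ m.2.1 ∈ B) {r : ℕ}
      (A : Fin r → Finset J) (hA : ∀ i, A i ⊆ B) (R : ∀ i, Alg J U (A i)) : Alg J U B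

namespace Alg

variable {J U : Type} [SmallCategory J] [DecidableEq J]

/-- The number of operators; an `h`-hop operator counts as `h + 1` operators. -/
def size : {A : Finset J} → Alg J U A → ℕ
  | _, obj _ => 1
  | _, map _ R => R.size + 1
  | _, select _ _ _ _ _ R => R.size + 1
  | _, selectConst _ _ _ _ R => R.size + 1
  | _, project _ R => R.size + 1
  | _, recast _ R => R.size + 1
  | _, union R S => R.size + S.size + 1
  | _, inter R S => R.size + S.size + 1
  | _, diff R S => R.size + S.size + 1
  | _, div _ _ R S => R.size + S.size + 1
  | _, getTree _ _ R S => R.size + S.size + 1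
  | _, getReach _ _ _ R S K => R.size + S.size + K.size + 1
  | _, getnHop _ _ _ h R S K => R.size + S.size + K.size + h + 1
  | _, lim _ _ _ _ _ R => ∑ i, (R i).size + 1

/-- The value of an expression. -/
def eval [DataDomain U] (I : Instance J U) : {A : Finset J} → Alg J U A → Set (Tuple I A)
  | _, obj _ => Set.univ
  | _, @map _ _ _ _ X Y f R =>
      {t | ∃ s ∈ R.eval I,
        t ⟨Y, Finset.mem_singleton_self Y⟩ = I.F.map f (s ⟨X, Finset.mem_singleton_self X⟩)}
  | _, @select _ _ _ _ _ X Y X' Y' hX hY f θ g R =>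
      {t | t ∈ R.eval I ∧
        θ.Holds (I.val X' (I.F.map f (t ⟨X, hX⟩))) (I.val Y' (I.F.map g (t ⟨Y, hY⟩)))}
  | _, @selectConst _ _ _ _ _ X X' hX f θ α R =>
      {t | t ∈ R.eval I ∧ θ.Holds (I.val X' (I.F.map f (t ⟨X, hX⟩))) α}
  | _, project h R => {t | ∃ s ∈ R.eval I, t = s.restrict h}
  | _, recast σ R => {t | ∃ s ∈ R.eval I, ∀ X, I.val X.1 (t X) = I.val (σ X).1 (s (σ X))}
  | _, union R S => R.eval I ∪ S.eval I
  | _, inter R S => R.eval I ∩ S.eval I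
  | _, diff R S => R.eval I \ S.eval I
  | _, div hA hD R S =>
      {t | (∃ r ∈ R.eval I, r.restrict Finset.sdiff_subset = t) ∧
        ∀ s ∈ S.eval I, ∃ r ∈ R.eval I,
          r.restrict Finset.sdiff_subset = t ∧ r.restrict hA = s.restrict hD}
  | _, @getTree _ _ _ _ X Y _ τ R S =>
      {t | t.restrict (by simp) ∈ R.eval I ∧ t.restrict (by simp) ∈ S.eval I ∧
        τ.Holds (I.val X (t ⟨X, by simp⟩)) (I.val Y (t ⟨Y, by simp⟩))}
  | _, @getReach _ _ _ _ X Y E _ _ _ src tgt R S K =>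
      {t | t.restrict (by simp) ∈ R.eval I ∧ t.restrict (by simp) ∈ S.eval I ∧
        Relation.ReflTransGen (EdgeRel I src tgt {e | ∃ s ∈ K.eval I, s ⟨E, by simp⟩ = e})
          (I.val X (t ⟨X, by simp⟩)) (I.val Y (t ⟨Y, by simp⟩))}
  | _, @getnHop _ _ _ _ X Y E _ _ _ src tgt h R S K =>
      {t | t.restrict (by simp) ∈ R.eval I ∧ t.restrict (by simp) ∈ S.eval I ∧
        Hops (EdgeRel I src tgt {e | ∃ s ∈ K.eval I, s ⟨E, by simp⟩ = e}) h
          (I.val X (t ⟨X, by simp⟩)) (I.val Y (t ⟨Y, by simp⟩))}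
  | _, lim _ M hM _ hA R =>
      {t | (∀ i, t.restrict (hA i) ∈ (R i).eval I) ∧
        ∀ (m : Mor J) (hm : m ∈ M),
          I.F.map m.2.2 (t ⟨m.1, (hM m hm).1⟩) = t ⟨m.2.1, (hM m hm).2⟩}

end Alg

/-! ### Categorical calculus -/

/-- Formulas of categorical calculus. There is one variable for each object, it ranges over that
object, and `Formula J U A` holds the formulas whose free variables are those in `A`. -/
inductive Formula (J U : Type) [SmallCategory J] [DecidableEq J] : Finset J → Type
  /-- Range term: the value of `x` belongs to the object `O`. -/
  | mem {A : Finset J} {X : J} (hX : X ∈ A) (O : J) : Formula J U A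
  /-- `f(x) = y`. -/
  | app {A : Finset J} {X Y : J} (hX : X ∈ A) (hY : Y ∈ A) (f : X ⟶ Y) : Formula J U A
  /-- `f(x) θ g(y)`. -/
  | cmp {A : Finset J} {X Y X' Y' : J} (hX : X ∈ A) (hY : Y ∈ A) (f : X ⟶ X') (θ : Cmp)
      (g : Y ⟶ Y') : Formula J U A
  /-- `f(x) θ α`. -/
  | cmpConst {A : Finset J} {X X' : J} (hX : X ∈ A) (f : X ⟶ X') (θ : Cmp) (α : U) :
      Formula J U A
  /-- A tree relation between `x` and `y`. -/
  | tree {A : Finset J} {X Y : J} (hX : X ∈ A) (hY : Y ∈ A) (hXY : X ≠ Y) (τ : TreeRel) :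
      Formula J U A
  /-- `y` is reachable from `x` along edges in `E`. -/
  | reach {A : Finset J} {X Y E V W : J} (hX : X ∈ A) (hY : Y ∈ A) (hXY : X ≠ Y) (src : E ⟶ V)
      (tgt : E ⟶ W) : Formula J U A
  /-- `y` is reached from `x` by `h` hops along edges in `E`. -/
  | nHop {A : Finset J} {X Y E V W : J} (hX : X ∈ A) (hY : Y ∈ A) (hXY : X ≠ Y) (src : E ⟶ V)
      (tgt : E ⟶ W) (h : ℕ) : Formula J U A
  | not {A : Finset J} (φ : Formula J U A) : Formula J U A
  | and {A : Finset J} (φ ψ : Formula J U A) : Formula J U A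
  | or {A : Finset J} (φ ψ : Formula J U A) : Formula J U A
  | ex {A : Finset J} (X : J) (φ : Formula J U (insert X A)) : Formula J U A
  | all {A : Finset J} (X : J) (φ : Formula J U (insert X A)) : Formula J U A

namespace Formula

variable {J U : Type} [SmallCategory J] [DecidableEq J]

/-- The size of a formula; an `h`-hop atom counts as `h + 1`. -/
def size : {A : Finset J} → Formula J U A → ℕ
  | _, mem _ _ => 1
  | _, app _ _ _ => 1
  | _, cmp _ _ _ _ _ => 1
  | _, cmpConst _ _ _ _ => 1
  | _, tree _ _ _ _ => 1
  | _, reach _ _ _ _ _ => 1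
  | _, nHop _ _ _ _ _ h => h + 1
  | _, not φ => φ.size + 1
  | _, and φ ψ => φ.size + ψ.size + 1
  | _, or φ ψ => φ.size + ψ.size + 1
  | _, ex _ φ => φ.size + 1
  | _, all _ φ => φ.size + 1

/-- Satisfaction of a formula by an assignment of its free variables. -/
def Sat [DataDomain U] (I : Instance J U) : {A : Finset J} → Formula J U A → Tuple I A → Prop
  | _, @mem _ _ _ _ _ X hX O, t => ∃ o, I.val O o = I.val X (t ⟨X, hX⟩)
  | _, @app _ _ _ _ _ X Y hX hY f, t => I.F.map f (t ⟨X, hX⟩) = t ⟨Y, hY⟩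
  | _, @cmp _ _ _ _ _ X Y X' Y' hX hY f θ g, t =>
      θ.Holds (I.val X' (I.F.map f (t ⟨X, hX⟩))) (I.val Y' (I.F.map g (t ⟨Y, hY⟩)))
  | _, @cmpConst _ _ _ _ _ X X' hX f θ α, t => θ.Holds (I.val X' (I.F.map f (t ⟨X, hX⟩))) α
  | _, @tree _ _ _ _ _ X Y hX hY _ τ, t =>
      τ.Holds (I.val X (t ⟨X, hX⟩)) (I.val Y (t ⟨Y, hY⟩))
  | _, @reach _ _ _ _ _ X Y _ _ _ hX hY _ src tgt, t =>
      Relation.ReflTransGen (EdgeRel I src tgt Set.univ)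
        (I.val X (t ⟨X, hX⟩)) (I.val Y (t ⟨Y, hY⟩))
  | _, @nHop _ _ _ _ _ X Y _ _ _ hX hY _ src tgt h, t =>
      Hops (EdgeRel I src tgt Set.univ) h (I.val X (t ⟨X, hX⟩)) (I.val Y (t ⟨Y, hY⟩))
  | _, not φ, t => ¬ φ.Sat I t
  | _, and φ ψ, t => φ.Sat I t ∧ ψ.Sat I t
  | _, or φ ψ, t => φ.Sat I t ∨ ψ.Sat I t
  | _, ex X φ, t => ∃ v, φ.Sat I (t.set X v)
  | _, all X φ, t => ∀ v, φ.Sat I (t.set X v)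

end Formula

/-! ### Queries and their answers -/

/-- One target of a query: the objects that its tuples have components in, and, for every instance,
the set of its tuples. -/
structure Target (J U : Type) [SmallCategory J] where
  /-- The components. -/
  T : Finset J
  /-- The answer. -/
  answer : ∀ I : Instance J U, Set (Tuple I T)

/-- An algebra query: one expression for each of its target objects. -/
abbrev AlgebraQuery (J U : Type) [SmallCategory J] [DecidableEq J] : Type :=
  List (Σ A : Finset J, Alg J U A)

/-- The number of operators of an algebra query. -/
def AlgebraQuery.size {J U : Type} [SmallCategory J] [DecidableEq J] (Q : AlgebraQuery J U) : ℕ :=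
  (Q.map fun e => e.2.size).sum

/-- The targets of an algebra query. -/
def AlgebraQuery.targets {J U : Type} [SmallCategory J] [DecidableEq J] [DataDomain U]
    (Q : AlgebraQuery J U) : List (Target J U) :=
  Q.map fun e => ⟨e.1, fun I => e.2.eval I⟩

/-- A calculus query `{T₁, …, Tₘ | φ}`: its targets are variables or tuples of variables. -/
structure CalculusQuery (J U : Type) [SmallCategory J] [DecidableEq J] where
  /-- The free variables of the query. -/
  A : Finset J
  /-- The target variables and tuples of variables. -/
  heads : List {T : Finset J // T ⊆ A}
  /-- The qualification. -/
  body : Formula J U A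

/-- The size of a calculus query. -/
def CalculusQuery.size {J U : Type} [SmallCategory J] [DecidableEq J]
    (Q : CalculusQuery J U) : ℕ :=
  Q.body.size + Q.heads.length

/-- The targets of a calculus query. -/
def CalculusQuery.targets {J U : Type} [SmallCategory J] [DecidableEq J] [DataDomain U]
    (Q : CalculusQuery J U) : List (Target J U) :=
  Q.heads.map fun T => ⟨T.1, fun I => {t | ∃ s : Tuple I Q.A, Q.body.Sat I s ∧ t = s.restrict T.2}⟩

/-! ### Random access machines -/

/-- The read-only input of a machine. The elements of every object are numbered from `0`. -/
structure Input (J U : Type) [SmallCategory J] where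
  /-- The number of elements of an object. -/
  card : J → ℕ
  /-- The functions, on numbers of elements. -/
  app : Mor J → ℕ → ℕ
  /-- The data values of the elements. -/
  value : J → ℕ → Option U
  /-- Further numbers, for a candidate answer. -/
  arg : ℕ → ℕ

/-- Instructions. Registers are numbered by naturals, and `d`, `r`, `s` are registers. -/
inductive Instr (J U : Type) [SmallCategory J] where
  /-- `d := k`. -/
  | const (d k : ℕ)
  /-- `d := r`. -/
  | copy (d r : ℕ)
  /-- `d := r + s`. -/
  | plus (d r s : ℕ)
  /-- `d := r - s`, or `0` if `r < s`. -/
  | minus (d r s : ℕ)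
  /-- `d :=` the content of the register whose number is in `r`. -/
  | load (d r : ℕ)
  /-- The register whose number is in `d` is set to the content of `r`. -/
  | store (d r : ℕ)
  /-- Continue at instruction `l` if `r` contains `0`. -/
  | jumpZero (r l : ℕ)
  /-- `d :=` the number of elements of `X`. -/
  | card (d : ℕ) (X : J)
  /-- `d := f(r)`. -/
  | app (d : ℕ) (f : Mor J) (r : ℕ)
  /-- `d := 1` if the value of element `r` of `X` and that of element `s` of `Y` compare, or `0`. -/
  | cmp (d : ℕ) (θ : Cmp) (X : J) (r : ℕ) (Y : J) (s : ℕ)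
  /-- `d := 1` if the value of element `r` of `X` and the constant compare, otherwise `0`. -/
  | cmpConst (d : ℕ) (θ : Cmp) (X : J) (r : ℕ) (α : U)
  /-- `d := 1` if the values of two elements are in the tree relation, otherwise `0`. -/
  | tree (d : ℕ) (τ : TreeRel) (X : J) (r : ℕ) (Y : J) (s : ℕ)
  /-- `d :=` number `k` of the candidate answer. -/
  | arg (d k : ℕ)
  /-- `d :=` a bit that is chosen nondeterministically. -/
  | choose (d : ℕ)
  /-- Append the content of `r` to the write-only output tape `ch`. -/
  | out (ch r : ℕ)

/-- A program is a finite list of instructions. -/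
abbrev Program (J U : Type) [SmallCategory J] : Type := List (Instr J U)

/-- A configuration: program counter, contents of the registers, and output tapes. -/
structure Config where
  /-- The program counter. -/
  pc : ℕ
  /-- The contents of the registers. -/
  mem : ℕ →₀ ℕ
  /-- The contents of the output tapes. -/
  out : ℕ → List ℕ

/-- The initial configuration. -/
def Config.init : Config := ⟨0, 0, fun _ => []⟩

/-- Set register `d` to `v` and go to the next instruction. -/
def Config.put (c : Config) (d v : ℕ) : Config := ⟨c.pc + 1, c.mem.update d v, c.out⟩

/-- The number of bits in use: those of the numbers and of the contents of all registers in use. -/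
def Config.space (c : Config) : ℕ := ∑ a ∈ c.mem.support, (Nat.size a + Nat.size (c.mem a))

section Machine

variable {J U : Type} [SmallCategory J] [DataDomain U]

open Classical in
/-- The effect of one instruction, where `b` is the bit for a nondeterministic choice. -/
def Instr.exec (inp : Input J U) (b : Bool) (c : Config) : Instr J U → Config
  | const d k => c.put d k
  | copy d r => c.put d (c.mem r)
  | plus d r s => c.put d (c.mem r + c.mem s)
  | minus d r s => c.put d (c.mem r - c.mem s)
  | load d r => c.put d (c.mem (c.mem r))
  | store d r => c.put (c.mem d) (c.mem r)
  | jumpZero r l => if c.mem r = 0 then ⟨l, c.mem, c.out⟩ else ⟨c.pc + 1, c.mem, c.out⟩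
  | card d X => c.put d (inp.card X)
  | app d f r => c.put d (inp.app f (c.mem r))
  | cmp d θ X r Y s => c.put d
      (if ∃ u v, inp.value X (c.mem r) = some u ∧ inp.value Y (c.mem s) = some v ∧ θ.Holds u v
        then 1 else 0)
  | cmpConst d θ X r α => c.put d
      (if ∃ u, inp.value X (c.mem r) = some u ∧ θ.Holds u α then 1 else 0)
  | tree d τ X r Y s => c.put d
      (if ∃ u v, inp.value X (c.mem r) = some u ∧ inp.value Y (c.mem s) = some v ∧ τ.Holds u v
        then 1 else 0)
  | arg d k => c.put d (inp.arg k)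
  | choose d => c.put d b.toNat
  | out ch r => ⟨c.pc + 1, c.mem, Function.update c.out ch (c.out ch ++ [c.mem r])⟩

namespace Program

/-- One step; a configuration whose program counter is outside of the program has halted. -/
def step (P : Program J U) (inp : Input J U) (b : Bool) (c : Config) : Config :=
  match P[c.pc]? with
  | none => c
  | some i => i.exec inp b c

/-- The program makes no nondeterministic choices. -/
def Deterministic (P : Program J U) : Prop := ∀ d, Instr.choose d ∉ P

/-- The configuration has halted. -/
def Halted (P : Program J U) (c : Config) : Prop := P.length ≤ c.pc

/-- The configuration after `k` steps of a deterministic program. -/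
def run (P : Program J U) (inp : Input J U) (k : ℕ) : Config := (P.step inp false)^[k] Config.init

/-- Some sequence of choices leads to the configuration. -/
def Reaches (P : Program J U) (inp : Input J U) (c : Config) : Prop :=
  Relation.ReflTransGen (fun c c' => ∃ b, c' = P.step inp b c) Config.init c

/-- Some computation halts with `1` in register `0`. -/
def Accepts (P : Program J U) (inp : Input J U) : Prop :=
  ∃ c, P.Reaches inp c ∧ P.Halted c ∧ c.mem 0 = 1

end Program

end Machine

/-! ### Complexity of queries -/

section Complexity

variable {J U : Type} [SmallCategory J]

/-- A numbering of the elements of every object. -/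
abbrev Numbering (I : Instance J U) : Type := ∀ X, I.F.obj X ≃ Fin (Fintype.card (I.F.obj X))

/-- The numbers of the components of a tuple, in an order that depends on the components alone. -/
def Tuple.code {I : Instance J U} (ν : Numbering I) {T : Finset J} (t : Tuple I T) : List ℕ :=
  T.attach.toList.map fun X => (ν X.1 (t X) : ℕ)

/-- An instance with numbered elements, and a candidate answer, as machine input. -/
def Instance.input (I : Instance J U) (ν : Numbering I) (a : List ℕ) : Input J U where
  card X := Fintype.card (I.F.obj X)
  app f k := if h : k < Fintype.card (I.F.obj f.1) then
      (ν f.2.1 (I.F.map f.2.2 ((ν f.1).symm ⟨k, h⟩)) : ℕ) else 0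
  value X k := if h : k < Fintype.card (I.F.obj X) then
      some (I.val X ((ν X).symm ⟨k, h⟩)) else none
  arg k := a.getD k 0

/-- `w` lists the tuples of `S`, each exactly once, in some order. Each tuple is written as its
length followed by its components. -/
def IsListing {I : Instance J U} (ν : Numbering I) {T : Finset J} (S : Set (Tuple I T))
    (w : List ℕ) : Prop :=
  ∃ L : List (Tuple I T), L.Nodup ∧ (∀ t, t ∈ L ↔ t ∈ S) ∧
    w = (L.map fun t => T.card :: t.code ν).flatten

/-- A fixed deterministic program computes the answers to all the targets within `time n` steps, on
every instance (with any numbering) whose objects have at most `n` elements, for `n ≥ 1`. -/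
def ComputableInTime [DataDomain U] (Q : List (Target J U)) (time : ℕ → ℕ) : Prop :=
  ∃ P : Program J U, P.Deterministic ∧
    ∀ (I : Instance J U) (ν : Numbering I) (n : ℕ), 1 ≤ n →
      (∀ X, Fintype.card (I.F.obj X) ≤ n) →
      ∃ k ≤ time n, P.Halted (P.run (I.input ν []) k) ∧
        ∀ (i : ℕ) (hi : i < Q.length),
          IsListing ν ((Q[i]).answer I) ((P.run (I.input ν []) k).out i)

/-- The problem whether a given tuple is an answer is in `NSPACE[log n]`: a fixed nondeterministic
program accepts exactly the answers, and none of its computations uses more than `O(log n)` bits, if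
the objects have at most `n` elements. -/
def InNSpaceLog [DataDomain U] (Q : Target J U) : Prop :=
  ∃ (P : Program J U) (c : ℕ),
    ∀ (I : Instance J U) (ν : Numbering I) (t : Tuple I Q.T),
      (P.Accepts (I.input ν (t.code ν)) ↔ t ∈ Q.answer I) ∧
      ∀ n : ℕ, 1 ≤ n → (∀ X, Fintype.card (I.F.obj X) ≤ n) →
        ∀ s, P.Reaches (I.input ν (t.code ν)) s → s.space ≤ c * (Nat.log 2 n + 1)

end Complexity

end CatQuery

end

/-! Both halves pass through a small core language, `Core`, whose expressions are predicates on
assignments of element numbers to all objects. Algebra expressions and formulas are translated into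
it (`Alg.sem_core`, `Formula.sem_core`). An operator becomes boundedly many core operators of cost
`O(p)` per tuple, or `O((h + 1) * p)` for `h` hops; a limit adds at most `q` equations. Since
identities give `p ≤ q`, a query of size `k` has weight `O(k * q)` (`Alg.weight_core_le`,
`Formula.weight_core_le`).

Time. Every subexpression is tabulated over all `N ^ p` assignments, where `N` is the largest number
of elements of an object, but at least `1`. Boolean operators act entry by entry. Three operators
need an idea to stay within a constant number of passes over `N ^ p` entries. An image (projection,
quantifier, division) is scattered from its source: one pass over the source tuples marks the target
entries (`wp_imageOp`). Reachability is searched from each start separately, and the search is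
linear because the successors of an edge are chained into a list: an edge leads only to its greatest
successor and to the next smaller edge with the same source (`exists_thread_iff`, `wp_reachOp`). A
hop is the composition of a relation with two partial functions on edges, so it takes one pass over
pairs of a start and an edge (`hopRel_iff`, `wp_hopOp`). These walk operators take quadratic time,
and `N ^ 2 ≤ N ^ p` because their endpoints lie in two different objects.

The algorithms are written in a language of arrays and bounded loops, which is compiled to
structured programs (`HCmd.big`) and then to machine code (`Big.steps`), with step counts
throughout. There is no multiplication: `N ^ p` is found by counting, and multiples of `N ^ i` are
stored in arrays (`wp_countOp`, `wp_weightsOp`).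

Space. For a fixed query, conditions and quantifiers need a fixed number of registers that hold
element numbers. Negated reachability needs the Immerman–Szelepcsényi method of inductive counting:
from the number of vertices in one layer of a search, a nondeterministic program finds the number in
the next layer, and once the last number is known, non-membership can be certified too
(`LogFun.existsIn`, `LogFun.card_layerSet_succ`, `LogDec.reach`). The notion `LogFun` asks that
every halting computation yields the right value and that one exists, so it is closed under
complement and composition. Without addition and computed addresses all numbers stay at most `n`
plus a constant, which bounds the space (`Program.Reaches.mem_le`). -/

set_option linter.unusedSectionVars false
noncomputable section
namespace CatQuery

/-! ### A structured language for random access machines -/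

section Structured

variable {J U : Type} [SmallCategory J]

/-- Contents of the registers and of the output tapes. -/
structure St where
  mem : ℕ → ℕ
  out : ℕ → List ℕ

/-- Set register `d` to `v`. -/
def St.put (σ : St) (d v : ℕ) : St := ⟨Function.update σ.mem d v, σ.out⟩

theorem St.put_mem (σ : St) (d v a : ℕ) : (σ.put d v).mem a = if a = d then v else σ.mem a := by
  simp [St.put, Function.update_apply]

@[simp] theorem St.put_mem_same (σ : St) (d v : ℕ) : (σ.put d v).mem d = v := by
  simp [St.put_mem]

theorem St.put_mem_ne (σ : St) {d a : ℕ} (v : ℕ) (h : a ≠ d) : (σ.put d v).mem a = σ.mem a := by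
  simp [St.put_mem, h]

/-- The registers and output tapes of a configuration. -/
def Config.toSt (c : Config) : St := ⟨c.mem, c.out⟩

/-- `1` for a true proposition and `0` for a false one. -/
def flag (P : Prop) : ℕ := @ite ℕ P (Classical.propDecidable P) 1 0

theorem flag_true {P : Prop} (h : P) : flag P = 1 := by simp [flag, h]

theorem flag_false {P : Prop} (h : ¬ P) : flag P = 0 := by simp [flag, h]

theorem flag_le_one (P : Prop) : flag P ≤ 1 := by
  by_cases h : P <;> simp [flag, h]

@[simp] theorem flag_eq_zero {P : Prop} : flag P = 0 ↔ ¬ P := by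
  by_cases h : P <;> simp [flag, h]

@[simp] theorem flag_eq_one {P : Prop} : flag P = 1 ↔ P := by
  by_cases h : P <;> simp [flag, h]

theorem flag_congr {P Q : Prop} (h : P ↔ Q) : flag P = flag Q := by rw [propext h]

/-- Structured programs. -/
inductive Cmd (J U : Type) [SmallCategory J] where
  | skip
  | instr (i : Instr J U)
  | seq (a b : Cmd J U)
  /-- Execute `c` if register `r` is not `0`. -/
  | ifNZ (r : ℕ) (c : Cmd J U)
  /-- Execute `c` repeatedly until register `r` is not `0`. -/
  | loop (c : Cmd J U) (r : ℕ)

/-- The instruction is a jump. -/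
def Instr.IsJump : Instr J U → Prop
  | jumpZero _ _ => True
  | _ => False

namespace Cmd

/-- The number of instructions. -/
def len : Cmd J U → ℕ
  | skip => 0
  | instr _ => 1
  | seq a b => a.len + b.len
  | ifNZ _ c => c.len + 1
  | loop c _ => c.len + 1

/-- The instructions of a structured program that starts at position `o`. -/
def compile : Cmd J U → ℕ → List (Instr J U)
  | skip, _ => []
  | instr i, _ => [i]
  | seq a b, o => a.compile o ++ b.compile (o + a.len)
  | ifNZ r c, o => .jumpZero r (o + (c.len + 1)) :: c.compile (o + 1)
  | loop c r, o => c.compile o ++ [.jumpZero r o]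

@[simp] theorem length_compile (c : Cmd J U) (o : ℕ) : (c.compile o).length = c.len := by
  induction c generalizing o <;> simp_all [compile, len]

/-- The instructions of the structured program satisfy `p`. -/
def All (p : Instr J U → Prop) : Cmd J U → Prop
  | skip => True
  | instr i => p i
  | seq a b => a.All p ∧ b.All p
  | ifNZ _ c => c.All p
  | loop c _ => c.All p

theorem All.mono {p p' : Instr J U → Prop} (h : ∀ i, p i → p' i) {c : Cmd J U} (hc : c.All p) :
    c.All p' := by
  induction c with
  | skip => trivial
  | instr i => exact h _ hc
  | seq a b iha ihb => exact ⟨iha hc.1, ihb hc.2⟩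
  | ifNZ r c ih => exact ih hc
  | loop c r ih => exact ih hc

theorem All.compile {p : Instr J U → Prop} (hj : ∀ r l, p (.jumpZero r l)) {c : Cmd J U}
    (hc : c.All p) (o : ℕ) : ∀ i ∈ c.compile o, p i := by
  induction c generalizing o with
  | skip => simp [Cmd.compile]
  | instr i => simpa [Cmd.compile, Cmd.All] using hc
  | seq a b iha ihb =>
    intro i hi
    rcases List.mem_append.1 hi with hi | hi
    exacts [iha hc.1 _ i hi, ihb hc.2 _ i hi]
  | ifNZ r c ih =>
    intro i hi
    rcases List.mem_cons.1 hi with rfl | hi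
    exacts [hj _ _, ih hc _ i hi]
  | loop c r ih =>
    intro i hi
    rcases List.mem_append.1 hi with hi | hi
    · exact ih hc _ i hi
    · rw [List.mem_singleton.1 hi]; exact hj _ _

end Cmd

namespace Program

variable {P : Program J U}

/-- The instructions from position `o` on start with `code`. -/
def CodeAt (P : Program J U) (o : ℕ) (code : List (Instr J U)) : Prop :=
  ∃ pre post, P = pre ++ code ++ post ∧ pre.length = o

theorem CodeAt.left {o : ℕ} {x y : List (Instr J U)} (h : P.CodeAt o (x ++ y)) :
    P.CodeAt o x := by
  obtain ⟨pre, post, rfl, rfl⟩ := h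
  exact ⟨pre, y ++ post, by simp, rfl⟩

theorem CodeAt.right {o : ℕ} {x y : List (Instr J U)} (h : P.CodeAt o (x ++ y)) :
    P.CodeAt (o + x.length) y := by
  obtain ⟨pre, post, rfl, rfl⟩ := h
  exact ⟨pre ++ x, post, by simp, by simp⟩

theorem CodeAt.get {o : ℕ} {i : Instr J U} (h : P.CodeAt o [i]) : P[o]? = some i := by
  obtain ⟨pre, post, rfl, rfl⟩ := h
  simp

end Program

variable [DataDomain U]

/-- The effect of an instruction other than a jump. -/
def Instr.eff (inp : Input J U) (b : Bool) (σ : St) : Instr J U → St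
  | const d k => σ.put d k
  | copy d r => σ.put d (σ.mem r)
  | plus d r s => σ.put d (σ.mem r + σ.mem s)
  | minus d r s => σ.put d (σ.mem r - σ.mem s)
  | load d r => σ.put d (σ.mem (σ.mem r))
  | store d r => σ.put (σ.mem d) (σ.mem r)
  | jumpZero _ _ => σ
  | card d X => σ.put d (inp.card X)
  | app d f r => σ.put d (inp.app f (σ.mem r))
  | cmp d θ X r Y s => σ.put d (flag
      (∃ u v, inp.value X (σ.mem r) = some u ∧ inp.value Y (σ.mem s) = some v ∧ θ.Holds u v))
  | cmpConst d θ X r α => σ.put d (flag (∃ u, inp.value X (σ.mem r) = some u ∧ θ.Holds u α))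
  | tree d τ X r Y s => σ.put d (flag
      (∃ u v, inp.value X (σ.mem r) = some u ∧ inp.value Y (σ.mem s) = some v ∧ τ.Holds u v))
  | arg d k => σ.put d (inp.arg k)
  | choose d => σ.put d b.toNat
  | out ch r => ⟨σ.mem, Function.update σ.out ch (σ.out ch ++ [σ.mem r])⟩

/-- Only a jump makes the next program counter depend on the data. For all other instructions the
effect on registers and tapes is independent of the counter, which lets `Big` do without one. -/
theorem Instr.exec_eq_eff (inp : Input J U) (b : Bool) (c : Config) (i : Instr J U)
    (hi : ¬ i.IsJump) :
    (i.exec inp b c).pc = c.pc + 1 ∧ (i.exec inp b c).toSt = i.eff inp b c.toSt := by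
  cases i <;>
    simp_all [Instr.exec, Instr.eff, Config.toSt, St.put, Config.put, Instr.IsJump,
      Finsupp.coe_update, flag] <;> congr

/-- Timed evaluation of structured programs. -/
inductive Big (inp : Input J U) : Cmd J U → St → ℕ → St → Prop
  | skip (σ) : Big inp .skip σ 0 σ
  | instr (i b σ) (h : ¬ i.IsJump) : Big inp (.instr i) σ 1 (i.eff inp b σ)
  | seq {a b σ t σ' t' σ''} : Big inp a σ t σ' → Big inp b σ' t' σ'' →
      Big inp (.seq a b) σ (t + t') σ''
  | ifNZ {r c σ t σ'} : σ.mem r ≠ 0 → Big inp c σ t σ' → Big inp (.ifNZ r c) σ (t + 1) σ'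
  | ifZ {r c σ} : σ.mem r = 0 → Big inp (.ifNZ r c) σ 1 σ
  | last {r c σ t σ'} : Big inp c σ t σ' → σ'.mem r ≠ 0 → Big inp (.loop c r) σ (t + 1) σ'
  | again {r c σ t σ' t' σ''} : Big inp c σ t σ' → σ'.mem r = 0 →
      Big inp (.loop c r) σ' t' σ'' → Big inp (.loop c r) σ (t + 1 + t') σ''

namespace Program

/-- Some sequence of `t` steps leads from the first configuration to the second. -/
def Steps (P : Program J U) (inp : Input J U) : ℕ → Config → Config → Prop
  | 0, c, c' => c = c'
  | t + 1, c, c' => ∃ b, P.Steps inp t (P.step inp b c) c'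

variable {P : Program J U} {inp : Input J U}

theorem Steps.trans {t t' : ℕ} {c c' c'' : Config} (h : P.Steps inp t c c')
    (h' : P.Steps inp t' c' c'') : P.Steps inp (t + t') c c'' := by
  induction t generalizing c with
  | zero => cases h; simpa using h'
  | succ t ih =>
    obtain ⟨b, hb⟩ := h
    rw [show t + 1 + t' = (t + t') + 1 by omega]
    exact ⟨b, ih hb⟩

theorem Steps.reaches {t : ℕ} {c : Config} (h : P.Steps inp t Config.init c) :
    P.Reaches inp c := by
  have key : ∀ t (c c' : Config), P.Steps inp t c c' →
      Relation.ReflTransGen (fun c c' => ∃ b, c' = P.step inp b c) c c' := by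
    intro t
    induction t with
    | zero => intro c c' h; cases h; exact .refl
    | succ t ih => rintro c c' ⟨b, hb⟩; exact .head ⟨b, rfl⟩ (ih _ _ hb)
  exact key t _ _ h

theorem Reaches.steps {c : Config} (h : P.Reaches inp c) : ∃ t, P.Steps inp t Config.init c := by
  induction h with
  | refl => exact ⟨0, rfl⟩
  | tail _ h ih =>
    obtain ⟨t, ht⟩ := ih
    obtain ⟨b, rfl⟩ := h
    exact ⟨t + 1, ht.trans ⟨b, rfl⟩⟩

/-- Only `choose` reads the bit. Hence a run of any choices, as produced by `Big.steps`, is the run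
with all bits `false`. -/
theorem Deterministic.step_eq (hP : P.Deterministic) (b : Bool) (c : Config) :
    P.step inp b c = P.step inp false c := by
  unfold step
  split
  · rfl
  · rename_i i hi
    have hm : i ∈ P := List.mem_of_getElem? hi
    cases i <;> first | rfl | exact absurd hm (hP _)

theorem Deterministic.steps_eq (hP : P.Deterministic) {t : ℕ} {c c' : Config}
    (h : P.Steps inp t c c') : c' = (P.step inp false)^[t] c := by
  induction t generalizing c with
  | zero => exact h.symm
  | succ t ih =>
    obtain ⟨b, hb⟩ := h
    rw [Function.iterate_succ_apply, ← hP.step_eq b]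
    exact ih hb

theorem CodeAt.step_eq {o : ℕ} {i : Instr J U} (h : P.CodeAt o [i]) {c : Config} (hc : c.pc = o)
    (b : Bool) : P.step inp b c = i.exec inp b c := by
  subst hc
  simp [step, h.get]

end Program

open Program

/-- A compiled structured program performs the evaluation. -/
theorem Big.steps {P : Program J U} {inp : Input J U} {cmd : Cmd J U} {σ σ' : St} {t : ℕ}
    (h : Big inp cmd σ t σ') {o : ℕ} (hP : P.CodeAt o (cmd.compile o)) {c : Config}
    (hc : c.pc = o) (hσ : c.toSt = σ) :
    ∃ c', P.Steps inp t c c' ∧ c'.pc = o + cmd.len ∧ c'.toSt = σ' := by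
  induction h generalizing o c with
  | skip σ => exact ⟨c, rfl, by simpa [Cmd.len] using hc, hσ⟩
  | instr i b σ hi =>
    obtain ⟨h1, h2⟩ := i.exec_eq_eff inp b c hi
    refine ⟨i.exec inp b c, ⟨b, ?_⟩, by simp [Cmd.len, h1, hc], by rw [h2, hσ]⟩
    exact hP.step_eq hc b
  | seq _ _ iha ihb =>
    obtain ⟨c1, s1, p1, e1⟩ := iha hP.left hc hσ
    have hr := hP.right
    rw [Cmd.length_compile] at hr
    obtain ⟨c2, s2, p2, e2⟩ := ihb hr p1 e1
    exact ⟨c2, s1.trans s2, by simp [Cmd.len, p2, Nat.add_assoc], e2⟩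
  | @ifNZ r cm σ t σ' hr _ ih =>
    have h0 : c.mem r ≠ 0 := by rw [← hσ] at hr; exact hr
    have hP' : P.CodeAt o ([.jumpZero r (o + (cm.len + 1))] ++ cm.compile (o + 1)) := hP
    have hst : P.step inp false c = ⟨c.pc + 1, c.mem, c.out⟩ := by
      rw [hP'.left.step_eq hc]; simp [Instr.exec, h0]
    obtain ⟨c2, s2, p2, e2⟩ := ih (c := P.step inp false c) hP'.right (by rw [hst]; simp [hc])
      (by rw [hst]; exact hσ)
    refine ⟨c2, ⟨false, s2⟩, ?_, e2⟩
    simp only [Cmd.len, p2, List.length_singleton]; omega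
  | @ifZ r cm σ hr =>
    have h0 : c.mem r = 0 := by rw [← hσ] at hr; exact hr
    have hP' : P.CodeAt o ([.jumpZero r (o + (cm.len + 1))] ++ cm.compile (o + 1)) := hP
    refine ⟨_, ⟨false, rfl⟩, ?_, ?_⟩ <;> rw [hP'.left.step_eq hc] <;>
      simp [Instr.exec, h0, Cmd.len, Config.toSt, ← hσ]
  | @last r cm σ t σ' _ hr ih =>
    obtain ⟨c1, s1, p1, e1⟩ := ih hP.left hc hσ
    have h0 : c1.mem r ≠ 0 := by rw [← e1] at hr; exact hr
    have hr' := hP.right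
    rw [Cmd.length_compile] at hr'
    refine ⟨_, s1.trans ⟨false, rfl⟩, ?_, ?_⟩ <;> rw [hr'.step_eq p1] <;>
      simp [Instr.exec, h0, Cmd.len, Config.toSt, ← e1, p1, Nat.add_assoc]
  | @again r cm σ t σ' t' σ'' _ hr _ ih ih' =>
    obtain ⟨c1, s1, p1, e1⟩ := ih hP.left hc hσ
    have h0 : c1.mem r = 0 := by rw [← e1] at hr; exact hr
    have hr' := hP.right
    rw [Cmd.length_compile] at hr'
    have hst : P.step inp false c1 = ⟨o, c1.mem, c1.out⟩ := by
      rw [hr'.step_eq p1]; simp [Instr.exec, h0]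
    -- The backward jump returns to position `o`, where the same loop starts, so the hypothesis for
    -- the remaining iterations applies with the same `hP`.
    obtain ⟨c2, s2, p2, e2⟩ := ih' (c := P.step inp false c1) hP (by rw [hst])
      (by rw [hst]; exact e1)
    exact ⟨c2, (s1.trans (t' := 1) ⟨false, rfl⟩).trans s2, p2, e2⟩

/-- A halting computation that passes through a compiled structured program evaluates it. -/
theorem Program.Steps.big {P : Program J U} {inp : Input J U} {cmd : Cmd J U}
    (hcmd : cmd.All fun i => ¬ i.IsJump) {o : ℕ} (hP : P.CodeAt o (cmd.compile o)) {c cf : Config}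
    {t : ℕ} (hc : c.pc = o) (h : P.Steps inp t c cf) (hf : P.Halted cf) :
    ∃ t1 t2 c1, Big inp cmd c.toSt t1 c1.toSt ∧ c1.pc = o + cmd.len ∧ t1 + t2 = t ∧
      P.Steps inp t2 c1 cf := by
  -- A configuration that points at an instruction has not halted, so a computation from it to a
  -- halted configuration has a first step, which executes that instruction.
  have first : ∀ {o : ℕ} {i : Instr J U} {c : Config} {t : ℕ}, P.CodeAt o [i] → c.pc = o →
      P.Steps inp t c cf → ∃ t', t = t' + 1 ∧ ∃ b, P.Steps inp t' (i.exec inp b c) cf := by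
    intro o i c t hi hc h
    cases t with
    | zero =>
      cases h
      have := hi.get
      rw [← hc] at this
      obtain ⟨hlt, _⟩ := List.getElem?_eq_some_iff.1 this
      exact absurd hf (by simpa [Halted] using hlt)
    | succ t =>
      obtain ⟨b, hb⟩ := h
      rw [hi.step_eq hc] at hb
      exact ⟨t, rfl, b, hb⟩
  induction cmd generalizing o c t with
  | skip => exact ⟨0, t, c, .skip _, by simpa [Cmd.len] using hc, by simp, h⟩
  | instr i =>
    obtain ⟨t', rfl, b, hb⟩ := first hP hc h
    obtain ⟨h1, h2⟩ := i.exec_eq_eff inp b c hcmd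
    exact ⟨1, t', _, h2 ▸ .instr i b _ hcmd, by simp [h1, hc, Cmd.len], by omega, hb⟩
  | seq a b iha ihb =>
    obtain ⟨t1, t2, c1, h1, p1, rfl, s1⟩ := iha hcmd.1 hP.left hc h
    have hr := hP.right
    rw [Cmd.length_compile] at hr
    obtain ⟨t3, t4, c2, h2, p2, rfl, s2⟩ := ihb hcmd.2 hr p1 s1
    exact ⟨t1 + t3, t4, c2, .seq h1 h2, by simp [p2, Cmd.len, Nat.add_assoc], by omega, s2⟩
  | ifNZ r cm ih =>
    have hP' : P.CodeAt o ([.jumpZero r (o + (cm.len + 1))] ++ cm.compile (o + 1)) := hP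
    obtain ⟨t', rfl, b, hb⟩ := first hP'.left hc h
    by_cases h0 : c.mem r = 0
    · simp only [Instr.exec, h0, if_true] at hb
      exact ⟨1, t', ⟨o + (cm.len + 1), c.mem, c.out⟩, .ifZ h0, rfl, by omega, hb⟩
    · simp only [Instr.exec, h0, if_false] at hb
      obtain ⟨t1, t2, c1, h1, p1, rfl, s1⟩ := ih hcmd hP'.right (by simp [hc]) hb
      exact ⟨t1 + 1, t2, c1, .ifNZ h0 h1, by simp [p1, Cmd.len]; omega, by omega, s1⟩
  | loop cm r ih =>
    -- Repetition of a loop does not descend in the structure of the command, so this case uses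
    -- induction on the number of steps left.
    induction t using Nat.strong_induction_on generalizing c with
    | _ t iht =>
      obtain ⟨t1, t2, c1, h1, p1, rfl, s1⟩ := ih hcmd hP.left hc h
      have hr := hP.right
      rw [Cmd.length_compile] at hr
      obtain ⟨t3, rfl, b, hb⟩ := first hr p1 s1
      by_cases h0 : c1.mem r = 0
      · simp only [Instr.exec, h0, if_true] at hb
        obtain ⟨t4, t5, c2, h2, p2, rfl, s2⟩ := iht _ (by omega) rfl hb
        exact ⟨t1 + 1 + t4, t5, c2, .again h1 h0 h2, p2, by omega, s2⟩
      · simp only [Instr.exec, h0, if_false] at hb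
        exact ⟨t1 + 1, t3, ⟨c1.pc + 1, c1.mem, c1.out⟩, .last h1 h0,
          by simp [p1, Cmd.len, Nat.add_assoc], by omega, hb⟩

end Structured

end CatQuery
end
set_option linter.unusedSectionVars false
noncomputable section
namespace CatQuery

/-! ### A core query language on numbers of elements -/

section CoreLanguage

variable {J U : Type} [SmallCategory J]

/-- The identity of an object. -/
abbrev ident (X : J) : Mor J := ⟨X, X, 𝟙 X⟩

/-- Binary relations between data values. -/
inductive ValRel where
  | cmp (θ : Cmp)
  | tree (τ : TreeRel)

/-- The meaning of the binary relations between data values. -/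
def ValRel.Holds [DataDomain U] : ValRel → U → U → Prop
  | cmp θ, u, v => θ.Holds u v
  | tree τ, u, v => τ.Holds u v

/-- Conditions on the components of a tuple. -/
inductive Atom (J U : Type) [SmallCategory J] where
  /-- `f(x)` and `g(y)` are in a relation. -/
  | bin (ρ : ValRel) (f g : Mor J)
  /-- `f(x) θ α`. -/
  | const (f : Mor J) (θ : Cmp) (α : U)

/-- The condition that the component at `X` is an element of `X`. -/
def Atom.valid (X : J) : Atom J U := .bin (.cmp .eq) (ident X) (ident X)

/-- The data of a reachability query: endpoints, and edges with source and target. -/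
structure WalkSpec (J : Type) [SmallCategory J] where
  {X Y E V W : J}
  hXY : X ≠ Y
  src : E ⟶ V
  tgt : E ⟶ W

/-- The source morphism. -/
def WalkSpec.s (w : WalkSpec J) : Mor J := ⟨w.E, w.V, w.src⟩

/-- The target morphism. -/
def WalkSpec.t (w : WalkSpec J) : Mor J := ⟨w.E, w.W, w.tgt⟩

/-- Predicates on assignments of numbers to all objects. -/
inductive Core (J U : Type) [SmallCategory J] where
  | atoms (l : List (Atom J U))
  | not (e : Core J U)
  | and (e e' : Core J U)
  /-- The image of the tuples over `A` in `e` under links from components of `A` to those of `B`. -/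
  | image (A B : Finset J) (lk : J → Mor J) (e : Core J U)
  /-- The tuples over `B` of which all extensions by tuples over `A` in `e'`, and at least one
  extension, are in `e`. -/
  | divide (A B : Finset J) (e e' : Core J U)
  /-- Walks of at least one edge. -/
  | reach (w : WalkSpec J) (K : Core J U)
  /-- Walks of `h + 1` edges. -/
  | hop (w : WalkSpec J) (h : ℕ) (K : Core J U)

variable {I : Instance J U}

/-- The value `f(x)` where `x` has number `k`, if there is an element with this number. -/
def fval (ν : Numbering I) (f : Mor J) (k : ℕ) : Option U :=
  if h : k < Fintype.card (I.F.obj f.1) then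
    some (I.val f.2.1 (I.F.map f.2.2 ((ν f.1).symm ⟨k, h⟩))) else none

/-- `f` at number `k` and `g` at number `l` have the same value. -/
def veq (ν : Numbering I) (f : Mor J) (k : ℕ) (g : Mor J) (l : ℕ) : Prop :=
  ∃ u, fval ν f k = some u ∧ fval ν g l = some u

theorem lt_of_fval {ν : Numbering I} {f : Mor J} {k : ℕ} {u : U} (h : fval ν f k = some u) :
    k < Fintype.card (I.F.obj f.1) := by
  by_contra hk
  simp [fval, hk] at h

theorem fval_number (ν : Numbering I) {X Y : J} (f : X ⟶ Y) (x : I.F.obj X) :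
    fval ν ⟨X, Y, f⟩ (ν X x) = some (I.val Y (I.F.map f x)) := by
  simp [fval]

theorem exists_number (ν : Numbering I) {X : J} {k : ℕ} (h : k < Fintype.card (I.F.obj X)) :
    ∃ x, (ν X x : ℕ) = k :=
  ⟨(ν X).symm ⟨k, h⟩, by simp⟩

theorem number_inj (ν : Numbering I) {X : J} {x y : I.F.obj X} (h : (ν X x : ℕ) = ν X y) :
    x = y :=
  (ν X).injective (Fin.ext h)

theorem fval_ident_number (ν : Numbering I) {X : J} (x : I.F.obj X) :
    fval ν (ident X) (ν X x) = some (I.val X x) := by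
  simp [fval_number]

/-- Within one object a value determines the element because `I.val X` is an embedding. Elements of
different objects can only be compared through their values. -/
theorem fval_ident_inj {ν : Numbering I} {X : J} {k l : ℕ} {u : U}
    (hk : fval ν (ident X) k = some u) (hl : fval ν (ident X) l = some u) : k = l := by
  obtain ⟨x, rfl⟩ := exists_number ν (lt_of_fval hk)
  obtain ⟨y, rfl⟩ := exists_number ν (lt_of_fval hl)
  rw [fval_ident_number] at hk hl
  rw [(I.val X).injective (Option.some.inj (hk.trans hl.symm))]

theorem veq.lt_left {ν : Numbering I} {f : Mor J} {k : ℕ} {g : Mor J} {l : ℕ}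
    (h : veq ν f k g l) : k < Fintype.card (I.F.obj f.1) := lt_of_fval h.choose_spec.1

theorem veq.lt_right {ν : Numbering I} {f : Mor J} {k : ℕ} {g : Mor J} {l : ℕ}
    (h : veq ν f k g l) : l < Fintype.card (I.F.obj g.1) := lt_of_fval h.choose_spec.2

/-- With transitivity this makes `veq` a partial equivalence relation. Edges whose sources have the
same value therefore form classes, on which both the search over threads and the representatives of
hops rest. -/
theorem veq.symm {ν : Numbering I} {f : Mor J} {k : ℕ} {g : Mor J} {l : ℕ}
    (h : veq ν f k g l) : veq ν g l f k := ⟨h.choose, h.choose_spec.2, h.choose_spec.1⟩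

theorem veq.trans {ν : Numbering I} {f : Mor J} {k : ℕ} {g : Mor J} {l : ℕ} {f' : Mor J} {k' : ℕ}
    (h : veq ν f k g l) (h' : veq ν g l f' k') : veq ν f k f' k' := by
  obtain ⟨u, h1, h2⟩ := h
  obtain ⟨v, h3, h4⟩ := h'
  rw [h2] at h3
  cases h3
  exact ⟨u, h1, h4⟩

theorem veq_self {ν : Numbering I} {f : Mor J} {k : ℕ} (h : k < Fintype.card (I.F.obj f.1)) :
    veq ν f k f k := by
  simp [veq, fval, h]

theorem veq.eq {ν : Numbering I} {X : J} {k l : ℕ} (h : veq ν (ident X) k (ident X) l) :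
    k = l := fval_ident_inj h.choose_spec.1 h.choose_spec.2

theorem veq_number {ν : Numbering I} {X X' Y Y' : J} {f : X ⟶ X'} {g : Y ⟶ Y'} {x : I.F.obj X}
    {y : I.F.obj Y} : veq ν ⟨X, X', f⟩ (ν X x) ⟨Y, Y', g⟩ (ν Y y) ↔
      I.val X' (I.F.map f x) = I.val Y' (I.F.map g y) := by
  simp only [veq, fval_number, Option.some.injEq]
  exact ⟨fun ⟨u, h, h'⟩ => h.trans h'.symm, fun h => ⟨_, h, rfl⟩⟩

namespace WalkSpec

variable (ν : Numbering I) (w : WalkSpec J) (K : ℕ → Prop)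

/-- The edge `k` in `K` starts at `x`. -/
def start (x k : ℕ) : Prop := K k ∧ veq ν (ident w.X) x w.s k

/-- The edge `k'` in `K` starts where `k` ends. -/
def next (k k' : ℕ) : Prop := K k' ∧ veq ν w.t k w.s k'

/-- The edge `k` ends at `y`. -/
def fin (k y : ℕ) : Prop := veq ν w.t k (ident w.Y) y

end WalkSpec

variable [DataDomain U]

/-- The meaning of conditions. -/
def Atom.Sem (ν : Numbering I) (d : J → ℕ) : Atom J U → Prop
  | bin ρ f g => ∃ u v, fval ν f (d f.1) = some u ∧ fval ν g (d g.1) = some v ∧ ρ.Holds u v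
  | const f θ α => ∃ u, fval ν f (d f.1) = some u ∧ θ.Holds u α

theorem Atom.sem_eq {ν : Numbering I} {d : J → ℕ} {f g : Mor J} :
    (Atom.bin (.cmp .eq) f g : Atom J U).Sem ν d ↔ veq ν f (d f.1) g (d g.1) := by
  constructor
  · rintro ⟨u, v, h, h', h''⟩
    have : u = v := h''
    subst this
    exact ⟨u, h, h'⟩
  · rintro ⟨u, h, h'⟩
    exact ⟨u, u, h, h', rfl⟩

theorem Atom.sem_valid {ν : Numbering I} {d : J → ℕ} {X : J} :
    (Atom.valid X : Atom J U).Sem ν d ↔ d X < Fintype.card (I.F.obj X) := by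
  rw [Atom.valid, sem_eq]
  exact ⟨veq.lt_left, fun h => veq_self h⟩

variable [DecidableEq J]

/-- The image of a predicate under links from components of `A` to those of `B`. -/
def Image (ν : Numbering I) (A B : Finset J) (lk : J → Mor J) (P : (J → ℕ) → Prop)
    (d : J → ℕ) : Prop :=
  ∃ d' : J → ℕ, (∀ Z ∉ A, d' Z = 0) ∧ (∀ Z ∈ A, d' Z < Fintype.card (I.F.obj Z)) ∧ P d' ∧
    ∀ X ∈ B, veq ν (lk X) (d' (lk X).1) (ident X) (d X)

/-- The meaning of the core language. -/
def Core.Sem (ν : Numbering I) : Core J U → (J → ℕ) → Prop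
  | atoms l, d => ∀ a ∈ l, a.Sem ν d
  | not e, d => ¬ e.Sem ν d
  | and e e', d => e.Sem ν d ∧ e'.Sem ν d
  | image A B lk e, d => Image ν A B lk (e.Sem ν) d
  | divide A B e e', d => Image ν A B ident (e.Sem ν) d ∧
      ¬ Image ν A B ident (fun d' => e'.Sem ν d' ∧ ¬ e.Sem ν d') d
  | reach w K, d => ∃ k k', w.start ν (fun k => K.Sem ν (Pi.single w.E k)) (d w.X) k ∧
      Relation.ReflTransGen (w.next ν fun k => K.Sem ν (Pi.single w.E k)) k k' ∧
      w.fin ν k' (d w.Y)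
  | hop w h K, d => ∃ k k', w.start ν (fun k => K.Sem ν (Pi.single w.E k)) (d w.X) k ∧
      Hops (w.next ν fun k => K.Sem ν (Pi.single w.E k)) h k k' ∧ w.fin ν k' (d w.Y)

/-- The cost of evaluation per tuple, up to a constant, if there are `p` objects. -/
def Core.weight (p : ℕ) : Core J U → ℕ
  | atoms l => l.length + p
  | not e => e.weight p + p
  | and e e' => e.weight p + e'.weight p + p
  | image _ _ _ e => e.weight p + p
  | divide _ _ e e' => e.weight p + e'.weight p + p
  | reach _ K => K.weight p + p
  | hop _ h K => K.weight p + (h + 1) * p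

/-! ### Codes of tuples -/

/-- The numbers of the components of `t` are given by `d`. -/
def IsCode (ν : Numbering I) {A : Finset J} (t : Tuple I A) (d : J → ℕ) : Prop :=
  ∀ X : {X // X ∈ A}, (ν X.1 (t X) : ℕ) = d X.1

/-- The numbers in `d` are those of a tuple in `S`. -/
def CodeIn (ν : Numbering I) {A : Finset J} (S : Set (Tuple I A)) (d : J → ℕ) : Prop :=
  ∃ t ∈ S, IsCode ν t d

/-- The numbers in `d` are numbers of elements. -/
def ValidOn (I : Instance J U) (A : Finset J) (d : J → ℕ) : Prop :=
  ∀ X ∈ A, d X < Fintype.card (I.F.obj X)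

/-- The numbers of the components of a tuple, and `0` elsewhere. -/
def encode (ν : Numbering I) {A : Finset J} (t : Tuple I A) (X : J) : ℕ :=
  if h : X ∈ A then ν X (t ⟨X, h⟩) else 0

section Codes

variable {ν : Numbering I} {A : Finset J} {t s : Tuple I A} {d : J → ℕ}

theorem isCode_encode : IsCode ν t (encode ν t) := fun X => by simp [encode, X.2]

theorem encode_of_notMem {X : J} (h : X ∉ A) : encode ν t X = 0 := by simp [encode, h]

theorem IsCode.validOn (h : IsCode ν t d) : ValidOn I A d := fun X hX => by
  rw [← h ⟨X, hX⟩]; exact Fin.is_lt _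

theorem ValidOn.exists_isCode (ν : Numbering I) (h : ValidOn I A d) :
    ∃ t : Tuple I A, IsCode ν t d :=
  ⟨fun X => (ν X.1).symm ⟨d X.1, h X.1 X.2⟩, fun X => by simp⟩

theorem IsCode.unique (h : IsCode ν t d) (h' : IsCode ν s d) : t = s :=
  funext fun X => number_inj ν ((h X).trans (h' X).symm)

theorem IsCode.codeIn_iff (h : IsCode ν t d) {S : Set (Tuple I A)} : CodeIn ν S d ↔ t ∈ S :=
  ⟨fun ⟨s, hs, hc⟩ => h.unique hc ▸ hs, fun ht => ⟨t, ht, h⟩⟩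

theorem CodeIn.validOn {S : Set (Tuple I A)} (h : CodeIn ν S d) : ValidOn I A d :=
  h.choose_spec.2.validOn

theorem IsCode.encode_eq (h : IsCode ν t d) (h0 : ∀ X ∉ A, d X = 0) : encode ν t = d := by
  funext X
  by_cases hX : X ∈ A
  · rw [← h ⟨X, hX⟩]; simp [encode, hX]
  · rw [h0 X hX, encode_of_notMem hX]

theorem IsCode.restrict {B : Finset J} (hB : B ⊆ A) (h : IsCode ν t d) :
    IsCode ν (t.restrict hB) d := fun X => h ⟨X.1, hB X.2⟩

theorem IsCode.fval {X Y : J} (h : IsCode ν t d) (hX : X ∈ A) (f : X ⟶ Y) :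
    fval ν ⟨X, Y, f⟩ (d X) = some (I.val Y (I.F.map f (t ⟨X, hX⟩))) := by
  rw [← h ⟨X, hX⟩, fval_number]

theorem IsCode.fval_ident {X : J} (h : IsCode ν t d) (hX : X ∈ A) :
    CatQuery.fval ν (ident X) (d X) = some (I.val X (t ⟨X, hX⟩)) := by
  rw [← h ⟨X, hX⟩, fval_ident_number]

theorem sem_atoms_valid {A : Finset J} :
    (∀ a ∈ A.toList.map Atom.valid, Atom.Sem (U := U) ν d a) ↔ ValidOn I A d := by
  simp [ValidOn, Atom.sem_valid]

/-- The image of a relation under links. -/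
theorem image_codeIn {P : (J → ℕ) → Prop} {R : Set (Tuple I A)}
    (he : ∀ d, P d ↔ CodeIn ν R d) {B : Finset J} {lk : J → Mor J} :
    Image ν A B lk P d ↔
      ∃ s ∈ R, ∀ X ∈ B, veq ν (lk X) (encode ν s (lk X).1) (ident X) (d X) := by
  constructor
  · rintro ⟨d', h0, -, h2, h3⟩
    obtain ⟨s, hs, hc⟩ := (he _).1 h2
    refine ⟨s, hs, ?_⟩
    rwa [hc.encode_eq h0]
  · rintro ⟨s, hs, h⟩
    exact ⟨encode ν s, fun Z hZ => encode_of_notMem hZ, isCode_encode.validOn,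
      (he _).2 ⟨s, hs, isCode_encode⟩, h⟩

theorem veq_ident_encode {X : J} (hX : X ∈ A) :
    veq ν (ident X) (encode ν s X) (ident X) (d X) ↔ (ν X (s ⟨X, hX⟩) : ℕ) = d X := by
  rw [← isCode_encode ⟨X, hX⟩]
  exact ⟨veq.eq, fun h => h ▸ veq_self (Fin.is_lt _)⟩

/-- The projection of a relation. -/
theorem image_ident_codeIn {P : (J → ℕ) → Prop} {R : Set (Tuple I A)}
    (he : ∀ d, P d ↔ CodeIn ν R d) {B : Finset J} (hB : B ⊆ A) :
    Image ν A B ident P d ↔ CodeIn ν {t | ∃ s ∈ R, t = s.restrict hB} d := by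
  rw [image_codeIn he]
  constructor
  · rintro ⟨s, hs, h⟩
    exact ⟨s.restrict hB, ⟨s, hs, rfl⟩, fun X => (veq_ident_encode (hB X.2)).1 (h X.1 X.2)⟩
  · rintro ⟨_, ⟨s, hs, rfl⟩, h⟩
    exact ⟨s, hs, fun X hX => (veq_ident_encode (hB hX)).2 (h ⟨X, hX⟩)⟩

end Codes

/-! ### Walks -/

section Walks

variable {ν : Numbering I} (w : WalkSpec J) (K : ℕ → Prop) {Ks : Set (I.F.obj w.E)}

theorem edgeRel_iff (hK : ∀ e, K (ν w.E e) ↔ e ∈ Ks) {u v : U} :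
    EdgeRel I w.src w.tgt Ks u v ↔ ∃ k, K k ∧ fval ν w.s k = some u ∧ fval ν w.t k = some v := by
  constructor
  · rintro ⟨e, he, rfl, rfl⟩
    exact ⟨ν w.E e, (hK e).2 he, fval_number ν w.src e, fval_number ν w.tgt e⟩
  · rintro ⟨k, hk, h1, h2⟩
    obtain ⟨e, rfl⟩ := exists_number ν (lt_of_fval h1)
    refine ⟨e, (hK e).1 hk, ?_, ?_⟩
    · exact Option.some.inj ((fval_number ν w.src e).symm.trans h1)
    · exact Option.some.inj ((fval_number ν w.tgt e).symm.trans h2)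

/-- A walk of `h + 1` edges is a chain of edges with `h` transitions, each from an edge to one that
starts where it ends. Walks are thus followed on edges: all edges have numbers in the single object
`E`, whereas nodes are values that may come from different objects. -/
theorem hops_edgeRel_iff (hK : ∀ e, K (ν w.E e) ↔ e ∈ Ks) {u v : U} (h : ℕ) :
    Hops (EdgeRel I w.src w.tgt Ks) (h + 1) u v ↔ ∃ k k', (K k ∧ fval ν w.s k = some u) ∧
      Hops (w.next ν K) h k k' ∧ fval ν w.t k' = some v := by
  induction h generalizing v with
  | zero =>
    constructor
    · rintro ⟨_, rfl, h⟩
      obtain ⟨k, hk, h1, h2⟩ := (edgeRel_iff w K hK).1 h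
      exact ⟨k, k, ⟨hk, h1⟩, rfl, h2⟩
    · rintro ⟨k, _, ⟨hk, h1⟩, rfl, h2⟩
      exact ⟨u, rfl, (edgeRel_iff w K hK).2 ⟨k, hk, h1, h2⟩⟩
  | succ h ih =>
    constructor
    · rintro ⟨x, hx, hxv⟩
      obtain ⟨k, k', hk, hh, hf⟩ := ih.1 hx
      obtain ⟨k2, hk2, h1, h2⟩ := (edgeRel_iff w K hK).1 hxv
      exact ⟨k, k2, hk, ⟨k', hh, hk2, x, hf, h1⟩, h2⟩
    · rintro ⟨k, k2, hk, ⟨k', hh, hk2, x, h1, h1'⟩, h2⟩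
      exact ⟨x, ih.2 ⟨k, k', hk, hh, h1⟩, (edgeRel_iff w K hK).2 ⟨k2, hk2, h1', h2⟩⟩

/-- The empty walk is a separate case: a node reaches itself even if it lies on no edge. All other
walks are chains of edges, as for hops. -/
theorem reach_edgeRel_iff (hK : ∀ e, K (ν w.E e) ↔ e ∈ Ks) {u v : U} :
    Relation.ReflTransGen (EdgeRel I w.src w.tgt Ks) u v ↔
      u = v ∨ ∃ k k', (K k ∧ fval ν w.s k = some u) ∧
        Relation.ReflTransGen (w.next ν K) k k' ∧ fval ν w.t k' = some v := by
  constructor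
  · intro h
    induction h with
    | refl => exact Or.inl rfl
    | @tail x y _ hxy ih =>
      right
      obtain ⟨k2, hk2, h1, h2⟩ := (edgeRel_iff w K hK).1 hxy
      rcases ih with rfl | ⟨k, k', hk, hh, hf⟩
      · exact ⟨k2, k2, ⟨hk2, h1⟩, .refl, h2⟩
      · exact ⟨k, k2, hk, hh.tail ⟨hk2, x, hf, h1⟩, h2⟩
  · rintro (rfl | ⟨k, k', ⟨hk, h1⟩, hh, h2⟩)
    · exact .refl
    · induction hh generalizing v with
      | refl => exact .single ((edgeRel_iff w K hK).2 ⟨k, hk, h1, h2⟩)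
      | tail _ hn ih =>
        obtain ⟨hk2, x, hx, hx'⟩ := hn
        exact (ih hx).tail ((edgeRel_iff w K hK).2 ⟨_, hk2, hx', h2⟩)

end Walks

end CoreLanguage

end CatQuery
end
set_option linter.unusedSectionVars false
noncomputable section
namespace CatQuery

/-! ### Translation of algebra and calculus to the core language -/

section Translation

variable {J U : Type} [SmallCategory J] [DecidableEq J]

/-- Disjunction in the core language. -/
def Core.or (e e' : Core J U) : Core J U := .not (.and (.not e) (.not e'))

/-- Conjunction of a list in the core language. -/
def Core.all (l : List (Core J U)) : Core J U := l.foldr Core.and (.atoms [])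

/-- The condition that the components in `A` are elements. -/
def Core.validOn (A : Finset J) : Core J U := .atoms (A.toList.map Atom.valid)

/-- Equality of the values of two components. -/
def Core.eq (X Y : J) : Core J U := .atoms [.bin (.cmp .eq) (ident X) (ident Y)]

/-- Translation of algebra expressions. -/
def Alg.core : {A : Finset J} → Alg J U A → Core J U
  | _, obj X => .atoms [.valid X]
  | _, @map _ _ _ _ X Y f R => .image {X} {Y} (fun _ => ⟨X, Y, f⟩) R.core
  | _, @select _ _ _ _ _ X Y X' Y' _ _ f θ g R =>
      .and (.atoms [.bin (.cmp θ) ⟨X, X', f⟩ ⟨Y, Y', g⟩]) R.core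
  | _, @selectConst _ _ _ _ _ X X' _ f θ α R => .and (.atoms [.const ⟨X, X', f⟩ θ α]) R.core
  | _, @project _ _ _ _ A B _ R => .image A B ident R.core
  | _, @recast _ _ _ _ A B σ R =>
      .image A B (fun X => if h : X ∈ B then ident (σ ⟨X, h⟩).1 else ident X) R.core
  | _, union R S => .or R.core S.core
  | _, inter R S => .and R.core S.core
  | _, diff R S => .and R.core (.not S.core)
  | _, @div _ _ _ _ A D B _ _ R S => .divide A (A \ B) R.core (.image D B ident S.core)
  | _, @getTree _ _ _ _ X Y _ τ R S =>
      .and (.atoms [.bin (.tree τ) (ident X) (ident Y)]) (.and R.core S.core)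
  | _, @getReach _ _ _ _ X Y _ _ _ hXY src tgt R S K =>
      .and (.or (.eq X Y) (.reach ⟨hXY, src, tgt⟩ K.core)) (.and R.core S.core)
  | _, @getnHop _ _ _ _ X Y _ _ _ _ _ _ 0 R S _ => .and (.eq X Y) (.and R.core S.core)
  | _, @getnHop _ _ _ _ _ _ _ _ _ hXY src tgt (h + 1) R S K =>
      .and (.hop ⟨hXY, src, tgt⟩ h K.core) (.and R.core S.core)
  | _, lim B M _ _ _ R => .and (.all (List.ofFn fun i => (R i).core))
      (.and (.validOn B) (.atoms (M.toList.map fun m => .bin (.cmp .eq) m (ident m.2.1))))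

/-- Translation of formulas. -/
def Formula.core : {A : Finset J} → Formula J U A → Core J U
  | A, @mem _ _ _ _ _ X _ O =>
      .and (.validOn A) (.image {O} {X} (fun _ => ident O) (.atoms []))
  | A, @app _ _ _ _ _ X Y _ _ f =>
      .and (.validOn A) (.atoms [.bin (.cmp .eq) ⟨X, Y, f⟩ (ident Y)])
  | A, @cmp _ _ _ _ _ X Y X' Y' _ _ f θ g =>
      .and (.validOn A) (.atoms [.bin (.cmp θ) ⟨X, X', f⟩ ⟨Y, Y', g⟩])
  | A, @cmpConst _ _ _ _ _ X X' _ f θ α => .and (.validOn A) (.atoms [.const ⟨X, X', f⟩ θ α])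
  | A, @tree _ _ _ _ _ X Y _ _ _ τ =>
      .and (.validOn A) (.atoms [.bin (.tree τ) (ident X) (ident Y)])
  | A, @reach _ _ _ _ _ X Y _ _ _ _ _ hXY src tgt =>
      .and (.validOn A) (.or (.eq X Y) (.reach ⟨hXY, src, tgt⟩ (.atoms [])))
  | A, @nHop _ _ _ _ _ X Y _ _ _ _ _ _ _ _ 0 => .and (.validOn A) (.eq X Y)
  | A, @nHop _ _ _ _ _ _ _ _ _ _ _ _ hXY src tgt (h + 1) =>
      .and (.validOn A) (.hop ⟨hXY, src, tgt⟩ h (.atoms []))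
  | A, not φ => .and (.validOn A) (.not φ.core)
  | _, and φ ψ => .and φ.core ψ.core
  | _, or φ ψ => .or φ.core ψ.core
  | A, ex X φ => .and (.validOn A) (.image (insert X A) (A.erase X) ident φ.core)
  | A, all X φ =>
      .and (.validOn A) (.not (.image (insert X A) (A.erase X) ident (.not φ.core)))

theorem Core.weight_all (p : ℕ) (l : List (Core J U)) :
    (Core.all l).weight p = (l.map fun e => e.weight p + p).sum + p := by
  induction l with
  | nil => simp [all, weight]
  | cons e l ih =>
    simp only [all] at ih
    simp [all, weight, ih]; ring

theorem Alg.size_pos {A : Finset J} (e : Alg J U A) : 1 ≤ e.size := by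
  cases e <;> simp [size]

theorem Formula.size_pos {A : Finset J} (φ : Formula J U A) : 1 ≤ φ.size := by
  cases φ <;> simp [size]

/-! ### Weights of the translations -/

section Weight

variable [FinCategory J]

/-- Every object has its identity. This inequality is what turns a cost of `p` per tuple and
operator into the factor `q`. -/
theorem numObjects_le_numMorphisms : numObjects J ≤ numMorphisms J := by
  refine Fintype.card_le_of_injective (fun X : J => ident X) fun X Y h => ?_
  exact congrArg Sigma.fst h

theorem card_le_numObjects (A : Finset J) : A.card ≤ numObjects J := Finset.card_le_univ A

theorem card_le_numMorphisms (M : Finset (Mor J)) : M.card ≤ numMorphisms J :=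
  Finset.card_le_univ M

theorem numObjects_pos [Nonempty J] : 1 ≤ numObjects J := Fintype.card_pos

/-- Every operator becomes boundedly many core operators of weight `p` (`(h + 1) * p` for hops) with
few conditions, except that a limit has up to `q` equations. The summand `numObjects J` on the left
strengthens the induction: it pays for the conjunction that `Core.all` adds for every relationship
object of a limit. The constant `20` is generous. -/
theorem Alg.weight_core_le [Nonempty J] {A : Finset J} (e : Alg J U A) :
    e.core.weight (numObjects J) + numObjects J ≤ 20 * (e.size * numMorphisms J) := by
  have hp := numObjects_le_numMorphisms (J := J)
  have h1 := numObjects_pos (J := J)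
  induction e with
  | obj X => simp only [core, Core.weight, size, List.length_singleton]; nlinarith
  | map f R ih => simp only [core, Core.weight, size]; nlinarith
  | select _ _ f θ g R ih =>
    simp only [core, Core.weight, size, List.length_singleton]; nlinarith
  | selectConst _ f θ α R ih =>
    simp only [core, Core.weight, size, List.length_singleton]; nlinarith
  | project _ R ih => simp only [core, Core.weight, size]; nlinarith
  | recast σ R ih => simp only [core, Core.weight, size]; nlinarith
  | union R S ih ih' => simp only [core, Core.or, Core.weight, size]; nlinarith
  | inter R S ih ih' => simp only [core, Core.weight, size]; nlinarith
  | diff R S ih ih' => simp only [core, Core.weight, size]; nlinarith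
  | div _ _ R S ih ih' => simp only [core, Core.weight, size]; nlinarith
  | getTree _ τ R S ih ih' =>
    simp only [core, Core.weight, size, List.length_singleton]; nlinarith
  | getReach _ src tgt R S K ih ih' ih'' =>
    simp only [core, Core.or, Core.eq, Core.weight, size, List.length_singleton]; nlinarith
  | getnHop _ src tgt h R S K ih ih' ih'' =>
    cases h with
    | zero => simp only [core, Core.eq, Core.weight, size, List.length_singleton]; nlinarith
    | succ h =>
      simp only [core, Core.weight, size]; nlinarith
  | @lim B M hM r A hA R ih =>
    have hM' := card_le_numMorphisms M
    have hB := card_le_numObjects B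
    have hs : ∑ i, ((R i).core.weight (numObjects J) + numObjects J) ≤
        20 * ((∑ i, (R i).size) * numMorphisms J) := by
      rw [Finset.sum_mul, Finset.mul_sum]
      exact Finset.sum_le_sum fun i _ => ih i
    simp only [core, Core.weight, size, Core.weight_all, List.map_ofFn, List.sum_ofFn,
      Core.validOn, List.length_map, Finset.length_toList, Function.comp_def]
    rw [add_mul]
    omega

theorem Formula.weight_core_le [Nonempty J] {A : Finset J} (φ : Formula J U A) :
    φ.core.weight (numObjects J) + numObjects J ≤ 20 * (φ.size * numMorphisms J) := by
  have hp := numObjects_le_numMorphisms (J := J)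
  have h1 := numObjects_pos (J := J)
  induction φ with
  | @mem A X hX O =>
    have hA := card_le_numObjects A
    simp [core, Core.validOn, Core.weight, size]; nlinarith
  | @app A X Y hX hY f =>
    have hA := card_le_numObjects A
    simp [core, Core.validOn, Core.weight, size]; nlinarith
  | @cmp A X Y X' Y' hX hY f θ g =>
    have hA := card_le_numObjects A
    simp [core, Core.validOn, Core.weight, size]; nlinarith
  | @cmpConst A X X' hX f θ α =>
    have hA := card_le_numObjects A
    simp [core, Core.validOn, Core.weight, size]; nlinarith
  | @tree A X Y hX hY hXY τ =>
    have hA := card_le_numObjects A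
    simp [core, Core.validOn, Core.weight, size]; nlinarith
  | @reach A X Y E V W hX hY hXY src tgt =>
    have hA := card_le_numObjects A
    simp [core, Core.validOn, Core.weight, Core.or, Core.eq, size]; nlinarith
  | @nHop A X Y E V W hX hY hXY src tgt h =>
    have hA := card_le_numObjects A
    cases h <;> simp [core, Core.validOn, Core.weight, Core.eq, size] <;> nlinarith
  | @not A φ ih =>
    have hA := card_le_numObjects A
    simp only [core, Core.validOn, Core.weight, size, List.length_map, Finset.length_toList]
    nlinarith
  | and φ ψ ih ih' => simp only [core, Core.weight, size]; nlinarith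
  | or φ ψ ih ih' => simp only [core, Core.or, Core.weight, size]; nlinarith
  | @ex A X φ ih =>
    have hA := card_le_numObjects A
    simp only [core, Core.validOn, Core.weight, size, List.length_map, Finset.length_toList]
    nlinarith
  | @all A X φ ih =>
    have hA := card_le_numObjects A
    simp only [core, Core.validOn, Core.weight, size, List.length_map, Finset.length_toList]
    nlinarith

end Weight

/-! ### Correctness of the translations -/

section Semantics

variable [DataDomain U] {I : Instance J U} {ν : Numbering I} {d : J → ℕ}

theorem Core.sem_or {e e' : Core J U} : (Core.or e e').Sem ν d ↔ e.Sem ν d ∨ e'.Sem ν d := by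
  simp only [Core.or, Core.Sem]; tauto

theorem Core.sem_all {l : List (Core J U)} : (Core.all l).Sem ν d ↔ ∀ e ∈ l, e.Sem ν d := by
  induction l with
  | nil => simp [all, Sem]
  | cons e l ih =>
    simp only [all] at ih
    simp [all, Sem, ih]

theorem sem_and {e e' : Core J U} : (Core.and e e').Sem ν d ↔ e.Sem ν d ∧ e'.Sem ν d := Iff.rfl

theorem Core.sem_validOn {A : Finset J} :
    (Core.validOn A : Core J U).Sem ν d ↔ ValidOn I A d := sem_atoms_valid

theorem Core.sem_eq {X Y : J} :
    (Core.eq X Y : Core J U).Sem ν d ↔ veq ν (ident X) (d X) (ident Y) (d Y) := by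
  simp [Core.eq, Core.Sem, Atom.sem_eq]

/-- A predicate that agrees with a relation on codes and implies validity describes the relation. -/
theorem codeIn_of_isCode {A : Finset J} {P : (J → ℕ) → Prop} {S : Set (Tuple I A)}
    (hv : P d → ValidOn I A d) (h : ∀ t : Tuple I A, IsCode ν t d → (P d ↔ t ∈ S)) :
    P d ↔ CodeIn ν S d := by
  constructor
  · intro hP
    obtain ⟨t, ht⟩ := (hv hP).exists_isCode ν
    exact ht.codeIn_iff.2 ((h t ht).1 hP)
  · rintro ⟨t, hS, ht⟩
    exact (h t ht).2 hS

theorem sem_bin {A : Finset J} {t : Tuple I A} (ht : IsCode ν t d) {X Y X' Y' : J} (hX : X ∈ A)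
    (hY : Y ∈ A) {ρ : ValRel} {f : X ⟶ X'} {g : Y ⟶ Y'} :
    (Core.atoms [.bin ρ ⟨X, X', f⟩ ⟨Y, Y', g⟩] : Core J U).Sem ν d ↔
      ρ.Holds (I.val X' (I.F.map f (t ⟨X, hX⟩))) (I.val Y' (I.F.map g (t ⟨Y, hY⟩))) := by
  simp [Core.Sem, Atom.Sem, ht.fval hX, ht.fval hY]

theorem sem_const {A : Finset J} {t : Tuple I A} (ht : IsCode ν t d) {X X' : J} (hX : X ∈ A)
    {θ : Cmp} {f : X ⟶ X'} {α : U} :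
    (Core.atoms [.const ⟨X, X', f⟩ θ α] : Core J U).Sem ν d ↔
      θ.Holds (I.val X' (I.F.map f (t ⟨X, hX⟩))) α := by
  simp [Core.Sem, Atom.Sem, ht.fval hX]

theorem sem_map {A : Finset J} {t : Tuple I A} (ht : IsCode ν t d) {X Y : J} (hX : X ∈ A)
    (hY : Y ∈ A) {f : X ⟶ Y} :
    (Core.atoms [.bin (.cmp .eq) ⟨X, Y, f⟩ (ident Y)] : Core J U).Sem ν d ↔
      I.F.map f (t ⟨X, hX⟩) = t ⟨Y, hY⟩ := by
  rw [sem_bin ht hX hY]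
  simp [ValRel.Holds, Cmp.Holds]

theorem veq_ident {A : Finset J} {t : Tuple I A} (ht : IsCode ν t d) {X Y : J} (hX : X ∈ A)
    (hY : Y ∈ A) : veq ν (ident X) (d X) (ident Y) (d Y) ↔
      I.val X (t ⟨X, hX⟩) = I.val Y (t ⟨Y, hY⟩) := by
  simp only [veq, ht.fval_ident hX, ht.fval_ident hY, Option.some.injEq]
  exact ⟨fun ⟨u, h, h'⟩ => h.trans h'.symm, fun h => ⟨_, h, rfl⟩⟩

/-- `Core.reach` covers walks of at least one edge, and the disjunct `Core.eq` supplies the empty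
walk. It suffices to know `K` at numbers of elements, because no other number can be the start or a
continuation of a walk. -/
theorem sem_reach {A : Finset J} {t : Tuple I A} (ht : IsCode ν t d) (w : WalkSpec J)
    (hX : w.X ∈ A) (hY : w.Y ∈ A) {K : Core J U} {Ks : Set (I.F.obj w.E)}
    (hK : ∀ e, K.Sem ν (Pi.single w.E (ν w.E e)) ↔ e ∈ Ks) :
    (Core.or (.eq w.X w.Y) (.reach w K)).Sem ν d ↔
      Relation.ReflTransGen (EdgeRel I w.src w.tgt Ks) (I.val w.X (t ⟨w.X, hX⟩))
        (I.val w.Y (t ⟨w.Y, hY⟩)) := by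
  rw [Core.sem_or, Core.sem_eq, veq_ident ht hX hY,
    reach_edgeRel_iff w (fun k => K.Sem ν (Pi.single w.E k)) hK]
  simp [Core.Sem, WalkSpec.start, WalkSpec.fin, veq, ht.fval_ident hX, ht.fval_ident hY]

theorem sem_hop {A : Finset J} {t : Tuple I A} (ht : IsCode ν t d) (w : WalkSpec J)
    (hX : w.X ∈ A) (hY : w.Y ∈ A) {K : Core J U} {Ks : Set (I.F.obj w.E)}
    (hK : ∀ e, K.Sem ν (Pi.single w.E (ν w.E e)) ↔ e ∈ Ks) (h : ℕ) :
    (Core.hop w h K).Sem ν d ↔ Hops (EdgeRel I w.src w.tgt Ks) (h + 1)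
      (I.val w.X (t ⟨w.X, hX⟩)) (I.val w.Y (t ⟨w.Y, hY⟩)) := by
  rw [hops_edgeRel_iff w (fun k => K.Sem ν (Pi.single w.E k)) hK]
  simp [Core.Sem, WalkSpec.start, WalkSpec.fin, veq, ht.fval_ident hX, ht.fval_ident hY]

theorem codeIn_single {E : J} {S : Set (Tuple I {E})} (e : I.F.obj E) :
    CodeIn ν S (Pi.single E (ν E e)) ↔
      e ∈ {e | ∃ s ∈ S, s ⟨E, Finset.mem_singleton_self E⟩ = e} := by
  constructor
  · rintro ⟨s, hs, hc⟩
    exact ⟨s, hs, number_inj ν (by simpa using hc ⟨E, Finset.mem_singleton_self E⟩)⟩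
  · rintro ⟨s, hs, rfl⟩
    refine ⟨s, hs, ?_⟩
    rintro ⟨X, hX⟩
    obtain rfl := Finset.mem_singleton.1 hX
    simp

theorem codeIn_pair_iff {X Y : J} {R : Set (Tuple I {X})} {S : Set (Tuple I {Y})}
    {t : Tuple I {X, Y}} (ht : IsCode ν t d) {P : Prop} :
    (P ∧ CodeIn ν R d ∧ CodeIn ν S d) ↔
      (t.restrict (by simp) ∈ R ∧ t.restrict (by simp) ∈ S ∧ P) := by
  rw [(ht.restrict (by simp : {X} ⊆ ({X, Y} : Finset J))).codeIn_iff,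
    (ht.restrict (by simp : {Y} ⊆ ({X, Y} : Finset J))).codeIn_iff]
  tauto

theorem validOn_pair {X Y : J} {R : Set (Tuple I {X})} {S : Set (Tuple I {Y})}
    (hR : CodeIn ν R d) (hS : CodeIn ν S d) : ValidOn I {X, Y} d := by
  intro Z hZ
  rcases Finset.mem_insert.1 hZ with rfl | hZ
  · exact hR.validOn Z (by simp)
  · exact hS.validOn Z hZ

/-- The empty conjunction holds for invalid numbers as well, so `image_codeIn` does not apply; here
the validity of the source tuple comes from the condition built into `Image`. This serves range
terms. -/
theorem image_codeIn_univ {A B : Finset J} {lk : J → Mor J} :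
    Image ν A B lk (fun d => ∀ a ∈ ([] : List (Atom J U)), a.Sem ν d) d ↔
      ∃ s : Tuple I A, ∀ X ∈ B, veq ν (lk X) (encode ν s (lk X).1) (ident X) (d X) := by
  constructor
  · rintro ⟨d', h0, h1, -, h3⟩
    obtain ⟨s, hs⟩ := ValidOn.exists_isCode ν h1
    exact ⟨s, by rwa [hs.encode_eq h0]⟩
  · rintro ⟨s, h⟩
    exact ⟨encode ν s, fun Z hZ => encode_of_notMem hZ, isCode_encode.validOn, by simp, h⟩

/-- The translation of algebra expressions preserves the meaning. -/
theorem Alg.sem_core {A : Finset J} (e : Alg J U A) (d : J → ℕ) :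
    e.core.Sem ν d ↔ CodeIn ν (e.eval I) d := by
  induction e generalizing d with
  | obj X =>
    refine codeIn_of_isCode (fun h Z hZ => ?_) fun t ht => ?_
    · obtain rfl := Finset.mem_singleton.1 hZ
      simpa [core, Core.Sem, Atom.sem_valid] using h
    · simpa [core, Core.Sem, Atom.sem_valid, eval] using ht.validOn X (by simp)
  | @map X Y f R ih =>
    have hX := Finset.mem_singleton_self X
    have hY := Finset.mem_singleton_self Y
    simp only [core, Core.Sem]
    rw [image_codeIn (ih)]
    have key : ∀ s : Tuple I {X}, encode ν s X = ν X (s ⟨X, hX⟩) := fun s => by simp [encode]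
    refine codeIn_of_isCode (P := fun d => ∃ s ∈ R.eval I, ∀ X_1 ∈ ({Y} : Finset J),
      veq ν ⟨X, Y, f⟩ (encode ν s X) (ident X_1) (d X_1)) ?_ fun t ht => ?_
    · rintro ⟨s, -, h⟩ Z hZ
      obtain rfl := Finset.mem_singleton.1 hZ
      exact (h Z hZ).lt_right
    · simp only [eval, Finset.mem_singleton, forall_eq, key, Set.mem_ofPred_eq, ← ht ⟨Y, hY⟩,
        veq_number, I.F.map_id]
      simp [eq_comm]
  | @select A X Y X' Y' hX hY f θ g R ih =>
    refine codeIn_of_isCode (fun h => ((ih d).1 h.2).validOn) fun t ht => ?_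
    simp only [core]
    rw [Core.Sem, ih, sem_bin ht hX hY, ht.codeIn_iff, and_comm]
    rfl
  | @selectConst A X X' hX f θ α R ih =>
    refine codeIn_of_isCode (fun h => ((ih d).1 h.2).validOn) fun t ht => ?_
    simp only [core]
    rw [Core.Sem, ih, sem_const ht hX, ht.codeIn_iff, and_comm]
    rfl
  | project h R ih => exact image_ident_codeIn ih h
  | @recast A B σ R ih =>
    simp only [core, Core.Sem]
    rw [image_codeIn (ih)]
    refine codeIn_of_isCode (P := fun d => ∃ s ∈ R.eval I, ∀ X ∈ B,
      veq ν (if h : X ∈ B then ident (σ ⟨X, h⟩).1 else ident X) (encode ν s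
        (if h : X ∈ B then ident (σ ⟨X, h⟩).1 else ident X).1) (ident X) (d X)) ?_ fun t ht => ?_
    · rintro ⟨s, -, h⟩ Z hZ
      exact (h Z hZ).lt_right
    · have key : ∀ s : Tuple I A, ∀ X : {X // X ∈ B},
          encode ν s (σ X).1 = ν (σ X).1 (s (σ X)) := fun s X => by simp [encode]
      have : ∀ s : Tuple I A, ∀ X : {X // X ∈ B},
          veq ν (ident (σ X).1) (encode ν s (σ X).1) (ident X.1) (d X.1) ↔
            I.val X.1 (t X) = I.val (σ X).1 (s (σ X)) := fun s X => by
        rw [key, ← ht X, veq_number]; simp [eq_comm]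
      simp only [eval, Set.mem_ofPred_eq, ← this]
      refine exists_congr fun s => and_congr_right fun _ => ?_
      constructor
      · intro h X; simpa [X.2] using h X.1 X.2
      · intro h X hX; simpa [hX] using h ⟨X, hX⟩
  | union R S ih ih' =>
    simp only [core]
    rw [Core.sem_or, ih, ih']
    simp only [CodeIn, eval, Set.mem_union, or_and_right, exists_or]
  | inter R S ih ih' =>
    refine codeIn_of_isCode (fun h => ((ih d).1 h.1).validOn) fun t ht => ?_
    simp only [core]
    rw [Core.Sem, ih, ih', ht.codeIn_iff, ht.codeIn_iff]
    rfl
  | diff R S ih ih' =>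
    refine codeIn_of_isCode (fun h => ((ih d).1 h.1).validOn) fun t ht => ?_
    simp only [core]
    rw [Core.Sem, Core.Sem, ih, ih', ht.codeIn_iff, ht.codeIn_iff]
    rfl
  | @div A D B hA hD R S ih ih' =>
    have h1 := fun d => image_ident_codeIn (d := d) ih (Finset.sdiff_subset (s := A) (t := B))
    have h2 := fun d => image_ident_codeIn (d := d) ih' hD
    refine codeIn_of_isCode (fun h => ((h1 d).1 h.1).validOn) fun t ht => ?_
    simp only [core, Core.Sem]
    rw [h1, ht.codeIn_iff]
    simp only [h2]
    have h3 := fun d => codeIn_of_isCode (ν := ν) (d := d)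
      (P := fun d => ValidOn I A d ∧ CodeIn ν {t | ∃ s ∈ S.eval I, t = s.restrict hD} d ∧
        ¬ CodeIn ν (R.eval I) d)
      (S := {r | (∃ s ∈ S.eval I, r.restrict hA = s.restrict hD) ∧ r ∉ R.eval I})
      (fun h => h.1) (fun r hr => by
        simp only [hr.codeIn_iff, (hr.restrict hA).codeIn_iff, hr.validOn, true_and]
        rfl)
    -- `Image` ranges over valid tuples anyway, so adding `ValidOn` changes nothing. The predicate
    -- then has the form `CodeIn`, and `image_ident_codeIn` applies.
    have h4 : Image ν A (A \ B) ident (fun d' => CodeIn ν {t | ∃ s ∈ S.eval I,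
        t = s.restrict hD} d' ∧ ¬ R.core.Sem ν d') d ↔ Image ν A (A \ B) ident
        (fun d => ValidOn I A d ∧ CodeIn ν {t | ∃ s ∈ S.eval I, t = s.restrict hD} d ∧
        ¬ CodeIn ν (R.eval I) d) d := by
      simp only [Image, ih]
      refine exists_congr fun d' => ?_
      simp only [ValidOn]
      tauto
    rw [h4, image_ident_codeIn h3 Finset.sdiff_subset, ht.codeIn_iff]
    simp only [eval, Set.mem_ofPred_eq]
    refine and_congr ⟨fun ⟨s, hs, h⟩ => ⟨s, hs, h.symm⟩, fun ⟨s, hs, h⟩ => ⟨s, hs, h.symm⟩⟩ ?_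
    -- By `glue` and `uniq`, `t` and `s` determine exactly one tuple over `A` that extends `t` and
    -- agrees with `s` on `B`. Hence "every `s` has its tuple in `R`" is the same as "no such glued
    -- tuple is outside of `R`", which is how `divide` expresses division with two images and one
    -- difference.
    have glue : ∀ s : Tuple I D, ∃ r : Tuple I A, t = r.restrict Finset.sdiff_subset ∧
        r.restrict hA = s.restrict hD := by
      intro s
      refine ⟨fun X => if h : X.1 ∈ B then s ⟨X.1, hD h⟩ else
        t ⟨X.1, Finset.mem_sdiff.2 ⟨X.2, h⟩⟩, ?_, ?_⟩
      · funext X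
        simp [Tuple.restrict, (Finset.mem_sdiff.1 X.2).2]
      · funext X
        simp [Tuple.restrict, X.2]
    have uniq : ∀ r r' : Tuple I A, r.restrict Finset.sdiff_subset =
        r'.restrict (B := A \ B) Finset.sdiff_subset → r.restrict hA = r'.restrict hA → r = r' := by
      intro r r' ha hb
      funext X
      by_cases h : X.1 ∈ B
      · exact congrFun hb ⟨X.1, h⟩
      · exact congrFun ha ⟨X.1, Finset.mem_sdiff.2 ⟨X.2, h⟩⟩
    constructor
    · intro h s hs
      obtain ⟨r, hr, hr'⟩ := glue s
      by_contra hne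
      refine h ⟨r, ⟨⟨s, hs, hr'⟩, fun hR => hne ⟨r, hR, hr.symm, hr'⟩⟩, hr⟩
    · rintro h ⟨r, ⟨⟨s, hs, hr'⟩, hR⟩, hr⟩
      obtain ⟨r2, h2, h3, h4⟩ := h s hs
      exact hR (uniq r2 r (h3.trans hr) (h4.trans hr'.symm) ▸ h2)
  | @getTree X Y hXY τ R S ih ih' =>
    have hX : X ∈ ({X, Y} : Finset J) := by simp
    have hY : Y ∈ ({X, Y} : Finset J) := by simp
    refine codeIn_of_isCode (fun h => validOn_pair ((ih d).1 h.2.1) ((ih' d).1 h.2.2))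
      fun t ht => ?_
    simp only [core]
    rw [sem_and, sem_and, ih, ih', codeIn_pair_iff ht, sem_bin ht hX hY]
    simp [eval, ValRel.Holds]
  | @getReach X Y E V W hXY src tgt R S K ih ih' ih'' =>
    have hX : X ∈ ({X, Y} : Finset J) := by simp
    have hY : Y ∈ ({X, Y} : Finset J) := by simp
    refine codeIn_of_isCode (fun h => validOn_pair ((ih d).1 h.2.1) ((ih' d).1 h.2.2))
      fun t ht => ?_
    simp only [core]
    rw [sem_and, sem_and, ih, ih', codeIn_pair_iff ht, sem_reach ht ⟨hXY, src, tgt⟩ hX hY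
      fun e => (ih'' _).trans (codeIn_single e)]
    rfl
  | @getnHop X Y E V W hXY src tgt h R S K ih ih' ih'' =>
    have hX : X ∈ ({X, Y} : Finset J) := by simp
    have hY : Y ∈ ({X, Y} : Finset J) := by simp
    cases h with
    | zero =>
      refine codeIn_of_isCode (fun h => validOn_pair ((ih d).1 h.2.1) ((ih' d).1 h.2.2))
        fun t ht => ?_
      simp only [core]
      rw [sem_and, sem_and, ih, ih', codeIn_pair_iff ht, Core.sem_eq, veq_ident ht hX hY]
      rfl
    | succ h =>
      refine codeIn_of_isCode (fun h => validOn_pair ((ih d).1 h.2.1) ((ih' d).1 h.2.2))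
        fun t ht => ?_
      simp only [core]
      rw [sem_and, sem_and, ih, ih', codeIn_pair_iff ht, sem_hop ht ⟨hXY, src, tgt⟩ hX hY
        fun e => (ih'' _).trans (codeIn_single e)]
      rfl
  | @lim B M hM r A hA R ih =>
    refine codeIn_of_isCode (fun h => Core.sem_validOn.1 h.2.1) fun t ht => ?_
    simp only [core]
    rw [Core.Sem, Core.Sem, Core.sem_validOn, Core.sem_all]
    simp only [List.forall_mem_ofFn_iff, ih, (ht.restrict (hA _)).codeIn_iff, ht.validOn, true_and,
      eval, Set.mem_ofPred_eq]
    refine and_congr_right fun _ => ?_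
    simp only [Core.Sem, List.mem_map, Finset.mem_toList, forall_exists_index, and_imp,
      forall_apply_eq_imp_iff₂]
    refine forall₂_congr fun m hm => ?_
    rw [← sem_map (f := m.2.2) ht]
    simp [Core.Sem]

/-- Quantification over `X` is a projection. The links are those of `A.erase X` and not of `A`: the
bound variable may shadow a free one, in which case the old component at `X` must be forgotten. -/
theorem IsCode.erase {A : Finset J} {X : J} {t : Tuple I A} (ht : IsCode ν t d)
    {P : (J → ℕ) → Prop} {S : Set (Tuple I (insert X A))} (h : ∀ d, P d ∧ ValidOn I (insert X A) d ↔
      CodeIn ν S d) :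
    Image ν (insert X A) (A.erase X) ident P d ↔ ∃ v, t.set X v ∈ S := by
  have hs : A.erase X ⊆ insert X A := (Finset.erase_subset _ _).trans (Finset.subset_insert _ _)
  have h1 : Image ν (insert X A) (A.erase X) ident P d ↔ Image ν (insert X A) (A.erase X) ident
      (fun d => P d ∧ ValidOn I (insert X A) d) d := by
    refine exists_congr fun d' => ?_
    simp only [ValidOn]
    tauto
  rw [h1, image_ident_codeIn h hs, (ht.restrict (Finset.erase_subset X A)).codeIn_iff]
  constructor
  · rintro ⟨s, hS, hr⟩
    refine ⟨s ⟨X, Finset.mem_insert_self X A⟩, ?_⟩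
    convert hS
    funext Y
    by_cases hY : Y.1 = X
    · obtain ⟨Y, hY'⟩ := Y
      obtain rfl : Y = X := hY
      simp [Tuple.set]
    · simp only [Tuple.set, hY, dite_false]
      exact congrFun hr ⟨Y.1, Finset.mem_erase.2 ⟨hY, Finset.mem_of_mem_insert_of_ne Y.2 hY⟩⟩
  · rintro ⟨v, hv⟩
    refine ⟨_, hv, ?_⟩
    funext Y
    simp [Tuple.restrict, Tuple.set, (Finset.mem_erase.1 Y.2).1]

/-- An atom constrains only the components it mentions, and a negation admits invalid numbers, so
the translation of formulas adds validity of all free variables. On the code of a tuple this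
condition is void. -/
theorem IsCode.sem_validOn_and {A : Finset J} {t : Tuple I A} (ht : IsCode ν t d)
    {e : Core J U} : (Core.and (.validOn A) e).Sem ν d ↔ e.Sem ν d := by
  rw [sem_and, Core.sem_validOn]
  exact and_iff_right ht.validOn

/-- The translation of formulas preserves the meaning. -/
theorem Formula.sem_core {A : Finset J} (φ : Formula J U A) (d : J → ℕ) :
    φ.core.Sem ν d ↔ CodeIn ν {t | φ.Sat I t} d := by
  induction φ generalizing d with
  | @mem A X hX O =>
    refine codeIn_of_isCode (fun h => Core.sem_validOn.1 h.1) fun t ht => ?_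
    simp only [core]
    rw [ht.sem_validOn_and]
    simp only [Core.Sem]
    rw [image_codeIn_univ]
    simp only [Finset.mem_singleton, forall_eq, ← ht ⟨X, hX⟩]
    constructor
    · rintro ⟨s, h⟩
      have : encode ν s O = ν O (s ⟨O, Finset.mem_singleton_self O⟩) := by simp [encode]
      rw [this, veq_number] at h
      exact ⟨_, by simpa using h⟩
    · rintro ⟨o, ho⟩
      refine ⟨fun Z => cast (congrArg I.F.obj (Finset.mem_singleton.1 Z.2).symm) o, ?_⟩
      · simp only [encode, Finset.mem_singleton_self, dite_true, cast_eq]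
        rw [veq_number]
        simpa using ho
  | @app A X Y hX hY f =>
    refine codeIn_of_isCode (fun h => Core.sem_validOn.1 h.1) fun t ht => ?_
    simp only [core]
    rw [ht.sem_validOn_and, sem_map ht hX hY]
    rfl
  | @cmp A X Y X' Y' hX hY f θ g =>
    refine codeIn_of_isCode (fun h => Core.sem_validOn.1 h.1) fun t ht => ?_
    simp only [core]
    rw [ht.sem_validOn_and, sem_bin ht hX hY]
    rfl
  | @cmpConst A X X' hX f θ α =>
    refine codeIn_of_isCode (fun h => Core.sem_validOn.1 h.1) fun t ht => ?_
    simp only [core]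
    rw [ht.sem_validOn_and, sem_const ht hX]
    rfl
  | @tree A X Y hX hY hXY τ =>
    refine codeIn_of_isCode (fun h => Core.sem_validOn.1 h.1) fun t ht => ?_
    simp only [core]
    rw [ht.sem_validOn_and, sem_bin ht hX hY]
    simp [Sat, ValRel.Holds]
  | @reach A X Y E V W hX hY hXY src tgt =>
    refine codeIn_of_isCode (fun h => Core.sem_validOn.1 h.1) fun t ht => ?_
    simp only [core]
    rw [ht.sem_validOn_and, sem_reach ht ⟨hXY, src, tgt⟩ hX hY (Ks := Set.univ)
      (fun e => by simp [Core.Sem])]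
    rfl
  | @nHop A X Y E V W hX hY hXY src tgt h =>
    refine codeIn_of_isCode (fun h => ?_) fun t ht => ?_
    · cases ‹ℕ› <;> exact Core.sem_validOn.1 h.1
    cases h with
    | zero =>
      simp only [core]
      rw [ht.sem_validOn_and, Core.sem_eq, veq_ident ht hX hY]
      rfl
    | succ h =>
      simp only [core]
      rw [ht.sem_validOn_and, sem_hop ht ⟨hXY, src, tgt⟩ hX hY (Ks := Set.univ)
        (fun e => by simp [Core.Sem])]
      rfl
  | not φ ih =>
    refine codeIn_of_isCode (fun h => Core.sem_validOn.1 h.1) fun t ht => ?_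
    simp only [core]
    rw [ht.sem_validOn_and, Core.Sem, ih, ht.codeIn_iff]
    rfl
  | and φ ψ ih ih' =>
    refine codeIn_of_isCode (fun h => ((ih d).1 h.1).validOn) fun t ht => ?_
    simp only [core]
    rw [Core.Sem, ih, ih', ht.codeIn_iff, ht.codeIn_iff]
    rfl
  | or φ ψ ih ih' =>
    simp only [core]
    rw [Core.sem_or, ih, ih']
    simp only [CodeIn, Sat, Set.mem_ofPred_eq, or_and_right, exists_or]
  | @ex A X φ ih =>
    refine codeIn_of_isCode (fun h => Core.sem_validOn.1 h.1) fun t ht => ?_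
    simp only [core]
    rw [ht.sem_validOn_and, Core.Sem, ht.erase (S := {t | φ.Sat I t})]
    · rfl
    · intro d
      rw [ih]
      exact and_iff_left_of_imp CodeIn.validOn
  | @all A X φ ih =>
    refine codeIn_of_isCode (fun h => Core.sem_validOn.1 h.1) fun t ht => ?_
    simp only [core]
    rw [ht.sem_validOn_and, Core.Sem, Core.Sem, ht.erase (S := {t | ¬ φ.Sat I t})]
    · simp [Sat]
    · intro d
      -- The complement of `φ` contains invalid assignments; they are removed by the condition
      -- `ValidOn` that `IsCode.erase` allows for.
      refine codeIn_of_isCode (P := fun d => (Core.not φ.core).Sem ν d ∧ _) (fun h => h.2) fun t ht => ?_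
      rw [Core.Sem, ih, ht.codeIn_iff]
      exact and_iff_left ht.validOn

end Semantics

end Translation

end CatQuery
end
set_option linter.unusedSectionVars false
noncomputable section
namespace CatQuery

/-! ### A language with arrays and bounded loops -/

section ArrayLanguage

variable {J U : Type} [SmallCategory J]

/-- Expressions over loop variables and arrays. -/
inductive Exp (J U : Type) [SmallCategory J] where
  | var (v : J ⊕ ℕ)
  | lit (n : ℕ)
  /-- The bound of all loops. -/
  | bound
  | card (X : J)
  | add (a b : Exp J U)
  | sub (a b : Exp J U)
  /-- The entry of an array. -/
  | get (a : ℕ) (i : Exp J U)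
  | app (f : Mor J) (a : Exp J U)
  | cmp (θ : Cmp) (X : J) (a : Exp J U) (Y : J) (b : Exp J U)
  | cmpConst (θ : Cmp) (X : J) (a : Exp J U) (α : U)
  | tree (τ : TreeRel) (X : J) (a : Exp J U) (Y : J) (b : Exp J U)
  /-- `a` if `c` is not `0`, otherwise `b`. -/
  | ite (c a b : Exp J U)

/-- Commands. -/
inductive HCmd (J U : Type) [SmallCategory J] where
  | skip
  /-- Set entry `i` of array `a`. -/
  | store (a : ℕ) (i e : Exp J U)
  | seq (c c' : HCmd J U)
  | ite (e : Exp J U) (c c' : HCmd J U)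
  /-- Execute `c` for all values of `v` below the bound. -/
  | forV (v : J ⊕ ℕ) (c : HCmd J U)
  | out (ch : ℕ) (e : Exp J U)

/-- Arrays and output tapes. -/
structure Mem where
  arr : ℕ → ℕ → ℕ
  out : ℕ → List ℕ

/-- Change an entry of an array. -/
def Mem.store (μ : Mem) (a i v : ℕ) : Mem :=
  ⟨Function.update μ.arr a (Function.update (μ.arr a) i v), μ.out⟩

theorem Mem.store_arr (μ : Mem) (a i v b j : ℕ) :
    (μ.store a i v).arr b j = if b = a ∧ j = i then v else μ.arr b j := by
  simp only [store, Function.update_apply]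
  split_ifs <;> simp_all

@[simp] theorem Mem.store_arr_same (μ : Mem) (a i v j : ℕ) :
    (μ.store a i v).arr a j = if j = i then v else μ.arr a j := by simp [store_arr]

theorem Mem.store_arr_ne (μ : Mem) {a b : ℕ} (i v : ℕ) (h : b ≠ a) :
    (μ.store a i v).arr b = μ.arr b := by funext j; simp [store_arr, h]

/-- The input, the bound of loops, the length of arrays, and the number of arrays. -/
structure Ctx (J U : Type) [SmallCategory J] where
  inp : Input J U
  N : ℕ
  M : ℕ
  K : ℕ

namespace Exp

/-- A bound on the number of steps. -/
def cost : Exp J U → ℕ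
  | var _ => 1
  | lit _ => 1
  | bound => 1
  | card _ => 1
  | add a b => a.cost + b.cost + 1
  | sub a b => a.cost + b.cost + 1
  | get _ i => i.cost + 4
  | app _ a => a.cost + 1
  | cmp _ _ a _ b => a.cost + b.cost + 1
  | cmpConst _ _ a _ => a.cost + 1
  | tree _ _ a _ b => a.cost + b.cost + 1
  | ite c a b => c.cost + a.cost + b.cost + 4

end Exp

/-- A bound on the number of steps. -/
def HCmd.cost (N : ℕ) : HCmd J U → ℕ
  | skip => 0
  | store _ i e => i.cost + e.cost + 4
  | seq c c' => c.cost N + c'.cost N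
  | ite e c c' => e.cost + c.cost N + c'.cost N + 3
  | forV _ c => N * (c.cost N + 4) + 2
  | out _ e => e.cost + 1

section Eval

variable [DecidableEq J] [DataDomain U] (C : Ctx J U)

/-- The value of an expression. -/
def Exp.eval (ρ : J ⊕ ℕ → ℕ) (A : ℕ → ℕ → ℕ) : Exp J U → ℕ
  | var v => ρ v
  | lit n => n
  | bound => C.N
  | card X => C.inp.card X
  | add a b => a.eval ρ A + b.eval ρ A
  | sub a b => a.eval ρ A - b.eval ρ A
  | get a i => A a (i.eval ρ A)
  | app f a => C.inp.app f (a.eval ρ A)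
  | cmp θ X a Y b => flag (∃ u v, C.inp.value X (a.eval ρ A) = some u ∧
      C.inp.value Y (b.eval ρ A) = some v ∧ θ.Holds u v)
  | cmpConst θ X a α => flag (∃ u, C.inp.value X (a.eval ρ A) = some u ∧ θ.Holds u α)
  | tree τ X a Y b => flag (∃ u v, C.inp.value X (a.eval ρ A) = some u ∧
      C.inp.value Y (b.eval ρ A) = some v ∧ τ.Holds u v)
  | ite c a b => if c.eval ρ A = 0 then b.eval ρ A else a.eval ρ A

/-- The evaluation reads no array out of bounds. -/
def Exp.Safe (ρ : J ⊕ ℕ → ℕ) (A : ℕ → ℕ → ℕ) : Exp J U → Prop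
  | var _ => True
  | lit _ => True
  | bound => True
  | card _ => True
  | add a b => a.Safe ρ A ∧ b.Safe ρ A
  | sub a b => a.Safe ρ A ∧ b.Safe ρ A
  | get a i => i.Safe ρ A ∧ a < C.K ∧ i.eval C ρ A < C.M
  | app _ a => a.Safe ρ A
  | cmp _ _ a _ b => a.Safe ρ A ∧ b.Safe ρ A
  | cmpConst _ _ a _ => a.Safe ρ A
  | tree _ _ a _ b => a.Safe ρ A ∧ b.Safe ρ A
  | ite c a b => c.Safe ρ A ∧ (c.eval C ρ A ≠ 0 → a.Safe ρ A) ∧ (c.eval C ρ A = 0 → b.Safe ρ A)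

/-- The effect of a command. -/
def HCmd.exec : HCmd J U → (J ⊕ ℕ → ℕ) → Mem → Mem
  | skip, _, μ => μ
  | store a i e, ρ, μ => μ.store a (i.eval C ρ μ.arr) (e.eval C ρ μ.arr)
  | seq c c', ρ, μ => c'.exec ρ (c.exec ρ μ)
  | ite e c c', ρ, μ => if e.eval C ρ μ.arr = 0 then c'.exec ρ μ else c.exec ρ μ
  | forV v c, ρ, μ =>
      (List.range C.N).foldl (fun μ k => c.exec (Function.update ρ v k) μ) μ
  | out ch e, ρ, μ =>
      ⟨μ.arr, Function.update μ.out ch (μ.out ch ++ [e.eval C ρ μ.arr])⟩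

/-- The command accesses no array out of bounds, and its loops do not share variables. -/
def HCmd.Safe : HCmd J U → (J ⊕ ℕ → ℕ) → Mem → Prop
  | skip, _, _ => True
  | store a i e, ρ, μ => i.Safe C ρ μ.arr ∧ e.Safe C ρ μ.arr ∧ a < C.K ∧ i.eval C ρ μ.arr < C.M
  | seq c c', ρ, μ => c.Safe ρ μ ∧ c'.Safe ρ (c.exec C ρ μ)
  | ite e c c', ρ, μ => e.Safe C ρ μ.arr ∧ (e.eval C ρ μ.arr ≠ 0 → c.Safe ρ μ) ∧
      (e.eval C ρ μ.arr = 0 → c'.Safe ρ μ)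
  | forV v c, ρ, μ => ρ v = 0 ∧ ∀ k < C.N, c.Safe (Function.update ρ v k)
      ((List.range k).foldl (fun μ k => c.exec C (Function.update ρ v k) μ) μ)
  | out _ e, ρ, μ => e.Safe C ρ μ.arr

/-! ### Implementation of the array language -/

/-- The register of variable number `v`. -/
def adV (v : ℕ) : ℕ := 8 * v
/-- The register for the base address of an array. -/
def adB (a : ℕ) : ℕ := 8 * a + 2
/-- Registers for intermediate results. -/
def adS (i : ℕ) : ℕ := 8 * i + 4
/-- The register that holds `1`. -/
def adOne : ℕ := 6
/-- The register that holds the bound of loops. -/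
def adN : ℕ := 14

/-- Code that leaves the value of an expression in the `k`-th register for results. -/
def Exp.code (num : J ⊕ ℕ → ℕ) : Exp J U → ℕ → Cmd J U
  | var v, k => .instr (.copy (adS k) (adV (num v)))
  | lit n, k => .instr (.const (adS k) n)
  | bound, k => .instr (.copy (adS k) adN)
  | card X, k => .instr (.card (adS k) X)
  | add a b, k => .seq (a.code num k) (.seq (b.code num (k + 1))
      (.instr (.plus (adS k) (adS k) (adS (k + 1)))))
  | sub a b, k => .seq (a.code num k) (.seq (b.code num (k + 1))
      (.instr (.minus (adS k) (adS k) (adS (k + 1)))))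
  | get a i, k => .seq (i.code num k) (.seq (.instr (.plus (adS k) (adS k) (adB a)))
      (.seq (.instr (.plus (adS k) (adS k) (adS k))) (.seq (.instr (.plus (adS k) (adS k) adOne))
        (.instr (.load (adS k) (adS k))))))
  | app f a, k => .seq (a.code num k) (.instr (.app (adS k) f (adS k)))
  | cmp θ X a Y b, k => .seq (a.code num k) (.seq (b.code num (k + 1))
      (.instr (.cmp (adS k) θ X (adS k) Y (adS (k + 1)))))
  | cmpConst θ X a α, k => .seq (a.code num k) (.instr (.cmpConst (adS k) θ X (adS k) α))
  | tree τ X a Y b, k => .seq (a.code num k) (.seq (b.code num (k + 1))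
      (.instr (.tree (adS k) τ X (adS k) Y (adS (k + 1)))))
  | ite c a b, k => .seq (c.code num k) (.seq (.instr (.minus (adS (k + 1)) adOne (adS k)))
      (.seq (.ifNZ (adS k) (a.code num (k + 2))) (.seq (.ifNZ (adS (k + 1)) (b.code num (k + 2)))
        (.instr (.copy (adS k) (adS (k + 2)))))))

/-- Code for a command that uses the registers for results from the `k`-th on. -/
def HCmd.code (num : J ⊕ ℕ → ℕ) : HCmd J U → ℕ → Cmd J U
  | skip, _ => .skip
  | store a i e, k => .seq (i.code num k) (.seq (e.code num (k + 1))
      (.seq (.instr (.plus (adS k) (adS k) (adB a))) (.seq (.instr (.plus (adS k) (adS k) (adS k)))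
        (.seq (.instr (.plus (adS k) (adS k) adOne))
          (.instr (.store (adS k) (adS (k + 1))))))))
  | seq c c', k => .seq (c.code num k) (c'.code num k)
  | ite e c c', k => .seq (e.code num k) (.seq (.instr (.minus (adS (k + 1)) adOne (adS k)))
      (.seq (.ifNZ (adS k) (c.code num (k + 2))) (.ifNZ (adS (k + 1)) (c'.code num (k + 2)))))
  | forV v c, k => .seq (.instr (.const (adV (num v)) 0))
      (.seq (.loop (.seq (c.code num k) (.seq (.instr (.plus (adV (num v)) (adV (num v)) adOne))
        (.seq (.instr (.minus (adS k) adN (adV (num v))))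
          (.instr (.minus (adS k) adOne (adS k)))))) (adS k))
        (.instr (.const (adV (num v)) 0)))
  | out ch e, k => .seq (e.code num k) (.instr (.out ch (adS k)))

/-- Evaluation within `t` steps. -/
def BigLE (inp : Input J U) (c : Cmd J U) (t : ℕ) (σ σ' : St) : Prop :=
  ∃ t' ≤ t, Big inp c σ t' σ'

theorem BigLE.seq {inp : Input J U} {a b : Cmd J U} {t t' : ℕ} {σ σ' σ'' : St}
    (h : BigLE inp a t σ σ') (h' : BigLE inp b t' σ' σ'') :
    BigLE inp (.seq a b) (t + t') σ σ'' := by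
  obtain ⟨s, hs, h⟩ := h
  obtain ⟨s', hs', h'⟩ := h'
  exact ⟨s + s', by omega, .seq h h'⟩

theorem BigLE.instr (inp : Input J U) (i : Instr J U) (hi : ¬ i.IsJump) (σ : St) :
    BigLE inp (.instr i) 1 σ (i.eff inp false σ) := ⟨1, le_rfl, .instr i false σ hi⟩

theorem BigLE.ifNZ {inp : Input J U} {c : Cmd J U} {t r : ℕ} {σ σ' : St} (hr : σ.mem r ≠ 0)
    (h : BigLE inp c t σ σ') : BigLE inp (.ifNZ r c) (t + 1) σ σ' := by
  obtain ⟨s, hs, h⟩ := h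
  exact ⟨s + 1, by omega, .ifNZ hr h⟩

theorem BigLE.ifZ {inp : Input J U} {c : Cmd J U} {r : ℕ} {σ : St} (hr : σ.mem r = 0) :
    BigLE inp (.ifNZ r c) 1 σ σ := ⟨1, le_rfl, .ifZ hr⟩

theorem BigLE.mono {inp : Input J U} {c : Cmd J U} {t t' : ℕ} {σ σ' : St}
    (h : BigLE inp c t σ σ') (ht : t ≤ t') : BigLE inp c t' σ σ' :=
  ⟨h.choose, h.choose_spec.1.trans ht, h.choose_spec.2⟩

/-- The registers represent variables and arrays. -/
structure Rep (num : J ⊕ ℕ → ℕ) (ρ : J ⊕ ℕ → ℕ) (μ : Mem) (σ : St) : Prop where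
  var : ∀ v, σ.mem (adV (num v)) = ρ v
  base : ∀ a < C.K, σ.mem (adB a) = a * C.M
  one : σ.mem adOne = 1
  bound : σ.mem adN = C.N
  cell : ∀ a i, i < C.M → σ.mem (2 * (a * C.M + i) + 1) = μ.arr a i
  out : σ.out = μ.out

/-- The states agree, except for the registers for results from the `k`-th on. -/
def Agree (k : ℕ) (σ σ' : St) : Prop :=
  σ'.out = σ.out ∧ ∀ x, (∀ i ≥ k, x ≠ adS i) → σ'.mem x = σ.mem x

theorem Agree.trans {k : ℕ} {σ σ' σ'' : St} (h : Agree k σ σ') (h' : Agree k σ' σ'') :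
    Agree k σ σ'' :=
  ⟨h'.1.trans h.1, fun x hx => (h'.2 x hx).trans (h.2 x hx)⟩

theorem Agree.mono {k k' : ℕ} {σ σ' : St} (h : Agree k' σ σ') (hk : k ≤ k') : Agree k σ σ' :=
  ⟨h.1, fun x hx => h.2 x fun i hi => hx i (hk.trans hi)⟩

theorem Agree.put {k : ℕ} (σ : St) {i : ℕ} (hi : k ≤ i) (v : ℕ) : Agree k σ (σ.put (adS i) v) :=
  ⟨rfl, fun x hx => by simp [St.put_mem, hx i hi]⟩

theorem Agree.low {k i : ℕ} {σ σ' : St} (h : Agree k σ σ') (hi : i < k) :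
    σ'.mem (adS i) = σ.mem (adS i) :=
  h.2 _ fun j hj => by simp only [adS]; omega

variable {C} {num : J ⊕ ℕ → ℕ} {ρ : J ⊕ ℕ → ℕ} {μ : Mem} {σ σ' : St}

theorem Rep.agree (h : Rep C num ρ μ σ) {k : ℕ} (ha : Agree k σ σ') : Rep C num ρ μ σ' where
  var v := by rw [ha.2 _ (by intro i _; simp only [adS, adV]; omega), h.var]
  base a hK := by rw [ha.2 _ (by intro i _; simp only [adS, adB]; omega), h.base a hK]
  one := by rw [ha.2 _ (by intro i _; simp only [adS, adOne]; omega), h.one]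
  bound := by rw [ha.2 _ (by intro i _; simp only [adS, adN]; omega), h.bound]
  cell a i hi := by rw [ha.2 _ (by intro i _; simp only [adS]; omega), h.cell a i hi]
  out := ha.1.trans h.out

/-- Code for level `k` alters only the result registers from the `k`-th on, which is what `Agree k`
records. The first operand in register `k` therefore survives the evaluation of the second one at
level `k + 1`, and no register of a variable or an array cell is touched. -/
theorem Exp.big (e : Exp J U) (k : ℕ) (h : Rep C num ρ μ σ) (hs : e.Safe C ρ μ.arr) :
    ∃ σ', BigLE C.inp (e.code num k) e.cost σ σ' ∧ Agree k σ σ' ∧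
      σ'.mem (adS k) = e.eval C ρ μ.arr := by
  have two : ∀ (a b : Exp J U) (i : Instr J U), ¬ i.IsJump →
      (∀ (k : ℕ) {σ : St}, Rep C num ρ μ σ → ∃ σ', BigLE C.inp (a.code num k) a.cost σ σ' ∧
        Agree k σ σ' ∧ σ'.mem (adS k) = a.eval C ρ μ.arr) →
      (∀ (k : ℕ) {σ : St}, Rep C num ρ μ σ → ∃ σ', BigLE C.inp (b.code num k) b.cost σ σ' ∧
        Agree k σ σ' ∧ σ'.mem (adS k) = b.eval C ρ μ.arr) →
      ∀ (k : ℕ) {σ : St}, Rep C num ρ μ σ → ∃ σ', σ'.mem (adS k) = a.eval C ρ μ.arr ∧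
        σ'.mem (adS (k + 1)) = b.eval C ρ μ.arr ∧ Agree k σ σ' ∧
        BigLE C.inp (.seq (a.code num k) (.seq (b.code num (k + 1)) (.instr i)))
          (a.cost + b.cost + 1) σ (i.eff C.inp false σ') := by
    intro a b i hi ha hb k σ h
    obtain ⟨σ1, h1, a1, e1⟩ := ha k h
    obtain ⟨σ2, h2, a2, e2⟩ := hb (k + 1) (h.agree a1)
    exact ⟨σ2, by rw [a2.low (Nat.lt_succ_self k), e1], e2, a1.trans (a2.mono (Nat.le_succ k)),
      (h1.seq (h2.seq (.instr _ i hi σ2))).mono (by omega)⟩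
  induction e generalizing k σ with
  | var v => exact ⟨_, .instr _ _ (by simp [Instr.IsJump]) _, .put _ le_rfl _,
      by simp [Instr.eff, eval, h.var]⟩
  | lit n => exact ⟨_, .instr _ _ (by simp [Instr.IsJump]) _, .put _ le_rfl _,
      by simp [Instr.eff, eval]⟩
  | bound => exact ⟨_, .instr _ _ (by simp [Instr.IsJump]) _, .put _ le_rfl _,
      by simp [Instr.eff, eval, h.bound]⟩
  | card X => exact ⟨_, .instr _ _ (by simp [Instr.IsJump]) _, .put _ le_rfl _,
      by simp [Instr.eff, eval]⟩
  | add a b iha ihb =>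
    obtain ⟨σ1, e1, e2, a1, h1⟩ := two a b (.plus (adS k) (adS k) (adS (k + 1))) (by simp [Instr.IsJump])
      (fun k _ h => iha k h hs.1) (fun k _ h => ihb k h hs.2) k h
    exact ⟨_, h1, a1.trans (.put _ le_rfl _), by simp [Instr.eff, eval, e1, e2]⟩
  | sub a b iha ihb =>
    obtain ⟨σ1, e1, e2, a1, h1⟩ := two a b (.minus (adS k) (adS k) (adS (k + 1))) (by simp [Instr.IsJump])
      (fun k _ h => iha k h hs.1) (fun k _ h => ihb k h hs.2) k h
    exact ⟨_, h1, a1.trans (.put _ le_rfl _), by simp [Instr.eff, eval, e1, e2]⟩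
  | get a i ih =>
    obtain ⟨σ1, h1, a1, e1⟩ := ih k h hs.1
    have r1 := h.agree a1
    refine ⟨_, (h1.seq ((BigLE.instr _ _ (by simp [Instr.IsJump]) _).seq
      ((BigLE.instr _ _ (by simp [Instr.IsJump]) _).seq ((BigLE.instr _ _
      (by simp [Instr.IsJump]) _).seq (BigLE.instr _ _ (by simp [Instr.IsJump]) _))))).mono
        (by simp only [cost]; omega),
      a1.trans ((Agree.put _ le_rfl _).trans ((Agree.put _ le_rfl _).trans
        ((Agree.put _ le_rfl _).trans (Agree.put _ le_rfl _)))), ?_⟩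
    have hne : adOne ≠ adS k := by simp only [adS, adOne]; omega
    have hne' : 2 * (a * C.M + eval C ρ μ.arr i) + 1 ≠ adS k := by simp only [adS]; omega
    simp only [Instr.eff, St.put_mem_same, e1, St.put_mem_ne _ _ hne, r1.one, eval, r1.base _ hs.2.1]
    -- The address `2 * (a * M + i) + 1` is formed by additions: `i` plus the base `a * M`, doubled,
    -- plus one. Array cells get all odd addresses, so the even ones are free for bookkeeping
    -- although `M` is unknown at compile time.
    rw [← r1.cell a _ hs.2.2, show eval C ρ μ.arr i + a * C.M + (eval C ρ μ.arr i + a * C.M) + 1 =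
      2 * (a * C.M + eval C ρ μ.arr i) + 1 by ring]
    simp only [St.put_mem_ne _ _ hne']
  | app f a ih =>
    obtain ⟨σ1, h1, a1, e1⟩ := ih k h hs
    exact ⟨_, h1.seq (.instr _ _ (by simp [Instr.IsJump]) _), a1.trans (.put _ le_rfl _),
      by simp [Instr.eff, eval, e1]⟩
  | cmp θ X a Y b iha ihb =>
    obtain ⟨σ1, e1, e2, a1, h1⟩ := two a b (.cmp (adS k) θ X (adS k) Y (adS (k + 1)))
      (by simp [Instr.IsJump]) (fun k _ h => iha k h hs.1) (fun k _ h => ihb k h hs.2) k h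
    exact ⟨_, h1, a1.trans (.put _ le_rfl _), by simp [Instr.eff, eval, e1, e2]⟩
  | cmpConst θ X a α ih =>
    obtain ⟨σ1, h1, a1, e1⟩ := ih k h hs
    exact ⟨_, h1.seq (.instr _ _ (by simp [Instr.IsJump]) _), a1.trans (.put _ le_rfl _),
      by simp [Instr.eff, eval, e1]⟩
  | tree τ X a Y b iha ihb =>
    obtain ⟨σ1, e1, e2, a1, h1⟩ := two a b (.tree (adS k) τ X (adS k) Y (adS (k + 1)))
      (by simp [Instr.IsJump]) (fun k _ h => iha k h hs.1) (fun k _ h => ihb k h hs.2) k h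
    exact ⟨_, h1, a1.trans (.put _ le_rfl _), by simp [Instr.eff, eval, e1, e2]⟩
  | ite c a b ihc iha ihb =>
    obtain ⟨σ1, h1, a1, e1⟩ := ihc k h hs.1
    have r1 := h.agree a1
    -- Register `adS (k + 1)` receives `1 - c`, so exactly one of the two conditionals fires. The
    -- branches work from level `k + 2` on and leave this flag intact for the second test.
    have a2 : Agree k σ1 (σ1.put (adS (k + 1)) (σ1.mem adOne - σ1.mem (adS k))) :=
      .put _ (Nat.le_succ k) _
    have r2 := r1.agree a2
    have hk : (σ1.put (adS (k + 1)) (σ1.mem adOne - σ1.mem (adS k))).mem (adS k) =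
        c.eval C ρ μ.arr := by
      rw [St.put_mem_ne _ _ (by simp only [adS]; omega), e1]
    have hk1 : (σ1.put (adS (k + 1)) (σ1.mem adOne - σ1.mem (adS k))).mem (adS (k + 1)) =
        1 - c.eval C ρ μ.arr := by rw [St.put_mem_same, e1, r1.one]
    have i2 : BigLE C.inp (.instr (.minus (adS (k + 1)) adOne (adS k))) 1 σ1
        (σ1.put (adS (k + 1)) (σ1.mem adOne - σ1.mem (adS k))) :=
      .instr _ _ (by simp [Instr.IsJump]) _
    by_cases hc : c.eval C ρ μ.arr = 0
    · obtain ⟨σ3, h3, a3, e3⟩ := ihb (k + 2) r2 (hs.2.2 hc)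
      refine ⟨_, (h1.seq (i2.seq ((BigLE.ifZ (hk.trans hc)).seq ((BigLE.ifNZ (by
        rw [hk1, hc]; simp) h3).seq (.instr _ _ (by simp [Instr.IsJump]) _))))).mono
        (by simp only [cost]; omega), a1.trans (a2.trans ((a3.mono (by omega)).trans
          (.put _ le_rfl _))), ?_⟩
      simp [Instr.eff, e3, eval, hc]
    · obtain ⟨σ3, h3, a3, e3⟩ := iha (k + 2) r2 (hs.2.1 hc)
      refine ⟨_, (h1.seq (i2.seq ((BigLE.ifNZ (by rwa [hk]) h3).seq ((BigLE.ifZ (by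
        rw [a3.low (by omega), hk1]; omega)).seq (.instr _ _ (by simp [Instr.IsJump]) _))))).mono
        (by simp only [cost]; omega), a1.trans (a2.trans ((a3.mono (by omega)).trans
          (.put _ le_rfl _))), ?_⟩
      simp [Instr.eff, e3, eval, hc]

/-- Bookkeeping registers are even and cells odd, so they cannot collide. Two cells do not collide
either: division by `M` recovers `b` from `b * M + j` when `j < M`. -/
theorem Rep.store (h : Rep C num ρ μ σ) {a i v : ℕ} (hi : i < C.M) :
    Rep C num ρ (μ.store a i v) (σ.put (2 * (a * C.M + i) + 1) v) where
  var w := by rw [St.put_mem_ne _ _ (by simp only [adV]; omega), h.var]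
  base b hK := by rw [St.put_mem_ne _ _ (by simp only [adB]; omega), h.base b hK]
  one := by rw [St.put_mem_ne _ _ (by simp only [adOne]; omega), h.one]
  bound := by rw [St.put_mem_ne _ _ (by simp only [adN]; omega), h.bound]
  cell b j hj := by
    rw [St.put_mem, Mem.store_arr, h.cell b j hj]
    refine if_congr ⟨fun e => ?_, fun ⟨e, e'⟩ => by rw [e, e']⟩ rfl rfl
    have e' : b * C.M + j = a * C.M + i := by omega
    have hM : 0 < C.M := by omega
    have hb : b = a := by
      have := congrArg (· / C.M) e'
      simpa [Nat.add_comm _ j, Nat.add_comm _ i, Nat.add_mul_div_right, hM,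
        Nat.div_eq_of_lt hj, Nat.div_eq_of_lt hi] using this
    subst hb
    exact ⟨rfl, by omega⟩
  out := h.out

theorem Rep.put_var (hn : Function.Injective num) (h : Rep C num ρ μ σ) (v : J ⊕ ℕ) (k : ℕ) :
    Rep C num (Function.update ρ v k) μ (σ.put (adV (num v)) k) where
  var w := by
    rw [St.put_mem, Function.update_apply, h.var]
    refine if_congr ⟨fun e => hn ?_, fun e => by rw [e]⟩ rfl rfl
    simp only [adV] at e; omega
  base b hK := by rw [St.put_mem_ne _ _ (by simp only [adB, adV]; omega), h.base b hK]
  one := by rw [St.put_mem_ne _ _ (by simp only [adOne, adV]; omega), h.one]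
  bound := by rw [St.put_mem_ne _ _ (by simp only [adN, adV]; omega), h.bound]
  cell b j hj := by rw [St.put_mem_ne _ _ (by simp only [adV]; omega), h.cell b j hj]
  out := h.out

/-- The condition `1 ≤ N` is needed because a compiled loop tests at its end and runs at least once.
The last clause, on result registers below `k`, protects the flag of an enclosing conditional. -/
theorem HCmd.big (hn : Function.Injective num) (hN : 1 ≤ C.N) (c : HCmd J U) (k : ℕ)
    (h : Rep C num ρ μ σ) (hs : c.Safe C ρ μ) :
    ∃ σ', BigLE C.inp (c.code num k) (c.cost C.N) σ σ' ∧ Rep C num ρ (c.exec C ρ μ) σ' ∧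
      ∀ i < k, σ'.mem (adS i) = σ.mem (adS i) := by
  induction c generalizing k ρ μ σ with
  | skip => exact ⟨σ, ⟨0, le_rfl, .skip σ⟩, h, fun _ _ => rfl⟩
  | store a i e =>
    obtain ⟨hi, he, ha, hM⟩ := hs
    obtain ⟨σ1, h1, a1, e1⟩ := i.big k h hi
    obtain ⟨σ2, h2, a2, e2⟩ := e.big (k + 1) (h.agree a1) he
    have e1' : σ2.mem (adS k) = _ := (a2.low (Nat.lt_succ_self k)).trans e1
    have a12 := a1.trans (a2.mono (Nat.le_succ k))
    have r2 := h.agree a12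
    refine ⟨_, (h1.seq (h2.seq ((BigLE.instr _ _ (by simp [Instr.IsJump]) _).seq
      ((BigLE.instr _ _ (by simp [Instr.IsJump]) _).seq ((BigLE.instr _ _
      (by simp [Instr.IsJump]) _).seq (BigLE.instr _ _ (by simp [Instr.IsJump]) _)))))).mono
        (by simp only [cost]; omega), ?_⟩
    have hne : adOne ≠ adS k := by simp only [adS, adOne]; omega
    have hne' : adS (k + 1) ≠ adS k := by simp only [adS]; omega
    simp only [Instr.eff, St.put_mem_same, e1', St.put_mem_ne _ _ hne, r2.one, r2.base _ ha,
      St.put_mem_ne _ _ hne', e2, exec]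
    rw [show Exp.eval C ρ μ.arr i + a * C.M + (Exp.eval C ρ μ.arr i + a * C.M) + 1 =
      2 * (a * C.M + Exp.eval C ρ μ.arr i) + 1 by ring]
    refine ⟨Rep.store (r2.agree ((Agree.put _ le_rfl _).trans ((Agree.put _ le_rfl _).trans
      (Agree.put _ le_rfl _)))) hM, fun j hj => ?_⟩
    have : adS j ≠ adS k := by simp only [adS]; omega
    have h3 : adS j ≠ 2 * (a * C.M + Exp.eval C ρ μ.arr i) + 1 := by simp only [adS]; omega
    rw [St.put_mem_ne _ _ h3]
    simp only [St.put_mem_ne _ _ this]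
    exact a12.low hj
  | seq c c' ih ih' =>
    obtain ⟨σ1, h1, r1, l1⟩ := ih k h hs.1
    obtain ⟨σ2, h2, r2, l2⟩ := ih' k r1 hs.2
    exact ⟨σ2, h1.seq h2, r2, fun i hi => (l2 i hi).trans (l1 i hi)⟩
  | ite e c c' ih ih' =>
    obtain ⟨σ1, h1, a1, e1⟩ := e.big k h hs.1
    have r1 := h.agree a1
    have a2 : Agree k σ1 (σ1.put (adS (k + 1)) (σ1.mem adOne - σ1.mem (adS k))) :=
      .put _ (Nat.le_succ k) _
    have r2 := r1.agree a2
    have hk : (σ1.put (adS (k + 1)) (σ1.mem adOne - σ1.mem (adS k))).mem (adS k) =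
        e.eval C ρ μ.arr := by
      rw [St.put_mem_ne _ _ (by simp only [adS]; omega), e1]
    have hk1 : (σ1.put (adS (k + 1)) (σ1.mem adOne - σ1.mem (adS k))).mem (adS (k + 1)) =
        1 - e.eval C ρ μ.arr := by rw [St.put_mem_same, e1, r1.one]
    have i2 : BigLE C.inp (.instr (.minus (adS (k + 1)) adOne (adS k))) 1 σ1
        (σ1.put (adS (k + 1)) (σ1.mem adOne - σ1.mem (adS k))) :=
      .instr _ _ (by simp [Instr.IsJump]) _
    by_cases hc : e.eval C ρ μ.arr = 0
    · obtain ⟨σ3, h3, r3, l3⟩ := ih' (k + 2) r2 (hs.2.2 hc)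
      refine ⟨σ3, (h1.seq (i2.seq ((BigLE.ifZ (hk.trans hc)).seq (BigLE.ifNZ (by
        rw [hk1, hc]; simp) h3)))).mono (by simp only [cost]; omega),
        by simpa only [exec, hc, if_true] using r3, fun i hi => ?_⟩
      rw [l3 i (by omega), (a1.trans a2).low hi]
    · obtain ⟨σ3, h3, r3, l3⟩ := ih (k + 2) r2 (hs.2.1 hc)
      refine ⟨σ3, (h1.seq (i2.seq ((BigLE.ifNZ (by rwa [hk]) h3).seq (BigLE.ifZ (by
        rw [l3 (k + 1) (by omega), hk1]; omega))))).mono (by simp only [cost]; omega),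
        by simpa only [exec, hc, if_false] using r3, fun i hi => ?_⟩
      rw [l3 i (by omega), (a1.trans a2).low hi]
  | forV v c ih =>
    obtain ⟨hv, hs⟩ := hs
    set body : Cmd J U := .seq (c.code num k) (.seq (.instr (.plus (adV (num v)) (adV (num v)) adOne))
        (.seq (.instr (.minus (adS k) adN (adV (num v))))
          (.instr (.minus (adS k) adOne (adS k))))) with hbody
    let μs : ℕ → Mem := fun j =>
      (List.range j).foldl (fun μ k => c.exec C (Function.update ρ v k) μ) μ
    have step : ∀ j < C.N, ∀ σ, Rep C num (Function.update ρ v j) (μs j) σ →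
        ∃ σ', BigLE C.inp body (c.cost C.N + 3) σ σ' ∧
          Rep C num (Function.update ρ v (j + 1)) (μs (j + 1)) σ' ∧
          (∀ i < k, σ'.mem (adS i) = σ.mem (adS i)) ∧ σ'.mem (adS k) = 1 - (C.N - (j + 1)) := by
      intro j hj σ hr
      obtain ⟨σ1, h1, r1, l1⟩ := ih k hr (hs j hj)
      have r2 : Rep C num (Function.update ρ v (j + 1)) (μs (j + 1))
          (σ1.put (adV (num v)) (σ1.mem (adV (num v)) + σ1.mem adOne)) := by
        have := r1.put_var hn v (j + 1)
        rw [r1.var, r1.one]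
        simpa [μs, List.range_succ] using this
      refine ⟨_, (h1.seq ((BigLE.instr _ _ (by simp [Instr.IsJump]) _).seq ((BigLE.instr _ _
        (by simp [Instr.IsJump]) _).seq (BigLE.instr _ _ (by simp [Instr.IsJump]) _)))).mono
        (by omega), r2.agree ((Agree.put (k := k) _ le_rfl _).trans (Agree.put _ le_rfl _)), ?_, ?_⟩
      · intro i hi
        have h2 : adS i ≠ adS k := by simp only [adS]; omega
        have h3 : adS i ≠ adV (num v) := by simp only [adS, adV]; omega
        simp only [Instr.eff, St.put_mem_ne _ _ h2, St.put_mem_ne _ _ h3, l1 i hi]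
      · have h2 : adOne ≠ adS k := by simp only [adS, adOne]; omega
        have h3 : adOne ≠ adV (num v) := by simp only [adV, adOne]; omega
        have h4 : adN ≠ adV (num v) := by simp only [adV, adN]; omega
        simp only [Instr.eff, St.put_mem_same, St.put_mem_ne _ _ h2, St.put_mem_ne _ _ h3,
          St.put_mem_ne _ _ h4, r1.one, r1.bound, r1.var, Function.update_self]
    -- Induction on the number `r` of iterations after the current one. The loop ends when `1 - (N -
    -- (j + 1))` is not `0`, that is, after the iteration `j = N - 1`.
    have iter : ∀ r j, j + r + 1 = C.N → ∀ σ, Rep C num (Function.update ρ v j) (μs j) σ →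
        ∃ σ', BigLE C.inp (.loop body (adS k)) ((r + 1) * (c.cost C.N + 4)) σ σ' ∧
          Rep C num (Function.update ρ v C.N) (μs C.N) σ' ∧
          (∀ i < k, σ'.mem (adS i) = σ.mem (adS i)) := by
      intro r
      induction r with
      | zero =>
        intro j hj σ hr
        obtain ⟨σ1, ⟨t, ht, h1⟩, r1, l1, s1⟩ := step j (by omega) σ hr
        have hj' : j + 1 = C.N := by omega
        rw [hj'] at r1 s1
        exact ⟨σ1, ⟨t + 1, by omega, .last h1 (by rw [s1]; simp)⟩, r1, l1⟩
      | succ r ihr =>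
        intro j hj σ hr
        obtain ⟨σ1, ⟨t, ht, h1⟩, r1, l1, s1⟩ := step j (by omega) σ hr
        obtain ⟨σ2, ⟨t2, ht2, h2⟩, r2, l2⟩ := ihr (j + 1) (by omega) σ1 r1
        exact ⟨σ2, ⟨t + 1 + t2, by rw [add_mul (r + 1)]; omega, .again h1 (by rw [s1]; omega) h2⟩, r2,
          fun i hi => (l2 i hi).trans (l1 i hi)⟩
    obtain ⟨σ1, h1, r1, l1⟩ := iter (C.N - 1) 0 (by omega) (σ.put (adV (num v)) 0)
      (h.put_var hn v 0)
    have r2 := r1.put_var hn v 0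
    -- Resetting the loop variable to `0` restores the environment, because safety demands `ρ v = 0`
    -- before the loop.
    rw [Function.update_idem, ← hv, Function.update_eq_self] at r2
    refine ⟨σ1.put (adV (num v)) (ρ v), ((BigLE.instr _ _ (by simp [Instr.IsJump]) _).seq
      (h1.seq ?_)).mono (t := 1 + (_ + 1)) ?_, r2, ?_⟩
    · have := BigLE.instr C.inp (.const (adV (num v)) 0) (by simp [Instr.IsJump]) σ1
      rw [Instr.eff] at this
      rwa [hv]
    · simp only [cost, Nat.sub_add_cancel hN]; omega
    · intro i hi
      have h3 : adS i ≠ adV (num v) := by simp only [adS, adV]; omega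
      rw [St.put_mem_ne _ _ h3, l1 i hi, St.put_mem_ne _ _ h3]
  | out ch e =>
    obtain ⟨σ1, h1, a1, e1⟩ := e.big k h hs
    have r1 := h.agree a1
    refine ⟨_, h1.seq (.instr _ _ (by simp [Instr.IsJump]) _), ⟨r1.var, r1.base, r1.one, r1.bound,
      r1.cell, ?_⟩, fun i hi => a1.low hi⟩
    simp [Instr.eff, exec, e1, r1.out]

end Eval

end ArrayLanguage

end CatQuery
end
set_option linter.unusedSectionVars false
noncomputable section
namespace CatQuery

/-! ### Reasoning about the array language -/

section ArrayLogic

variable {J U : Type} [SmallCategory J] [DecidableEq J] [DataDomain U] {C : Ctx J U}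

/-- The command is safe, and its result satisfies `Q`. -/
def HCmd.WP (C : Ctx J U) (c : HCmd J U) (ρ : J ⊕ ℕ → ℕ) (μ : Mem) (Q : Mem → Prop) : Prop :=
  c.Safe C ρ μ ∧ Q (c.exec C ρ μ)

namespace HCmd

variable {c c' : HCmd J U} {ρ : J ⊕ ℕ → ℕ} {μ : Mem} {Q Q' : Mem → Prop}

theorem WP.mono (h : c.WP C ρ μ Q) (hQ : ∀ μ, Q μ → Q' μ) : c.WP C ρ μ Q' := ⟨h.1, hQ _ h.2⟩

theorem wp_skip (h : Q μ) : (skip : HCmd J U).WP C ρ μ Q := ⟨trivial, h⟩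

theorem wp_store {a : ℕ} {i e : Exp J U} (hi : i.Safe C ρ μ.arr) (he : e.Safe C ρ μ.arr)
    (ha : a < C.K) (hM : i.eval C ρ μ.arr < C.M)
    (h : Q (μ.store a (i.eval C ρ μ.arr) (e.eval C ρ μ.arr))) : (store a i e).WP C ρ μ Q :=
  ⟨⟨hi, he, ha, hM⟩, h⟩

theorem wp_seq (h : c.WP C ρ μ fun μ' => c'.WP C ρ μ' Q) : (seq c c').WP C ρ μ Q :=
  ⟨⟨h.1, h.2.1⟩, h.2.2⟩

theorem wp_ite {e : Exp J U} (he : e.Safe C ρ μ.arr) (h : e.eval C ρ μ.arr ≠ 0 → c.WP C ρ μ Q)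
    (h' : e.eval C ρ μ.arr = 0 → c'.WP C ρ μ Q) : (ite e c c').WP C ρ μ Q := by
  refine ⟨⟨he, fun h0 => (h h0).1, fun h0 => (h' h0).1⟩, ?_⟩
  by_cases h0 : e.eval C ρ μ.arr = 0
  · simpa [exec, h0] using (h' h0).2
  · simpa [exec, h0] using (h h0).2

/-- The invariant is indexed by the number of completed iterations. It gives safety of each
iteration and the final state at once, since the memory before iteration `k` is a fold over
`List.range k`. -/
theorem wp_forV {v : J ⊕ ℕ} (Inv : ℕ → Mem → Prop) (hv : ρ v = 0) (h0 : Inv 0 μ)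
    (hs : ∀ k < C.N, ∀ μ, Inv k μ → c.WP C (Function.update ρ v k) μ (Inv (k + 1)))
    (hQ : ∀ μ, Inv C.N μ → Q μ) : (forV v c).WP C ρ μ Q := by
  have key : ∀ k ≤ C.N, Inv k
      ((List.range k).foldl (fun μ k => c.exec C (Function.update ρ v k) μ) μ) := by
    intro k
    induction k with
    | zero => intro _; simpa using h0
    | succ k ih =>
      intro hk
      rw [List.range_succ, List.foldl_append]
      exact (hs k hk _ (ih (by omega))).2
  exact ⟨⟨hv, fun k hk => (hs k hk _ (key k hk.le)).1⟩, hQ _ (key _ le_rfl)⟩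

/-- Nested loops. -/
def forAll (vs : List (J ⊕ ℕ)) (c : HCmd J U) : HCmd J U := vs.foldr forV c

end HCmd

/-- The assignments to the variables `vs` in the order of nested loops. -/
def box (N : ℕ) : List (J ⊕ ℕ) → (J ⊕ ℕ → ℕ) → List (J ⊕ ℕ → ℕ)
  | [], ρ => [ρ]
  | v :: vs, ρ => (List.range N).flatMap fun k => box N vs (Function.update ρ v k)

theorem mem_box {N : ℕ} {vs : List (J ⊕ ℕ)} {ρ ρ' : J ⊕ ℕ → ℕ} (hvs : vs.Nodup) :
    ρ' ∈ box N vs ρ ↔ (∀ v ∈ vs, ρ' v < N) ∧ ∀ v ∉ vs, ρ' v = ρ v := by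
  induction vs generalizing ρ with
  | nil => simp [box, funext_iff]
  | cons v vs ih =>
    obtain ⟨hv, hvs⟩ := List.nodup_cons.1 hvs
    simp only [box, List.mem_flatMap, List.mem_range, ih hvs, List.mem_cons, not_or, and_imp,
      forall_eq_or_imp]
    constructor
    · rintro ⟨k, hk, h1, h2⟩
      refine ⟨⟨?_, h1⟩, fun w hw hw' => ?_⟩
      · rw [h2 v hv, Function.update_self]; exact hk
      · rw [h2 w hw', Function.update_of_ne hw]
    · rintro ⟨⟨hk, h1⟩, h2⟩
      refine ⟨ρ' v, hk, h1, fun w hw => ?_⟩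
      by_cases e : w = v
      · subst e; simp
      · rw [Function.update_of_ne e, h2 w e hw]

theorem nodup_box {N : ℕ} {vs : List (J ⊕ ℕ)} {ρ : J ⊕ ℕ → ℕ} (hvs : vs.Nodup) :
    (box N vs ρ).Nodup := by
  induction vs generalizing ρ with
  | nil => simp [box]
  | cons v vs ih =>
    obtain ⟨hv, hvs⟩ := List.nodup_cons.1 hvs
    refine List.nodup_flatMap.2 ⟨fun k _ => ih hvs, ?_⟩
    refine List.nodup_range.imp_of_mem fun {k l} _ _ hkl ρ' h h' => hkl ?_
    have h1 := ((mem_box hvs).1 h).2 v hv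
    have h2 := ((mem_box hvs).1 h').2 v hv
    simp only [Function.update_self] at h1 h2
    exact h1.symm.trans h2

theorem length_box {N : ℕ} {vs : List (J ⊕ ℕ)} {ρ : J ⊕ ℕ → ℕ} :
    (box N vs ρ).length = N ^ vs.length := by
  induction vs generalizing ρ with
  | nil => simp [box]
  | cons v vs ih => simp [box, ih, pow_succ, mul_comm]

namespace HCmd

variable {c c' : HCmd J U} {ρ : J ⊕ ℕ → ℕ} {μ : Mem} {Q : Mem → Prop}

/-- The invariant depends on the list of assignments visited so far, so nested loops are treated
like one loop through `box`, whatever their depth. -/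
theorem wp_forAll {vs : List (J ⊕ ℕ)} (Inv : List (J ⊕ ℕ → ℕ) → Mem → Prop) (hvs : vs.Nodup)
    (hv : ∀ v ∈ vs, ρ v = 0) (h0 : Inv [] μ)
    (hs : ∀ L, ∀ ρ' ∈ box C.N vs ρ, ∀ μ, Inv L μ → c.WP C ρ' μ (Inv (L ++ [ρ'])))
    (hQ : ∀ μ, Inv (box C.N vs ρ) μ → Q μ) : (forAll vs c).WP C ρ μ Q := by
  -- For the induction, an inner loop must be able to start after some assignments `L0` have been
  -- visited by earlier iterations of the outer ones.
  suffices H : ∀ L0, Inv L0 μ → (forAll vs c).WP C ρ μ (Inv (L0 ++ box C.N vs ρ)) from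
    (H [] h0).mono hQ
  clear h0 hQ
  induction vs generalizing ρ μ with
  | nil => intro L0 h; exact hs L0 ρ (by simp [box]) μ h
  | cons v vs ih =>
    intro L0 h
    obtain ⟨hv', hvs⟩ := List.nodup_cons.1 hvs
    refine wp_forV (fun k => Inv (L0 ++ (List.range k).flatMap fun k =>
      box C.N vs (Function.update ρ v k))) (hv v (by simp)) (by simpa using h) ?_ fun _ h => h
    intro k hk μ hI
    rw [List.range_succ, List.flatMap_append, ← List.append_assoc]
    simp only [List.flatMap_cons, List.flatMap_nil, List.append_nil]
    refine ih hvs (fun w hw => ?_) (fun L ρ' h' => hs L ρ' ?_) _ hI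
    · rw [Function.update_of_ne (by rintro rfl; exact hv' hw)]
      exact hv w (by simp [hw])
    · exact List.mem_flatMap.2 ⟨k, by simpa using hk, h'⟩

/-- A level adds `4 * N + 2 ≤ 6 * N` steps of overhead per execution, and `N` is at most the total
number of iterations. The overhead per innermost iteration is therefore linear in the number of
levels. -/
theorem cost_forAll {N : ℕ} (hN : 1 ≤ N) (vs : List (J ⊕ ℕ)) :
    (forAll vs c).cost N ≤ N ^ vs.length * (c.cost N + 6 * vs.length) := by
  induction vs with
  | nil => simp [forAll]
  | cons v vs ih =>
    have h1 : (forAll (v :: vs) c).cost N = N * ((forAll vs c).cost N + 4) + 2 := rfl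
    have h2 : N ≤ N ^ (vs.length + 1) := Nat.le_self_pow (by omega) N
    rw [h1, List.length_cons]
    calc N * ((forAll vs c).cost N + 4) + 2
        ≤ N * (N ^ vs.length * (c.cost N + 6 * vs.length) + 4) + 2 * N := by gcongr; omega
      _ = N ^ (vs.length + 1) * (c.cost N + 6 * vs.length) + 6 * N := by ring
      _ ≤ N ^ (vs.length + 1) * (c.cost N + 6 * vs.length) + 6 * N ^ (vs.length + 1) := by gcongr
      _ = _ := by ring

end HCmd

/-- The memories agree outside of the array `a`. -/
def SameBut (a : ℕ) (μ μ' : Mem) : Prop := μ'.out = μ.out ∧ ∀ b ≠ a, μ'.arr b = μ.arr b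

theorem SameBut.refl (a : ℕ) (μ : Mem) : SameBut a μ μ := ⟨rfl, fun _ _ => rfl⟩

theorem SameBut.store {a : ℕ} {μ μ' : Mem} (h : SameBut a μ μ') (i v : ℕ) :
    SameBut a μ (μ'.store a i v) :=
  ⟨h.1, fun b hb => by rw [Mem.store_arr_ne _ _ _ hb, h.2 b hb]⟩

namespace HCmd

variable {ρ : J ⊕ ℕ → ℕ} {μ : Mem}

/-- Set entry `i` of `a` to `1` for all values of the variables that satisfy the condition. -/
def scatter (vs : List (J ⊕ ℕ)) (a : ℕ) (cond i : Exp J U) : HCmd J U :=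
  forAll vs (ite cond (store a i (.lit 1)) skip)

/-- This is the basic device against searching for witnesses: one pass over the sources marks every
target that has one. The index has to be meaningful only where the condition holds, and both
expressions may be evaluated in any memory that differs from the first one in `a` alone, since the
loop writes nothing else. -/
theorem wp_scatter {vs : List (J ⊕ ℕ)} {a : ℕ} {cond i : Exp J U} (hvs : vs.Nodup)
    (hv : ∀ v ∈ vs, ρ v = 0) (ha : a < C.K) (h0 : ∀ k, μ.arr a k = 0)
    {P : (J ⊕ ℕ → ℕ) → Prop} {ix : (J ⊕ ℕ → ℕ) → ℕ}
    (hc : ∀ ρ' ∈ box C.N vs ρ, ∀ μ', SameBut a μ μ' → cond.Safe C ρ' μ'.arr ∧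
      (cond.eval C ρ' μ'.arr ≠ 0 ↔ P ρ'))
    (hi : ∀ ρ' ∈ box C.N vs ρ, P ρ' → ∀ μ', SameBut a μ μ' → i.Safe C ρ' μ'.arr ∧
      i.eval C ρ' μ'.arr = ix ρ' ∧ ix ρ' < C.M) :
    (scatter vs a cond i).WP C ρ μ fun μ' => SameBut a μ μ' ∧
      ∀ k, μ'.arr a k = flag (∃ ρ' ∈ box C.N vs ρ, P ρ' ∧ ix ρ' = k) := by
  refine wp_forAll (fun L μ' => SameBut a μ μ' ∧ ∀ k, μ'.arr a k = flag (∃ ρ' ∈ L, P ρ' ∧ ix ρ' = k))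
    hvs hv ⟨.refl _ _, fun k => ?_⟩ ?_ fun _ h => h
  · rw [h0, flag_false (by simp)]
  · rintro L ρ' hρ' μ' ⟨hsb, hk⟩
    obtain ⟨c1, c2⟩ := hc ρ' hρ' μ' hsb
    refine wp_ite c1 (fun hne => ?_) fun he => ?_
    · obtain ⟨i1, i2, i3⟩ := hi ρ' hρ' (c2.1 hne) μ' hsb
      refine wp_store i1 trivial ha (by rwa [i2]) ⟨hsb.store _ _, fun k => ?_⟩
      rw [Mem.store_arr_same, i2]
      by_cases e : k = ix ρ'
      · rw [if_pos e, Exp.eval, flag_true ⟨ρ', by simp, c2.1 hne, e.symm⟩]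
      · rw [if_neg e, hk]
        refine flag_congr ⟨fun ⟨x, hx, h⟩ => ⟨x, by simp [hx], h⟩, ?_⟩
        rintro ⟨x, hx, h1, h2⟩
        rcases List.mem_append.1 hx with hx | hx
        · exact ⟨x, hx, h1, h2⟩
        · rw [List.mem_singleton.1 hx] at h2
          exact absurd h2.symm e
    · have hP : ¬ P ρ' := fun h => c2.2 h he
      refine wp_skip ⟨hsb, fun k => ?_⟩
      rw [hk]
      refine flag_congr ⟨fun ⟨x, hx, h⟩ => ⟨x, by simp [hx], h⟩, ?_⟩
      rintro ⟨x, hx, h1, h2⟩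
      rcases List.mem_append.1 hx with hx | hx
      · exact ⟨x, hx, h1, h2⟩
      · rw [List.mem_singleton.1 hx] at h1
        exact absurd h1 hP

end HCmd

/-- `j + 1` for the last `j < n` with `R j`, or `0`. -/
def lastHit (R : ℕ → Prop) : ℕ → ℕ
  | 0 => 0
  | n + 1 => @ite ℕ (R n) (Classical.propDecidable _) (n + 1) (lastHit R n)

theorem lastHit_succ_iff {R : ℕ → Prop} {n j : ℕ} :
    lastHit R n = j + 1 ↔ j < n ∧ R j ∧ ∀ k < n, R k → k ≤ j := by
  induction n with
  | zero => simp [lastHit]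
  | succ n ih =>
    by_cases h : R n
    · simp only [lastHit, h, if_true, Nat.add_right_cancel_iff]
      constructor
      · rintro rfl; exact ⟨by omega, h, fun k hk _ => by omega⟩
      · rintro ⟨h1, _, h3⟩; have := h3 n (by omega) h; omega
    · simp only [lastHit, h, if_false, ih]
      constructor
      · rintro ⟨h1, h2, h3⟩
        refine ⟨by omega, h2, fun k hk hR => ?_⟩
        rcases Nat.lt_succ_iff_lt_or_eq.1 hk with hk | rfl
        exacts [h3 k hk hR, absurd hR h]
      · rintro ⟨h1, h2, h3⟩
        have : j ≠ n := by rintro rfl; exact h h2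
        exact ⟨by omega, h2, fun k hk hR => h3 k (by omega) hR⟩

theorem lastHit_le {R : ℕ → Prop} {n : ℕ} : lastHit R n ≤ n := by
  rcases h : lastHit R n with _ | j
  · omega
  · have := (lastHit_succ_iff.1 h).1; omega

theorem lastHit_eq_zero_iff {R : ℕ → Prop} {n : ℕ} : lastHit R n = 0 ↔ ∀ k < n, ¬ R k := by
  induction n with
  | zero => simp [lastHit]
  | succ n ih =>
    by_cases h : R n
    · simp only [lastHit, h, if_true]
      exact ⟨by omega, fun h' => absurd h (h' n (by omega))⟩
    · simp only [lastHit, h, if_false, ih]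
      constructor
      · intro h' k hk
        rcases Nat.lt_succ_iff_lt_or_eq.1 hk with hk | rfl
        exacts [h' k hk, h]
      · exact fun h' k hk => h' k (by omega)

theorem lastHit_congr {R R' : ℕ → Prop} {n : ℕ} (h : ∀ k, R k ↔ R' k) :
    lastHit R n = lastHit R' n := by rw [funext fun k => propext (h k)]

/-- The last hit for a relation that determines its second argument. -/
theorem lastHit_eq_succ_of_unique {R : ℕ → Prop} {n j : ℕ} (hn : ∀ k, R k → k < n)
    (hu : ∀ k k', R k → R k' → k = k') : lastHit R n = j + 1 ↔ R j := by
  rw [lastHit_succ_iff]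
  exact ⟨fun h => h.2.1, fun h => ⟨hn j h, h, fun k _ hk => (hu k j hk h).le⟩⟩

/-- The first loop variable. -/
abbrev vi : J ⊕ ℕ := .inr 0
/-- The second loop variable. -/
abbrev vj : J ⊕ ℕ := .inr 1

namespace HCmd

variable {ρ : J ⊕ ℕ → ℕ} {μ : Mem}

/-- Set entry `i` of `a` to the last `j` that satisfies the condition. -/
def lastHits (a : ℕ) (cond : Exp J U) : HCmd J U :=
  forV vi (forV vj (ite cond (store a (.var vi) (.add (.var vj) (.lit 1))) skip))

/-- The inner loop runs upwards and overwrites, so the last hit survives. Entries are shifted by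
one, and an untouched entry `0` means that there is none. -/
theorem wp_lastHits {a : ℕ} {cond : Exp J U} (hi : ρ vi = 0) (hj : ρ vj = 0) (ha : a < C.K)
    (hNM : C.N ≤ C.M) (h0 : ∀ k, μ.arr a k = 0) {R : ℕ → ℕ → Prop}
    (hc : ∀ i < C.N, ∀ j < C.N, ∀ μ', SameBut a μ μ' →
      cond.Safe C (Function.update (Function.update ρ vi i) vj j) μ'.arr ∧
      (cond.eval C (Function.update (Function.update ρ vi i) vj j) μ'.arr ≠ 0 ↔ R i j)) :
    (lastHits a cond).WP C ρ μ fun μ' => SameBut a μ μ' ∧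
      ∀ i < C.N, μ'.arr a i = lastHit (R i) C.N := by
  refine wp_forV (fun n μ' => SameBut a μ μ' ∧ (∀ i < n, μ'.arr a i = lastHit (R i) C.N) ∧
    ∀ i ≥ n, μ'.arr a i = 0) hi ⟨.refl _ _, by simp, fun i _ => h0 i⟩ ?_
    fun μ' h => ⟨h.1, h.2.1⟩
  rintro n hn μ1 ⟨s1, l1, z1⟩
  refine wp_forV (fun m μ' => SameBut a μ μ' ∧ (∀ i < n, μ'.arr a i = lastHit (R i) C.N) ∧
    μ'.arr a n = lastHit (R n) m ∧ ∀ i ≥ n + 1, μ'.arr a i = 0) ?_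
    ⟨s1, l1, by simpa [lastHit] using z1 n le_rfl, fun i hi => z1 i (by omega)⟩ ?_ ?_
  · rw [Function.update_of_ne (by simp)]; exact hj
  · rintro m hm μ2 ⟨s2, l2, e2, z2⟩
    obtain ⟨c1, c2⟩ := hc n hn m hm μ2 s2
    refine wp_ite c1 (fun hne => ?_) fun he => ?_
    · have hR := c2.1 hne
      refine wp_store trivial ⟨trivial, trivial⟩ ha ?_ ?_
      · simp only [Exp.eval]
        rw [Function.update_of_ne (by simp), Function.update_self]; omega
      · have h1 : (Exp.var vi : Exp J U).eval C
            (Function.update (Function.update ρ vi n) vj m) μ2.arr = n := by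
          simp [Exp.eval, Function.update_of_ne]
        have h2 : (Exp.add (.var vj) (.lit 1) : Exp J U).eval C
            (Function.update (Function.update ρ vi n) vj m) μ2.arr = m + 1 := by
          simp [Exp.eval]
        rw [h1, h2]
        refine ⟨s2.store _ _, fun i hi => ?_, ?_, fun i hi => ?_⟩
        · rw [Mem.store_arr_same, if_neg (by omega), l2 i hi]
        · simp [lastHit, hR]
        · rw [Mem.store_arr_same, if_neg (by omega), z2 i hi]
    · have hR : ¬ R n m := fun h => c2.2 h he
      refine wp_skip ⟨s2, l2, ?_, z2⟩
      simp [lastHit, hR, e2]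
  · rintro μ2 ⟨s2, l2, e2, z2⟩
    refine ⟨s2, fun i hi => ?_, z2⟩
    rcases Nat.lt_succ_iff_lt_or_eq.1 hi with hi | rfl
    exacts [l2 i hi, e2]

end HCmd

end ArrayLogic

/-! ### Numbering of tuples -/

section Keys

variable {J : Type} [Fintype J]

/-- A numbering of the objects. -/
def objIdx (X : J) : ℕ := Fintype.equivFin J X

theorem objIdx_lt (X : J) : objIdx X < Fintype.card J := (Fintype.equivFin J X).2

theorem objIdx_inj {X Y : J} (h : objIdx X = objIdx Y) : X = Y :=
  (Fintype.equivFin J).injective (Fin.ext h)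

/-- The number with the digits `d`. -/
def key (N : ℕ) (d : J → ℕ) : ℕ := ∑ X, d X * N ^ objIdx X

/-- `key` is expansion in base `N`, so the equivalence of digit functions with `Fin (N ^ p)`
provides both its range and its injectivity. -/
theorem key_eq {N : ℕ} {d : J → ℕ} (hd : ∀ X, d X < N) :
    key N d = finFunctionFinEquiv (fun i => (⟨d ((Fintype.equivFin J).symm i), hd _⟩ : Fin N)) := by
  rw [finFunctionFinEquiv_apply, key, ← (Fintype.equivFin J).symm.sum_comp]
  simp [objIdx]

theorem key_lt {N : ℕ} {d : J → ℕ} (hd : ∀ X, d X < N) : key N d < N ^ Fintype.card J := by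
  rw [key_eq hd]; exact Fin.is_lt _

theorem key_inj {N : ℕ} {d d' : J → ℕ} (hd : ∀ X, d X < N) (hd' : ∀ X, d' X < N)
    (h : key N d = key N d') : d = d' := by
  rw [key_eq hd, key_eq hd'] at h
  have := finFunctionFinEquiv.injective (Fin.ext h)
  funext X
  simpa using congrArg Fin.val (congrFun this (Fintype.equivFin J X))

theorem key_single [DecidableEq J] {N : ℕ} (X : J) (k : ℕ) :
    key N (Pi.single X k) = k * N ^ objIdx X := by
  rw [key, Finset.sum_eq_single X]
  · simp
  · intro Y _ hY; simp [Pi.single_eq_of_ne hY]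
  · simp

theorem key_add {N : ℕ} (d d' : J → ℕ) : key N (d + d') = key N d + key N d' := by
  simp [key, add_mul, Finset.sum_add_distrib]

/-- The digits at positions in `B`. -/
def digitsOn [DecidableEq J] (B : Finset J) (d : J → ℕ) (X : J) : ℕ := if X ∈ B then d X else 0

theorem sum_eq_key [DecidableEq J] {N : ℕ} (B : Finset J) (d : J → ℕ) :
    (B.toList.map fun X => d X * N ^ objIdx X).sum = key N (digitsOn B d) := by
  rw [Finset.sum_map_toList, key]
  simp [digitsOn, ite_mul, Finset.sum_ite_mem]

end Keys

end CatQuery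
end
set_option linter.unusedSectionVars false
noncomputable section
namespace CatQuery

/-! ### Tables -/

section Tables

variable {J U : Type} [SmallCategory J] [DecidableEq J] [Fintype J] [DataDomain U]
  {I : Instance J U} {ν : Numbering I} {C : Ctx J U}

/-- The context fits the input. -/
structure Fits (C : Ctx J U) (ν : Numbering I) : Prop where
  inp_eq : C.inp = I.input ν []
  one_le : 1 ≤ C.N
  card_le : ∀ X, Fintype.card (I.F.obj X) ≤ C.N
  length : C.M = C.N ^ Fintype.card J
  pos : 0 < Fintype.card J

theorem Fits.le (hC : Fits C ν) : C.N ≤ C.M := by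
  rw [hC.length]; exact Nat.le_self_pow hC.pos.ne' _

theorem Fits.key_lt (hC : Fits C ν) {d : J → ℕ} (hd : ∀ X, d X < C.N) : key C.N d < C.M := by
  rw [hC.length]; exact CatQuery.key_lt hd

theorem single_lt {N : ℕ} {X : J} {k : ℕ} (hk : k < N) (Y : J) :
    (Pi.single X k : J → ℕ) Y < N := by
  by_cases h : Y = X
  · subst h; simpa
  · rw [Pi.single_eq_of_ne h]; omega

theorem Fits.digit_lt (hC : Fits C ν) (X : J) {k : ℕ} (hk : k < C.N) :
    k * C.N ^ objIdx X < C.M := by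
  rw [← key_single]; exact hC.key_lt (single_lt hk)

/-- The array with the multiples of the weight of the digit at `X`. -/
def wt (X : J) : ℕ := 1 + objIdx X

/-- The first array that can be used for tables. -/
def tableBase (J : Type) [Fintype J] : ℕ := Fintype.card J + 2

theorem wt_lt (X : J) : wt X < tableBase J := by
  have := objIdx_lt X
  simp only [wt, tableBase]; omega

/-- The arrays of multiples of weights are set up. -/
def Weights (C : Ctx J U) (μ : Mem) : Prop :=
  ∀ (X : J) (k : ℕ), k < C.N → μ.arr (wt X) k = k * C.N ^ objIdx X

/-- The component at `X`. -/
def dg (X : J) : Exp J U := .var (.inl X)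

/-- The environment with digits `d`. -/
def env (d : J → ℕ) : J ⊕ ℕ → ℕ := Sum.elim d fun _ => 0

@[simp] theorem eval_dg (d : J → ℕ) (A : ℕ → ℕ → ℕ) (X : J) :
    (dg X : Exp J U).eval C (env d) A = d X := rfl

@[simp] theorem safe_dg (ρ : J ⊕ ℕ → ℕ) (A : ℕ → ℕ → ℕ) (X : J) :
    (dg X : Exp J U).Safe C ρ A := trivial

/-- The sum of the multiples of weights for the digits `e X` with `X` in a list. -/
def sumE (l : List J) (e : J → Exp J U) : Exp J U :=
  l.foldr (fun X r => .add (.get (wt X) (e X)) r) (.lit 0)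

/-- The machine cannot multiply in one step. The products `d X * N ^ objIdx X` are read from the
precomputed arrays `wt X`, so a key takes a number of steps proportional to the number of digits. -/
theorem sumE_ok {μ : Mem} (hC : Fits C ν) (hK : tableBase J ≤ C.K) (hW : Weights C μ)
    {ρ : J ⊕ ℕ → ℕ} {e : J → Exp J U} {l : List J}
    (h : ∀ X ∈ l, (e X).Safe C ρ μ.arr ∧ (e X).eval C ρ μ.arr < C.N) :
    (sumE l e).Safe C ρ μ.arr ∧ (sumE l e).eval C ρ μ.arr =
      (l.map fun X => (e X).eval C ρ μ.arr * C.N ^ objIdx X).sum := by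
  induction l with
  | nil => exact ⟨trivial, rfl⟩
  | cons X l ih =>
    obtain ⟨s, v⟩ := ih fun Y hY => h Y (List.mem_cons_of_mem _ hY)
    obtain ⟨s', v'⟩ := h X (by simp)
    refine ⟨⟨⟨s', (wt_lt X).trans_le hK, v'.trans_le hC.le⟩, s⟩, ?_⟩
    change μ.arr (wt X) _ + _ = _
    rw [hW X _ v', List.map_cons, List.sum_cons]
    congr 1

theorem cost_sumE {c : ℕ} {e : J → Exp J U} {l : List J} (h : ∀ X ∈ l, (e X).cost ≤ c) :
    (sumE l e).cost ≤ l.length * (c + 5) + 1 := by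
  induction l with
  | nil => simp [sumE, Exp.cost]
  | cons X l ih =>
    have h1 : (sumE (X :: l) e).cost = (e X).cost + 4 + (sumE l e).cost + 1 := rfl
    have := ih fun Y hY => h Y (List.mem_cons_of_mem _ hY)
    have := h X (by simp)
    rw [h1, List.length_cons, add_mul]; omega

/-- The number of the current tuple. -/
def keyE (J U : Type) [SmallCategory J] [Fintype J] : Exp J U :=
  sumE (Finset.univ : Finset J).toList dg

theorem keyE_ok {μ : Mem} (hC : Fits C ν) (hK : tableBase J ≤ C.K) (hW : Weights C μ)
    {d : J → ℕ} (hd : ∀ X, d X < C.N) :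
    (keyE J U).Safe C (env d) μ.arr ∧ (keyE J U).eval C (env d) μ.arr = key C.N d := by
  obtain ⟨s, v⟩ := sumE_ok (l := (Finset.univ : Finset J).toList) (e := dg) (ρ := env d) hC hK hW
    fun X _ => ⟨safe_dg _ _ _, hd X⟩
  refine ⟨s, v.trans ?_⟩
  change ((Finset.univ : Finset J).toList.map fun X => d X * C.N ^ objIdx X).sum = _
  rw [sum_eq_key]
  congr 1
  funext X
  simp [digitsOn]

theorem cost_keyE : (keyE J U).cost ≤ 6 * Fintype.card J + 1 := by
  refine (cost_sumE (c := 1) fun _ _ => le_rfl).trans ?_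
  rw [Finset.length_toList, Finset.card_univ]; omega

/-- The array `a` is a table of the predicate `P`. -/
def Table (C : Ctx J U) (μ : Mem) (a : ℕ) (P : (J → ℕ) → Prop) : Prop :=
  ∀ d : J → ℕ, (∀ X, d X < C.N) → μ.arr a (key C.N d) = flag (P d)

theorem Table.congr {μ : Mem} {a : ℕ} {P P' : (J → ℕ) → Prop} (h : Table C μ a P)
    (hP : ∀ d, (∀ X, d X < C.N) → (P d ↔ P' d)) : Table C μ a P' := fun d hd => by
  rw [h d hd, flag_congr (hP d hd)]

/-- The entry of a table for the current tuple. -/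
def tabE (a : ℕ) : Exp J U := .get a (keyE J U)

theorem tabE_ok {μ : Mem} (hC : Fits C ν) (hK : tableBase J ≤ C.K) (hW : Weights C μ)
    {a : ℕ} (ha : a < C.K) {P : (J → ℕ) → Prop} (hT : Table C μ a P)
    {d : J → ℕ} (hd : ∀ X, d X < C.N) : (tabE a : Exp J U).Safe C (env d) μ.arr ∧
      (tabE a : Exp J U).eval C (env d) μ.arr = flag (P d) := by
  obtain ⟨s, v⟩ := keyE_ok (U := U) hC hK hW hd
  refine ⟨⟨s, ha, by rw [v]; exact hC.key_lt hd⟩, ?_⟩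
  rw [tabE, Exp.eval, v, hT d hd]

theorem cost_tabE (a : ℕ) : (tabE a : Exp J U).cost ≤ 6 * Fintype.card J + 5 := by
  have := cost_keyE (J := J) (U := U)
  simp only [tabE, Exp.cost]; omega

/-- The memories agree outside of the arrays from `lo` to `hi`. -/
def Frame (lo hi : ℕ) (μ μ' : Mem) : Prop :=
  μ'.out = μ.out ∧ ∀ b, (b < lo ∨ hi ≤ b) → μ'.arr b = μ.arr b

theorem SameBut.frame {a lo hi : ℕ} {μ μ' : Mem} (h : SameBut a μ μ') (h1 : lo ≤ a) (h2 : a < hi) :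
    Frame lo hi μ μ' := ⟨h.1, fun b hb => h.2 b (by omega)⟩

theorem Frame.refl (lo hi : ℕ) (μ : Mem) : Frame lo hi μ μ := ⟨rfl, fun _ _ => rfl⟩

theorem Frame.trans {lo hi : ℕ} {μ μ' μ'' : Mem} (h : Frame lo hi μ μ') (h' : Frame lo hi μ' μ'') :
    Frame lo hi μ μ'' := ⟨h'.1.trans h.1, fun b hb => (h'.2 b hb).trans (h.2 b hb)⟩

theorem Frame.mono {lo hi lo' hi' : ℕ} {μ μ' : Mem} (h : Frame lo hi μ μ') (h1 : lo' ≤ lo)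
    (h2 : hi ≤ hi') : Frame lo' hi' μ μ' := ⟨h.1, fun b hb => h.2 b (by omega)⟩

theorem Frame.table {lo hi a : ℕ} {μ μ' : Mem} (h : Frame lo hi μ μ') {P : (J → ℕ) → Prop}
    (hT : Table C μ a P) (ha : a < lo ∨ hi ≤ a) : Table C μ' a P := fun d hd => by
  rw [h.2 a ha]; exact hT d hd

theorem Frame.weights {lo hi : ℕ} {μ μ' : Mem} (h : Frame lo hi μ μ') (hW : Weights C μ)
    (hlo : tableBase J ≤ lo) : Weights C μ' := fun X k hk => by
  rw [h.2 _ (Or.inl ((wt_lt X).trans_le hlo))]; exact hW X k hk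

theorem SameBut.weights {a : ℕ} {μ μ' : Mem} (h : SameBut a μ μ') (hW : Weights C μ)
    (ha : tableBase J ≤ a) : Weights C μ' := fun X k hk => by
  rw [h.2 _ ((wt_lt X).trans_le ha).ne]; exact hW X k hk

theorem SameBut.table {a b : ℕ} {μ μ' : Mem} (h : SameBut a μ μ') {P : (J → ℕ) → Prop}
    (hT : Table C μ b P) (hb : b ≠ a) : Table C μ' b P := fun d hd => by
  rw [h.2 b hb]; exact hT d hd

/-- The variables for all components in a list. -/
def digitVars (l : List J) : List (J ⊕ ℕ) := l.map .inl

theorem nodup_digitVars {l : List J} (h : l.Nodup) : (digitVars l).Nodup :=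
  h.map Sum.inl_injective

theorem mem_box_digitVars {N : ℕ} {l : List J} (hl : l.Nodup) {ρ' : J ⊕ ℕ → ℕ} :
    ρ' ∈ box N (digitVars l) (fun _ => 0) ↔
      ∃ d : J → ℕ, ρ' = env d ∧ (∀ X ∈ l, d X < N) ∧ ∀ X ∉ l, d X = 0 := by
  rw [mem_box (nodup_digitVars hl)]
  simp only [digitVars, List.mem_map]
  constructor
  · rintro ⟨h1, h2⟩
    refine ⟨fun X => ρ' (.inl X), ?_, fun X hX => h1 _ ⟨X, hX, rfl⟩, fun X hX => h2 _ (by simpa)⟩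
    funext v
    rcases v with X | i
    · rfl
    · exact h2 _ (by simp)
  · rintro ⟨d, rfl, h1, h2⟩
    refine ⟨?_, ?_⟩
    · rintro _ ⟨X, hX, rfl⟩; exact h1 X hX
    · rintro (X | i) hv
      · exact h2 X fun hX => hv ⟨X, hX, rfl⟩
      · rfl

/-- Fill the table `a` by a condition on the current tuple. -/
def fill (a : ℕ) (cond : Exp J U) : HCmd J U :=
  .scatter (digitVars (Finset.univ : Finset J).toList) a cond (keyE J U)

/-- A table is indexed by assignments to all objects, even when the relation has fewer components;
this makes all operators uniform in cost. Every key is hit by a single assignment, by `key_inj`, so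
the marks left by scattering are the truth values. -/
theorem wp_fill (hC : Fits C ν) {a : ℕ} (ha : a < C.K) (ha' : tableBase J ≤ a) {μ : Mem}
    (hW : Weights C μ) (h0 : ∀ k, μ.arr a k = 0) {cond : Exp J U} {P : (J → ℕ) → Prop}
    (hc : ∀ d : J → ℕ, (∀ X, d X < C.N) → ∀ μ', SameBut a μ μ' → Weights C μ' →
      cond.Safe C (env d) μ'.arr ∧ (cond.eval C (env d) μ'.arr ≠ 0 ↔ P d)) :
    (fill a cond).WP C (fun _ => 0) μ fun μ' => SameBut a μ μ' ∧ Table C μ' a P := by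
  have hl : (Finset.univ : Finset J).toList.Nodup := Finset.nodup_toList _
  have hbox : ∀ ρ' : J ⊕ ℕ → ℕ, ρ' ∈ box C.N (digitVars (Finset.univ : Finset J).toList)
      (fun _ => 0) ↔ ∃ d : J → ℕ, ρ' = env d ∧ ∀ X, d X < C.N := fun ρ' => by
    rw [mem_box_digitVars hl]; simp
  refine (HCmd.wp_scatter (P := fun ρ' => P fun X => ρ' (.inl X))
    (ix := fun ρ' => key C.N fun X => ρ' (.inl X)) (nodup_digitVars hl) (fun _ _ => rfl)
    ha h0 ?_ ?_).mono ?_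
  · intro ρ' hρ' μ' hs
    obtain ⟨d, rfl, hd⟩ := (hbox ρ').1 hρ'
    exact hc d hd μ' hs (hs.weights hW ha')
  · intro ρ' hρ' _ μ' hs
    obtain ⟨d, rfl, hd⟩ := (hbox ρ').1 hρ'
    obtain ⟨s, v⟩ := keyE_ok (U := U) hC (ha'.trans ha.le) (hs.weights hW ha') hd
    exact ⟨s, v, hC.key_lt hd⟩
  · rintro μ' ⟨hs, hk⟩
    refine ⟨hs, fun d hd => ?_⟩
    rw [hk]
    refine flag_congr ⟨?_, fun h => ⟨env d, (hbox _).2 ⟨d, rfl, hd⟩, h, rfl⟩⟩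
    rintro ⟨ρ', hρ', hP, he⟩
    obtain ⟨d', rfl, hd'⟩ := (hbox ρ').1 hρ'
    obtain rfl : d' = d := key_inj hd' hd he
    exact hP

/-- Absence of repetitions in `l` is used only to bound the number of nested loops by the number of
objects. -/
theorem cost_scatter {N : ℕ} (hN : 1 ≤ N) (l : List J) (a : ℕ) (cond i : Exp J U) :
    (HCmd.scatter (digitVars l) a cond i).cost N ≤
      N ^ Fintype.card J * (cond.cost + i.cost + 8 + 6 * Fintype.card J) ∨ ¬ l.Nodup := by
  by_cases hl : l.Nodup
  · left
    have h1 : l.length ≤ Fintype.card J := hl.length_le_card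
    refine (HCmd.cost_forAll hN _).trans ?_
    simp only [digitVars, List.length_map]
    have h2 : (HCmd.ite cond (.store a i (.lit 1)) .skip).cost N = cond.cost + i.cost + 8 := by
      simp only [HCmd.cost, Exp.cost]; omega
    rw [h2]
    gcongr
  · exact Or.inr hl

theorem cost_fill {N : ℕ} (hN : 1 ≤ N) (a : ℕ) (cond : Exp J U) :
    (fill a cond).cost N ≤ N ^ Fintype.card J * (cond.cost + 12 * Fintype.card J + 9) := by
  refine ((cost_scatter hN _ a cond (keyE J U)).resolve_right
    (not_not.2 (Finset.nodup_toList _))).trans (Nat.mul_le_mul_left _ ?_)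
  have := cost_keyE (J := J) (U := U)
  omega

/-! ### Conditions on components -/

/-- The relation of two values. -/
def relE (ρ : ValRel) (f : Mor J) (a : Exp J U) (g : Mor J) (b : Exp J U) : Exp J U :=
  match ρ with
  | .cmp θ => .cmp θ f.2.1 (.app f a) g.2.1 (.app g b)
  | .tree τ => .tree τ f.2.1 (.app f a) g.2.1 (.app g b)

/-- The relation of two values, and `0` for numbers that are not those of elements. -/
def binE (ρ : ValRel) (f : Mor J) (a : Exp J U) (g : Mor J) (b : Exp J U) : Exp J U :=
  .ite (.sub (.card f.1) a) (.ite (.sub (.card g.1) b) (relE ρ f a g b) (.lit 0)) (.lit 0)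

theorem input_value (ν : Numbering I) (l : List ℕ) {f : Mor J} {k : ℕ}
    (hk : k < Fintype.card (I.F.obj f.1)) :
    (I.input ν l).value f.2.1 ((I.input ν l).app f k) = fval ν f k := by
  simp [Instance.input, fval, hk]

/-- The range tests are essential: the input returns `0` for a morphism applied to an invalid
number, and `0` may be the number of an element of the target. -/
theorem binE_ok (hC : Fits C ν) (r : ValRel) (f g : Mor J) {a b : Exp J U} {ρ : J ⊕ ℕ → ℕ}
    {A : ℕ → ℕ → ℕ} (ha : a.Safe C ρ A) (hb : b.Safe C ρ A) :
    (binE r f a g b).Safe C ρ A ∧ ((binE r f a g b).eval C ρ A ≠ 0 ↔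
      ∃ u v, fval ν f (a.eval C ρ A) = some u ∧ fval ν g (b.eval C ρ A) = some v ∧
        r.Holds u v) := by
  constructor
  · refine ⟨⟨trivial, ha⟩, fun _ => ⟨⟨trivial, hb⟩, fun _ => ?_, fun _ => trivial⟩,
      fun _ => trivial⟩
    cases r <;> exact ⟨ha, hb⟩
  · have hcard : ∀ X, C.inp.card X = Fintype.card (I.F.obj X) := fun X => by rw [hC.inp_eq]; rfl
    simp only [binE, Exp.eval, hcard]
    by_cases h1 : a.eval C ρ A < Fintype.card (I.F.obj f.1)
    swap
    · rw [if_pos (by omega)]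
      simp only [ne_eq, not_true_eq_false, false_iff]
      rintro ⟨u, v, h, -⟩
      exact h1 (lt_of_fval h)
    by_cases h2 : b.eval C ρ A < Fintype.card (I.F.obj g.1)
    swap
    · rw [if_neg (by omega), if_pos (by omega)]
      simp only [ne_eq, not_true_eq_false, false_iff]
      rintro ⟨u, v, -, h, -⟩
      exact h2 (lt_of_fval h)
    rw [if_neg (by omega), if_neg (by omega)]
    cases r <;> simp [relE, Exp.eval, hC.inp_eq, input_value, h1, h2, ValRel.Holds]

theorem cost_binE (r : ValRel) (f g : Mor J) (a b : Exp J U) :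
    (binE r f a g b).cost ≤ 2 * a.cost + 2 * b.cost + 17 := by
  cases r <;> simp only [binE, relE, Exp.cost] <;> omega

/-- Equality of two values. -/
def veqE (f : Mor J) (a : Exp J U) (g : Mor J) (b : Exp J U) : Exp J U :=
  binE (.cmp .eq) f a g b

theorem veqE_ok (hC : Fits C ν) (f g : Mor J) {a b : Exp J U} {ρ : J ⊕ ℕ → ℕ}
    {A : ℕ → ℕ → ℕ} (ha : a.Safe C ρ A) (hb : b.Safe C ρ A) :
    (veqE f a g b).Safe C ρ A ∧ ((veqE f a g b).eval C ρ A ≠ 0 ↔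
      veq ν f (a.eval C ρ A) g (b.eval C ρ A)) := by
  obtain ⟨h1, h2⟩ := binE_ok hC (.cmp .eq) f g ha hb
  refine ⟨h1, h2.trans ⟨?_, ?_⟩⟩
  · rintro ⟨u, v, h, h', h''⟩
    obtain rfl : u = v := h''
    exact ⟨u, h, h'⟩
  · rintro ⟨u, h, h'⟩
    exact ⟨u, u, h, h', rfl⟩

/-- The truth value of a condition. -/
def atomE : Atom J U → Exp J U
  | .bin ρ f g => binE ρ f (dg f.1) g (dg g.1)
  | .const f θ α => .ite (.sub (.card f.1) (dg f.1)) (.cmpConst θ f.2.1 (.app f (dg f.1)) α) (.lit 0)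

theorem atomE_ok (hC : Fits C ν) (a : Atom J U) (d : J → ℕ) (A : ℕ → ℕ → ℕ) :
    (atomE a).Safe C (env d) A ∧ ((atomE a).eval C (env d) A ≠ 0 ↔ a.Sem ν d) := by
  cases a with
  | bin ρ f g => exact binE_ok hC ρ f g (safe_dg _ _ _) (safe_dg _ _ _)
  | const f θ α =>
    refine ⟨⟨⟨trivial, trivial⟩, fun _ => trivial, fun _ => trivial⟩, ?_⟩
    have hcard : ∀ X, C.inp.card X = Fintype.card (I.F.obj X) := fun X => by rw [hC.inp_eq]; rfl
    simp only [atomE, Exp.eval, hcard, eval_dg, Atom.Sem]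
    by_cases h1 : d f.1 < Fintype.card (I.F.obj f.1)
    · rw [if_neg (by omega)]
      simp [hC.inp_eq, input_value, h1]
    · rw [if_pos (by omega)]
      simp only [ne_eq, not_true_eq_false, false_iff]
      rintro ⟨u, h, -⟩
      exact h1 (lt_of_fval h)

theorem cost_atomE (a : Atom J U) : (atomE a).cost ≤ 21 := by
  cases a with
  | bin ρ f g => exact cost_binE ρ f g (dg f.1) (dg g.1)
  | const f θ α => simp [atomE, dg, Exp.cost]

/-- Conjunction. -/
def allE {α : Type} (l : List α) (e : α → Exp J U) (last : Exp J U) : Exp J U :=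
  l.foldr (fun a r => .ite (e a) r (.lit 0)) last

/-- Evaluation stops at the first false condition, so `last` has to be safe only if all conditions
hold. -/
theorem allE_ok {α : Type} {l : List α} {e : α → Exp J U} {last : Exp J U} {ρ : J ⊕ ℕ → ℕ}
    {A : ℕ → ℕ → ℕ} {P : α → Prop} {Q : Prop}
    (h : ∀ a ∈ l, (e a).Safe C ρ A ∧ ((e a).eval C ρ A ≠ 0 ↔ P a))
    (hl : (∀ a ∈ l, P a) → last.Safe C ρ A ∧ (last.eval C ρ A ≠ 0 ↔ Q)) :
    (allE l e last).Safe C ρ A ∧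
      ((allE l e last).eval C ρ A ≠ 0 ↔ (∀ a ∈ l, P a) ∧ Q) := by
  induction l with
  | nil => simpa [allE] using hl (by simp)
  | cons a l ih =>
    obtain ⟨s, v⟩ := h a (by simp)
    have h' := ih (fun b hb => h b (List.mem_cons_of_mem _ hb))
    by_cases ha : P a
    · obtain ⟨s', v'⟩ := h' (fun hb => hl (by simpa [ha] using hb))
      refine ⟨⟨s, fun _ => s', fun _ => trivial⟩, ?_⟩
      change (if _ = 0 then _ else _) ≠ 0 ↔ _
      rw [if_neg (v.2 ha)]
      rw [List.forall_mem_cons, and_assoc, and_iff_right ha]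
      exact v'
    · have h0 : (e a).eval C ρ A = 0 := by by_contra hne; exact ha (v.1 hne)
      refine ⟨⟨s, fun hne => absurd h0 hne, fun _ => trivial⟩, ?_⟩
      change (if _ = 0 then _ else _) ≠ 0 ↔ _
      rw [if_pos h0]
      simp [Exp.eval, ha]

theorem cost_allE {α : Type} {l : List α} {e : α → Exp J U} {last : Exp J U} {c : ℕ}
    (h : ∀ a ∈ l, (e a).cost ≤ c) : (allE l e last).cost ≤ l.length * (c + 5) + last.cost := by
  induction l with
  | nil => simp [allE]
  | cons a l ih =>
    have h1 : (allE (a :: l) e last).cost = (e a).cost + (allE l e last).cost + 1 + 4 := rfl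
    have := ih fun b hb => h b (List.mem_cons_of_mem _ hb)
    have := h a (by simp)
    rw [h1, List.length_cons, add_mul]; omega

/-! ### Pointwise operations -/

theorem wp_atoms (hC : Fits C ν) {a : ℕ} (ha : a < C.K) (ha' : tableBase J ≤ a) {μ : Mem}
    (hW : Weights C μ) (h0 : ∀ k, μ.arr a k = 0) (l : List (Atom J U)) :
    (fill a (allE l atomE (.lit 1))).WP C (fun _ => 0) μ fun μ' => SameBut a μ μ' ∧
      Table C μ' a fun d => ∀ x ∈ l, x.Sem ν d := by
  refine wp_fill hC ha ha' hW h0 fun d _ μ' _ _ => ?_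
  obtain ⟨s, v⟩ := allE_ok (last := .lit 1) (Q := True) (fun x (_ : x ∈ l) => atomE_ok hC x d μ'.arr)
    (fun _ => ⟨trivial, by simp [Exp.eval]⟩)
  exact ⟨s, v.trans (by simp)⟩

/-- Negation of a truth value. -/
def notE (e : Exp J U) : Exp J U := .ite e (.lit 0) (.lit 1)

theorem wp_not (hC : Fits C ν) {a b : ℕ} (ha : a < C.K) (ha' : tableBase J ≤ a) {μ : Mem}
    (hW : Weights C μ) (h0 : ∀ k, μ.arr a k = 0) (hb : b < C.K) (hab : b ≠ a)
    {P : (J → ℕ) → Prop} (hT : Table C μ b P) :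
    (fill a (notE (tabE b))).WP C (fun _ => 0) μ fun μ' => SameBut a μ μ' ∧
      Table C μ' a fun d => ¬ P d := by
  refine wp_fill hC ha ha' hW h0 fun d hd μ' hs hW' => ?_
  obtain ⟨s, v⟩ := tabE_ok hC (ha'.trans ha.le) hW' hb (hs.table hT hab) hd
  refine ⟨⟨s, fun _ => trivial, fun _ => trivial⟩, ?_⟩
  rw [notE, Exp.eval, v]
  by_cases h : P d <;> simp [h, flag, Exp.eval]

theorem wp_and (hC : Fits C ν) {a b b' : ℕ} (ha : a < C.K) (ha' : tableBase J ≤ a) {μ : Mem}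
    (hW : Weights C μ) (h0 : ∀ k, μ.arr a k = 0) (hb : b < C.K) (hab : b ≠ a)
    (hb' : b' < C.K) (hab' : b' ≠ a) {P P' : (J → ℕ) → Prop} (hT : Table C μ b P)
    (hT' : Table C μ b' P') :
    (fill a (.ite (tabE b) (tabE b') (.lit 0))).WP C (fun _ => 0) μ fun μ' => SameBut a μ μ' ∧
      Table C μ' a fun d => P d ∧ P' d := by
  refine wp_fill hC ha ha' hW h0 fun d hd μ' hs hW' => ?_
  obtain ⟨s, v⟩ := tabE_ok hC (ha'.trans ha.le) hW' hb (hs.table hT hab) hd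
  obtain ⟨s', v'⟩ := tabE_ok hC (ha'.trans ha.le) hW' hb' (hs.table hT' hab') hd
  refine ⟨⟨s, fun _ => s', fun _ => trivial⟩, ?_⟩
  rw [Exp.eval, v, v']
  by_cases h : P d <;> simp [h, flag, Exp.eval]

theorem wp_andNot (hC : Fits C ν) {a b b' : ℕ} (ha : a < C.K) (ha' : tableBase J ≤ a) {μ : Mem}
    (hW : Weights C μ) (h0 : ∀ k, μ.arr a k = 0) (hb : b < C.K) (hab : b ≠ a)
    (hb' : b' < C.K) (hab' : b' ≠ a) {P P' : (J → ℕ) → Prop} (hT : Table C μ b P)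
    (hT' : Table C μ b' P') :
    (fill a (.ite (tabE b) (notE (tabE b')) (.lit 0))).WP C (fun _ => 0) μ fun μ' =>
      SameBut a μ μ' ∧ Table C μ' a fun d => P d ∧ ¬ P' d := by
  refine wp_fill hC ha ha' hW h0 fun d hd μ' hs hW' => ?_
  obtain ⟨s, v⟩ := tabE_ok hC (ha'.trans ha.le) hW' hb (hs.table hT hab) hd
  obtain ⟨s', v'⟩ := tabE_ok hC (ha'.trans ha.le) hW' hb' (hs.table hT' hab') hd
  refine ⟨⟨s, fun _ => ⟨s', fun _ => trivial, fun _ => trivial⟩, fun _ => trivial⟩, ?_⟩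
  rw [Exp.eval, v, notE]
  simp only [Exp.eval, v']
  by_cases h : P d <;> by_cases h' : P' d <;> simp [h, h', flag]

/-! ### Images -/

/-- Tabulate the element of `X` whose value is that of `f`, for every element. -/
def partner (f : Mor J) (X : J) (a : ℕ) : HCmd J U :=
  if f.2.1 = X then
    .forV vi (.ite (.sub (.card f.1) (.var vi))
      (.store a (.var vi) (.add (.app f (.var vi)) (.lit 1))) .skip)
  else .lastHits a (veqE f (.var vi) (ident X) (.var vj))

/-- If the target of `f` is `X` itself, the partner is `f(z)` and one linear pass suffices.
Otherwise all elements of `X` are compared by value in a quadratic pass; this is affordable because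
two different objects exist, so that `N ^ 2 ≤ N ^ p`. A partner is unique because values are
injective on `X`, so the last hit is the only one. -/
theorem wp_partner (hC : Fits C ν) (f : Mor J) (X : J) {a : ℕ} (ha : a < C.K) {μ : Mem}
    (h0 : ∀ k, μ.arr a k = 0) :
    (partner f X a).WP C (fun _ => 0) μ fun μ' => SameBut a μ μ' ∧
      ∀ z < C.N, ∀ x, μ'.arr a z = x + 1 ↔ veq ν f z (ident X) x := by
  unfold partner
  split_ifs with hX
  · obtain ⟨Z, Y, f⟩ := f
    obtain rfl : Y = X := hX
    refine HCmd.wp_forV (fun n μ' => SameBut a μ μ' ∧ ∀ z, ∀ x, μ'.arr a z = x + 1 ↔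
      z < n ∧ veq ν ⟨Z, Y, f⟩ z (ident Y) x) rfl ⟨.refl _ _, fun z x => by simp [h0]⟩ ?_ ?_
    · rintro n hn μ' ⟨hs, hk⟩
      have hcard : ∀ X, C.inp.card X = Fintype.card (I.F.obj X) := fun X => by rw [hC.inp_eq]; rfl
      have hv : (Exp.var vi : Exp J U).eval C (Function.update (fun _ => 0) vi n) μ'.arr = n := by
        simp [Exp.eval]
      refine HCmd.wp_ite ⟨trivial, trivial⟩ (fun hne => ?_) fun he => ?_
      · have hlt : n < Fintype.card (I.F.obj Z) := by
          simp only [Exp.eval, hcard, Function.update_self] at hne; omega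
        refine HCmd.wp_store trivial ⟨trivial, trivial⟩ ha
          (by rw [hv]; exact hn.trans_le hC.le) ⟨hs.store _ _, fun z x => ?_⟩
        rw [hv, Mem.store_arr_same]
        by_cases e : z = n
        · subst e
          obtain ⟨y, rfl⟩ := exists_number ν hlt
          simp only [if_true, Exp.eval, Function.update_self, Nat.add_right_cancel_iff,
            Nat.lt_succ_self, true_and]
          have happ : C.inp.app ⟨Z, Y, f⟩ (ν Z y) = ν Y (I.F.map f y) := by
            rw [hC.inp_eq]; simp [Instance.input]
          rw [happ]
          constructor
          · rintro rfl
            exact veq_number.2 (by simp)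
          · intro h
            obtain ⟨x', rfl⟩ := exists_number ν h.lt_right
            have := veq_number.1 h
            simp only [Functor.map_id_apply] at this
            rw [(I.val Y).injective this]
        · rw [if_neg e, hk]
          exact and_congr_left fun _ => by omega
      · refine HCmd.wp_skip ⟨hs, fun z x => ?_⟩
        rw [hk]
        refine ⟨fun h => ⟨by omega, h.2⟩, fun ⟨h1, h2⟩ => ⟨?_, h2⟩⟩
        have h3 := h2.lt_left
        simp only [Exp.eval, hcard, Function.update_self] at he
        simp only at h3
        rcases Nat.lt_succ_iff_lt_or_eq.1 h1 with h | rfl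
        exacts [h, by omega]
    · rintro μ' ⟨hs, hk⟩
      exact ⟨hs, fun z hz x => by rw [hk]; exact and_iff_right hz⟩
  · refine (HCmd.wp_lastHits (R := fun z x => veq ν f z (ident X) x) rfl rfl ha hC.le h0 ?_).mono ?_
    · intro i _ j _ μ' _
      have := veqE_ok (U := U) hC f (ident X) (a := .var vi) (b := .var vj)
        (ρ := Function.update (Function.update (fun _ => 0) vi i) vj j) (A := μ'.arr) trivial trivial
      simpa [Exp.eval, Function.update_of_ne] using this
    · rintro μ' ⟨hs, hk⟩
      refine ⟨hs, fun z hz x => ?_⟩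
      rw [hk z hz]
      exact lastHit_eq_succ_of_unique (fun k hk => hk.lt_right.trans_le (hC.card_le X))
        fun k k' h h' => (h.symm.trans h').eq

theorem cost_partner {N : ℕ} (hN : 1 ≤ N) (f : Mor J) (X : J) (a : ℕ) :
    (partner f X a : HCmd J U).cost N ≤ N ^ Fintype.card J * 100 := by
  have hp : 0 < Fintype.card J := Fintype.card_pos_iff.2 ⟨X⟩
  have h1 : N ≤ N ^ Fintype.card J := Nat.le_self_pow hp.ne' N
  unfold partner
  split_ifs with hX
  · simp only [HCmd.cost, Exp.cost]; omega
  · have h2 : 2 ≤ Fintype.card J := Fintype.one_lt_card_iff.2 ⟨_, _, hX⟩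
    have h3 : N ^ 2 ≤ N ^ Fintype.card J := Nat.pow_le_pow_right hN h2
    have h4 := cost_binE (.cmp .eq) f (ident X) (.var vi) (.var vj : Exp J U)
    simp only [Exp.cost] at h4
    simp only [HCmd.lastHits, HCmd.cost, Exp.cost, veqE]
    nlinarith

end Tables

end CatQuery
end
set_option linter.unusedSectionVars false
noncomputable section
namespace CatQuery

/-! ### Images under links, by scattering from the source -/

section ImageOp

variable {J U : Type} [SmallCategory J] [DecidableEq J] [Fintype J] [DataDomain U]
  {I : Instance J U} {ν : Numbering I} {C : Ctx J U}

/-- Entries from `lo` to `hi` are unused. -/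
def Fresh (lo hi : ℕ) (μ : Mem) : Prop := ∀ a, lo ≤ a → a < hi → ∀ k, μ.arr a k = 0

theorem Fresh.mono {lo hi lo' hi' : ℕ} {μ : Mem} (h : Fresh lo hi μ) (h1 : lo ≤ lo')
    (h2 : hi' ≤ hi) : Fresh lo' hi' μ := fun a ha ha' => h a (h1.trans ha) (ha'.trans_le h2)

theorem Fresh.frame {lo hi lo' hi' : ℕ} {μ μ' : Mem} (h : Fresh lo hi μ)
    (hf : Frame lo' hi' μ μ') (hd : hi ≤ lo' ∨ hi' ≤ lo) : Fresh lo hi μ' := fun a ha ha' k => by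
  rw [hf.2 a (by omega)]; exact h a ha ha' k

/-- The partner of `z` in a tabulation. -/
def PartnerOK (ν : Numbering I) (C : Ctx J U) (f : Mor J) (X : J) (T : ℕ → ℕ) : Prop :=
  ∀ z < C.N, ∀ x, T z = x + 1 ↔ veq ν f z (ident X) x

/-- Tabulate the partners for all links. -/
def partners (lk : J → Mor J) (j : ℕ) (l : List J) : HCmd J U :=
  l.foldr (fun X c => .seq (partner (lk X) X (j + objIdx X)) c) .skip

theorem wp_partners (hC : Fits C ν) (lk : J → Mor J) {j : ℕ} (hj : j + Fintype.card J ≤ C.K)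
    {l : List J} (hl : l.Nodup) {μ : Mem} (h0 : ∀ X ∈ l, ∀ k, μ.arr (j + objIdx X) k = 0) :
    (partners lk j l).WP C (fun _ => 0) μ fun μ' => μ'.out = μ.out ∧
      (∀ b, (∀ X ∈ l, b ≠ j + objIdx X) → μ'.arr b = μ.arr b) ∧
      ∀ X ∈ l, PartnerOK ν C (lk X) X (μ'.arr (j + objIdx X)) := by
  induction l generalizing μ with
  | nil => exact HCmd.wp_skip ⟨rfl, fun _ _ => rfl, by simp⟩
  | cons X l ih =>
    obtain ⟨hX, hl⟩ := List.nodup_cons.1 hl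
    have hlt := objIdx_lt X
    refine HCmd.wp_seq ((wp_partner hC (lk X) X (by omega) (h0 X (by simp))).mono ?_)
    rintro μ1 ⟨hs, hp⟩
    have hne : ∀ Y ∈ l, j + objIdx Y ≠ j + objIdx X := fun Y hY h =>
      hX (objIdx_inj (Nat.add_left_cancel h) ▸ hY)
    refine (ih hl fun Y hY k => ?_).mono ?_
    · rw [hs.2 _ (hne Y hY)]; exact h0 Y (by simp [hY]) k
    · rintro μ2 ⟨ho, hf, hq⟩
      refine ⟨ho.trans hs.1, fun b hb => ?_, fun Y hY => ?_⟩
      · rw [hf b fun Y hY => hb Y (by simp [hY]), hs.2 b (hb X (by simp))]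
      · rcases List.mem_cons.1 hY with rfl | hY
        · rw [hf _ fun Z hZ => (hne Z hZ).symm]; exact hp
        · exact hq Y hY

theorem cost_partners {N : ℕ} (hN : 1 ≤ N) (lk : J → Mor J) (j : ℕ) (l : List J) :
    (partners lk j l : HCmd J U).cost N ≤ l.length * (N ^ Fintype.card J * 100) := by
  induction l with
  | nil => simp [partners, HCmd.cost]
  | cons X l ih =>
    have h := cost_partner (U := U) hN (lk X) X (j + objIdx X)
    have h1 : (partners lk j (X :: l) : HCmd J U).cost N =
      (partner (lk X) X (j + objIdx X) : HCmd J U).cost N + (partners lk j l).cost N := rfl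
    rw [h1, List.length_cons, add_mul]; omega

/-- The partner of the component that is linked with the component at `X`. -/
def linkE (lk : J → Mor J) (j : ℕ) (X : J) : Exp J U := .get (j + objIdx X) (dg (lk X).1)

/-- The condition that the current tuple is in a relation and has partners. -/
def imageCond (A B : Finset J) (lk : J → Mor J) (src j : ℕ) : Exp J U :=
  allE A.toList (fun Z => .sub (.card Z) (dg Z))
    (allE [src] tabE (allE B.toList (linkE lk j) (.lit 1)))

/-- Compute the image of the table `src` in the table `j`. -/
def imageOp (A B : Finset J) (lk : J → Mor J) (src j : ℕ) : HCmd J U :=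
  .seq (partners lk (j + 2) B.toList) (.seq
    (.scatter (digitVars A.toList) (j + 1) (imageCond A B lk src (j + 2))
      (sumE B.toList fun X => .sub (linkE lk (j + 2) X) (.lit 1)))
    (fill j (.get (j + 1) (sumE B.toList dg))))

theorem digitsOn_lt {N : ℕ} (hN : 1 ≤ N) {B : Finset J} {d : J → ℕ} (h : ∀ X ∈ B, d X < N) (X : J) :
    digitsOn B d X < N := by
  unfold digitsOn
  split_ifs with hX
  exacts [h X hX, hN]

/-- Links are made functional by tabulating partners. Then one pass over the tuples on `A` in the
relation marks, for each, the key of the linked tuple on `B`. No pair of a source and a target is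
ever compared, so the cost is a sum of powers of `N` and not a product. -/
theorem wp_imageOp (hC : Fits C ν) (A B : Finset J) (lk : J → Mor J) {src j : ℕ}
    (hj : tableBase J ≤ j) (hK : j + (Fintype.card J + 2) ≤ C.K) (hs : src < C.K)
    (hsj : src < j ∨ j + (Fintype.card J + 2) ≤ src) {μ : Mem} (hW : Weights C μ)
    (h0 : Fresh j (j + (Fintype.card J + 2)) μ) {P : (J → ℕ) → Prop} (hT : Table C μ src P) :
    (imageOp A B lk src j).WP C (fun _ => 0) μ fun μ' =>
      Frame j (j + (Fintype.card J + 2)) μ μ' ∧ Table C μ' j (Image ν A B lk P) := by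
  have hcard : ∀ X, C.inp.card X = Fintype.card (I.F.obj X) := fun X => by rw [hC.inp_eq]; rfl
  refine HCmd.wp_seq ((wp_partners hC lk (j := j + 2) (by omega) (Finset.nodup_toList B)
    fun X _ => h0 _ (by omega) (by have := objIdx_lt X; omega)).mono ?_)
  rintro μ1 ⟨ho1, hf1, hp1⟩
  have f1 : Frame j (j + (Fintype.card J + 2)) μ μ1 :=
    ⟨ho1, fun b hb => hf1 b fun X _ => by have := objIdx_lt X; omega⟩
  have hW1 := f1.weights hW hj
  have hT1 := f1.table hT (by omega)
  have hz : ∀ b, j ≤ b → b < j + 2 → ∀ k, μ1.arr b k = 0 := fun b hb hb' k => by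
    rw [hf1 b fun X _ => by omega]; exact h0 b hb (by omega) k
  -- the scattering loop
  let x : (J → ℕ) → J → ℕ := fun d X => μ1.arr (j + 2 + objIdx X) (d (lk X).1) - 1
  let R : (J → ℕ) → Prop := fun d => (∀ Z ∈ A.toList, d Z < Fintype.card (I.F.obj Z)) ∧
    (∀ _ ∈ [src], P d) ∧ (∀ X ∈ B.toList, μ1.arr (j + 2 + objIdx X) (d (lk X).1) ≠ 0) ∧ True
  have hbd : ∀ d : J → ℕ, (∀ X ∈ A.toList, d X < C.N) → (∀ X ∉ A.toList, d X = 0) →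
      ∀ X, d X < C.N := fun d h1 h2 X => by
    by_cases hX : X ∈ A.toList
    · exact h1 X hX
    · rw [h2 X hX]; exact hC.one_le
  have hx : ∀ d : J → ℕ, (∀ X, d X < C.N) → R d → ∀ X ∈ B, veq ν (lk X) (d (lk X).1) (ident X)
      (x d X) := fun d hd hR X hX => by
    have hX' := Finset.mem_toList.2 hX
    refine (hp1 X hX' _ (hd _) _).1 ?_
    have := hR.2.2.1 X hX'
    simp only [x]; omega
  have hxN : ∀ d : J → ℕ, (∀ X, d X < C.N) → R d → ∀ X ∈ B, x d X < C.N := fun d hd hR X hX =>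
    (hx d hd hR X hX).lt_right.trans_le (hC.card_le X)
  have link_ok : ∀ d : J → ℕ, (∀ X, d X < C.N) → ∀ μ', SameBut (j + 1) μ1 μ' → ∀ X,
      (linkE lk (j + 2) X : Exp J U).Safe C (env d) μ'.arr ∧
      (linkE lk (j + 2) X : Exp J U).eval C (env d) μ'.arr =
        μ1.arr (j + 2 + objIdx X) (d (lk X).1) := fun d hd μ' hsb X => by
    have := objIdx_lt X
    refine ⟨⟨trivial, by omega, (hd _).trans_le hC.le⟩, ?_⟩
    simp only [linkE, Exp.eval, eval_dg]
    rw [hsb.2 _ (by omega)]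
  refine HCmd.wp_seq ((HCmd.wp_scatter (P := fun ρ' => R fun X => ρ' (.inl X))
    (ix := fun ρ' => key C.N (digitsOn B (x fun X => ρ' (.inl X))))
    (nodup_digitVars (Finset.nodup_toList A)) (fun _ _ => rfl) (by omega)
    (hz (j + 1) (by omega) (by omega)) ?_ ?_).mono ?_)
  · intro ρ' hρ' μ' hsb
    obtain ⟨d, rfl, hd1, hd2⟩ := (mem_box_digitVars (Finset.nodup_toList A)).1 hρ'
    have hd := hbd d hd1 hd2
    refine allE_ok (fun Z _ => ⟨⟨trivial, trivial⟩, ?_⟩) fun _ =>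
      allE_ok (fun s hsm => ?_) fun _ => allE_ok (fun X _ => ?_) fun _ => ⟨trivial, by simp [Exp.eval]⟩
    · simp only [Exp.eval, hcard, eval_dg]
      change _ ↔ d Z < _
      omega
    · rw [List.mem_singleton.1 hsm]
      obtain ⟨s1, v1⟩ := tabE_ok hC (by omega) (hsb.weights hW1 (by omega)) hs
        (hsb.table hT1 (by omega)) hd
      exact ⟨s1, by rw [v1]; simp; rfl⟩
    · obtain ⟨s1, v1⟩ := link_ok d hd μ' hsb X
      exact ⟨s1, by rw [v1]; rfl⟩
  · intro ρ' hρ' hR μ' hsb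
    obtain ⟨d, rfl, hd1, hd2⟩ := (mem_box_digitVars (Finset.nodup_toList A)).1 hρ'
    have hd := hbd d hd1 hd2
    have hv : ∀ X, (Exp.sub (linkE lk (j + 2) X) (.lit 1) : Exp J U).eval C (env d) μ'.arr =
        x d X := fun X => by
      simp only [Exp.eval, (link_ok d hd μ' hsb X).2]; rfl
    obtain ⟨s1, v1⟩ := sumE_ok (l := B.toList) (ρ := env d) hC (by omega)
      (hsb.weights hW1 (by omega)) (e := fun X => .sub (linkE lk (j + 2) X) (.lit 1)) fun X hX =>
        ⟨⟨(link_ok d hd μ' hsb X).1, trivial⟩, by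
          rw [hv]; exact hxN d hd hR X (Finset.mem_toList.1 hX)⟩
    refine ⟨s1, ?_, hC.key_lt (digitsOn_lt hC.one_le (hxN d hd hR))⟩
    rw [v1]
    simp only [hv]
    exact sum_eq_key B (x d)
  · rintro μ2 ⟨hs2, hk2⟩
    have f2 := f1.trans (hs2.frame (lo := j) (hi := j + (Fintype.card J + 2)) (by omega) (by omega))
    have hW2 := f2.weights hW hj
    -- Only keys with digit `0` outside of `B` have been marked. Membership in the image depends on
    -- the components in `B` alone, so the final pass reads, for every assignment, the mark of its
    -- restriction to `B`.
    refine (wp_fill (P := Image ν A B lk P) hC (by omega) hj hW2 (fun k => ?_) ?_).mono ?_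
    · rw [hs2.2 j (by omega)]; exact hz j le_rfl (by omega) k
    · intro d hd μ3 hs3 hW3
      obtain ⟨s1, v1⟩ := sumE_ok (l := B.toList) (ρ := env d) (e := dg) hC (by omega) hW3
        fun X _ => ⟨safe_dg _ _ _, hd X⟩
      have hkey : (sumE B.toList dg : Exp J U).eval C (env d) μ3.arr = key C.N (digitsOn B d) :=
        v1.trans (sum_eq_key B d)
      have hlt := hC.key_lt (digitsOn_lt (B := B) hC.one_le fun X _ => hd X)
      refine ⟨⟨s1, by omega, by rw [hkey]; exact hlt⟩, ?_⟩
      rw [Exp.eval, hkey, hs3.2 _ (by omega), hk2, ne_eq, flag_eq_zero, not_not]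
      constructor
      · rintro ⟨ρ', hρ', hR, he⟩
        obtain ⟨d', rfl, hd1, hd2⟩ := (mem_box_digitVars (Finset.nodup_toList A)).1 hρ'
        have hd' := hbd d' hd1 hd2
        have he' := key_inj (digitsOn_lt hC.one_le (hxN d' hd' hR))
          (digitsOn_lt hC.one_le fun X _ => hd X) he
        refine ⟨d', fun Z hZ => hd2 Z (by simpa using hZ), fun Z hZ => hR.1 Z (by simpa using hZ),
          hR.2.1 src (by simp), fun X hX => ?_⟩
        have h1 := congrFun he' X
        simp only [digitsOn, hX, if_true] at h1
        rw [← h1]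
        exact hx d' hd' hR X hX
      · rintro ⟨d', h1, h2, h3, h4⟩
        have hd1 : ∀ X ∈ A.toList, d' X < C.N := fun X hX =>
          (h2 X (by simpa using hX)).trans_le (hC.card_le X)
        have hd2 : ∀ X ∉ A.toList, d' X = 0 := fun X hX => h1 X (by simpa using hX)
        have hd' := hbd d' hd1 hd2
        have h5 : ∀ X ∈ B, μ1.arr (j + 2 + objIdx X) (d' (lk X).1) = d X + 1 := fun X hX =>
          (hp1 X (by simpa using hX) _ (hd' _) _).2 (h4 X hX)
        refine ⟨env d', (mem_box_digitVars (Finset.nodup_toList A)).2 ⟨d', rfl, hd1, hd2⟩,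
          ⟨fun Z hZ => h2 Z (by simpa using hZ), fun _ _ => h3, fun X hX => ?_, trivial⟩, ?_⟩
        · change μ1.arr (j + 2 + objIdx X) (d' (lk X).1) ≠ 0
          rw [h5 X (by simpa using hX)]; omega
        · congr 1
          funext X
          unfold digitsOn
          split_ifs with hX
          · change μ1.arr (j + 2 + objIdx X) (d' (lk X).1) - 1 = d X
            rw [h5 X hX]; omega
          · rfl
    · rintro μ3 ⟨hs3, hT3⟩
      exact ⟨f2.trans (hs3.frame le_rfl (by omega)), hT3⟩

theorem cost_imageOp {N : ℕ} (hN : 1 ≤ N) (hp : 0 < Fintype.card J) (A B : Finset J)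
    (lk : J → Mor J) (src j : ℕ) :
    (imageOp A B lk src j : HCmd J U).cost N ≤ N ^ Fintype.card J * (250 * Fintype.card J) := by
  have hA : A.card ≤ Fintype.card J := A.card_le_univ
  have hB : B.card ≤ Fintype.card J := B.card_le_univ
  have h1 := cost_partners (U := U) hN lk (j + 2) B.toList
  have h2 := (cost_scatter (U := U) hN A.toList (j + 1) (imageCond A B lk src (j + 2))
    (sumE B.toList fun X => .sub (linkE lk (j + 2) X) (.lit 1))).resolve_right
      (not_not.2 (Finset.nodup_toList _))
  have h3 := cost_fill (U := U) hN j (.get (j + 1) (sumE B.toList dg) : Exp J U)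
  have c1 : (sumE B.toList dg : Exp J U).cost ≤ B.toList.length * (1 + 5) + 1 :=
    cost_sumE fun X _ => le_rfl
  have c2 : (sumE B.toList fun X => .sub (linkE lk (j + 2) X) (.lit 1) : Exp J U).cost ≤
      B.toList.length * (7 + 5) + 1 := cost_sumE fun X _ => by simp [linkE, dg, Exp.cost]
  have c3 : (allE B.toList (linkE lk (j + 2)) (.lit 1) : Exp J U).cost ≤
      B.toList.length * (5 + 5) + 1 := cost_allE fun X _ => by simp [linkE, dg, Exp.cost]
  have c4 : (allE [src] tabE (allE B.toList (linkE lk (j + 2)) (.lit 1)) : Exp J U).cost ≤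
      1 * ((6 * Fintype.card J + 5) + 5) + _ := cost_allE fun X _ => cost_tabE X
  have c5 : (imageCond A B lk src (j + 2) : Exp J U).cost ≤
      A.toList.length * (3 + 5) + _ := cost_allE fun X _ => by simp [dg, Exp.cost]
  rw [Finset.length_toList] at h1 c1 c2 c3 c5
  have e : (imageOp A B lk src j : HCmd J U).cost N =
    (partners lk (j + 2) B.toList : HCmd J U).cost N + ((HCmd.scatter (digitVars A.toList) (j + 1)
      (imageCond A B lk src (j + 2))
      (sumE B.toList fun X => .sub (linkE lk (j + 2) X) (.lit 1)) : HCmd J U).cost N +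
      (fill j (.get (j + 1) (sumE B.toList dg)) : HCmd J U).cost N) := rfl
  rw [e]
  simp only [Exp.cost] at h3
  set p := Fintype.card J
  have h4 : B.card * (N ^ p * 100) ≤ N ^ p * (100 * p) := by
    calc B.card * (N ^ p * 100) ≤ p * (N ^ p * 100) := by gcongr
      _ = _ := by ring
  have h5 := h2.trans (Nat.mul_le_mul_left (N ^ p) (m := 72 * p) (by omega))
  have h6 := h3.trans (Nat.mul_le_mul_left (N ^ p) (m := 40 * p) (by omega))
  have : N ^ p * (250 * p) = N ^ p * (100 * p) + N ^ p * (72 * p) + N ^ p * (40 * p) +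
    N ^ p * (38 * p) := by ring
  omega

end ImageOp

end CatQuery
end
set_option linter.unusedSectionVars false
noncomputable section
namespace CatQuery

/-! ### Walks -/

section ChildSibling

/-- Steps from an edge to the greatest of its successors, and to the next smaller edge with the same
source. -/
def Thread (N : ℕ) (K : ℕ → Prop) (out par : ℕ → ℕ → Prop) (e e' : ℕ) : Prop :=
  lastHit (fun k => K k ∧ out e k) N = e' + 1 ∨
    lastHit (fun k => k < e ∧ K k ∧ par e k) N = e' + 1

variable {N : ℕ} {K S : ℕ → Prop} {out par : ℕ → ℕ → Prop}

/-- If a search followed every pair of consecutive edges, it would take quadratic time from a single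
start. Threads give each edge at most two continuations. Here the edges of a class with a common
source are met in descending order from any member `g`: the next smaller member is still at least
`e`, as `e` is itself a candidate. -/
theorem thread_siblings (hN : ∀ k, K k → k < N) {P : ℕ → Prop} (hP : ∀ e, P e → K e)
    (hpar : ∀ e e', P e → (P e' ↔ K e' ∧ par e e')) {g : ℕ} (hg : P g) {e : ℕ} (he : P e)
    (hle : e ≤ g) : Relation.ReflTransGen (Thread N K out par) g e := by
  induction g using Nat.strong_induction_on with
  | _ g ih =>
    rcases hle.eq_or_lt with rfl | hlt
    · exact .refl
    · rcases h : lastHit (fun k => k < g ∧ K k ∧ par g k) N with _ | g'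
      · exact absurd ⟨hlt, (hpar g e hg).1 he⟩ (lastHit_eq_zero_iff.1 h e (hN e (hP e he)))
      · obtain ⟨-, ⟨h1, h2⟩, h3⟩ := lastHit_succ_iff.1 h
        have := h3 e (hN e (hP e he)) ⟨hlt, (hpar g e hg).1 he⟩
        exact .head (Or.inr h) (ih g' h1 ((hpar g g' hg).2 h2) this)

/-- The edges on walks are found by following threads. -/
theorem exists_thread_iff (hN : ∀ k, K k → k < N)
    (hS : ∀ e e', K e ∧ S e → (K e' ∧ S e' ↔ K e' ∧ par e e'))
    (hout : ∀ a e e', K e ∧ out a e → (K e' ∧ out a e' ↔ K e' ∧ par e e')) {k : ℕ} :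
    (∃ k0, (K k0 ∧ S k0) ∧ Relation.ReflTransGen (fun e e' => K e' ∧ out e e') k0 k) ↔
      ∃ g, lastHit (fun k => K k ∧ S k) N = g + 1 ∧
        Relation.ReflTransGen (Thread N K out par) g k := by
  -- A nonempty class has a greatest member, the entry point from which `thread_siblings` reaches
  -- the whole class.
  have first : ∀ {P : ℕ → Prop}, (∀ e, P e → K e) → ∀ {e}, P e → ∃ g, lastHit P N = g + 1 ∧ P g ∧
      e ≤ g := fun {P} hP {e} he => by
    rcases h : lastHit P N with _ | g
    · exact absurd he (lastHit_eq_zero_iff.1 h e (hN e (hP e he)))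
    · obtain ⟨-, h1, h2⟩ := lastHit_succ_iff.1 h
      exact ⟨g, rfl, h1, h2 e (hN e (hP e he)) he⟩
  constructor
  · rintro ⟨k0, h0, h⟩
    induction h with
    | refl =>
      obtain ⟨g, h1, h2, h3⟩ := first (P := fun k => K k ∧ S k) (fun e he => he.1) h0
      exact ⟨g, h1, thread_siblings hN (P := fun k => K k ∧ S k) (fun e he => he.1) hS h2 h0 h3⟩
    | @tail b c _ hbc ih =>
      obtain ⟨g, h1, h2⟩ := ih
      obtain ⟨g', h3, h4, h5⟩ := first (P := fun k => K k ∧ out b k) (fun e he => he.1) hbc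
      exact ⟨g, h1, (h2.tail (Or.inl h3)).trans (thread_siblings hN (P := fun k => K k ∧ out b k)
        (fun e he => he.1) (hout b) h4 hbc h5)⟩
  · rintro ⟨g, hg, h⟩
    induction h with
    | refl => exact ⟨g, (lastHit_succ_iff.1 hg).2.1, .refl⟩
    | @tail b c _ hbc ih =>
      obtain ⟨k0, h0, h⟩ := ih
      rcases hbc with hbc | hbc
      · exact ⟨k0, h0, h.tail (lastHit_succ_iff.1 hbc).2.1⟩
      · obtain ⟨-, ⟨-, h1⟩, -⟩ := lastHit_succ_iff.1 hbc
        -- A sibling step from `b` to `c` is no step of a walk. Instead the step that entered `b` is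
        -- redirected to `c`, which has the same source; if `b` was the first edge, the walk starts
        -- at `c`.
        rcases Relation.ReflTransGen.cases_tail h with rfl | ⟨a, ha, hab⟩
        · exact ⟨c, (hS _ c h0).2 h1, .refl⟩
        · exact ⟨k0, h0, ha.tail ((hout a b c hab).2 h1)⟩

end ChildSibling

/-! ### Tables of edges and of pairs -/

section EdgeOps

variable {J U : Type} [SmallCategory J] [DecidableEq J] [Fintype J] [DataDomain U]
  {I : Instance J U} {ν : Numbering I} {C : Ctx J U}

/-- Membership of an edge in a table. -/
def memE (jk : ℕ) (E : J) (e : Exp J U) : Exp J U := .get jk (.get (wt E) e)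

/-- An edge relation has one component, and its table is read at the assignment that is `0`
elsewhere. The key of this assignment is a single multiple of a weight, so the test takes constant
time rather than time `O(p)`. -/
theorem memE_ok (hC : Fits C ν) {jk : ℕ} (hjk : jk < C.K) (hK : tableBase J ≤ C.K) {μ : Mem}
    (hW : Weights C μ) {P : (J → ℕ) → Prop} (hT : Table C μ jk P) (E : J) {e : Exp J U}
    {ρ : J ⊕ ℕ → ℕ} (he : e.Safe C ρ μ.arr) (hlt : e.eval C ρ μ.arr < C.N) :
    (memE jk E e).Safe C ρ μ.arr ∧
      ((memE jk E e).eval C ρ μ.arr ≠ 0 ↔ P (Pi.single E (e.eval C ρ μ.arr))) := by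
  have h1 := hW E _ hlt
  refine ⟨⟨⟨he, (wt_lt E).trans_le hK, hlt.trans_le hC.le⟩, hjk, ?_⟩, ?_⟩
  · rw [Exp.eval, h1]; exact hC.digit_lt E hlt
  · simp only [memE, Exp.eval]
    rw [h1, ← key_single, hT _ (single_lt hlt)]
    simp

/-- The guarded last edge in a table whose source has the value of `f`. -/
def edgesOp (a jk : ℕ) (s f : Mor J) (g : Exp J U) : HCmd J U :=
  .lastHits a (.ite g (.ite (memE jk s.1 (.var vj)) (veqE f (.var vi) s (.var vj)) (.lit 0)) (.lit 0))

theorem wp_edgesOp (hC : Fits C ν) {a jk : ℕ} (ha : a < C.K) (ha' : tableBase J ≤ a)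
    (hjk : jk < C.K) (hne : jk ≠ a) {μ : Mem} (hW : Weights C μ) (h0 : ∀ k, μ.arr a k = 0)
    {P : (J → ℕ) → Prop} (hT : Table C μ jk P) (s f : Mor J) {g : Exp J U} {G : ℕ → ℕ → Prop}
    (hg : ∀ i < C.N, ∀ j < C.N, ∀ μ', SameBut a μ μ' →
      g.Safe C (Function.update (Function.update (fun _ => 0) vi i) vj j) μ'.arr ∧
      (g.eval C (Function.update (Function.update (fun _ => 0) vi i) vj j) μ'.arr ≠ 0 ↔ G i j)) :
    (edgesOp a jk s f g).WP C (fun _ => 0) μ fun μ' => SameBut a μ μ' ∧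
      ∀ i < C.N, μ'.arr a i = lastHit (fun j => G i j ∧ P (Pi.single s.1 j) ∧ veq ν f i s j) C.N := by
  refine HCmd.wp_lastHits rfl rfl ha hC.le h0 fun i hi j hj μ' hs => ?_
  obtain ⟨g1, g2⟩ := hg i hi j hj μ' hs
  have hvi : (Exp.var vi : Exp J U).eval C
    (Function.update (Function.update (fun _ => 0) vi i) vj j) μ'.arr = i := by
      simp [Exp.eval, Function.update_of_ne]
  have hvj : (Exp.var vj : Exp J U).eval C
    (Function.update (Function.update (fun _ => 0) vi i) vj j) μ'.arr = j := by
      simp [Exp.eval]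
  obtain ⟨m1, m2⟩ := memE_ok hC hjk (ha'.trans ha.le) (hs.weights hW ha') (hs.table hT hne) s.1
    (e := .var vj) (ρ := Function.update (Function.update (fun _ => 0) vi i) vj j) trivial
    (by rwa [hvj])
  obtain ⟨v1, v2⟩ := veqE_ok hC f s (a := .var vi) (b := .var vj)
    (ρ := Function.update (Function.update (fun _ => 0) vi i) vj j) (A := μ'.arr) trivial trivial
  rw [hvj] at m2
  rw [hvi, hvj] at v2
  refine ⟨⟨g1, fun _ => ⟨m1, fun _ => v1, fun _ => trivial⟩, fun _ => trivial⟩, ?_⟩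
  rw [← g2, ← m2, ← v2]
  simp only [Exp.eval]
  split_ifs <;> simp_all

theorem cost_edgesOp {N : ℕ} (hN : 1 ≤ N) (hp : 2 ≤ Fintype.card J) (a jk : ℕ) (s f : Mor J)
    {g : Exp J U} (hg : g.cost ≤ 13) : (edgesOp a jk s f g).cost N ≤ N ^ Fintype.card J * 90 := by
  have h3 : N ^ 2 ≤ N ^ Fintype.card J := Nat.pow_le_pow_right hN hp
  have h4 := cost_binE (.cmp .eq) f s (.var vi) (.var vj : Exp J U)
  simp only [Exp.cost] at h4
  simp only [edgesOp, memE, HCmd.lastHits, HCmd.cost, Exp.cost, veqE]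
  nlinarith

/-- The number of a pair of components. -/
def pairE (X Y : J) (a b : Exp J U) : Exp J U := .add (.get (wt X) a) (.get (wt Y) b)

/-- The number of a pair of components. -/
def pairIx (N : ℕ) (X Y : J) (x y : ℕ) : ℕ := key N (Pi.single X x + Pi.single Y y)

theorem pair_lt {N : ℕ} {X Y : J} (hXY : X ≠ Y) {x y : ℕ} (hx : x < N) (hy : y < N) (Z : J) :
    (Pi.single X x + Pi.single Y y : J → ℕ) Z < N := by
  rw [Pi.add_apply]
  by_cases h : Z = X
  · subst h; simpa [Pi.single_eq_of_ne hXY] using hx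
  · rw [Pi.single_eq_of_ne h, zero_add]; exact single_lt hy Z

theorem pairIx_inj {N : ℕ} {X Y : J} (hXY : X ≠ Y) {x y x' y' : ℕ} (hx : x < N) (hy : y < N)
    (hx' : x' < N) (hy' : y' < N) : pairIx N X Y x y = pairIx N X Y x' y' ↔ x = x' ∧ y = y' := by
  constructor
  · intro h
    have := key_inj (pair_lt hXY hx hy) (pair_lt hXY hx' hy') h
    have h1 := congrFun this X
    have h2 := congrFun this Y
    simpa [Pi.single_eq_of_ne hXY, Pi.single_eq_of_ne hXY.symm] using And.intro h1 h2
  · rintro ⟨rfl, rfl⟩; rfl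

theorem Fits.pairIx_lt (hC : Fits C ν) {X Y : J} (hXY : X ≠ Y) {x y : ℕ} (hx : x < C.N)
    (hy : y < C.N) : pairIx C.N X Y x y < C.M := hC.key_lt (pair_lt hXY hx hy)

theorem pairE_ok (hC : Fits C ν) (hK : tableBase J ≤ C.K) {μ : Mem} (hW : Weights C μ) (X Y : J)
    {a b : Exp J U} {ρ : J ⊕ ℕ → ℕ} {x y : ℕ} (ha : a.Safe C ρ μ.arr) (hx : a.eval C ρ μ.arr = x)
    (hx' : x < C.N) (hb : b.Safe C ρ μ.arr) (hy : b.eval C ρ μ.arr = y) (hy' : y < C.N) :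
    (pairE X Y a b).Safe C ρ μ.arr ∧ (pairE X Y a b).eval C ρ μ.arr = pairIx C.N X Y x y := by
  refine ⟨⟨⟨ha, (wt_lt X).trans_le hK, ?_⟩, hb, (wt_lt Y).trans_le hK, ?_⟩, ?_⟩
  · rw [hx]; exact hx'.trans_le hC.le
  · rw [hy]; exact hy'.trans_le hC.le
  · simp only [pairE, Exp.eval]
    rw [hx, hy, hW X x hx', hW Y y hy', pairIx, key_add, key_single, key_single]

end EdgeOps

end CatQuery
end
set_option linter.unusedSectionVars false
noncomputable section
namespace CatQuery

/-! ### Reachability by a search over threads -/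

section ReachOp

variable {J U : Type} [SmallCategory J] [DecidableEq J] [Fintype J] [DataDomain U]
  {I : Instance J U} {ν : Numbering I} {C : Ctx J U}

/-- Append `v - 1` to a list if it is not in the list, and `v` is not `0`. -/
def pushNew (q : List ℕ) : ℕ → List ℕ
  | 0 => q
  | e + 1 => if e ∈ q then q else q ++ [e]

theorem prefix_pushNew (q : List ℕ) (v : ℕ) : q <+: pushNew q v := by
  rcases v with _ | e
  · exact List.prefix_rfl
  · simp only [pushNew]; split_ifs
    exacts [List.prefix_rfl, List.prefix_append _ _]

theorem mem_pushNew {q : List ℕ} {v a : ℕ} : a ∈ pushNew q v ↔ a ∈ q ∨ v = a + 1 := by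
  rcases v with _ | e
  · simp [pushNew]
  · simp only [pushNew]; split_ifs with h
    · refine ⟨Or.inl, ?_⟩
      rintro (h' | h')
      · exact h'
      · obtain rfl : e = a := by omega
        exact h
    · simp [eq_comm]

/-- The arrays from `j` hold the marks of the elements of a queue, the queue, and its length. -/
structure QueueOK (N j x : ℕ) (q : List ℕ) (μ : Mem) : Prop where
  seen : ∀ e < N, (μ.arr j e = x + 1 ↔ e ∈ q) ∧ μ.arr j e ≤ x + 1
  get : ∀ i (h : i < q.length), μ.arr (j + 1) i = q[i]
  len : μ.arr (j + 2) 0 = q.length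
  nodup : q.Nodup
  lt : ∀ e ∈ q, e < N

/-- Entries are distinct and below `N`. Hence the queue fits into an array, and `N` iterations are
enough to exhaust it. -/
theorem QueueOK.length_le {N j x : ℕ} {q : List ℕ} {μ : Mem} (h : QueueOK N j x q μ) :
    q.length ≤ N := by
  have := (List.subperm_of_subset h.nodup (l₂ := List.range N)
    fun e he => List.mem_range.2 (h.lt e he)).length_le
  simpa using this

/-- Append `e - 1` to the queue of the phase `vi`. -/
def pushC (j : ℕ) (e : Exp J U) : HCmd J U :=
  .ite e (.ite (.sub (.add (.var vi) (.lit 1)) (.get j (.sub e (.lit 1))))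
    (.seq (.store (j + 1) (.get (j + 2) (.lit 0)) (.sub e (.lit 1)))
      (.seq (.store (j + 2) (.lit 0) (.add (.get (j + 2) (.lit 0)) (.lit 1)))
        (.store j (.sub e (.lit 1)) (.add (.var vi) (.lit 1))))) .skip) .skip

/-- In phase `x` an element is marked by `x + 1`; marks of earlier phases are smaller and count as
absent, so they need not be erased. The expression `e` is evaluated again after the new entry and
the new length have been written, which is why `he` speaks of all memories with the same old
entries. -/
theorem wp_pushC (hC : Fits C ν) {j x : ℕ} (hj : j + 3 ≤ C.K) {q : List ℕ} {μ : Mem}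
    (h : QueueOK C.N j x q μ) {e : Exp J U} {v : ℕ} (hv : v ≤ C.N) {ρ : J ⊕ ℕ → ℕ} (hρ : ρ vi = x)
    (he : ∀ μ' : Mem, (∀ b, b < j + 1 ∨ j + 3 ≤ b → μ'.arr b = μ.arr b) →
      (∀ i < q.length, μ'.arr (j + 1) i = μ.arr (j + 1) i) →
      e.Safe C ρ μ'.arr ∧ e.eval C ρ μ'.arr = v) :
    (pushC j e).WP C ρ μ fun μ' => Frame j (j + 3) μ μ' ∧ QueueOK C.N j x (pushNew q v) μ' := by
  obtain ⟨s0, v0⟩ := he μ (fun _ _ => rfl) fun _ _ => rfl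
  have hM := hC.one_le.trans hC.le
  refine HCmd.wp_ite s0 (fun hne => ?_) fun h0 => ?_
  swap
  · rw [v0] at h0
    subst h0
    exact HCmd.wp_skip ⟨.refl _ _ _, h⟩
  rw [v0] at hne
  obtain ⟨a, rfl⟩ : ∃ a, v = a + 1 := ⟨v - 1, by omega⟩
  have ha : a < C.N := by omega
  have ev : ∀ A, e.eval C ρ A = a + 1 → (Exp.sub e (.lit 1)).eval C ρ A = a := fun A h => by
    simp [Exp.eval, h]
  obtain ⟨h1, h2⟩ := h.seen a ha
  have hget : (Exp.get j (.sub e (.lit 1))).eval C ρ μ.arr = μ.arr j a := by rw [Exp.eval, ev _ v0]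
  refine HCmd.wp_ite ⟨⟨trivial, trivial⟩, ⟨s0, trivial⟩, by omega, ?_⟩ (fun hne => ?_) fun h0 => ?_
  · rw [ev _ v0]; exact ha.trans_le hC.le
  · have hq : a ∉ q := by
      intro hq
      refine hne ?_
      have h3 := h1.2 hq
      rw [Exp.eval, hget, h3]
      simp [Exp.eval, hρ]
    -- The new entry `a` is not in the queue and is below `N` like the others, so there is room for
    -- it.
    have hlen : q.length < C.N := by
      have := (List.subperm_of_subset (l₂ := List.range C.N)
        (List.nodup_cons.2 ⟨hq, h.nodup⟩) (by
          intro b hb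
          rcases List.mem_cons.1 hb with rfl | hb
          exacts [List.mem_range.2 ha, List.mem_range.2 (h.lt b hb)])).length_le
      simpa using this
    have el : (Exp.get (j + 2) (.lit 0) : Exp J U).eval C ρ μ.arr = q.length := h.len
    refine HCmd.wp_seq (HCmd.wp_store ⟨trivial, by omega, by simp only [Exp.eval]; omega⟩ ⟨s0, trivial⟩
      (by omega) (by rw [el]; exact hlen.trans_le hC.le) ?_)
    rw [el, ev _ v0]
    set μ1 := μ.store (j + 1) q.length a with hμ1
    have e1 : (Exp.add (.get (j + 2) (.lit 0)) (.lit 1) : Exp J U).eval C ρ μ1.arr = q.length + 1 := by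
      simp only [Exp.eval, hμ1]
      rw [Mem.store_arr_ne _ _ _ (by omega), h.len]
    refine HCmd.wp_seq (HCmd.wp_store trivial
      ⟨⟨trivial, by omega, by simp only [Exp.eval]; omega⟩, trivial⟩ (by omega)
        (by simp only [Exp.eval]; omega) ?_)
    rw [e1]
    set μ2 := μ1.store (j + 2) ((Exp.lit 0 : Exp J U).eval C ρ μ1.arr) (q.length + 1) with hμ2
    obtain ⟨s2, v2⟩ := he μ2 (fun b hb => by
        rw [hμ2, Mem.store_arr_ne _ _ _ (by omega), hμ1, Mem.store_arr_ne _ _ _ (by omega)])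
      fun i hi => by
        rw [hμ2, Mem.store_arr_ne _ _ _ (by omega), hμ1, Mem.store_arr_same, if_neg (by omega)]
    refine HCmd.wp_store ⟨s2, trivial⟩ ⟨trivial, trivial⟩ (by omega)
      (by rw [ev _ v2]; exact ha.trans_le hC.le) ?_
    rw [ev _ v2]
    have e3 : (Exp.add (.var vi) (.lit 1) : Exp J U).eval C ρ μ2.arr = x + 1 := by
      simp [Exp.eval, hρ]
    rw [e3]
    have hp : pushNew q (a + 1) = q ++ [a] := by simp [pushNew, hq]
    rw [hp]
    refine ⟨⟨rfl, fun b hb => ?_⟩, fun b hb => ?_, fun i hi => ?_, ?_, ?_, ?_⟩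
    · rw [Mem.store_arr_ne _ _ _ (by omega), hμ2, Mem.store_arr_ne _ _ _ (by omega), hμ1,
        Mem.store_arr_ne _ _ _ (by omega)]
    · rw [Mem.store_arr_same, hμ2, Mem.store_arr_ne _ _ _ (by omega), hμ1,
        Mem.store_arr_ne _ _ _ (by omega)]
      split_ifs with hba
      · simp [hba]
      · simpa [hba] using h.seen b hb
    · rw [Mem.store_arr_ne _ _ _ (by omega), hμ2, Mem.store_arr_ne _ _ _ (by omega), hμ1,
        Mem.store_arr_same]
      simp only [List.length_append, List.length_singleton] at hi
      split_ifs with hiq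
      · simp [hiq]
      · rw [List.getElem_append_left (by omega), h.get]
    · rw [Mem.store_arr_ne _ _ _ (by omega), hμ2, Mem.store_arr_same]
      simp [Exp.eval]
    · exact List.nodup_append.2 ⟨h.nodup, by simp, by
        intro b hb c hc; rw [List.mem_singleton.1 hc]; rintro rfl; exact hq hb⟩
    · intro b hb
      rcases List.mem_append.1 hb with hb | hb
      · exact h.lt b hb
      · rw [List.mem_singleton.1 hb]; exact ha
  · have hq : a ∈ q := by
      refine h1.1 ?_
      rw [Exp.eval] at h0
      rw [hget] at h0
      simp only [Exp.eval, hρ] at h0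
      omega
    refine HCmd.wp_skip ⟨.refl _ _ _, ?_⟩
    simpa [pushNew, hq] using h

/-- Process an edge of the queue: record its target, and append its successors. -/
def visitC (X Y : J) (j : ℕ) : HCmd J U :=
  .ite (.sub (.get (j + 7) (.lit 0)) (.var vj))
    (.seq (.ite (.get (j + 4) (.get (j + 6) (.var vj)))
      (.store (j + 8) (pairE X Y (.var vi) (.sub (.get (j + 4) (.get (j + 6) (.var vj))) (.lit 1)))
        (.lit 1)) .skip)
      (.seq (pushC (j + 5) (.get (j + 2) (.get (j + 6) (.var vj))))
        (pushC (j + 5) (.get (j + 3) (.get (j + 6) (.var vj)))))) .skip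

/-- The search from all elements of `X`. -/
def searchC (X Y : J) (j : ℕ) : HCmd J U :=
  .forV vi (.seq (.store (j + 7) (.lit 0) (.lit 0)) (.seq (pushC (j + 5) (.get (j + 1) (.var vi)))
    (.forV vj (visitC X Y j))))

/-- The arrays that the search reads. -/
structure SearchPre (ν : Numbering I) (C : Ctx J U) (w : WalkSpec J) (K : ℕ → Prop) (j : ℕ)
    (μ : Mem) : Prop where
  weights : Weights C μ
  start : ∀ x < C.N, μ.arr (j + 1) x = lastHit (w.start ν K x) C.N
  child : ∀ e < C.N, μ.arr (j + 2) e = lastHit (w.next ν K e) C.N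
  sib : ∀ e < C.N, μ.arr (j + 3) e = lastHit (fun k => k < e ∧ K k ∧ veq ν w.s e w.s k) C.N
  fin : ∀ e < C.N, ∀ y, μ.arr (j + 4) e = y + 1 ↔ w.fin ν e y

theorem SearchPre.frame {w : WalkSpec J} {K : ℕ → Prop} {j lo hi : ℕ} {μ μ' : Mem}
    (h : SearchPre ν C w K j μ) (hf : Frame lo hi μ μ') (hj : tableBase J ≤ j) (hlo : j + 5 ≤ lo) :
    SearchPre ν C w K j μ' where
  weights := hf.weights h.weights (by omega)
  start := by rw [hf.2 _ (by omega)]; exact h.start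
  child := by rw [hf.2 _ (by omega)]; exact h.child
  sib := by rw [hf.2 _ (by omega)]; exact h.sib
  fin := by rw [hf.2 _ (by omega)]; exact h.fin

/-- The pair of `x` and `y` is found. -/
def Found (ν : Numbering I) (N : ℕ) (w : WalkSpec J) (K : ℕ → Prop) (x y : ℕ) : Prop :=
  ∃ g k, lastHit (w.start ν K x) N = g + 1 ∧ Relation.ReflTransGen
    (Thread N K (fun e k => veq ν w.t e w.s k) fun e k => veq ν w.s e w.s k) g k ∧ w.fin ν k y

/-- The edges that leave `x` and the edges that leave the end of an edge are classes of edges with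
sources of equal value, so `exists_thread_iff` applies to them by symmetry and transitivity of
`veq`. -/
theorem found_iff {N : ℕ} {w : WalkSpec J} {K : ℕ → Prop} (hN : ∀ k, K k → k < N) {x y : ℕ} :
    Found ν N w K x y ↔ ∃ k k', w.start ν K x k ∧ Relation.ReflTransGen (w.next ν K) k k' ∧
      w.fin ν k' y := by
  have key : ∀ {f : Mor J} {a e e' : ℕ}, K e ∧ veq ν f a w.s e →
      (K e' ∧ veq ν f a w.s e' ↔ K e' ∧ veq ν w.s e w.s e') := fun h =>
    and_congr_right fun _ => ⟨fun h' => h.2.symm.trans h', fun h' => h.2.trans h'⟩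
  have h := fun k => exists_thread_iff (k := k) (S := fun k => veq ν (ident w.X) x w.s k)
    (out := fun e k => veq ν w.t e w.s k) (par := fun e k => veq ν w.s e w.s k) hN
    (fun e e' h => key h) fun a e e' h => key h
  constructor
  · rintro ⟨g, k, h1, h2, h3⟩
    obtain ⟨k0, h4, h5⟩ := (h k).2 ⟨g, h1, h2⟩
    exact ⟨k0, k, h4, h5, h3⟩
  · rintro ⟨k0, k, h4, h5, h3⟩
    obtain ⟨g, h1, h2⟩ := (h k).1 ⟨k0, h4, h5⟩
    exact ⟨g, k, h1, h2, h3⟩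

/-- The state of the search from `x` before the edge at position `m` of the queue is processed. -/
structure SearchOK (ν : Numbering I) (C : Ctx J U) (w : WalkSpec J) (K : ℕ → Prop) (j x m : ℕ)
    (q : List ℕ) (μ : Mem) : Prop where
  queue : QueueOK C.N (j + 5) x q μ
  sound : ∀ e ∈ q, ∃ g, lastHit (w.start ν K x) C.N = g + 1 ∧ Relation.ReflTransGen
    (Thread C.N K (fun e k => veq ν w.t e w.s k) fun e k => veq ν w.s e w.s k) g e
  first : ∀ g, lastHit (w.start ν K x) C.N = g + 1 → g ∈ q
  closed : ∀ i < m, ∀ h : i < q.length, ∀ e,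
    Thread C.N K (fun e k => veq ν w.t e w.s k) (fun e k => veq ν w.s e w.s k) q[i] e → e ∈ q
  marks : ∀ x' < C.N, ∀ y < C.N, μ.arr (j + 8) (pairIx C.N w.X w.Y x' y) =
    flag ((x' < x ∧ Found ν C.N w K x' y) ∨ (x' = x ∧ ∃ i < m, ∃ h : i < q.length, w.fin ν q[i] y))

/-- After `N` positions the whole queue has been processed, so it contains the first edge and is
closed under threads. By soundness it is then exactly the set of edges on threads from `x`. -/
theorem SearchOK.found {w : WalkSpec J} {K : ℕ → Prop} {j x : ℕ} {q : List ℕ} {μ : Mem}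
    (h : SearchOK ν C w K j x C.N q μ) {y : ℕ} :
    (∃ i < C.N, ∃ h : i < q.length, w.fin ν q[i] y) ↔ Found ν C.N w K x y := by
  constructor
  · rintro ⟨i, -, hi, hf⟩
    obtain ⟨g, h1, h2⟩ := h.sound _ (List.getElem_mem hi)
    exact ⟨g, _, h1, h2, hf⟩
  · rintro ⟨g, k, h1, h2, hf⟩
    have hk : k ∈ q := by
      clear hf
      induction h2 with
      | refl => exact h.first g h1
      | tail _ hbc ih =>
        obtain ⟨i, hi, rfl⟩ := List.mem_iff_getElem.1 ih
        exact h.closed i (hi.trans_le h.queue.length_le) hi _ hbc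
    obtain ⟨i, hi, rfl⟩ := List.mem_iff_getElem.1 hk
    exact ⟨i, hi.trans_le h.queue.length_le, hi, hf⟩

/-- One visit takes constant time: one mark for the target of the edge, and at most two new entries.
The loop over positions has a fixed length, so visits beyond the end of the queue must do nothing.
-/
theorem wp_visitC (hC : Fits C ν) {w : WalkSpec J} {K : ℕ → Prop} {j x m : ℕ} {q : List ℕ}
    {μ : Mem} (hj : tableBase J ≤ j) (hK : j + 9 ≤ C.K) (hx : x < C.N)
    (hm : m < C.N) (hp : SearchPre ν C w K j μ) (h : SearchOK ν C w K j x m q μ) :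
    (visitC w.X w.Y j).WP C (Function.update (Function.update (fun _ => 0) vi x) vj m) μ
      fun μ' => Frame (j + 5) (j + 9) μ μ' ∧ ∃ q', SearchOK ν C w K j x (m + 1) q' μ' := by
  set ρ : J ⊕ ℕ → ℕ := Function.update (Function.update (fun _ => 0) vi x) vj m with hρ
  have hvi : ρ vi = x := by simp [hρ, Function.update_of_ne]
  have hvj : ρ vj = m := by simp [hρ]
  have hNM := hC.le
  have hM := hC.one_le.trans hC.le
  have hlen := h.queue.len
  have hYN : Fintype.card (I.F.obj w.Y) ≤ C.N := hC.card_le w.Y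
  refine HCmd.wp_ite ⟨⟨trivial, by omega, hM⟩, trivial⟩ (fun hne => ?_) fun h0 => ?_
  swap
  · simp only [Exp.eval, hlen, hvj] at h0
    have hq : q.length ≤ m := by omega
    refine HCmd.wp_skip ⟨.refl _ _ _, q, ⟨h.queue, h.sound, h.first,
      fun i _ hi => h.closed i (by omega) hi, fun x' hx' y hy => ?_⟩⟩
    rw [h.marks x' hx' y hy]
    refine flag_congr (or_congr_right (and_congr_right fun _ => ?_))
    exact ⟨fun ⟨i, h1, h2, h3⟩ => ⟨i, by omega, h2, h3⟩, fun ⟨i, h1, h2, h3⟩ => ⟨i, by omega, h2, h3⟩⟩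
  simp only [Exp.eval, hlen, hvj] at hne
  have hq : m < q.length := by omega
  set e := q[m] with he
  have heN : e < C.N := h.queue.lt _ (List.getElem_mem hq)
  have head : ∀ A : ℕ → ℕ → ℕ, A (j + 6) m = e →
      (Exp.get (j + 6) (.var vj) : Exp J U).Safe C ρ A ∧
      (Exp.get (j + 6) (.var vj) : Exp J U).eval C ρ A = e := fun A hA =>
    ⟨⟨trivial, by omega, by simp only [Exp.eval, hvj]; omega⟩, by simp only [Exp.eval, hvj, hA]⟩
  have get : ∀ b < C.K, ∀ A : ℕ → ℕ → ℕ, A (j + 6) m = e →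
      (Exp.get b (.get (j + 6) (.var vj)) : Exp J U).Safe C ρ A ∧
      (Exp.get b (.get (j + 6) (.var vj)) : Exp J U).eval C ρ A = A b e := fun b hb A hA => by
    obtain ⟨s, v⟩ := head A hA
    exact ⟨⟨s, hb, by rw [v]; omega⟩, by rw [Exp.eval, v]⟩
  have hA0 : μ.arr (j + 6) m = e := h.queue.get m hq
  -- the mark
  have step1 : (HCmd.ite (.get (j + 4) (.get (j + 6) (.var vj))) (.store (j + 8) (pairE w.X w.Y
      (.var vi) (.sub (.get (j + 4) (.get (j + 6) (.var vj))) (.lit 1))) (.lit 1)) .skip :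
      HCmd J U).WP C ρ μ fun μ' => SameBut (j + 8) μ μ' ∧ ∀ x' < C.N, ∀ y < C.N,
        μ'.arr (j + 8) (pairIx C.N w.X w.Y x' y) = flag ((x' < x ∧ Found ν C.N w K x' y) ∨
          (x' = x ∧ ∃ i < m + 1, ∃ h : i < q.length, w.fin ν q[i] y)) := by
    have split : ∀ y, (∃ i < m + 1, ∃ h : i < q.length, w.fin ν q[i] y) ↔
        (∃ i < m, ∃ h : i < q.length, w.fin ν q[i] y) ∨ w.fin ν e y := fun y => by
      constructor
      · rintro ⟨i, h1, h2, h3⟩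
        rcases Nat.lt_succ_iff_lt_or_eq.1 h1 with h1 | rfl
        exacts [Or.inl ⟨i, h1, h2, h3⟩, Or.inr h3]
      · rintro (⟨i, h1, h2, h3⟩ | h1)
        exacts [⟨i, by omega, h2, h3⟩, ⟨m, by omega, hq, h1⟩]
    obtain ⟨s, v⟩ := get (j + 4) (by omega) μ.arr hA0
    refine HCmd.wp_ite s (fun hne => ?_) fun h0 => ?_
    · rw [v] at hne
      obtain ⟨y0, hy0⟩ : ∃ y0, μ.arr (j + 4) e = y0 + 1 := ⟨μ.arr (j + 4) e - 1, by omega⟩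
      have hf := (hp.fin e heN y0).1 hy0
      have hyN : y0 < C.N := hf.lt_right.trans_le hYN
      obtain ⟨ps, pv⟩ := pairE_ok (U := U) hC (by omega) hp.weights w.X w.Y (a := .var vi)
        (b := .sub (.get (j + 4) (.get (j + 6) (.var vj))) (.lit 1)) (ρ := ρ) (x := x) (y := y0)
        trivial hvi hx ⟨s, trivial⟩ (by rw [Exp.eval, v, hy0]; rfl) hyN
      refine HCmd.wp_store ps trivial (by omega) (by rw [pv]; exact hC.pairIx_lt w.hXY hx hyN) ?_
      rw [pv]
      refine ⟨(SameBut.refl _ _).store _ _, fun x' hx' y hy => ?_⟩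
      rw [Mem.store_arr_same]
      split_ifs with hxy
      · obtain ⟨rfl, rfl⟩ := (pairIx_inj w.hXY hx' hy hx hyN).1 hxy
        rw [flag_true]
        · rfl
        · exact Or.inr ⟨rfl, (split _).2 (Or.inr hf)⟩
      · rw [h.marks x' hx' y hy]
        refine flag_congr (or_congr_right (and_congr_right fun hxx => ?_))
        rw [split]
        refine ⟨Or.inl, fun h' => h'.resolve_right fun h'' => hxy ?_⟩
        have : y = y0 := (h''.symm.trans hf).eq
        rw [hxx, this]
    · rw [v] at h0
      refine HCmd.wp_skip ⟨.refl _ _, fun x' hx' y hy => ?_⟩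
      rw [h.marks x' hx' y hy]
      refine flag_congr (or_congr_right (and_congr_right fun hxx => ?_))
      rw [split]
      refine ⟨Or.inl, fun h' => h'.resolve_right fun h'' => ?_⟩
      rw [(hp.fin e heN y).2 h''] at h0
      omega
  refine HCmd.wp_seq (step1.mono ?_)
  rintro μ1 ⟨s1, r1⟩
  have q1 : QueueOK C.N (j + 5) x q μ1 := by
    refine ⟨?_, ?_, ?_, h.queue.nodup, h.queue.lt⟩
    · rw [s1.2 _ (by omega)]; exact h.queue.seen
    · rw [s1.2 _ (by omega)]; exact h.queue.get
    · rw [s1.2 _ (by omega)]; exact h.queue.len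
  have f1 := s1.frame (lo := j + 5) (hi := j + 9) (by omega) (by omega)
  have p1 := hp.frame f1 hj le_rfl
  refine HCmd.wp_seq ((wp_pushC hC (by omega) q1 (v := lastHit (w.next ν K e) C.N) lastHit_le hvi
    fun μ' h1 h2 => ?_).mono ?_)
  · obtain ⟨s, v⟩ := get (j + 2) (by omega) μ'.arr (by
      rw [h2 m hq]; exact q1.get m hq)
    exact ⟨s, by rw [v, h1 _ (by omega), p1.child e heN]⟩
  rintro μ2 ⟨f2, q2⟩
  have f12 := f1.trans (f2.mono (by omega) (by omega))
  have p2 := hp.frame f12 hj le_rfl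
  -- Appending keeps earlier positions, so the current edge can be read from the queue again for the
  -- second continuation.
  have hq2 : m < (pushNew q (lastHit (w.next ν K e) C.N)).length :=
    hq.trans_le (prefix_pushNew _ _).length_le
  have e2 : (pushNew q (lastHit (w.next ν K e) C.N))[m] = e :=
    ((prefix_pushNew _ _).getElem hq).symm
  refine (wp_pushC hC (by omega) q2 (v := lastHit (fun k => k < e ∧ K k ∧ veq ν w.s e w.s k) C.N)
    lastHit_le hvi fun μ' h1 h2 => ?_).mono ?_
  · obtain ⟨s, v⟩ := get (j + 3) (by omega) μ'.arr (by
      rw [h2 m hq2, q2.get m hq2, e2])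
    exact ⟨s, by rw [v, h1 _ (by omega), p2.sib e heN]⟩
  rintro μ3 ⟨f3, q3⟩
  have hpre : q <+: pushNew (pushNew q (lastHit (w.next ν K e) C.N))
      (lastHit (fun k => k < e ∧ K k ∧ veq ν w.s e w.s k) C.N) :=
    (prefix_pushNew _ _).trans (prefix_pushNew _ _)
  have hmem : ∀ a, a ∈ pushNew (pushNew q (lastHit (w.next ν K e) C.N))
      (lastHit (fun k => k < e ∧ K k ∧ veq ν w.s e w.s k) C.N) ↔ a ∈ q ∨ Thread C.N K
        (fun e k => veq ν w.t e w.s k) (fun e k => veq ν w.s e w.s k) e a := fun a => by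
    rw [mem_pushNew, mem_pushNew, or_assoc]; rfl
  refine ⟨f12.trans (f3.mono (by omega) (by omega)), _, q3, fun a ha => ?_,
    fun g hg => hpre.subset (h.first g hg), fun i hi hi' a ha => ?_, fun x' hx' y hy => ?_⟩
  · rcases (hmem a).1 ha with ha | ha
    · exact h.sound a ha
    · obtain ⟨g, h1, h2⟩ := h.sound e (List.getElem_mem hq)
      exact ⟨g, h1, h2.tail ha⟩
  · have hiq : i < q.length := by omega
    rw [← hpre.getElem hiq] at ha
    rcases Nat.lt_succ_iff_lt_or_eq.1 hi with hi | rfl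
    · exact hpre.subset (h.closed i hi hiq a ha)
    · exact (hmem a).2 (Or.inr ha)
  · rw [f3.2 _ (by omega), f2.2 _ (by omega), r1 x' hx' y hy]
    refine flag_congr (or_congr_right (and_congr_right fun _ => ?_))
    constructor
    · rintro ⟨i, h1, h2, h3⟩
      exact ⟨i, h1, h2.trans_le hpre.length_le, by rwa [← hpre.getElem h2]⟩
    · rintro ⟨i, h1, h2, h3⟩
      have hiq : i < q.length := by omega
      exact ⟨i, h1, hiq, by rwa [hpre.getElem hiq]⟩

/-- One phase for each `x`, each of `N` visits of constant time. The mark array for pairs is shared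
by all phases; within phase `x` only pairs with first component `x` are added. -/
theorem wp_searchC (hC : Fits C ν) {w : WalkSpec J} {K : ℕ → Prop} {j : ℕ} {μ : Mem}
    (hj : tableBase J ≤ j) (hK : j + 9 ≤ C.K) (hp : SearchPre ν C w K j μ)
    (h0 : Fresh (j + 5) (j + 9) μ) :
    (searchC w.X w.Y j).WP C (fun _ => 0) μ fun μ' => Frame (j + 5) (j + 9) μ μ' ∧
      ∀ x < C.N, ∀ y < C.N,
        μ'.arr (j + 8) (pairIx C.N w.X w.Y x y) = flag (Found ν C.N w K x y) := by
  have hNM := hC.le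
  have hM := hC.one_le.trans hC.le
  refine HCmd.wp_forV (fun n μ' => Frame (j + 5) (j + 9) μ μ' ∧ (∀ e < C.N, μ'.arr (j + 5) e ≤ n) ∧
    ∀ x < C.N, ∀ y < C.N, μ'.arr (j + 8) (pairIx C.N w.X w.Y x y) =
      flag (x < n ∧ Found ν C.N w K x y)) rfl ⟨.refl _ _ _, fun e _ => ?_, fun x _ y _ => ?_⟩ ?_ ?_
  · rw [h0 _ le_rfl (by omega)]
  · rw [h0 _ (by omega) (by omega), flag_false (by simp)]
  swap
  · rintro μ' ⟨f, -, h⟩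
    exact ⟨f, fun x hx y hy => by rw [h x hx y hy]; exact flag_congr (and_iff_right hx)⟩
  rintro n hn μ1 ⟨f1, v1, r1⟩
  set ρ : J ⊕ ℕ → ℕ := Function.update (fun _ => 0) vi n with hρ
  have hvi : ρ vi = n := by simp [hρ]
  have hvj : ρ vj = 0 := by simp [hρ, Function.update_of_ne]
  refine HCmd.wp_seq (HCmd.wp_store trivial trivial (by omega) (by simp only [Exp.eval]; omega) ?_)
  set μ2 := μ1.store (j + 7) ((Exp.lit 0 : Exp J U).eval C ρ μ1.arr)
    ((Exp.lit 0 : Exp J U).eval C ρ μ1.arr) with hμ2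
  have f2 : Frame (j + 5) (j + 9) μ μ2 := f1.trans
    (((SameBut.refl _ _).store _ _).frame (by omega) (by omega))
  -- All marks are at most `n` at the start of phase `n`, so none equals `n + 1`. Resetting the
  -- length is enough to empty the queue.
  have q2 : QueueOK C.N (j + 5) n [] μ2 := by
    refine ⟨fun e he => ?_, by simp, by simp [hμ2, Exp.eval], by simp, by simp⟩
    have := v1 e he
    rw [hμ2, Mem.store_arr_ne _ _ _ (by omega)]
    constructor
    · simp only [List.not_mem_nil, iff_false]; omega
    · omega
  have p2 := hp.frame f2 hj le_rfl
  refine HCmd.wp_seq ((wp_pushC hC (by omega) q2 (e := .get (j + 1) (.var vi))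
    (v := lastHit (w.start ν K n) C.N) lastHit_le hvi
    fun μ' h1 h2 => ⟨⟨trivial, by omega, by simp only [Exp.eval, hvi]; omega⟩, ?_⟩).mono ?_)
  · simp only [Exp.eval, hvi]
    rw [h1 _ (by omega), p2.start n hn]
  rintro μ3 ⟨f3, q3⟩
  have f23 := f2.trans (f3.mono (by omega) (by omega))
  have hmem : ∀ a, a ∈ pushNew [] (lastHit (w.start ν K n) C.N) ↔
      lastHit (w.start ν K n) C.N = a + 1 := fun a => by simp [mem_pushNew]
  refine HCmd.wp_forV (fun m μ' => Frame (j + 5) (j + 9) μ μ' ∧ ∃ q, SearchOK ν C w K j n m q μ')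
    hvj ⟨f23, _, q3, fun e he => ⟨e, (hmem e).1 he, .refl⟩, fun g hg => (hmem g).2 hg,
      fun i hi => by omega, fun x' hx' y hy => ?_⟩ ?_ ?_
  · rw [f3.2 _ (by omega), hμ2, Mem.store_arr_ne _ _ _ (by omega), r1 x' hx' y hy]
    exact flag_congr ⟨Or.inl, fun h => h.resolve_right fun ⟨_, i, hi, _⟩ => by omega⟩
  · rintro m hm μ4 ⟨f4, q, h4⟩
    refine (wp_visitC hC hj hK hn hm (hp.frame f4 hj le_rfl) h4).mono ?_
    rintro μ5 ⟨f5, h5⟩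
    exact ⟨f4.trans f5, h5⟩
  · rintro μ4 ⟨f4, q, h4⟩
    refine ⟨f4, fun e he => (h4.queue.seen e he).2, fun x hx y hy => ?_⟩
    rw [h4.marks x hx y hy]
    refine flag_congr ?_
    rw [h4.found]
    constructor
    · rintro (⟨h1, h2⟩ | ⟨rfl, h2⟩)
      exacts [⟨by omega, h2⟩, ⟨by omega, h2⟩]
    · rintro ⟨h1, h2⟩
      rcases Nat.lt_succ_iff_lt_or_eq.1 h1 with h1 | rfl
      exacts [Or.inl ⟨h1, h2⟩, Or.inr ⟨rfl, h2⟩]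

/-- Compute in the table `j` the pairs that are connected by a walk in the table `jk`. -/
def reachOp (w : WalkSpec J) (jk j : ℕ) : HCmd J U :=
  .seq (edgesOp (j + 1) jk w.s (ident w.X) (.lit 1)) (.seq (edgesOp (j + 2) jk w.s w.t (.lit 1))
    (.seq (edgesOp (j + 3) jk w.s w.s (.sub (.var vi) (.var vj))) (.seq (partner w.t w.Y (j + 4))
      (.seq (searchC w.X w.Y j) (fill j (.get (j + 8) (pairE w.X w.Y (dg w.X) (dg w.Y))))))))

/-- The four tabulations provide the first edge for each start, the two continuations of each edge,
and the element of `Y` at its end. The guard `j < i` in the third one turns "last edge with the same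
source" into "next smaller edge". -/
theorem wp_reachOp (hC : Fits C ν) (w : WalkSpec J) {jk j : ℕ} (hj : tableBase J ≤ j)
    (hK : j + 9 ≤ C.K) (hjk : jk < C.K) (hne : jk < j ∨ j + 9 ≤ jk) {μ : Mem} (hW : Weights C μ)
    (h0 : Fresh j (j + 9) μ) {P : (J → ℕ) → Prop} (hT : Table C μ jk P)
    (hP : ∀ k, P (Pi.single w.E k) → k < C.N) :
    (reachOp w jk j).WP C (fun _ => 0) μ fun μ' => Frame j (j + 9) μ μ' ∧ Table C μ' j fun d =>
      ∃ k k', w.start ν (fun k => P (Pi.single w.E k)) (d w.X) k ∧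
        Relation.ReflTransGen (w.next ν fun k => P (Pi.single w.E k)) k k' ∧
        w.fin ν k' (d w.Y) := by
  have lit1 : ∀ (ρ : J ⊕ ℕ → ℕ) (A : ℕ → ℕ → ℕ), (Exp.lit 1 : Exp J U).Safe C ρ A ∧
      ((Exp.lit 1 : Exp J U).eval C ρ A ≠ 0 ↔ True) := fun ρ A => ⟨trivial, by simp [Exp.eval]⟩
  refine HCmd.wp_seq ((wp_edgesOp hC (by omega) (by omega) hjk (by omega) hW
    (h0 _ (by omega) (by omega)) hT w.s (ident w.X) fun _ _ _ _ _ _ => lit1 _ _).mono ?_)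
  rintro μ1 ⟨s1, e1⟩
  have f1 := s1.frame (lo := j) (hi := j + 9) (by omega) (by omega)
  refine HCmd.wp_seq ((wp_edgesOp hC (by omega) (by omega) hjk (by omega) (f1.weights hW hj)
    (by rw [s1.2 _ (by omega)]; exact h0 _ (by omega) (by omega)) (f1.table hT hne) w.s w.t
    fun _ _ _ _ _ _ => lit1 _ _).mono ?_)
  rintro μ2 ⟨s2, e2⟩
  have f2 := f1.trans (s2.frame (lo := j) (hi := j + 9) (by omega) (by omega))
  refine HCmd.wp_seq ((wp_edgesOp hC (by omega) (by omega) hjk (by omega) (f2.weights hW hj)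
    (by rw [s2.2 _ (by omega), s1.2 _ (by omega)]; exact h0 _ (by omega) (by omega))
    (f2.table hT hne) w.s w.s (g := .sub (.var vi) (.var vj)) (G := fun i j => j < i) fun i _ j _ _ _ =>
      ⟨⟨trivial, trivial⟩, by simp [Exp.eval, Function.update_of_ne]; omega⟩).mono ?_)
  rintro μ3 ⟨s3, e3⟩
  have f3 := f2.trans (s3.frame (lo := j) (hi := j + 9) (by omega) (by omega))
  refine HCmd.wp_seq ((wp_partner hC w.t w.Y (by omega) (by
    rw [s3.2 _ (by omega), s2.2 _ (by omega), s1.2 _ (by omega)]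
    exact h0 _ (by omega) (by omega))).mono ?_)
  rintro μ4 ⟨s4, e4⟩
  have f4 := f3.trans (s4.frame (lo := j) (hi := j + 9) (by omega) (by omega))
  have pre : SearchPre ν C w (fun k => P (Pi.single w.E k)) j μ4 := by
    refine ⟨f4.weights hW hj, fun x hx => ?_, fun e he => ?_, fun e he => ?_, e4⟩
    · rw [s4.2 _ (by omega), s3.2 _ (by omega), s2.2 _ (by omega), e1 x hx]
      exact lastHit_congr fun k => Iff.of_eq (true_and _)
    · rw [s4.2 _ (by omega), s3.2 _ (by omega), e2 e he]
      exact lastHit_congr fun k => Iff.of_eq (true_and _)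
    · rw [s4.2 _ (by omega), e3 e he]; rfl
  have fr : ∀ b, (b = j ∨ j + 5 ≤ b) → b < j + 9 → ∀ k, μ4.arr b k = 0 := fun b hb hb' => by
    rw [s4.2 _ (by omega), s3.2 _ (by omega), s2.2 _ (by omega), s1.2 _ (by omega)]
    exact h0 _ (by omega) hb'
  refine HCmd.wp_seq ((wp_searchC hC hj hK pre fun b hb hb' => fr b (Or.inr hb) hb').mono ?_)
  rintro μ5 ⟨f5, e5⟩
  have f45 := f4.trans (f5.mono (by omega) le_rfl)
  refine (wp_fill (P := fun d => Found ν C.N w (fun k => P (Pi.single w.E k)) (d w.X) (d w.Y)) hC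
    (by omega) hj (f45.weights hW hj) (by
      rw [f5.2 _ (by omega)]; exact fr j (Or.inl rfl) (by omega)) fun d hd μ' hs hW' => ?_).mono ?_
  · obtain ⟨s, v⟩ := pairE_ok (U := U) hC (by omega) hW' w.X w.Y (a := dg w.X) (b := dg w.Y)
      (ρ := env d) (x := d w.X) (y := d w.Y) trivial rfl (hd _) trivial rfl (hd _)
    refine ⟨⟨s, by omega, by rw [v]; exact hC.pairIx_lt w.hXY (hd _) (hd _)⟩, ?_⟩
    rw [Exp.eval, v, hs.2 _ (by omega), e5 _ (hd _) _ (hd _)]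
    simp
  · rintro μ6 ⟨s6, t6⟩
    exact ⟨f45.trans (s6.frame le_rfl (by omega)), t6.congr fun d _ => found_iff hP⟩

/-- The endpoints lie in two different objects, so `p ≥ 2` and every quadratic pass costs at most a
constant times `N ^ p`. -/
theorem cost_reachOp {N : ℕ} (hN : 1 ≤ N) (w : WalkSpec J) (jk j : ℕ) :
    (reachOp w jk j : HCmd J U).cost N ≤ N ^ Fintype.card J * (800 * Fintype.card J) := by
  have hp : 2 ≤ Fintype.card J := Fintype.one_lt_card_iff.2 ⟨_, _, w.hXY⟩
  have h1 := cost_edgesOp (U := U) hN hp (j + 1) jk w.s (ident w.X) (g := .lit 1) (by simp [Exp.cost])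
  have h2 := cost_edgesOp (U := U) hN hp (j + 2) jk w.s w.t (g := .lit 1) (by simp [Exp.cost])
  have h3 := cost_edgesOp (U := U) hN hp (j + 3) jk w.s w.s (g := .sub (.var vi) (.var vj))
    (by simp [Exp.cost])
  have h4 := cost_partner (U := U) hN w.t w.Y (j + 4)
  have h5 := cost_fill (U := U) hN j (.get (j + 8) (pairE w.X w.Y (dg w.X) (dg w.Y)) : Exp J U)
  have h6 : (searchC w.X w.Y j : HCmd J U).cost N ≤ N ^ Fintype.card J * 400 := by
    have h3 : N ^ 2 ≤ N ^ Fintype.card J := Nat.pow_le_pow_right hN hp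
    simp only [searchC, visitC, pushC, pairE, HCmd.cost, Exp.cost]
    nlinarith
  have e : (reachOp w jk j : HCmd J U).cost N = _ + (_ + (_ + (_ + (_ + _)))) := rfl
  rw [e]
  have c5 : (Exp.get (j + 8) (pairE w.X w.Y (dg w.X) (dg w.Y)) : Exp J U).cost = 15 := rfl
  rw [c5] at h5
  have h7 := h5.trans (Nat.mul_le_mul_left (N ^ Fintype.card J) (m := 25 * Fintype.card J) (by omega))
  have h8 : N ^ Fintype.card J * (800 * Fintype.card J) ≥
      N ^ Fintype.card J * (25 * Fintype.card J + 775 * 2) := Nat.mul_le_mul_left _ (by omega)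
  rw [mul_add] at h8
  omega

end ReachOp

end CatQuery
end
set_option linter.unusedSectionVars false
noncomputable section
namespace CatQuery

/-! ### Walks with a prescribed number of edges -/

section HopOp

variable {J U : Type} [SmallCategory J] [DecidableEq J] [Fintype J] [DataDomain U]
  {I : Instance J U} {ν : Numbering I} {C : Ctx J U}

/-- The array `a` is a table of pairs. -/
def PairTable (C : Ctx J U) (X Y : J) (a : ℕ → ℕ) (A : ℕ → ℕ → Prop) : Prop :=
  ∀ x < C.N, ∀ y < C.N, a (pairIx C.N X Y x y) = flag (A x y)

/-- Compose a relation with the graphs of two tabulated partial functions. -/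
def composeRel (N : ℕ) (s d : ℕ → ℕ) (A : ℕ → ℕ → Prop) (x c : ℕ) : Prop :=
  ∃ e < N, ∃ r, s e = r + 1 ∧ A x r ∧ d e = c + 1

/-- Compute the composition of the relation in `a` with the partial functions in `s` and `d`. -/
def composeOp (X Y : J) (s d a b : ℕ) : HCmd J U :=
  .scatter [vi, vj] b (.ite (.get s (.var vj)) (.ite (.get a (pairE X Y (.var vi)
      (.sub (.get s (.var vj)) (.lit 1)))) (.get d (.var vj)) (.lit 0)) (.lit 0))
    (pairE X Y (.var vi) (.sub (.get d (.var vj)) (.lit 1)))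

/-- Composition of two arbitrary relations would need a cubic pass. Here an edge `e` determines both
the point `s e` where it is entered and the point `d e` where it leads, so it suffices to run
through pairs of a start `x` and an edge `e`. -/
theorem wp_composeOp (hC : Fits C ν) {X Y : J} (hXY : X ≠ Y) {s d a b : ℕ} (hb : tableBase J ≤ b)
    (hbK : b < C.K) (hs : s < C.K) (hsb : s ≠ b) (hd : d < C.K) (hdb : d ≠ b) (ha : a < C.K)
    (hab : a ≠ b) {μ : Mem} (hW : Weights C μ) (h0 : ∀ k, μ.arr b k = 0) {A : ℕ → ℕ → Prop}
    (hA : PairTable C X Y (μ.arr a) A) (hsN : ∀ e < C.N, μ.arr s e ≤ C.N)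
    (hdN : ∀ e < C.N, μ.arr d e ≤ C.N) :
    (composeOp X Y s d a b).WP C (fun _ => 0) μ fun μ' => SameBut b μ μ' ∧
      PairTable C X Y (μ'.arr b) (composeRel C.N (μ.arr s) (μ.arr d) A) := by
  have hNM := hC.le
  have hbox : ∀ ρ' : J ⊕ ℕ → ℕ, ρ' ∈ box C.N [vi, vj] (fun _ => 0) → ρ' vi < C.N ∧ ρ' vj < C.N :=
    fun ρ' h => by
      have := ((mem_box (by simp)).1 h).1
      exact ⟨this _ (by simp), this _ (by simp)⟩
  refine (HCmd.wp_scatter (P := fun ρ' => ∃ r, μ.arr s (ρ' vj) = r + 1 ∧ A (ρ' vi) r ∧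
      μ.arr d (ρ' vj) ≠ 0) (ix := fun ρ' => pairIx C.N X Y (ρ' vi) (μ.arr d (ρ' vj) - 1)) (by simp)
    (fun _ _ => rfl) hbK h0 ?_ ?_).mono ?_
  · intro ρ' hρ' μ' hsb'
    obtain ⟨hi, hj⟩ := hbox ρ' hρ'
    have es : (Exp.get s (.var vj) : Exp J U).eval C ρ' μ'.arr = μ.arr s (ρ' vj) := by
      simp only [Exp.eval]; rw [hsb'.2 s hsb]
    have ed : (Exp.get d (.var vj) : Exp J U).eval C ρ' μ'.arr = μ.arr d (ρ' vj) := by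
      simp only [Exp.eval]; rw [hsb'.2 d hdb]
    have ss : (Exp.get s (.var vj) : Exp J U).Safe C ρ' μ'.arr :=
      ⟨trivial, hs, by simp only [Exp.eval]; omega⟩
    have sd : (Exp.get d (.var vj) : Exp J U).Safe C ρ' μ'.arr :=
      ⟨trivial, hd, by simp only [Exp.eval]; omega⟩
    rcases h : μ.arr s (ρ' vj) with _ | r
    · rw [h] at es
      refine ⟨⟨ss, fun hne => absurd es hne, fun _ => trivial⟩, ?_⟩
      rw [Exp.eval, if_pos es]
      simp [Exp.eval]
    · rw [h] at es
      have hr : r < C.N := by have := hsN _ hj; omega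
      obtain ⟨ps, pv⟩ := pairE_ok (U := U) hC (hb.trans hbK.le) (hsb'.weights hW hb) X Y
        (a := .var vi) (b := .sub (.get s (.var vj)) (.lit 1)) (ρ := ρ') (x := ρ' vi) (y := r)
        trivial rfl hi ⟨ss, trivial⟩ (by rw [Exp.eval, es]; rfl) hr
      refine ⟨⟨ss, fun _ => ⟨⟨ps, ha, by rw [pv]; exact hC.pairIx_lt hXY hi hr⟩, fun _ => sd,
        fun _ => trivial⟩, fun _ => trivial⟩, ?_⟩
      have eg : (Exp.get a (pairE X Y (.var vi) (.sub (.get s (.var vj)) (.lit 1))) :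
          Exp J U).eval C ρ' μ'.arr = flag (A (ρ' vi) r) := by
        rw [Exp.eval, pv, hsb'.2 a hab, hA _ hi _ hr]
      rw [Exp.eval, if_neg (by omega), Exp.eval, eg, ed]
      by_cases hAr : A (ρ' vi) r
      · simp [hAr, flag]
      · simp [hAr, flag, Exp.eval]
  · rintro ρ' hρ' ⟨r, -, -, hne⟩ μ' hsb'
    obtain ⟨hi, hj⟩ := hbox ρ' hρ'
    have hlt : μ.arr d (ρ' vj) - 1 < C.N := by have := hdN _ hj; omega
    obtain ⟨ps, pv⟩ := pairE_ok (U := U) hC (hb.trans hbK.le) (hsb'.weights hW hb) X Y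
      (a := .var vi) (b := .sub (.get d (.var vj)) (.lit 1)) (ρ := ρ') (x := ρ' vi)
      (y := μ.arr d (ρ' vj) - 1)
      trivial rfl hi ⟨⟨trivial, hd, by simp only [Exp.eval]; omega⟩, trivial⟩
      (by simp only [Exp.eval]; rw [hsb'.2 d hdb]) hlt
    exact ⟨ps, pv, hC.pairIx_lt hXY hi hlt⟩
  · rintro μ' ⟨hs', hk⟩
    refine ⟨hs', fun x hx c hc => ?_⟩
    rw [hk]
    refine flag_congr ⟨?_, ?_⟩
    · rintro ⟨ρ', hρ', ⟨r, h1, h2, h3⟩, h4⟩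
      obtain ⟨hi, hj⟩ := hbox ρ' hρ'
      have hlt : μ.arr d (ρ' vj) - 1 < C.N := by have := hdN _ hj; omega
      obtain ⟨rfl, rfl⟩ := (pairIx_inj hXY hi hlt hx hc).1 h4
      exact ⟨_, hj, r, h1, h2, by omega⟩
    · rintro ⟨e, he, r, h1, h2, h3⟩
      have e1 : Function.update (Function.update (fun _ : J ⊕ ℕ => 0) vi x) vj e vi = x := by
        simp [Function.update_of_ne]
      have e2 : Function.update (Function.update (fun _ : J ⊕ ℕ => 0) vi x) vj e vj = e := by simp
      refine ⟨Function.update (Function.update (fun _ => 0) vi x) vj e, (mem_box (by simp)).2 ⟨?_, ?_⟩,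
        ⟨r, by rw [e2]; exact h1, by rw [e1]; exact h2, by rw [e2, h3]; omega⟩, ?_⟩
      · intro v hv
        simp only [List.mem_cons, List.not_mem_nil, or_false] at hv
        rcases hv with rfl | rfl
        · rw [e1]; exact hx
        · rw [e2]; exact he
      · intro v hv
        simp only [List.mem_cons, List.not_mem_nil, or_false, not_or] at hv
        rw [Function.update_of_ne hv.2, Function.update_of_ne hv.1]
      · rw [e1, e2, h3]; rfl

theorem cost_composeOp {N : ℕ} (hN : 1 ≤ N) (hp : 2 ≤ Fintype.card J) (X Y : J) (s d a b : ℕ) :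
    (composeOp X Y s d a b : HCmd J U).cost N ≤ N ^ Fintype.card J * 100 := by
  have h3 : N ^ 2 ≤ N ^ Fintype.card J := Nat.pow_le_pow_right hN hp
  refine (HCmd.cost_forAll hN _).trans ?_
  simp only [pairE, HCmd.cost, Exp.cost, List.length_cons, List.length_nil]
  exact Nat.mul_le_mul h3 (by norm_num)

/-- The pairs of elements and representatives of classes of edges after `i` hops. -/
def hopRel (ν : Numbering I) (N : ℕ) (w : WalkSpec J) (K : ℕ → Prop) : ℕ → ℕ → ℕ → Prop
  | 0, x, c => lastHit (w.start ν K x) N = c + 1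
  | i + 1, x, c => composeRel N (fun e => lastHit (fun k => K e ∧ K k ∧ veq ν w.s e w.s k) N)
      (fun e => lastHit (w.next ν K e) N) (hopRel ν N w K i) x c

/-- A node from which edges in `K` leave is represented by the greatest of these edges. `hopRel i x
c` says that such a node with representative `c` is reached from `x` in `i` hops; an edge can be the
next one exactly if its own representative is `c`. Nodes without outgoing edges drop out, as they
cannot be continued. -/
theorem hopRel_iff {N : ℕ} {w : WalkSpec J} {K : ℕ → Prop} (hN : ∀ k, K k → k < N) (i x e : ℕ) :
    (∃ r, lastHit (fun k => K e ∧ K k ∧ veq ν w.s e w.s k) N = r + 1 ∧ hopRel ν N w K i x r) ↔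
      ∃ k, w.start ν K x k ∧ Hops (w.next ν K) i k e := by
  -- Two classes that have the same greatest edge coincide, because this edge belongs to both.
  -- Equality of representatives thus says that `e` leaves the node `f(a)`.
  have key : ∀ (f : Mor J) (a e : ℕ), (∃ r, lastHit (fun k => K e ∧ K k ∧ veq ν w.s e w.s k) N = r + 1 ∧
      lastHit (fun k => K k ∧ veq ν f a w.s k) N = r + 1) ↔ K e ∧ veq ν f a w.s e := by
    intro f a e
    constructor
    · rintro ⟨r, h1, h2⟩
      obtain ⟨-, ⟨h3, -, h4⟩, -⟩ := lastHit_succ_iff.1 h1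
      exact ⟨h3, (lastHit_succ_iff.1 h2).2.1.2.trans h4.symm⟩
    · rintro ⟨h1, h2⟩
      rw [lastHit_congr (R' := fun k => K k ∧ veq ν f a w.s k) fun k =>
        ⟨fun h => ⟨h.2.1, h2.trans h.2.2⟩, fun h => ⟨h1, h.1, h2.symm.trans h.2⟩⟩]
      rcases h : lastHit (fun k => K k ∧ veq ν f a w.s k) N with _ | r
      · exact absurd ⟨h1, h2⟩ (lastHit_eq_zero_iff.1 h e (hN e h1))
      · exact ⟨r, rfl, rfl⟩
  induction i generalizing e with
  | zero =>
    refine (key (ident w.X) x e).trans ⟨fun h => ⟨e, h, rfl⟩, ?_⟩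
    rintro ⟨k, h, rfl⟩
    exact h
  | succ i ih =>
    constructor
    · rintro ⟨r, h1, e', -, r', h2, h3, h4⟩
      obtain ⟨k, h5, h6⟩ := (ih e').1 ⟨r', h2, h3⟩
      exact ⟨k, h5, e', h6, (key w.t e' e).1 ⟨r, h1, h4⟩⟩
    · rintro ⟨k, h5, e', h6, h7⟩
      obtain ⟨r, h1, h4⟩ := (key w.t e' e).2 h7
      obtain ⟨r', h2, h3⟩ := (ih e').2 ⟨k, h5, h6⟩
      exact ⟨r, h1, e', hN e' (lastHit_succ_iff.1 h2).2.1.1, r', h2, h3, h4⟩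

/-- The iteration of `composeOp`. -/
def hopsC (X Y : J) (s d a : ℕ) : ℕ → HCmd J U
  | 0 => .skip
  | n + 1 => .seq (hopsC X Y s d a n) (composeOp X Y s d (a + n) (a + n + 1))

theorem wp_hopsC (hC : Fits C ν) {w : WalkSpec J} {K : ℕ → Prop} {s d a : ℕ}
    (ha : tableBase J ≤ a) (hs : s < a) (hd : d < a) {μ : Mem} (hW : Weights C μ)
    (hA : PairTable C w.X w.Y (μ.arr a) (hopRel ν C.N w K 0))
    (es : ∀ e < C.N, μ.arr s e = lastHit (fun k => K e ∧ K k ∧ veq ν w.s e w.s k) C.N)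
    (ed : ∀ e < C.N, μ.arr d e = lastHit (w.next ν K e) C.N) (n : ℕ) (hK : a + n < C.K)
    (h0 : Fresh (a + 1) (a + n + 1) μ) :
    (hopsC w.X w.Y s d a n).WP C (fun _ => 0) μ fun μ' => Frame (a + 1) (a + n + 1) μ μ' ∧
      PairTable C w.X w.Y (μ'.arr (a + n)) (hopRel ν C.N w K n) := by
  induction n with
  | zero => exact HCmd.wp_skip ⟨.refl _ _ _, hA⟩
  | succ n ih =>
    refine HCmd.wp_seq ((ih (by omega) (h0.mono le_rfl (by omega))).mono ?_)
    rintro μ1 ⟨f1, h1⟩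
    refine (wp_composeOp hC w.hXY (by omega) (by omega) (by omega) (by omega) (by omega) (by omega)
      (by omega) (by omega) (f1.weights hW (by omega)) (by
        rw [f1.2 _ (by omega)]; exact h0 _ (by omega) (by omega)) h1 (fun e he => ?_)
        fun e he => ?_).mono ?_
    · rw [f1.2 _ (by omega), es e he]; exact lastHit_le
    · rw [f1.2 _ (by omega), ed e he]; exact lastHit_le
    · rintro μ2 ⟨s2, h2⟩
      refine ⟨(f1.mono le_rfl (by omega)).trans (s2.frame (by omega) (by omega)), fun x hx c hc => ?_⟩
      rw [← add_assoc, h2 x hx c hc]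
      refine flag_congr (exists_congr fun e => and_congr_right fun he => exists_congr fun r => ?_)
      rw [f1.2 _ (by omega), f1.2 _ (by omega), es e he, ed e he]

theorem cost_hopsC {N : ℕ} (hN : 1 ≤ N) (hp : 2 ≤ Fintype.card J) (X Y : J) (s d a n : ℕ) :
    (hopsC X Y s d a n : HCmd J U).cost N ≤ n * (N ^ Fintype.card J * 100) := by
  induction n with
  | zero => simp [hopsC, HCmd.cost]
  | succ n ih =>
    have := cost_composeOp (U := U) hN hp X Y s d (a + n) (a + n + 1)
    simp only [hopsC, HCmd.cost]
    rw [add_mul]; omega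

/-- Compute in the table `j` the pairs that are connected by `h + 1` hops in the table `jk`. -/
def hopOp (w : WalkSpec J) (h jk j : ℕ) : HCmd J U :=
  .seq (edgesOp (j + 1) jk w.s (ident w.X) (.lit 1)) (.seq (edgesOp (j + 2) jk w.s w.t (.lit 1))
    (.seq (edgesOp (j + 3) jk w.s w.s (memE jk w.E (.var vi))) (.seq (partner w.t w.Y (j + 4))
      (.seq (.scatter [vi] (j + 6) (.get (j + 1) (.var vi))
          (pairE w.X w.Y (.var vi) (.sub (.get (j + 1) (.var vi)) (.lit 1))))
        (.seq (hopsC w.X w.Y (j + 3) (j + 2) (j + 6) h)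
          (.seq (composeOp w.X w.Y (j + 3) (j + 4) (j + 6 + h) (j + 5))
            (fill j (.get (j + 5) (pairE w.X w.Y (dg w.X) (dg w.Y))))))))))

/-- After `h` compositions, `hopRel h` describes the nodes from which the last edge may leave. The
final composition makes hop number `h + 1` but uses the partners of edge targets in `Y` in place of
representatives, so its result consists of endpoints. -/
theorem wp_hopOp (hC : Fits C ν) (w : WalkSpec J) (h : ℕ) {jk j : ℕ} (hj : tableBase J ≤ j)
    (hK : j + (h + 7) ≤ C.K) (hjk : jk < C.K) (hne : jk < j ∨ j + (h + 7) ≤ jk) {μ : Mem}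
    (hW : Weights C μ) (h0 : Fresh j (j + (h + 7)) μ) {P : (J → ℕ) → Prop} (hT : Table C μ jk P)
    (hP : ∀ k, P (Pi.single w.E k) → k < C.N) :
    (hopOp w h jk j).WP C (fun _ => 0) μ fun μ' => Frame j (j + (h + 7)) μ μ' ∧ Table C μ' j fun d =>
      ∃ k k', w.start ν (fun k => P (Pi.single w.E k)) (d w.X) k ∧
        Hops (w.next ν fun k => P (Pi.single w.E k)) h k k' ∧ w.fin ν k' (d w.Y) := by
  have hNM := hC.le
  have hYN : Fintype.card (I.F.obj w.Y) ≤ C.N := hC.card_le w.Y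
  have lit1 : ∀ (ρ : J ⊕ ℕ → ℕ) (A : ℕ → ℕ → ℕ), (Exp.lit 1 : Exp J U).Safe C ρ A ∧
      ((Exp.lit 1 : Exp J U).eval C ρ A ≠ 0 ↔ True) := fun ρ A => ⟨trivial, by simp [Exp.eval]⟩
  refine HCmd.wp_seq ((wp_edgesOp hC (by omega) (by omega) hjk (by omega) hW
    (h0 _ (by omega) (by omega)) hT w.s (ident w.X) fun _ _ _ _ _ _ => lit1 _ _).mono ?_)
  rintro μ1 ⟨s1, e1⟩
  have f1 := s1.frame (lo := j) (hi := j + (h + 7)) (by omega) (by omega)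
  refine HCmd.wp_seq ((wp_edgesOp hC (by omega) (by omega) hjk (by omega) (f1.weights hW hj)
    (by rw [s1.2 _ (by omega)]; exact h0 _ (by omega) (by omega)) (f1.table hT hne) w.s w.t
    fun _ _ _ _ _ _ => lit1 _ _).mono ?_)
  rintro μ2 ⟨s2, e2⟩
  have f2 := f1.trans (s2.frame (lo := j) (hi := j + (h + 7)) (by omega) (by omega))
  refine HCmd.wp_seq ((wp_edgesOp hC (by omega) (by omega) hjk (by omega) (f2.weights hW hj)
    (by rw [s2.2 _ (by omega), s1.2 _ (by omega)]; exact h0 _ (by omega) (by omega))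
    (f2.table hT hne) w.s w.s (g := memE jk w.E (.var vi))
    (G := fun i _ => P (Pi.single w.E i)) fun i hi k _ μ' hs' => ?_).mono ?_)
  · have hvi : ∀ j, (Exp.var vi : Exp J U).eval C
        (Function.update (Function.update (fun _ => 0) vi i) vj j) μ'.arr = i := fun j => by
      simp [Exp.eval, Function.update_of_ne]
    have := memE_ok hC hjk (by omega) (hs'.weights (f2.weights hW hj) (by omega))
      (hs'.table (f2.table hT hne) (by omega)) w.E (e := .var vi)
      (ρ := Function.update (Function.update (fun _ => 0) vi i) vj k) trivial (by rwa [hvi])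
    rwa [hvi] at this
  rintro μ3 ⟨s3, e3⟩
  have f3 := f2.trans (s3.frame (lo := j) (hi := j + (h + 7)) (by omega) (by omega))
  refine HCmd.wp_seq ((wp_partner hC w.t w.Y (by omega) (by
    rw [s3.2 _ (by omega), s2.2 _ (by omega), s1.2 _ (by omega)]
    exact h0 _ (by omega) (by omega))).mono ?_)
  rintro μ4 ⟨s4, e4⟩
  have f4 := f3.trans (s4.frame (lo := j) (hi := j + (h + 7)) (by omega) (by omega))
  have a1 : ∀ x < C.N, μ4.arr (j + 1) x =
      lastHit (w.start ν (fun k => P (Pi.single w.E k)) x) C.N := fun x hx => by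
    rw [s4.2 _ (by omega), s3.2 _ (by omega), s2.2 _ (by omega), e1 x hx]
    exact lastHit_congr fun k => Iff.of_eq (true_and _)
  have a2 : ∀ e < C.N, μ4.arr (j + 2) e =
      lastHit (w.next ν (fun k => P (Pi.single w.E k)) e) C.N := fun e he => by
    rw [s4.2 _ (by omega), s3.2 _ (by omega), e2 e he]
    exact lastHit_congr fun k => Iff.of_eq (true_and _)
  have a3 : ∀ e < C.N, μ4.arr (j + 3) e = lastHit (fun k => P (Pi.single w.E e) ∧
      P (Pi.single w.E k) ∧ veq ν w.s e w.s k) C.N := fun e he => by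
    rw [s4.2 _ (by omega), e3 e he]; rfl
  have fr : ∀ b, (b = j ∨ j + 5 ≤ b) → b < j + (h + 7) → ∀ k, μ4.arr b k = 0 := fun b hb hb' => by
    rw [s4.2 _ (by omega), s3.2 _ (by omega), s2.2 _ (by omega), s1.2 _ (by omega)]
    exact h0 _ (by omega) hb'
  have hbox : ∀ ρ' : J ⊕ ℕ → ℕ, ρ' ∈ box C.N [vi] (fun _ => 0) → ρ' vi < C.N :=
    fun ρ' h => ((mem_box (by simp)).1 h).1 _ (by simp)
  have hlt : ∀ x < C.N, ∀ r, μ4.arr (j + 1) x = r + 1 → r < C.N := fun x hx r hr => by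
    rw [a1 x hx] at hr
    exact (lastHit_succ_iff.1 hr).1
  refine HCmd.wp_seq ((HCmd.wp_scatter (P := fun ρ' => μ4.arr (j + 1) (ρ' vi) ≠ 0)
    (ix := fun ρ' => pairIx C.N w.X w.Y (ρ' vi) (μ4.arr (j + 1) (ρ' vi) - 1)) (by simp)
    (fun _ _ => rfl) (by omega) (fr _ (by omega) (by omega)) ?_ ?_).mono ?_)
  · intro ρ' hρ' μ' hs
    have := hbox ρ' hρ'
    refine ⟨⟨trivial, by omega, by simp only [Exp.eval]; omega⟩, ?_⟩
    simp only [Exp.eval]; rw [hs.2 _ (by omega)]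
  · intro ρ' hρ' hne' μ' hs
    have hi := hbox ρ' hρ'
    have hr := hlt _ hi (μ4.arr (j + 1) (ρ' vi) - 1) (by omega)
    obtain ⟨ps, pv⟩ := pairE_ok (U := U) hC (by omega) (hs.weights (f4.weights hW hj) (by omega))
      w.X w.Y (a := .var vi) (b := .sub (.get (j + 1) (.var vi)) (.lit 1)) (ρ := ρ') (x := ρ' vi)
      (y := μ4.arr (j + 1) (ρ' vi) - 1)
      trivial rfl hi ⟨⟨trivial, by omega, by simp only [Exp.eval]; omega⟩, trivial⟩
      (by simp only [Exp.eval]; rw [hs.2 _ (by omega)]) hr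
    exact ⟨ps, pv, hC.pairIx_lt w.hXY hi hr⟩
  rintro μ5 ⟨s5, k5⟩
  have f5 := f4.trans (s5.frame (lo := j) (hi := j + (h + 7)) (by omega) (by omega))
  have t5 : PairTable C w.X w.Y (μ5.arr (j + 6))
      (hopRel ν C.N w (fun k => P (Pi.single w.E k)) 0) := fun x hx c hc => by
    rw [k5]
    refine flag_congr ?_
    rw [hopRel, ← a1 x hx]
    constructor
    · rintro ⟨ρ', hρ', h1, h2⟩
      have hi := hbox ρ' hρ'
      have hr := hlt _ hi (μ4.arr (j + 1) (ρ' vi) - 1) (by omega)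
      obtain ⟨rfl, rfl⟩ := (pairIx_inj w.hXY hi hr hx hc).1 h2
      omega
    · intro h1
      have e1 : Function.update (fun _ : J ⊕ ℕ => 0) vi x vi = x := by simp
      refine ⟨Function.update (fun _ => 0) vi x, (mem_box (by simp)).2 ⟨?_, ?_⟩, ?_, ?_⟩
      · intro v hv
        simp only [List.mem_cons, List.not_mem_nil, or_false] at hv
        rw [hv, e1]; exact hx
      · intro v hv
        simp only [List.mem_cons, List.not_mem_nil, or_false] at hv
        rw [Function.update_of_ne hv]
      · rw [e1, h1]; omega
      · rw [e1, h1]; rfl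
  refine HCmd.wp_seq ((wp_hopsC (K := fun k => P (Pi.single w.E k)) hC (by omega) (by omega)
    (by omega) (f5.weights hW hj) t5 (fun e he => ?_) (fun e he => ?_) h (by omega)
    fun b hb hb' => ?_).mono ?_)
  · rw [s5.2 _ (by omega), a3 e he]
  · rw [s5.2 _ (by omega), a2 e he]
  · rw [s5.2 _ (by omega)]; exact fr b (by omega) (by omega)
  rintro μ6 ⟨g6, t6⟩
  have f6 := f5.trans (g6.mono (lo' := j) (hi' := j + (h + 7)) (by omega) (by omega))
  have c3 : ∀ e < C.N, μ6.arr (j + 3) e = lastHit (fun k => P (Pi.single w.E e) ∧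
      P (Pi.single w.E k) ∧ veq ν w.s e w.s k) C.N := fun e he => by
    rw [g6.2 _ (by omega), s5.2 _ (by omega), a3 e he]
  have c4 : ∀ e < C.N, ∀ y, μ6.arr (j + 4) e = y + 1 ↔ w.fin ν e y := fun e he y => by
    rw [g6.2 _ (by omega), s5.2 _ (by omega), e4 e he y]; rfl
  refine HCmd.wp_seq ((wp_composeOp hC w.hXY (by omega) (by omega) (by omega) (by omega) (by omega)
    (by omega) (by omega) (by omega) (f6.weights hW hj) (by
      rw [g6.2 _ (by omega), s5.2 _ (by omega)]; exact fr _ (by omega) (by omega)) t6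
      (fun e he => by rw [c3 e he]; exact lastHit_le) fun e he => ?_).mono ?_)
  · rcases h4 : μ6.arr (j + 4) e with _ | y
    · omega
    · have := ((c4 e he y).1 h4).lt_right
      simp only at this
      omega
  rintro μ7 ⟨s7, t7⟩
  have f7 := f6.trans (s7.frame (lo := j) (hi := j + (h + 7)) (by omega) (by omega))
  refine (wp_fill (P := fun d => composeRel C.N (μ6.arr (j + 3)) (μ6.arr (j + 4))
    (hopRel ν C.N w (fun k => P (Pi.single w.E k)) h) (d w.X) (d w.Y)) hC
    (by omega) hj (f7.weights hW hj) (by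
      rw [s7.2 _ (by omega), g6.2 _ (by omega), s5.2 _ (by omega)]
      exact fr j (Or.inl rfl) (by omega)) fun d hd μ' hs hW' => ?_).mono ?_
  · obtain ⟨s, v⟩ := pairE_ok (U := U) hC (by omega) hW' w.X w.Y (a := dg w.X) (b := dg w.Y)
      (ρ := env d) (x := d w.X) (y := d w.Y) trivial rfl (hd _) trivial rfl (hd _)
    refine ⟨⟨s, by omega, by rw [v]; exact hC.pairIx_lt w.hXY (hd _) (hd _)⟩, ?_⟩
    rw [Exp.eval, v, hs.2 _ (by omega), t7 _ (hd _) _ (hd _)]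
    simp
  · rintro μ8 ⟨s8, t8⟩
    refine ⟨f7.trans (s8.frame le_rfl (by omega)), t8.congr fun d _ => ?_⟩
    constructor
    · rintro ⟨e, he, r, h1, h2, h3⟩
      rw [c3 e he] at h1
      obtain ⟨k, h4, h5⟩ := (hopRel_iff hP h _ e).1 ⟨r, h1, h2⟩
      exact ⟨k, e, h4, h5, (c4 e he _).1 h3⟩
    · rintro ⟨k, e, h4, h5, h6⟩
      obtain ⟨r, h1, h2⟩ := (hopRel_iff hP h _ e).2 ⟨k, h4, h5⟩
      have he : e < C.N := hP e (lastHit_succ_iff.1 h1).2.1.1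
      exact ⟨e, he, r, by rw [c3 e he]; exact h1, h2, (c4 e he _).2 h6⟩

/-- Each of the `h + 1` compositions is a quadratic pass, within `N ^ p` since `p ≥ 2`; the
remaining operations do not depend on `h`. -/
theorem cost_hopOp {N : ℕ} (hN : 1 ≤ N) (w : WalkSpec J) (h jk j : ℕ) :
    (hopOp w h jk j : HCmd J U).cost N ≤
      N ^ Fintype.card J * (400 * ((h + 1) * Fintype.card J)) := by
  have hp : 2 ≤ Fintype.card J := Fintype.one_lt_card_iff.2 ⟨_, _, w.hXY⟩
  have h1 := cost_edgesOp (U := U) hN hp (j + 1) jk w.s (ident w.X) (g := .lit 1) (by simp [Exp.cost])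
  have h2 := cost_edgesOp (U := U) hN hp (j + 2) jk w.s w.t (g := .lit 1) (by simp [Exp.cost])
  have h3 := cost_edgesOp (U := U) hN hp (j + 3) jk w.s w.s (g := memE jk w.E (.var vi))
    (by simp [memE, Exp.cost])
  have h4 := cost_partner (U := U) hN w.t w.Y (j + 4)
  have h5 := cost_fill (U := U) hN j (.get (j + 5) (pairE w.X w.Y (dg w.X) (dg w.Y)) : Exp J U)
  have h6 : (HCmd.scatter [vi] (j + 6) (.get (j + 1) (.var vi)) (pairE w.X w.Y (.var vi)
      (.sub (.get (j + 1) (.var vi)) (.lit 1))) : HCmd J U).cost N ≤ N ^ Fintype.card J * 50 := by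
    have h3 : N ^ 1 ≤ N ^ Fintype.card J := Nat.pow_le_pow_right hN (by omega)
    refine (HCmd.cost_forAll hN _).trans ?_
    simp only [pairE, HCmd.cost, Exp.cost, List.length_cons, List.length_nil]
    exact Nat.mul_le_mul h3 (by norm_num)
  have h7 := cost_hopsC (U := U) hN hp w.X w.Y (j + 3) (j + 2) (j + 6) h
  have h8 := cost_composeOp (U := U) hN hp w.X w.Y (j + 3) (j + 4) (j + 6 + h) (j + 5)
  have e : (hopOp w h jk j : HCmd J U).cost N = _ + (_ + (_ + (_ + (_ + (_ + (_ + _)))))) := rfl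
  rw [e]
  have c5 : (Exp.get (j + 5) (pairE w.X w.Y (dg w.X) (dg w.Y)) : Exp J U).cost = 15 := rfl
  rw [c5] at h5
  have h7' := h7.trans (le_of_eq (show h * (N ^ Fintype.card J * 100) =
    N ^ Fintype.card J * (100 * h) by ring))
  have hh : 2 * h ≤ h * Fintype.card J := by nlinarith
  have h9 : N ^ Fintype.card J * (520 + 100 * h + (24 + 12 * Fintype.card J)) ≤
      N ^ Fintype.card J * (400 * ((h + 1) * Fintype.card J)) :=
    Nat.mul_le_mul_left _ (by rw [add_mul]; omega)
  refine le_trans ?_ h9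
  rw [mul_add, mul_add]
  have h10 : N ^ Fintype.card J * (15 + 12 * Fintype.card J + 9) =
    N ^ Fintype.card J * (24 + 12 * Fintype.card J) := by congr 1; omega
  omega

end HopOp

end CatQuery
end
set_option linter.unusedSectionVars false
noncomputable section
namespace CatQuery

/-! ### Evaluation of the core language in tables -/

section Evaluation

variable {J U : Type} [SmallCategory J] [DecidableEq J] [Fintype J] [DataDomain U]
  {I : Instance J U} {ν : Numbering I} {C : Ctx J U}

/-- The number of arrays used for the evaluation. -/
def Core.arrays : Core J U → ℕ
  | atoms _ => 1
  | not e => 1 + e.arrays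
  | and e e' => 1 + e.arrays + e'.arrays
  | image _ _ _ e => (Fintype.card J + 2) + e.arrays
  | divide _ _ e e' => 2 + (Fintype.card J + 2) + (Fintype.card J + 2) + e.arrays + e'.arrays
  | reach _ K => 9 + K.arrays
  | hop _ h K => (h + 7) + K.arrays

/-- Compute the table `j` of a predicate; the arrays from `j` on are used. -/
def Core.comp : Core J U → ℕ → HCmd J U
  | atoms l, j => fill j (allE l atomE (.lit 1))
  | not e, j => .seq (e.comp (j + 1)) (fill j (notE (tabE (j + 1))))
  | and e e', j => .seq (e.comp (j + 1)) (.seq (e'.comp (j + 1 + e.arrays))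
      (fill j (.ite (tabE (j + 1)) (tabE (j + 1 + e.arrays)) (.lit 0))))
  | image A B lk e, j => .seq (e.comp (j + (Fintype.card J + 2)))
      (imageOp A B lk (j + (Fintype.card J + 2)) j)
  | divide A B e e', j =>
      let a := j + 2 + (Fintype.card J + 2) + (Fintype.card J + 2)
      .seq (e.comp a) (.seq (e'.comp (a + e.arrays))
        (.seq (fill (j + 1) (.ite (tabE (a + e.arrays)) (notE (tabE a)) (.lit 0)))
          (.seq (imageOp A B ident a (j + 2))
            (.seq (imageOp A B ident (j + 1) (j + 2 + (Fintype.card J + 2)))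
              (fill j (.ite (tabE (j + 2)) (notE (tabE (j + 2 + (Fintype.card J + 2)))) (.lit 0)))))))
  | reach w K, j => .seq (K.comp (j + 9)) (reachOp w (j + 9) j)
  | hop w h K, j => .seq (K.comp (j + (h + 7))) (hopOp w h (j + (h + 7)) j)

theorem Core.arrays_pos (e : Core J U) : 0 < e.arrays := by cases e <;> simp only [arrays] <;> omega

/-- The walk operators require that edges have numbers below `N`, whereas a core predicate may also
hold at other numbers. Such numbers never start or continue a walk, as `veq` fails for them, so the
predicate may be cut down to bounded assignments. -/
theorem WalkSpec.start_and {w : WalkSpec J} {K B : ℕ → Prop}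
    (h : ∀ k < Fintype.card (I.F.obj w.E), B k) :
    w.start ν (fun k => K k ∧ B k) = w.start ν K := by
  funext x k
  exact propext ⟨fun h' => ⟨h'.1.1, h'.2⟩, fun h' => ⟨⟨h'.1, h _ h'.2.lt_right⟩, h'.2⟩⟩

theorem WalkSpec.next_and {w : WalkSpec J} {K B : ℕ → Prop}
    (h : ∀ k < Fintype.card (I.F.obj w.E), B k) :
    w.next ν (fun k => K k ∧ B k) = w.next ν K := by
  funext x k
  exact propext ⟨fun h' => ⟨h'.1.1, h'.2⟩, fun h' => ⟨⟨h'.1, h _ h'.2.lt_right⟩, h'.2⟩⟩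

/-- Arrays are allocated upwards: the result is in `j`, everything auxiliary is above it, and
nothing outside of the allotted interval changes. No array is used twice, since scattering only
writes marks and relies on entries being `0`. -/
theorem Core.wp_comp (hC : Fits C ν) (e : Core J U) (j : ℕ) (hj : tableBase J ≤ j)
    (hK : j + e.arrays ≤ C.K) {μ : Mem} (hW : Weights C μ) (h0 : Fresh j (j + e.arrays) μ) :
    (e.comp j).WP C (fun _ => 0) μ fun μ' =>
      Frame j (j + e.arrays) μ μ' ∧ Table C μ' j (e.Sem ν) := by
  have bounded : ∀ (P : (J → ℕ) → Prop) {μ : Mem} {a : ℕ}, Table C μ a P →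
      Table C μ a fun d => P d ∧ ∀ X, d X < C.N := fun P μ a h =>
    h.congr fun d hd => (and_iff_left hd).symm
  have edges : ∀ (w : WalkSpec J), ∀ k < Fintype.card (I.F.obj w.E),
      ∀ X, (Pi.single w.E k : J → ℕ) X < C.N := fun w k hk =>
    single_lt (hk.trans_le (hC.card_le _))
  have edge_lt : ∀ (w : WalkSpec J) (P : (J → ℕ) → Prop) (k : ℕ),
      (P (Pi.single w.E k) ∧ ∀ X, (Pi.single w.E k : J → ℕ) X < C.N) → k < C.N :=
    fun w P k h => by simpa using h.2 w.E
  induction e generalizing j μ with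
  | atoms l =>
    simp only [arrays] at *
    refine (wp_atoms hC (by omega) hj hW (h0 j le_rfl (by omega)) l).mono ?_
    rintro μ1 ⟨s1, t1⟩
    exact ⟨s1.frame le_rfl (by omega), t1⟩
  | not e ih =>
    simp only [arrays] at *
    have hz := e.arrays_pos
    refine HCmd.wp_seq ((ih (j + 1) (by omega) (by omega) hW (h0.mono (by omega) (by omega))).mono ?_)
    rintro μ1 ⟨f1, t1⟩
    refine (wp_not hC (by omega) hj (f1.weights hW (by omega)) (by
      rw [f1.2 _ (by omega)]; exact h0 j le_rfl (by omega)) (by omega) (by omega) t1).mono ?_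
    rintro μ2 ⟨s2, t2⟩
    exact ⟨(f1.mono (by omega) (by omega)).trans (s2.frame (by omega) (by omega)), t2⟩
  | and e e' ih ih' =>
    simp only [arrays] at *
    have hz := e.arrays_pos
    have hz' := e'.arrays_pos
    refine HCmd.wp_seq ((ih (j + 1) (by omega) (by omega) hW (h0.mono (by omega) (by omega))).mono ?_)
    rintro μ1 ⟨f1, t1⟩
    refine HCmd.wp_seq ((ih' (j + 1 + e.arrays) (by omega) (by omega) (f1.weights hW (by omega))
      ((h0.mono (by omega) (by omega)).frame f1 (Or.inr le_rfl))).mono ?_)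
    rintro μ2 ⟨f2, t2⟩
    refine (wp_and hC (by omega) hj (f2.weights (f1.weights hW (by omega)) (by omega)) (by
      rw [f2.2 _ (by omega), f1.2 _ (by omega)]; exact h0 j le_rfl (by omega)) (b := j + 1)
      (by omega) (by omega) (b' := j + 1 + e.arrays) (by omega) (by omega)
      (f2.table t1 (by omega)) t2).mono ?_
    rintro μ3 ⟨s3, t3⟩
    exact ⟨((f1.mono (by omega) (by omega)).trans (f2.mono (by omega) (by omega))).trans
      (s3.frame (by omega) (by omega)), t3⟩
  | image A B lk e ih =>
    simp only [arrays] at *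
    have hz := e.arrays_pos
    refine HCmd.wp_seq ((ih (j + (Fintype.card J + 2)) (by omega) (by omega) hW
      (h0.mono (by omega) (by omega))).mono ?_)
    rintro μ1 ⟨f1, t1⟩
    refine (wp_imageOp hC A B lk hj (by omega) (by omega) (Or.inr le_rfl)
      (f1.weights hW (by omega)) ((h0.mono le_rfl (by omega)).frame f1 (Or.inl le_rfl)) t1).mono ?_
    rintro μ2 ⟨f2, t2⟩
    exact ⟨(f1.mono (by omega) (by omega)).trans (f2.mono (by omega) (by omega)), t2⟩
  | divide A B e e' ih ih' =>
    simp only [arrays, comp] at *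
    have hz := e.arrays_pos
    have hz' := e'.arrays_pos
    obtain ⟨p, hp⟩ : ∃ p, p = Fintype.card J + 2 := ⟨_, rfl⟩
    rw [← hp] at hK h0 ⊢
    -- The table of `e` is computed once and then read twice, for the image and for the difference.
    -- This sharing is the reason why `divide` is a primitive: written with the other operators it
    -- would contain `e` twice, and nesting would double the cost at each level.
    refine HCmd.wp_seq ((ih (j + 2 + p + p) (by omega) (by omega) hW
      (h0.mono (by omega) (by omega))).mono ?_)
    rintro μ1 ⟨f1, t1⟩
    have g1 := f1.mono (lo' := j) (hi' := j + (2 + p + p + e.arrays + e'.arrays)) (by omega) (by omega)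
    refine HCmd.wp_seq ((ih' (j + 2 + p + p + e.arrays) (by omega) (by omega) (g1.weights hW hj)
      ((h0.mono (by omega) (by omega)).frame f1 (by omega))).mono ?_)
    rintro μ2 ⟨f2, t2⟩
    have g2 := g1.trans (f2.mono (by omega) (by omega))
    have u2 := f2.table t1 (by omega)
    refine HCmd.wp_seq ((wp_andNot hC (a := j + 1) (b := j + 2 + p + p + e.arrays)
      (b' := j + 2 + p + p) (by omega) (by omega) (g2.weights hW hj) (by
        rw [f2.2 _ (by omega), f1.2 _ (by omega)]; exact h0 _ (by omega) (by omega))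
      (by omega) (by omega) (by omega) (by omega) t2 u2).mono ?_)
    rintro μ3 ⟨s3, t3⟩
    have f3 := s3.frame (lo := j) (hi := j + 2) (by omega) (by omega)
    have g3 := g2.trans (f3.mono (by omega) (by omega))
    have u3 := f3.table u2 (by omega)
    have fr : ∀ b, (b = j ∨ j + 2 ≤ b) → b < j + 2 + p + p → ∀ k, μ3.arr b k = 0 := fun b hb hb' k => by
      rw [s3.2 _ (by omega), f2.2 _ (by omega), f1.2 _ (by omega)]
      exact h0 _ (by omega) (by omega) k
    refine HCmd.wp_seq ((wp_imageOp hC A B ident (src := j + 2 + p + p) (j := j + 2) (by omega)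
      (by omega) (by omega) (by omega) (g3.weights hW hj)
      (fun b hb hb' => fr b (by omega) (by omega)) u3).mono ?_)
    rintro μ4 ⟨f4, t4⟩
    rw [← hp] at f4
    have g4 := g3.trans (f4.mono (by omega) (by omega))
    refine HCmd.wp_seq ((wp_imageOp hC A B ident (src := j + 1) (j := j + 2 + p) (by omega)
      (by omega) (by omega) (by omega) (g4.weights hW hj)
      (fun b hb hb' k => by rw [f4.2 _ (by omega)]; exact fr b (by omega) (by omega) k)
      (f4.table t3 (by omega))).mono ?_)
    rintro μ5 ⟨f5, t5⟩
    rw [← hp] at f5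
    have g5 := g4.trans (f5.mono (by omega) (by omega))
    refine (wp_andNot hC (a := j) (b := j + 2) (b' := j + 2 + p) (by omega) hj (g5.weights hW hj)
      (fun k => by rw [f5.2 _ (by omega), f4.2 _ (by omega)]; exact fr j (by omega) (by omega) k)
      (by omega) (by omega) (by omega) (by omega) (f5.table t4 (by omega)) t5).mono ?_
    rintro μ6 ⟨s6, t6⟩
    exact ⟨g5.trans (s6.frame (by omega) (by omega)), t6⟩
  | reach w K ih =>
    simp only [arrays] at *
    have hz := K.arrays_pos
    refine HCmd.wp_seq ((ih (j + 9) (by omega) (by omega) hW (h0.mono (by omega) (by omega))).mono ?_)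
    rintro μ1 ⟨f1, t1⟩
    refine (wp_reachOp hC w hj (by omega) (by omega) (Or.inr le_rfl)
      (f1.weights hW (by omega)) ((h0.mono le_rfl (by omega)).frame f1 (Or.inl le_rfl))
      (bounded _ t1) (edge_lt w _)).mono ?_
    rintro μ2 ⟨f2, t2⟩
    refine ⟨(f1.mono (by omega) (by omega)).trans (f2.mono (by omega) (by omega)), ?_⟩
    rw [WalkSpec.start_and (edges w), WalkSpec.next_and (edges w)] at t2
    exact t2
  | hop w h K ih =>
    simp only [arrays] at *
    have hz := K.arrays_pos
    refine HCmd.wp_seq ((ih (j + (h + 7)) (by omega) (by omega) hW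
      (h0.mono (by omega) (by omega))).mono ?_)
    rintro μ1 ⟨f1, t1⟩
    refine (wp_hopOp hC w h hj (by omega) (by omega) (Or.inr le_rfl)
      (f1.weights hW (by omega)) ((h0.mono le_rfl (by omega)).frame f1 (Or.inl le_rfl))
      (bounded _ t1) (edge_lt w _)).mono ?_
    rintro μ2 ⟨f2, t2⟩
    refine ⟨(f1.mono (by omega) (by omega)).trans (f2.mono (by omega) (by omega)), ?_⟩
    rw [WalkSpec.start_and (edges w), WalkSpec.next_and (edges w)] at t2
    exact t2

/-- The number of arrays enters the running time, because the base addresses are computed one after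
the other during initialization. -/
theorem Core.arrays_le (hp : 0 < Fintype.card J) (e : Core J U) :
    e.arrays ≤ 9 * e.weight (Fintype.card J) := by
  induction e with
  | atoms l => simp only [arrays, weight]; omega
  | not e ih => simp only [arrays, weight]; omega
  | and e e' ih ih' => simp only [arrays, weight]; omega
  | image A B lk e ih => simp only [arrays, weight]; omega
  | divide A B e e' ih ih' => simp only [arrays, weight]; omega
  | reach w K ih => simp only [arrays, weight]; omega
  | hop w h K ih =>
    simp only [arrays, weight]
    have : (h + 1) * 1 ≤ (h + 1) * Fintype.card J := Nat.mul_le_mul_left _ hp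
    omega

theorem Core.cost_comp {N : ℕ} (hN : 1 ≤ N) (hp : 0 < Fintype.card J) (e : Core J U) (j : ℕ) :
    (e.comp j).cost N ≤ N ^ Fintype.card J * (1000 * e.weight (Fintype.card J)) := by
  have tab := fun a => cost_tabE (J := J) (U := U) a
  induction e generalizing j with
  | atoms l =>
    refine (cost_fill hN j _).trans (Nat.mul_le_mul_left _ ?_)
    have h1 := cost_allE (last := .lit 1) fun a (_ : a ∈ l) => cost_atomE (J := J) (U := U) a
    have h2 : (Exp.lit 1 : Exp J U).cost = 1 := rfl
    simp only [weight]
    omega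
  | not e ih =>
    have h1 := (cost_fill (J := J) (U := U) hN j (notE (tabE (j + 1)))).trans
      (Nat.mul_le_mul_left _ (m := 1000 * Fintype.card J) (by
        have := tab (j + 1); simp only [notE, Exp.cost]; omega))
    have h2 := ih (j + 1)
    simp only [weight, comp, HCmd.cost, mul_add] at *
    omega
  | and e e' ih ih' =>
    have h1 := (cost_fill (J := J) (U := U) hN j (.ite (tabE (j + 1)) (tabE (j + 1 + e.arrays)) (.lit 0))).trans
      (Nat.mul_le_mul_left _ (m := 1000 * Fintype.card J) (by
        have := tab (j + 1); have := tab (j + 1 + e.arrays); simp only [Exp.cost]; omega))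
    have h2 := ih (j + 1)
    have h3 := ih' (j + 1 + e.arrays)
    simp only [weight, comp, HCmd.cost, mul_add] at *
    omega
  | image A B lk e ih =>
    have h1 := (cost_imageOp (U := U) hN hp A B lk (j + (Fintype.card J + 2)) j).trans
      (Nat.mul_le_mul_left _ (m := 1000 * Fintype.card J) (by omega))
    have h2 := ih (j + (Fintype.card J + 2))
    simp only [weight, comp, HCmd.cost, mul_add] at *
    omega
  | divide A B e e' ih ih' =>
    set p := Fintype.card J with hpd
    have h1 := ih (j + 2 + (p + 2) + (p + 2))
    have h2 := ih' (j + 2 + (p + 2) + (p + 2) + e.arrays)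
    have h3 := (cost_fill (J := J) (U := U) hN (j + 1) (.ite (tabE (j + 2 + (p + 2) + (p + 2) + e.arrays))
      (notE (tabE (j + 2 + (p + 2) + (p + 2)))) (.lit 0))).trans
      (Nat.mul_le_mul_left _ (m := 70 * p) (by
        have := tab (j + 2 + (p + 2) + (p + 2) + e.arrays); have := tab (j + 2 + (p + 2) + (p + 2))
        simp only [Exp.cost, notE]; omega))
    have h4 := cost_imageOp (U := U) hN hp A B ident (j + 2 + (p + 2) + (p + 2)) (j + 2)
    have h5 := cost_imageOp (U := U) hN hp A B ident (j + 1) (j + 2 + (p + 2))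
    have h6 := (cost_fill (J := J) (U := U) hN j (.ite (tabE (j + 2))
      (notE (tabE (j + 2 + (p + 2)))) (.lit 0))).trans
      (Nat.mul_le_mul_left _ (m := 70 * p) (by
        have := tab (j + 2); have := tab (j + 2 + (p + 2))
        simp only [Exp.cost, notE]; omega))
    rw [← hpd] at h3 h4 h5 h6
    have e1 : N ^ p * (1000 * p) = N ^ p * (250 * p) + N ^ p * (250 * p) + N ^ p * (70 * p) +
      N ^ p * (70 * p) + N ^ p * (360 * p) := by ring
    simp only [weight, comp, HCmd.cost, mul_add, ← hpd] at *
    omega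
  | reach w K ih =>
    have h1 := (cost_reachOp (U := U) hN w (j + 9) j).trans
      (Nat.mul_le_mul_left _ (m := 1000 * Fintype.card J) (by omega))
    have h2 := ih (j + 9)
    simp only [weight, comp, HCmd.cost, mul_add] at *
    omega
  | hop w h K ih =>
    have h1 := (cost_hopOp (U := U) hN w h (j + (h + 7)) j).trans
      (Nat.mul_le_mul_left _ (m := 1000 * ((h + 1) * Fintype.card J)) (by omega))
    have h2 := ih (j + (h + 7))
    simp only [weight, comp, HCmd.cost] at *
    rw [mul_add 1000, mul_add (N ^ _)]
    omega

end Evaluation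

end CatQuery
end
set_option linter.unusedSectionVars false
noncomputable section
namespace CatQuery

/-! ### Output of tables -/

section Output

variable {J U : Type} [SmallCategory J] [DecidableEq J] [Fintype J] [DataDomain U]
  {I : Instance J U} {ν : Numbering I} {C : Ctx J U}

/-- Append a word to an output tape. -/
def Mem.emit (μ : Mem) (ch : ℕ) (w : List ℕ) : Mem :=
  ⟨μ.arr, Function.update μ.out ch (μ.out ch ++ w)⟩

theorem Mem.emit_emit (μ : Mem) (ch : ℕ) (w w' : List ℕ) :
    (μ.emit ch w).emit ch w' = μ.emit ch (w ++ w') := by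
  simp [emit]

theorem Mem.emit_nil (μ : Mem) (ch : ℕ) : μ.emit ch [] = μ := by simp [emit]

/-- Output the values of expressions. -/
def outList (ch : ℕ) (l : List (Exp J U)) : HCmd J U := l.foldr (fun e c => .seq (.out ch e) c) .skip

theorem wp_outList {ch : ℕ} {l : List (Exp J U)} {ρ : J ⊕ ℕ → ℕ} {μ : Mem}
    (h : ∀ e ∈ l, e.Safe C ρ μ.arr) :
    (outList ch l).WP C ρ μ fun μ' => μ' = μ.emit ch (l.map fun e => e.eval C ρ μ.arr) := by
  induction l generalizing μ with
  | nil => exact HCmd.wp_skip (Mem.emit_nil _ _).symm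
  | cons e l ih =>
    refine HCmd.wp_seq ⟨h e (by simp), ?_⟩
    refine (ih (μ := μ.emit ch [e.eval C ρ μ.arr]) fun e' he' => h e' (by simp [he'])).mono ?_
    rintro μ' rfl
    rw [Mem.emit_emit]; rfl

theorem cost_outList (N ch : ℕ) (l : List (Exp J U)) {c : ℕ} (h : ∀ e ∈ l, e.cost ≤ c) :
    (outList ch l).cost N ≤ l.length * (c + 1) := by
  induction l with
  | nil => simp [outList, HCmd.cost]
  | cons e l ih =>
    have h1 : (outList ch (e :: l)).cost N = e.cost + 1 + (outList ch l).cost N := rfl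
    have := ih fun e' he' => h e' (by simp [he'])
    have := h e (by simp)
    rw [h1, List.length_cons, add_mul]; omega

/-- The components in the order of codes. -/
def codeOrder (T : Finset J) : List J := T.attach.toList.map Subtype.val

theorem mem_codeOrder {T : Finset J} {X : J} : X ∈ codeOrder T ↔ X ∈ T := by simp [codeOrder]

theorem nodup_codeOrder (T : Finset J) : (codeOrder T).Nodup :=
  (Finset.nodup_toList _).map Subtype.val_injective

/-- List the tuples in the table `a`. -/
def listOp (T : Finset J) (a ch : ℕ) : HCmd J U :=
  .forAll (digitVars (codeOrder T)) (.ite (tabE a)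
    (outList ch (.lit T.card :: (codeOrder T).map dg)) .skip)

/-- The components are those of a tuple in `S`. -/
def Picked (ν : Numbering I) {T : Finset J} (S : Set (Tuple I T)) (ρ' : J ⊕ ℕ → ℕ) : Prop :=
  CodeIn ν S fun X => ρ' (.inl X)

-- The loops run only over the components in `T` and leave all other digits at `0`. An assignment in
-- the box is therefore determined by its components in `T`, so each tuple of `S` is met exactly
-- once, at `encode ν t`.
open Classical in
theorem isListing_box {T : Finset J} {S : Set (Tuple I T)} {N : ℕ}
    (hN : ∀ X, Fintype.card (I.F.obj X) ≤ N) :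
    IsListing ν S ((box N (digitVars (codeOrder T)) fun _ => 0).flatMap fun ρ' =>
      if Picked ν S ρ' then T.card :: (codeOrder T).map (fun X => ρ' (.inl X))
      else []) := by
  set B := box N (digitVars (codeOrder T)) fun _ => 0 with hB
  have hmem := fun ρ' => mem_box_digitVars (N := N) (nodup_codeOrder T) (ρ' := ρ')
  let F := B.filter fun ρ' => Picked ν S ρ'
  have hF : ∀ ρ' ∈ F, ρ' ∈ B ∧ Picked ν S ρ' := fun ρ' h => by
    simpa [F] using h
  refine ⟨F.pmap (fun ρ' (h : ρ' ∈ B ∧ Picked ν S ρ') => h.2.choose) hF, ?_, ?_, ?_⟩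
  · refine List.Nodup.pmap ?_ ((nodup_box (nodup_digitVars (nodup_codeOrder T))).filter _)
    rintro ρ1 h1 ρ2 h2 he
    obtain ⟨d1, rfl, -, z1⟩ := (hmem ρ1).1 h1.1
    obtain ⟨d2, rfl, -, z2⟩ := (hmem ρ2).1 h2.1
    congr 1
    funext X
    by_cases hX : X ∈ T
    · have e1 := h1.2.choose_spec.2 ⟨X, hX⟩
      have e2 := h2.2.choose_spec.2 ⟨X, hX⟩
      rw [he] at e1
      exact e1.symm.trans e2
    · rw [z1 X (by rwa [mem_codeOrder]), z2 X (by rwa [mem_codeOrder])]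
  · intro t
    rw [List.mem_pmap]
    constructor
    · rintro ⟨ρ', h, rfl⟩
      exact (hF ρ' h).2.choose_spec.1
    · intro ht
      have hc : CodeIn ν S (encode ν t) := ⟨t, ht, isCode_encode⟩
      have hm : env (encode ν t) ∈ B := (hmem _).2 ⟨_, rfl, fun X hX => by
          rw [mem_codeOrder] at hX
          exact (isCode_encode.validOn X hX).trans_le (hN X),
        fun X hX => encode_of_notMem (by rwa [mem_codeOrder] at hX)⟩
      refine ⟨env (encode ν t), List.mem_filter.2 ⟨hm, decide_eq_true (show Picked ν S (env (encode ν t)) from hc)⟩, ?_⟩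
      exact IsCode.unique (d := encode ν t) (Exists.choose_spec (p := fun t' => t' ∈ S ∧
        IsCode ν t' (encode ν t)) hc).2 isCode_encode
  · have h1 : ∀ (l : List (J ⊕ ℕ → ℕ)) (H : ∀ ρ' ∈ l, ρ' ∈ B ∧ Picked ν S ρ'),
        ((l.pmap (fun ρ' (h : ρ' ∈ B ∧ Picked ν S ρ') => h.2.choose) H).map
          fun t => T.card :: t.code ν) =
        l.map fun ρ' => T.card :: (codeOrder T).map fun X => ρ' (.inl X) := by
      intro l H
      induction l with
      | nil => rfl
      | cons ρ' l ih =>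
        simp only [List.pmap_cons, List.map_cons]
        rw [ih fun ρ h => H ρ (by simp [h])]
        congr 2
        rw [Tuple.code, codeOrder, List.map_map]
        exact List.map_congr_left fun X _ => (H ρ' (by simp)).2.choose_spec.2 X
    rw [h1, ← List.flatMap_def]
    simp only [F]
    clear_value B
    clear h1 hF hB F hmem
    induction B with
    | nil => rfl
    | cons ρ' B ih =>
      by_cases h : Picked ν S ρ'
      · simp [h, ih]
      · simp [h, ih]

theorem wp_listOp (hC : Fits C ν) {T : Finset J} {S : Set (Tuple I T)} {a : ℕ} (ch : ℕ)
    (ha : a < C.K) (hK : tableBase J ≤ C.K) {μ : Mem} (hW : Weights C μ)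
    (hT : Table C μ a (CodeIn ν S)) :
    (listOp T a ch).WP C (fun _ => 0) μ fun μ' => ∃ w, IsListing ν S w ∧ μ' = μ.emit ch w := by
  classical
  refine HCmd.wp_forAll (fun L μ' => μ' = μ.emit ch (L.flatMap fun ρ' =>
      if Picked ν S ρ' then T.card :: (codeOrder T).map (fun X => ρ' (.inl X))
      else [])) (nodup_digitVars (nodup_codeOrder T)) (fun _ _ => rfl) (by simp [Mem.emit_nil]) ?_
    fun μ' h => ⟨_, isListing_box hC.card_le, h⟩
  rintro L ρ' hρ' μ' rfl
  obtain ⟨d, rfl, hd1, hd2⟩ := (mem_box_digitVars (nodup_codeOrder T)).1 hρ'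
  have hd : ∀ X, d X < C.N := fun X => by
    by_cases hX : X ∈ codeOrder T
    · exact hd1 X hX
    · rw [hd2 X hX]; exact hC.one_le
  have hd' : Picked ν S (env d) = CodeIn ν S d := rfl
  obtain ⟨s, v⟩ := tabE_ok (μ := μ) hC hK hW ha hT hd
  refine HCmd.wp_ite s (fun hne => ?_) fun h0 => ?_
  · have hc : CodeIn ν S d := by
      by_contra hc
      exact hne (v.trans (flag_false hc))
    refine (wp_outList (fun e he => ?_)).mono ?_
    · rcases List.mem_cons.1 he with rfl | he
      · exact trivial
      · obtain ⟨X, -, rfl⟩ := List.mem_map.1 he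
        exact trivial
    · rintro μ' rfl
      rw [Mem.emit_emit, List.flatMap_append, List.flatMap_singleton, if_pos (hd' ▸ hc),
        List.map_cons, List.map_map]
      rfl
  · have hc : ¬ CodeIn ν S d := fun hc => by
      have := v.trans (flag_true hc)
      exact absurd (this.symm.trans h0) (by simp)
    refine HCmd.wp_skip ?_
    rw [List.flatMap_append, List.flatMap_singleton, if_neg (hd' ▸ hc), List.append_nil]

theorem cost_listOp {N : ℕ} (hN : 1 ≤ N) (hp : 0 < Fintype.card J) (T : Finset J) (a ch : ℕ) :
    (listOp T a ch : HCmd J U).cost N ≤ N ^ Fintype.card J * (30 * Fintype.card J) := by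
  have h1 : (codeOrder T).length ≤ Fintype.card J := (nodup_codeOrder T).length_le_card
  have h2 := cost_outList N ch (.lit T.card :: (codeOrder T).map dg : List (Exp J U)) (c := 1) (by
    intro e he
    rcases List.mem_cons.1 he with rfl | he
    · exact le_rfl
    · obtain ⟨X, -, rfl⟩ := List.mem_map.1 he
      exact le_rfl)
  have h3 := cost_tabE (J := J) (U := U) a
  simp only [List.length_cons, List.length_map] at h2
  refine (HCmd.cost_forAll hN _).trans (Nat.mul_le_mul (Nat.pow_le_pow_right hN ?_) ?_)
  · simpa [digitVars] using h1
  · simp only [digitVars, List.length_map, HCmd.cost]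
    omega

/-- A target of a query with a command that computes it. -/
structure Item (J U : Type) [SmallCategory J] extends Target J U where
  /-- The number of arrays that the command uses. -/
  arrays : ℕ
  /-- The command that computes a given table. -/
  code : ℕ → HCmd J U

/-- Compute and list the targets. -/
def listItems : List (Item J U) → ℕ → ℕ → HCmd J U
  | [], _, _ => .skip
  | it :: l, ch, j => .seq (it.code j) (.seq (listOp it.T j ch) (listItems l (ch + 1) (j + it.arrays)))

/-- `Base` is a property of the arrays below `j0` that all items may use. For a calculus query it
says that the table of the qualification is present; algebra expressions need nothing. -/
theorem wp_listItems (hC : Fits C ν) {Base : Mem → Prop} {j0 : ℕ} (hj0 : tableBase J ≤ j0)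
    (hB : ∀ μ μ' : Mem, Base μ → (∀ b < j0, μ'.arr b = μ.arr b) → Base μ') {l : List (Item J U)}
    (hl : ∀ it ∈ l, 0 < it.arrays ∧ ∀ j μ, j0 ≤ j → j + it.arrays ≤ C.K → Weights C μ → Base μ →
      Fresh j (j + it.arrays) μ → (it.code j).WP C (fun _ => 0) μ fun μ' =>
        Frame j (j + it.arrays) μ μ' ∧ Table C μ' j (CodeIn ν (it.answer I)))
    {ch j : ℕ} (hj : j0 ≤ j) (hK : j + (l.map Item.arrays).sum ≤ C.K) {μ : Mem}
    (hK' : tableBase J ≤ C.K) (hW : Weights C μ) (hμ : Base μ)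
    (h0 : Fresh j (j + (l.map Item.arrays).sum) μ) (ho : ∀ i, ch ≤ i → μ.out i = []) :
    (listItems l ch j).WP C (fun _ => 0) μ fun μ' => (∀ i < ch, μ'.out i = μ.out i) ∧
      ∀ (i : ℕ) (hi : i < l.length), IsListing ν (l[i].answer I) (μ'.out (ch + i)) := by
  induction l generalizing ch j μ with
  | nil => exact HCmd.wp_skip ⟨fun _ _ => rfl, by simp⟩
  | cons it l ih =>
    simp only [List.map_cons, List.sum_cons] at hK h0
    obtain ⟨hpos, hit⟩ := hl it (by simp)
    refine HCmd.wp_seq ((hit j μ hj (by omega) hW hμ (h0.mono le_rfl (by omega))).mono ?_)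
    rintro μ1 ⟨f1, t1⟩
    refine HCmd.wp_seq ((wp_listOp hC ch (by omega) hK' (f1.weights hW (by omega)) t1).mono ?_)
    rintro μ2 ⟨w, hw, rfl⟩
    refine (ih (μ := μ1.emit ch w) (fun it' h => hl it' (by simp [h])) (by omega) (by omega)
      (f1.weights hW (by omega)) (hB _ _ hμ fun b hb => f1.2 b (by omega))
      (fun b hb hb' k => by
        rw [show (μ1.emit ch w).arr b = μ1.arr b from rfl, f1.2 b (by omega)]
        exact h0 b (by omega) (by omega) k) fun i hi => ?_).mono ?_
    · simp only [Mem.emit]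
      rw [Function.update_of_ne (by omega), f1.1, ho i (by omega)]
    · rintro μ3 ⟨h3, h4⟩
      refine ⟨fun i hi => ?_, fun i hi => ?_⟩
      · rw [h3 i (by omega)]
        simp only [Mem.emit]
        rw [Function.update_of_ne (by omega), f1.1]
      · rcases i with _ | i
        · have : μ3.out ch = w := by
            rw [h3 ch (by omega)]
            simp [Mem.emit, f1.1, ho ch le_rfl]
          simpa [this] using hw
        · have := h4 i (by simpa using hi)
          rw [show ch + 1 + i = ch + (i + 1) by ring] at this
          simpa using this

theorem cost_listItems {N : ℕ} (hN : 1 ≤ N) (hp : 0 < Fintype.card J) (l : List (Item J U))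
    (ch j : ℕ) {B : Item J U → ℕ} (hB : ∀ it ∈ l, ∀ j, (it.code j).cost N ≤ N ^ Fintype.card J * B it) :
    (listItems l ch j).cost N ≤
      N ^ Fintype.card J * ((l.map B).sum + l.length * (30 * Fintype.card J)) := by
  induction l generalizing ch j with
  | nil => simp [listItems, HCmd.cost]
  | cons it l ih =>
    have h1 := ih (ch + 1) (j + it.arrays) fun it' h => hB it' (by simp [h])
    have h2 := hB it (by simp) j
    have h3 := cost_listOp (U := U) hN hp it.T j ch
    simp only [listItems, HCmd.cost, List.map_cons, List.sum_cons, List.length_cons]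
    calc _ ≤ _ := Nat.add_le_add h2 (Nat.add_le_add h3 h1)
      _ = _ := by ring

end Output

end CatQuery
end
set_option linter.unusedSectionVars false
noncomputable section
namespace CatQuery

/-! ### Initialization -/

section Setup

variable {J U : Type} [SmallCategory J] [DecidableEq J] [Fintype J] [DataDomain U]
  {I : Instance J U} {ν : Numbering I} {C : Ctx J U}

/-- Increase the bound of loops to the maximal number of elements of the objects in a list. -/
def boundC (l : List J) : Cmd J U :=
  l.foldr (fun X c => .seq (.instr (.card (adS 0) X)) (.seq (.instr (.minus (adS 1) (adS 0) adN))
    (.seq (.instr (.plus adN adN (adS 1))) c))) .skip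

/-- With truncated subtraction, `N + (c - N)` is the maximum of `N` and `c`. The program does not
know `n`; the computed bound is at least its initial value and at most any `n` that bounds this
value and all objects. -/
theorem big_boundC (inp : Input J U) (l : List J) (σ : St) :
    ∃ σ', BigLE inp (boundC l) (3 * l.length) σ σ' ∧ σ'.out = σ.out ∧
      (∀ x, x ≠ adN → (∀ i, x ≠ adS i) → σ'.mem x = σ.mem x) ∧ σ.mem adN ≤ σ'.mem adN ∧
      (∀ X ∈ l, inp.card X ≤ σ'.mem adN) ∧
      ∀ n, σ.mem adN ≤ n → (∀ X, inp.card X ≤ n) → σ'.mem adN ≤ n := by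
  induction l generalizing σ with
  | nil => exact ⟨σ, ⟨0, by simp, .skip σ⟩, rfl, fun _ _ _ => rfl, le_rfl, by simp, fun n h _ => h⟩
  | cons X l ih =>
    let σ1 := σ.put (adS 0) (inp.card X)
    let σ2 := σ1.put (adS 1) (σ1.mem (adS 0) - σ1.mem adN)
    let σ3 := σ2.put adN (σ2.mem adN + σ2.mem (adS 1))
    have h1 : σ1.mem adN = σ.mem adN := St.put_mem_ne _ _ (by simp [adS, adN])
    have h2 : σ2.mem adN = σ.mem adN := (St.put_mem_ne _ _ (by simp [adS, adN])).trans h1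
    have h3 : σ3.mem adN = σ.mem adN + (inp.card X - σ.mem adN) := by
      simp only [σ3, St.put_mem_same, h2]
      simp only [σ2, St.put_mem_same, h1]
      simp [σ1]
    obtain ⟨σ', b, o, f, m, c, u⟩ := ih σ3
    refine ⟨σ', ((BigLE.instr inp (.card (adS 0) X) (by simp [Instr.IsJump]) σ).seq
      ((BigLE.instr inp (.minus (adS 1) (adS 0) adN) (by simp [Instr.IsJump]) σ1).seq
      ((BigLE.instr inp (.plus adN adN (adS 1)) (by simp [Instr.IsJump]) σ2).seq b))).mono
        (by simp only [List.length_cons]; omega), o, fun x hx hx' => ?_, by omega, ?_, fun n hn hc => ?_⟩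
    · rw [f x hx hx']
      simp only [σ3, σ2, σ1]
      rw [St.put_mem_ne _ _ hx, St.put_mem_ne _ _ (hx' 1), St.put_mem_ne _ _ (hx' 0)]
    · intro Y hY
      rcases List.mem_cons.1 hY with rfl | hY
      exacts [by omega, c Y hY]
    · have := hc X
      exact u n (by omega) hc

/-- Compute the base addresses of arrays whose length is in register `1`. -/
def basesC : ℕ → Cmd J U
  | 0 => .skip
  | a + 1 => .seq (basesC a) (.instr (.plus (adB (a + 1)) (adB a) 1))

/-- Multiples of the array length arise by repeated addition. The length is taken from register `1`,
which is cell `0` of array `0`, where the counting loop leaves it. -/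
theorem big_basesC (inp : Input J U) (K : ℕ) (σ : St) (h0 : σ.mem (adB 0) = 0) :
    ∃ σ', BigLE inp (basesC K) K σ σ' ∧ σ'.out = σ.out ∧ (∀ x, (∀ a, x ≠ adB a) → σ'.mem x = σ.mem x) ∧
      ∀ a ≤ K, σ'.mem (adB a) = a * σ.mem 1 := by
  induction K with
  | zero =>
    refine ⟨σ, ⟨0, le_rfl, .skip σ⟩, rfl, fun _ _ => rfl, fun a ha => ?_⟩
    obtain rfl : a = 0 := by omega
    simpa using h0
  | succ K ih =>
    obtain ⟨σ1, b, o, f, g⟩ := ih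
    have h1 : σ1.mem 1 = σ.mem 1 := f 1 fun a => by simp only [adB]; omega
    refine ⟨_, b.seq (.instr inp _ (by simp [Instr.IsJump]) σ1), o, fun x hx => ?_, fun a ha => ?_⟩
    · simp only [Instr.eff]
      rw [St.put_mem_ne _ _ (hx _), f x hx]
    · simp only [Instr.eff, St.put_mem]
      split_ifs with h
      · obtain rfl : a = K + 1 := by simp only [adB] at h; omega
        rw [g K le_rfl, h1]; ring
      · exact g a (by by_contra h'; exact h (by simp only [adB]; omega))

/-- The numbers of the registers for variables. -/
def varNum : J ⊕ ℕ → ℕ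
  | .inl X => 2 * objIdx X
  | .inr i => 2 * i + 1

theorem varNum_injective : Function.Injective (varNum (J := J)) := by
  rintro (X | i) (Y | k) h <;> simp only [varNum] at h
  · rw [objIdx_inj (by omega : objIdx X = objIdx Y)]
  · omega
  · omega
  · rw [show i = k by omega]

/-- Count the tuples of numbers. -/
def countOp (J U : Type) [SmallCategory J] [Fintype J] : HCmd J U :=
  .forAll (digitVars (Finset.univ : Finset J).toList)
    (.store 0 (.lit 0) (.add (.get 0 (.lit 0)) (.lit 1)))

/-- `N ^ p` is obtained by counting the iterations of `p` nested loops, which takes no longer than a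
pass over a table. The only cell used has address `1` whatever the array length is, so the command
can run before the length is known. -/
theorem wp_countOp (hK : 0 < C.K) (hM : 0 < C.M) {μ : Mem} (h0 : μ.arr 0 0 = 0) :
    (countOp J U).WP C (fun _ => 0) μ fun μ' => SameBut 0 μ μ' ∧
      μ'.arr 0 0 = C.N ^ Fintype.card J ∧ ∀ i ≠ 0, μ'.arr 0 i = μ.arr 0 i := by
  refine HCmd.wp_forAll (fun L μ' => SameBut 0 μ μ' ∧ μ'.arr 0 0 = L.length ∧
    ∀ i ≠ 0, μ'.arr 0 i = μ.arr 0 i) (nodup_digitVars (Finset.nodup_toList _)) (fun _ _ => rfl)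
    ⟨.refl _ _, h0, fun _ _ => rfl⟩ ?_ ?_
  · rintro L ρ' - μ' ⟨s, h1, h2⟩
    refine HCmd.wp_store trivial ⟨⟨trivial, hK, hM⟩, trivial⟩ hK hM ⟨s.store _ _, ?_, fun i hi => ?_⟩
    · simp [Exp.eval, h1]
    · rw [Mem.store_arr_same]
      exact (if_neg hi).trans (h2 i hi)
  · rintro μ' ⟨s, h1, h2⟩
    refine ⟨s, ?_, h2⟩
    rw [h1, length_box]
    simp [digitVars]

/-- Compute the multiples of the weights of the first `n` digits. -/
def weightsOp (J U : Type) [SmallCategory J] [Fintype J] : ℕ → HCmd J U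
  | 0 => .store (Fintype.card J + 1) (.lit 0) (.lit 1)
  | m + 1 => .seq (weightsOp J U m) (.seq
      (.forV vi (.store (1 + m) (.var vi) (.ite (.var vi) (.add (.get (1 + m) (.sub (.var vi) (.lit 1)))
        (.get (Fintype.card J + 1) (.lit 0))) (.lit 0))))
      (.store (Fintype.card J + 1) (.lit 0) (.add (.get (1 + m) (.sub .bound (.lit 1)))
        (.get (Fintype.card J + 1) (.lit 0)))))

/-- Multiples of `N ^ m` arise by repeated addition, and the next power is `(N - 1) * N ^ m + N ^
m`. The current power is kept in array `p + 1`, just below the tables. -/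
theorem wp_weightsOp (hC : Fits C ν) (hK : tableBase J ≤ C.K) {μ : Mem} (m : ℕ)
    (hm : m ≤ Fintype.card J) :
    (weightsOp J U m).WP C (fun _ => 0) μ fun μ' => Frame 1 (tableBase J) μ μ' ∧
      μ'.arr (Fintype.card J + 1) 0 = C.N ^ m ∧ ∀ i < m, ∀ k < C.N, μ'.arr (1 + i) k = k * C.N ^ i := by
  have hNM := hC.le
  have h1N := hC.one_le
  simp only [tableBase] at *
  induction m with
  | zero =>
    refine HCmd.wp_store trivial trivial (by omega) (by simp only [Exp.eval]; omega)
      ⟨((SameBut.refl _ _).store _ _).frame (by omega) (by omega), ?_, by simp⟩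
    simp [Exp.eval]
  | succ m ih =>
    refine HCmd.wp_seq ((ih (by omega)).mono ?_)
    rintro μ1 ⟨f1, w1, d1⟩
    refine HCmd.wp_seq ((HCmd.wp_forV (v := vi) (fun n μ' => SameBut (1 + m) μ1 μ' ∧ ∀ k < n, μ'.arr (1 + m) k =
      k * C.N ^ m) rfl ⟨.refl _ _, by simp⟩ ?_ fun _ h => h).mono ?_)
    · rintro n hn μ2 ⟨s2, d2⟩
      have hvi : (Exp.var vi : Exp J U).eval C (Function.update (fun _ => 0) vi n) μ2.arr = n := by
        simp [Exp.eval]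
      have hv : (Exp.ite (.var vi) (.add (.get (1 + m) (.sub (.var vi) (.lit 1)))
          (.get (Fintype.card J + 1) (.lit 0))) (.lit 0) : Exp J U).eval C
          (Function.update (fun _ => 0) vi n) μ2.arr = n * C.N ^ m := by
        simp only [Exp.eval, Function.update_self]
        split_ifs with h
        · simp [h]
        · rw [d2 (n - 1) (by omega), s2.2 _ (by omega), w1]
          obtain ⟨n, rfl⟩ : ∃ n', n = n' + 1 := ⟨n - 1, by omega⟩
          simp only [Nat.add_sub_cancel]
          ring
      refine HCmd.wp_store trivial ⟨trivial, fun _ => ⟨⟨⟨trivial, trivial⟩, by omega, ?_⟩,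
        trivial, by omega, by simp only [Exp.eval]; omega⟩, fun _ => trivial⟩ (by omega)
        (by rw [hvi]; omega) ?_
      · simp only [Exp.eval, Function.update_self]; omega
      · rw [hvi, hv]
        refine ⟨s2.store _ _, fun k hk => ?_⟩
        rw [Mem.store_arr_same]
        split_ifs with h
        · rw [h]
        · exact d2 k (by omega)
    · rintro μ2 ⟨s2, d2⟩
      refine HCmd.wp_store trivial ⟨⟨⟨trivial, trivial⟩, by omega, by simp only [Exp.eval]; omega⟩,
        trivial, by omega, by simp only [Exp.eval]; omega⟩ (by omega) (by simp only [Exp.eval]; omega) ?_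
      refine ⟨(f1.trans (s2.frame (by omega) (by omega))).trans
        (((SameBut.refl _ _).store _ _).frame (by omega) (by omega)), ?_, fun i hi k hk => ?_⟩
      · rw [Mem.store_arr_same]
        simp only [Exp.eval, if_true]
        rw [d2 _ (by omega), s2.2 _ (by omega), w1, pow_succ]
        obtain ⟨n, hn⟩ : ∃ n', C.N = n' + 1 := ⟨C.N - 1, by omega⟩
        rw [hn, Nat.add_sub_cancel]
        ring
      · rw [Mem.store_arr_ne _ _ _ (by omega)]
        rcases Nat.lt_succ_iff_lt_or_eq.1 hi with hi | rfl
        · rw [s2.2 _ (by omega), d1 i hi k hk]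
        · exact d2 k hk

theorem cost_weightsOp {N : ℕ} (hN : 1 ≤ N) (hp : 0 < Fintype.card J) (m : ℕ) :
    (weightsOp J U m).cost N ≤ m * (N ^ Fintype.card J * 60) + 6 := by
  have h1 : N ≤ N ^ Fintype.card J := Nat.le_self_pow hp.ne' N
  induction m with
  | zero => simp [weightsOp, HCmd.cost, Exp.cost]
  | succ m ih =>
    simp only [weightsOp, HCmd.cost, Exp.cost] at *
    rw [add_mul]; omega

/-- Initialize, and execute a command that uses `K` arrays. -/
def mainC (K : ℕ) (c : HCmd J U) : Cmd J U :=
  .seq (.instr (.const adOne 1)) (.seq (.instr (.const adN 1))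
    (.seq (boundC (Finset.univ : Finset J).toList) (.seq ((countOp J U).code varNum 0)
      (.seq (basesC K) (.seq (.instr (.const 1 0))
        ((HCmd.seq (weightsOp J U (Fintype.card J)) c).code varNum 0))))))

theorem Exp.code_all {num : J ⊕ ℕ → ℕ} (e : Exp J U) (k : ℕ) :
    (e.code num k).All fun i => ∀ d, i ≠ .choose d := by
  induction e generalizing k <;> simp_all [Exp.code, Cmd.All]

theorem HCmd.code_all {num : J ⊕ ℕ → ℕ} (c : HCmd J U) (k : ℕ) :
    (c.code num k).All fun i => ∀ d, i ≠ .choose d := by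
  induction c generalizing k <;> simp_all [HCmd.code, Cmd.All, Exp.code_all]

theorem mainC_all (K : ℕ) (c : HCmd J U) : (mainC K c).All fun i => ∀ d, i ≠ .choose d := by
  have h1 : ∀ l : List J, (boundC l : Cmd J U).All fun i => ∀ d, i ≠ .choose d := fun l => by
    induction l with
    | nil => trivial
    | cons X l ih => exact ⟨by simp [Cmd.All], by simp [Cmd.All], by simp [Cmd.All], ih⟩
  have h2 : (basesC K : Cmd J U).All fun i => ∀ d, i ≠ .choose d := by
    induction K with
    | zero => trivial
    | succ K ih => exact ⟨ih, by simp [Cmd.All]⟩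
  exact ⟨by simp [Cmd.All], by simp [Cmd.All], h1 _, HCmd.code_all _ _, h2, by simp [Cmd.All],
    HCmd.code_all _ _⟩

/-- The context is supplied before `Q` is chosen, so the specification of `c` may refer to the bound
`N` that the program finds in the given instance. -/
theorem big_mainC (ν : Numbering I) (hp : 0 < Fintype.card J) {K : ℕ} (hK : tableBase J ≤ K)
    (c : HCmd J U) {n : ℕ} (hn : 1 ≤ n) (hcard : ∀ X, Fintype.card (I.F.obj X) ≤ n) :
    ∃ C : Ctx J U, Fits C ν ∧ C.K = K ∧ C.N ≤ n ∧ ∀ Q : Mem → Prop,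
      (∀ μ : Mem, Weights C μ → Fresh (tableBase J) K μ → (∀ i, μ.out i = []) →
        c.WP C (fun _ => 0) μ Q) →
      ∃ σ' μ', BigLE (I.input ν []) (mainC K c)
          (C.N ^ Fintype.card J * (100 * Fintype.card J) + K + c.cost C.N) ⟨fun _ => 0, fun _ => []⟩ σ' ∧
        σ'.out = μ'.out ∧ Q μ' := by
  let inp := I.input ν []
  let σ0 : St := ⟨fun _ => 0, fun _ => []⟩
  let σ1 := σ0.put adOne 1
  let σ2 := σ1.put adN 1
  have b1 : BigLE inp (.instr (.const adOne 1)) 1 σ0 σ1 := .instr _ _ (by simp [Instr.IsJump]) _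
  have b2 : BigLE inp (.instr (.const adN 1)) 1 σ1 σ2 := .instr _ _ (by simp [Instr.IsJump]) _
  obtain ⟨σ3, b3, o3, f3, m3, c3, u3⟩ := big_boundC inp (Finset.univ : Finset J).toList σ2
  have n2 : σ2.mem adN = 1 := St.put_mem_same _ _ _
  rw [n2] at m3
  have uN : σ3.mem adN ≤ n := u3 n (by omega) hcard
  have z3 : ∀ x, x ≠ adN → x ≠ adOne → (∀ i, x ≠ adS i) → σ3.mem x = 0 := fun x h1 h2 h3 => by
    rw [f3 x h1 h3]
    simp only [σ2, σ1, σ0]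
    rw [St.put_mem_ne _ _ h1, St.put_mem_ne _ _ h2]
  have e3 : σ3.mem adOne = 1 := by
    rw [f3 _ (by simp [adOne, adN]) (by simp only [adOne, adS]; omega)]
    simp only [σ2, σ1]
    rw [St.put_mem_ne _ _ (by simp [adOne, adN]), St.put_mem_same]
  obtain ⟨N, hN⟩ : ∃ N, N = σ3.mem adN := ⟨_, rfl⟩
  rw [← hN] at m3 uN
  -- Counting runs in a context with a single array, whose base address `0` needs no computation;
  -- the bases of the other arrays depend on the result of the count.
  let C1 : Ctx J U := ⟨inp, N, N ^ Fintype.card J, 1⟩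
  let C : Ctx J U := ⟨inp, N, N ^ Fintype.card J, K⟩
  have hC : Fits C ν := ⟨rfl, m3, fun X => (c3 X (by simp)).trans hN.ge, rfl, hp⟩
  refine ⟨C, hC, rfl, uN, fun Q hQ => ?_⟩
  have r3 : Rep C1 varNum (fun _ => 0) ⟨fun _ _ => 0, fun _ => []⟩ σ3 := by
    refine ⟨fun v => ?_, fun a ha => ?_, e3, hN.symm, fun a i _ => ?_, o3⟩
    · exact z3 _ (by simp only [adV, adN]; omega) (by simp only [adV, adOne]; omega)
        fun i => by simp only [adV, adS]; omega
    · obtain rfl : a = 0 := by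
        simp only [C1] at ha; omega
      rw [zero_mul]
      exact z3 _ (by simp [adB, adN]) (by simp [adB, adOne]) fun i => by simp only [adB, adS]; omega
    · exact z3 _ (by simp only [adN]; omega) (by simp only [adOne]; omega)
        fun i => by simp only [adS]; omega
  have hMpos : 0 < N ^ Fintype.card J := Nat.pow_pos m3
  obtain ⟨safe4, s4, e4, z4⟩ := wp_countOp (C := C1) (μ := ⟨fun _ _ => 0, fun _ => []⟩)
    Nat.one_pos hMpos rfl
  obtain ⟨σ4, b4, r4, -⟩ := HCmd.big (C := C1) varNum_injective m3 (countOp J U) 0 r3 safe4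
  set μ4 := HCmd.exec C1 (countOp J U) (fun _ => 0) ⟨fun _ _ => 0, fun _ => []⟩ with hμ4
  have h41 : σ4.mem 1 = N ^ Fintype.card J := by
    have := r4.cell 0 0 hMpos
    simpa [e4, C1] using this
  obtain ⟨σ5, b5, o5, f5, g5⟩ := big_basesC inp K σ4 (by
    have := r4.base 0 Nat.one_pos
    simpa using this)
  -- With the count erased all cells are `0` again, so the registers represent empty arrays in the
  -- full context.
  let σ6 := σ5.put 1 0
  have b6 : BigLE inp (.instr (.const 1 0)) 1 σ5 σ6 := .instr _ _ (by simp [Instr.IsJump]) _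
  have r6 : Rep C varNum (fun _ => 0) ⟨fun _ _ => 0, fun _ => []⟩ σ6 := by
    refine ⟨fun v => ?_, fun a ha => ?_, ?_, ?_, fun a i hi => ?_, ?_⟩
    · rw [St.put_mem_ne _ _ (by simp only [adV]; omega), f5 _ (by simp only [adV, adB]; omega), r4.var]
    · rw [St.put_mem_ne _ _ (by simp only [adB]; omega), g5 a ha.le, h41]
    · rw [St.put_mem_ne _ _ (by simp only [adOne]; omega), f5 _ (by simp only [adOne, adB]; omega), r4.one]
    · rw [St.put_mem_ne _ _ (by simp only [adN]; omega), f5 _ (by simp only [adN, adB]; omega), r4.bound]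
    · simp only [σ6, St.put_mem]
      split_ifs with h
      · rfl
      · rw [f5 _ (by simp only [adB]; omega)]
        have h5 := r4.cell a i hi
        simp only [C1] at h5
        simp only [C]
        rw [h5]
        by_cases ha : a = 0
        · subst ha
          exact z4 i (by rintro rfl; simp at h)
        · rw [s4.2 a ha]
    · exact o5.trans (r4.out.trans s4.1)
  have hfin : (HCmd.seq (weightsOp J U (Fintype.card J)) c).WP C (fun _ => 0)
      ⟨fun _ _ => 0, fun _ => []⟩ Q := by
    refine HCmd.wp_seq ((wp_weightsOp hC hK _ le_rfl).mono ?_)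
    rintro μ ⟨f, -, h⟩
    refine hQ μ (fun X k hk => h _ (objIdx_lt X) k hk) (fun a ha ha' k => ?_) fun i => ?_
    · rw [f.2 a (Or.inr ha)]
    · rw [f.1]
  obtain ⟨σ7, b7, r7, -⟩ := HCmd.big (C := C) varNum_injective m3 _ 0 r6 hfin.1
  refine ⟨σ7, _, (b1.seq (b2.seq (b3.seq (b4.seq (b5.seq (b6.seq b7)))))).mono ?_, r7.out, hfin.2⟩
  have k1 := HCmd.cost_forAll (J := J) (U := U) m3 (digitVars (Finset.univ : Finset J).toList)
    (c := .store 0 (.lit 0) (.add (.get 0 (.lit 0)) (.lit 1)))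
  have k2 : (digitVars (Finset.univ : Finset J).toList).length = Fintype.card J := by simp [digitVars]
  have k3 := cost_weightsOp (J := J) (U := U) m3 hp (Fintype.card J)
  rw [k2] at k1
  simp only [HCmd.cost, Exp.cost] at k1
  have k4 : (Finset.univ : Finset J).toList.length = Fintype.card J := by simp
  rw [k4]
  have k5 : (countOp J U).cost N ≤ N ^ Fintype.card J * (13 + 6 * Fintype.card J) := k1.trans (by
    exact Nat.mul_le_mul_left _ (by omega))
  change 1 + (1 + (3 * Fintype.card J + ((countOp J U).cost N + (K + (1 +
    ((weightsOp J U (Fintype.card J)).cost N + c.cost N)))))) ≤ N ^ Fintype.card J * (100 * Fintype.card J)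
      + K + c.cost N
  have k6 : Fintype.card J ≤ N ^ Fintype.card J * Fintype.card J := Nat.le_mul_of_pos_left _ hMpos
  have k7 : N ^ Fintype.card J * 1 ≤ N ^ Fintype.card J * Fintype.card J := Nat.mul_le_mul_left _ hp
  have k8 : N ^ Fintype.card J * (13 + 6 * Fintype.card J) =
    13 * (N ^ Fintype.card J * 1) + 6 * (N ^ Fintype.card J * Fintype.card J) := by ring
  have k9 : Fintype.card J * (N ^ Fintype.card J * 60) =
    60 * (N ^ Fintype.card J * Fintype.card J) := by ring
  have k10 : N ^ Fintype.card J * (100 * Fintype.card J) =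
    100 * (N ^ Fintype.card J * Fintype.card J) := by ring
  omega

/-- A command in the array language gives a program. -/
theorem exists_program (hp : 0 < Fintype.card J) {K : ℕ} (hK : tableBase J ≤ K) (c : HCmd J U) :
    ∃ P : Program J U, P.Deterministic ∧ ∀ (I : Instance J U) (ν : Numbering I) (n : ℕ), 1 ≤ n →
      (∀ X, Fintype.card (I.F.obj X) ≤ n) → ∃ C : Ctx J U, Fits C ν ∧ C.K = K ∧ C.N ≤ n ∧
      ∀ Q : Mem → Prop, (∀ μ : Mem, Weights C μ → Fresh (tableBase J) K μ → (∀ i, μ.out i = []) →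
        c.WP C (fun _ => 0) μ Q) →
      ∃ k ≤ C.N ^ Fintype.card J * (100 * Fintype.card J) + K + c.cost C.N,
        P.Halted (P.run (I.input ν []) k) ∧ ∃ μ', (P.run (I.input ν []) k).out = μ'.out ∧ Q μ' := by
  have hdet : Program.Deterministic ((mainC K c).compile 0) := fun d hd =>
    (mainC_all K c).compile (fun _ _ _ => by simp) 0 _ hd d rfl
  refine ⟨(mainC K c).compile 0, hdet, fun I ν n hn hcard => ?_⟩
  obtain ⟨C, hC, hCK, hCN, h⟩ := big_mainC ν hp hK c hn hcard
  refine ⟨C, hC, hCK, hCN, fun Q hQ => ?_⟩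
  obtain ⟨σ', μ', ⟨k, hk, hb⟩, ho, hq⟩ := h Q hQ
  obtain ⟨c', h1, h2, h3⟩ := hb.steps (P := (mainC K c).compile 0) (o := 0) ⟨[], [], by simp⟩
    (c := Config.init) rfl (by rfl)
  have h4 : Program.run ((mainC K c).compile 0) (I.input ν []) k = c' := (hdet.steps_eq h1).symm
  refine ⟨k, hk, ?_, μ', ?_, hq⟩
  · rw [h4, Program.Halted, h2, Cmd.length_compile]; omega
  · rw [h4, ← ho, ← h3]; rfl

end Setup

end CatQuery
end
set_option linter.unusedSectionVars false
noncomputable section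
namespace CatQuery

/-! ### Time bounds for queries -/

section TimeBounds

variable {J U : Type} [SmallCategory J] [FinCategory J] [DecidableEq J] [Nonempty J] [DataDomain U]

/-- An expression of an algebra query with its evaluation. -/
def algItem (e : Σ A : Finset J, Alg J U A) : Item J U :=
  ⟨⟨e.1, fun I => e.2.eval I⟩, e.2.core.arrays, e.2.core.comp⟩

/-- A target of a calculus query with its evaluation, given the table of the qualification. -/
def CalculusQuery.headItem (Q : CalculusQuery J U) (T : {T : Finset J // T ⊆ Q.A}) : Item J U :=
  ⟨⟨T.1, fun I => {t | ∃ s : Tuple I Q.A, Q.body.Sat I s ∧ t = s.restrict T.2}⟩,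
    Fintype.card J + 2, imageOp Q.A T.1 ident (tableBase J)⟩

theorem isListing_of_items {I : Instance J U} {ν : Numbering I} {l : List (Item J U)}
    {Q : List (Target J U)} (hQ : Q = l.map Item.toTarget) {w : ℕ → List ℕ}
    (h : ∀ (i : ℕ) (hi : i < l.length), IsListing ν (l[i].answer I) (w i)) (i : ℕ)
    (hi : i < Q.length) : IsListing ν (Q[i].answer I) (w i) := by
  subst hQ
  have e : (l.map Item.toTarget)[i] = (l[i]'(by simpa using hi)).toTarget := List.getElem_map _
  rw [e]
  exact h i _

theorem sum_weight_le (Q : AlgebraQuery J U) :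
    (Q.map fun e => e.2.core.weight (numObjects J) + numObjects J).sum ≤
      20 * (Q.size * numMorphisms J) := by
  induction Q with
  | nil => simp
  | cons e Q ih =>
    have := e.2.weight_core_le
    simp only [AlgebraQuery.size, List.map_cons, List.sum_cons] at *
    rw [add_mul]; omega

theorem sum_map_linear {α : Type} (l : List α) (f : α → ℕ) (a b : ℕ) :
    (l.map fun x => a * f x + b).sum = a * (l.map f).sum + l.length * b := by
  induction l with
  | nil => simp
  | cons x l ih => simp only [List.map_cons, List.sum_cons, List.length_cons, ih]; ring

theorem AlgebraQuery.computableInTime (Q : AlgebraQuery J U) : ComputableInTime Q.targets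
    fun n => 30000 * Q.size * (numMorphisms J * n ^ numObjects J) := by
  have hp : 0 < Fintype.card J := Fintype.card_pos
  rcases hQ : Q with _ | ⟨e0, Q0⟩
  -- The empty query has size `0` and must be answered in `0` steps, so no initialization is
  -- possible and the program is empty.
  · refine ⟨[], by simp [Program.Deterministic], fun I ν n _ _ => ⟨0, Nat.zero_le _, ?_, ?_⟩⟩
    · simp [Program.Halted, Program.run]
    · simp [AlgebraQuery.targets]
  rw [← hQ]
  have hsize : 1 ≤ Q.size := by
    have := e0.2.size_pos
    rw [hQ, AlgebraQuery.size, List.map_cons, List.sum_cons]; omega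
  let l : List (Item J U) := Q.map algItem
  let K := tableBase J + (l.map Item.arrays).sum
  obtain ⟨P, hP, h⟩ := exists_program hp (K := K) (Nat.le_add_right _ _)
    (listItems l 0 (tableBase J))
  refine ⟨P, hP, fun I ν n hn hcard => ?_⟩
  obtain ⟨C, hC, hCK, hCN, h⟩ := h I ν n hn hcard
  obtain ⟨k, hk, hh, μ', ho, hq⟩ := h
    (fun μ' => ∀ (i : ℕ) (hi : i < l.length), IsListing ν (l[i].answer I) (μ'.out i)) (by
      intro μ hW h0 hout
      refine (wp_listItems hC (Base := fun _ => True) le_rfl (fun _ _ _ _ => trivial) ?_ le_rfl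
        hCK.ge (by omega) hW trivial h0 fun i _ => hout i).mono fun μ' hμ' i hi => ?_
      · intro it hit
        obtain ⟨e, -, rfl⟩ := List.mem_map.1 hit
        refine ⟨e.2.core.arrays_pos, fun j μ hj hK hW _ h0 => ?_⟩
        refine (Core.wp_comp hC e.2.core j hj hK hW h0).mono ?_
        rintro μ' ⟨f, t⟩
        exact ⟨f, t.congr fun d _ => e.2.sem_core d⟩
      · simpa using hμ'.2 i hi)
  refine ⟨k, hk.trans ?_, hh, fun i hi => ?_⟩
  · have c1 : (listItems l 0 (tableBase J)).cost C.N ≤ C.N ^ Fintype.card J *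
        ((Q.map fun e => 1000 * e.2.core.weight (Fintype.card J) + 30 * Fintype.card J).sum) := by
      have : ∀ (Q : AlgebraQuery J U) ch j, (listItems (Q.map algItem) ch j).cost C.N ≤ C.N ^ Fintype.card J *
          ((Q.map fun e => 1000 * e.2.core.weight (Fintype.card J) + 30 * Fintype.card J).sum) := by
        intro Q
        induction Q with
        | nil => intro ch j; simp [listItems, HCmd.cost]
        | cons e Q ih =>
          intro ch j
          have h1 := ih (ch + 1) (j + (algItem e).arrays)
          have h2 := e.2.core.cost_comp hC.one_le hp j
          have h3 := cost_listOp (U := U) hC.one_le hp (algItem e).T j ch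
          simp only [List.map_cons, listItems, HCmd.cost, List.sum_cons]
          calc _ ≤ _ := Nat.add_le_add h2 (Nat.add_le_add h3 h1)
            _ = _ := by ring
      exact this Q 0 _
    have c2 : K ≤ 3 * Fintype.card J + 9 * (Q.map fun e => e.2.core.weight (Fintype.card J)).sum := by
      have : (l.map Item.arrays).sum ≤ 9 * (Q.map fun e => e.2.core.weight (Fintype.card J)).sum := by
        simp only [l, List.map_map]
        clear * - hp
        induction Q with
        | nil => simp
        | cons e Q ih =>
          have := e.2.core.arrays_le hp
          simp only [List.map_cons, List.sum_cons, Function.comp, algItem] at *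
          omega
      simp only [K, tableBase]; omega
    have c3 := sum_weight_le Q
    have c4 := sum_map_linear Q (fun e => e.2.core.weight (Fintype.card J)) 1000 (30 * Fintype.card J)
    have c5 := sum_map_linear Q (fun e => e.2.core.weight (Fintype.card J)) 1 (Fintype.card J)
    simp only [one_mul] at c5
    rw [show numObjects J = Fintype.card J from rfl] at *
    rw [c5] at c3
    rw [c4] at c1
    have hq : Fintype.card J ≤ Q.size * numMorphisms J :=
      (numObjects_le_numMorphisms (J := J)).trans (Nat.le_mul_of_pos_left _ hsize)
    set W := (Q.map fun e => e.2.core.weight (Fintype.card J)).sum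
    set p := Fintype.card J
    have c6 : K ≤ C.N ^ p * (3 * p + 9 * W) :=
      c2.trans (Nat.le_mul_of_pos_left _ (Nat.pow_pos hC.one_le))
    calc C.N ^ p * (100 * p) + K + (listItems l 0 (tableBase J)).cost C.N
        ≤ C.N ^ p * (100 * p) + C.N ^ p * (3 * p + 9 * W) +
            C.N ^ p * (1000 * W + Q.length * (30 * p)) := by gcongr
      _ = C.N ^ p * (103 * p + 1009 * W + 30 * (Q.length * p)) := by ring
      _ ≤ n ^ p * (30000 * (Q.size * numMorphisms J)) := by
          refine Nat.mul_le_mul (Nat.pow_le_pow_left hCN p) ?_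
          omega
      _ = _ := by ring
  · rw [ho]
    exact isListing_of_items (l := l) (by simp [l, algItem, AlgebraQuery.targets]) hq i hi

/-- The four contributions per table entry are the setup `100 * p`, the allocation of arrays `K`,
the qualification `1000 * W`, and `280 * p` for each head: `250 * p` for its image and `30 * p` for
its listing. Everything is linear in `W ≤ 20 * (s * q)` and in `p ≤ q`. -/
theorem time_le {p q W m s N n K t t' : ℕ} (hNn : N ≤ n) (hs : 1 ≤ s) (hpq : p ≤ q)
    (hW : W + p ≤ 20 * (s * q)) (hK : K ≤ N ^ p * (3 * p + 9 * W + m * (3 * p)))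
    (ht : t ≤ N ^ p * (1000 * W)) (ht' : t' ≤ N ^ p * (280 * (m * p))) :
    N ^ p * (100 * p) + K + (t + t') ≤ 30000 * (s + m) * (q * n ^ p) := by
  calc N ^ p * (100 * p) + K + (t + t')
      ≤ N ^ p * (100 * p) + N ^ p * (3 * p + 9 * W + m * (3 * p)) +
          (N ^ p * (1000 * W) + N ^ p * (280 * (m * p))) := by gcongr
    _ = N ^ p * (103 * p + 1009 * W + 283 * (m * p)) := by ring
    _ ≤ n ^ p * (30000 * ((s + m) * q)) := by
        refine Nat.mul_le_mul (Nat.pow_le_pow_left hNn p) ?_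
        have h1 : m * p ≤ m * q := Nat.mul_le_mul_left _ hpq
        have h3 : q ≤ s * q := Nat.le_mul_of_pos_left _ hs
        rw [add_mul]
        omega
    _ = _ := by ring

/-- The qualification is tabulated once, and each head is an image of that table. So every head
costs only `O(p)` per entry, which the summand for the number of heads in the size pays for. -/
theorem CalculusQuery.computableInTime (Q : CalculusQuery J U) : ComputableInTime Q.targets
    fun n => 30000 * Q.size * (numMorphisms J * n ^ numObjects J) := by
  have hp : 0 < Fintype.card J := Fintype.card_pos
  have hsize : 1 ≤ Q.size := by
    have := Q.body.size_pos
    rw [CalculusQuery.size]; omega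
  let l : List (Item J U) := Q.heads.map Q.headItem
  let K := tableBase J + Q.body.core.arrays + (l.map Item.arrays).sum
  obtain ⟨P, hP, h⟩ := exists_program hp (K := K) (by simp only [K]; omega)
    (.seq (Q.body.core.comp (tableBase J)) (listItems l 0 (tableBase J + Q.body.core.arrays)))
  refine ⟨P, hP, fun I ν n hn hcard => ?_⟩
  obtain ⟨C, hC, hCK, hCN, h⟩ := h I ν n hn hcard
  have hpos := Q.body.core.arrays_pos
  obtain ⟨k, hk, hh, μ', ho, hq⟩ := h
    (fun μ' => ∀ (i : ℕ) (hi : i < l.length), IsListing ν (l[i].answer I) (μ'.out i)) (by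
      intro μ hW h0 hout
      refine HCmd.wp_seq ((Core.wp_comp hC Q.body.core (tableBase J) le_rfl (by omega) hW
        (h0.mono le_rfl (by omega))).mono ?_)
      rintro μ1 ⟨f1, t1⟩
      refine (wp_listItems hC (Base := fun μ => Table C μ (tableBase J) (Q.body.core.Sem ν))
        (j0 := tableBase J + Q.body.core.arrays) (by omega) (fun μ μ' hT hb d hd => ?_) ?_ le_rfl
        hCK.ge (by omega) (f1.weights hW le_rfl) t1
        ((h0.mono (by omega) le_rfl).frame f1 (Or.inr le_rfl)) fun i _ => ?_).mono fun μ' hμ' i hi => ?_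
      · rw [hb _ (by omega)]; exact hT d hd
      · intro it hit
        obtain ⟨T, -, rfl⟩ := List.mem_map.1 hit
        refine ⟨Nat.succ_pos _, fun j μ hj hK hW hT h0 => ?_⟩
        refine (wp_imageOp hC Q.A T.1 ident (by omega) hK (by omega) (Or.inl (by omega)) hW h0 hT).mono ?_
        rintro μ' ⟨f, t⟩
        exact ⟨f, t.congr fun d _ => image_ident_codeIn (fun d => Q.body.sem_core d) T.2⟩
      · rw [f1.1, hout]
      · simpa using hμ'.2 i hi)
  refine ⟨k, hk.trans ?_, hh, fun i hi => ?_⟩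
  · have c1 := cost_listItems (U := U) hC.one_le hp l 0 (tableBase J + Q.body.core.arrays)
      (B := fun _ => 250 * Fintype.card J) (N := C.N) (by
        intro it hit j
        obtain ⟨T, -, rfl⟩ := List.mem_map.1 hit
        exact cost_imageOp (U := U) hC.one_le hp _ _ _ _ _)
    have c2 := Q.body.core.cost_comp hC.one_le hp (tableBase J)
    have c3 := Q.body.core.arrays_le hp
    have c4 := Q.body.weight_core_le
    have c5 : (l.map Item.arrays).sum = Q.heads.length * (Fintype.card J + 2) := by
      simp [l, CalculusQuery.headItem, Function.comp_def]
    have c6 : (l.map fun _ => 250 * Fintype.card J).sum = Q.heads.length * (250 * Fintype.card J) := by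
      simp [l]
    have c7 : l.length = Q.heads.length := by simp [l]
    rw [show numObjects J = Fintype.card J from rfl] at *
    have hq : Fintype.card J ≤ numMorphisms J := numObjects_le_numMorphisms (J := J)
    rw [c6, c7] at c1
    set W := Q.body.core.weight (Fintype.card J)
    set p := Fintype.card J
    set m := Q.heads.length
    have c8 : K ≤ C.N ^ p * (3 * p + 9 * W + m * (3 * p)) := by
      have : m * (p + 2) ≤ m * (3 * p) := Nat.mul_le_mul_left _ (by omega)
      refine le_trans ?_ (Nat.le_mul_of_pos_left _ (Nat.pow_pos hC.one_le))
      simp only [K, c5, tableBase]; omega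
    exact time_le hCN Q.body.size_pos hq c4 c8 c2 (c1.trans_eq (by ring))
  · rw [ho]
    exact isListing_of_items (l := l) (by simp [l, CalculusQuery.headItem, CalculusQuery.targets]) hq i hi

end TimeBounds

end CatQuery
end
set_option linter.unusedSectionVars false
noncomputable section
namespace CatQuery

/-! ### Nondeterministic structured programs -/

section Nondeterminism

variable {J U : Type} [SmallCategory J] [DataDomain U] {inp : Input J U} {m : Bool}

/-- All results of the program satisfy `Q` if `m = false`, and some result does if `m = true`. -/
def Tr (inp : Input J U) : Bool → Cmd J U → St → (St → Prop) → Prop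
  | false, c, σ, Q => ∀ t σ', Big inp c σ t σ' → Q σ'
  | true, c, σ, Q => ∃ t σ', Big inp c σ t σ' ∧ Q σ'

namespace Tr

variable {a b c : Cmd J U} {σ : St} {Q Q' : St → Prop} {r : ℕ}

theorem mono (h : Tr inp m c σ Q) (hQ : ∀ σ, Q σ → Q' σ) : Tr inp m c σ Q' := by
  cases m
  · exact fun t σ' hb => hQ _ (h t σ' hb)
  · obtain ⟨t, σ', hb, hq⟩ := h
    exact ⟨t, σ', hb, hQ _ hq⟩

theorem seq (h : Tr inp m a σ fun σ' => Tr inp m b σ' Q) : Tr inp m (.seq a b) σ Q := by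
  cases m
  · intro t σ' hb
    cases hb with
    | seq h1 h2 => exact h _ _ h1 _ _ h2
  · obtain ⟨t, σ', h1, t', σ'', h2, hq⟩ := h
    exact ⟨_, _, .seq h1 h2, hq⟩

theorem instr {i : Instr J U} (hi : ¬ i.IsJump) (hc : ∀ d, i ≠ .choose d)
    (h : Q (i.eff inp false σ)) : Tr inp m (.instr i) σ Q := by
  cases m
  · intro t σ' hb
    cases hb with
    | instr _ b _ _ =>
      have : i.eff inp b σ = i.eff inp false σ := by
        cases i <;> first | rfl | exact absurd rfl (hc _)
      rwa [this]
  · exact ⟨_, _, .instr i false σ hi, h⟩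

/-- `b₀` is the bit that the existential reading selects; the universal reading has to be correct
for both bits. Witnesses may therefore be used in proofs only under `m = true`. -/
theorem choose {d b₀ : ℕ} (hb : b₀ ≤ 1) (h : ∀ b ≤ 1, (m = true → b = b₀) → Q (σ.put d b)) :
    Tr inp m (.instr (.choose d)) σ Q := by
  have hj : ¬ (Instr.choose d : Instr J U).IsJump := by simp [Instr.IsJump]
  cases m
  · intro t σ' hb
    cases hb with
    | instr _ b _ _ => cases b <;> exact h _ (by simp) (by simp)
  · have h1 := h _ hb fun _ => rfl
    rcases Nat.le_one_iff_eq_zero_or_eq_one.1 hb with rfl | rfl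
    exacts [⟨_, _, .instr _ false σ hj, h1⟩, ⟨_, _, .instr _ true σ hj, h1⟩]

theorem set {d k : ℕ} (h : Q (σ.put d k)) : Tr inp m (.instr (.const d k)) σ Q :=
  .instr (by simp [Instr.IsJump]) (by simp) h

theorem copy {d k : ℕ} (h : Q (σ.put d (σ.mem k))) : Tr inp m (.instr (.copy d k)) σ Q :=
  .instr (by simp [Instr.IsJump]) (by simp) h

theorem minus {d k l : ℕ} (h : Q (σ.put d (σ.mem k - σ.mem l))) :
    Tr inp m (.instr (.minus d k l)) σ Q :=
  .instr (by simp [Instr.IsJump]) (by simp) h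

theorem card {d : ℕ} {X : J} (h : Q (σ.put d (inp.card X))) : Tr inp m (.instr (.card d X)) σ Q :=
  .instr (by simp [Instr.IsJump]) (by simp) h

theorem ifNZ (h : σ.mem r ≠ 0 → Tr inp m c σ Q) (h' : σ.mem r = 0 → Q σ) :
    Tr inp m (.ifNZ r c) σ Q := by
  by_cases hr : σ.mem r = 0
  · cases m
    · intro t σ' hb
      cases hb with
      | ifNZ h0 _ => exact absurd hr h0
      | ifZ _ => exact h' hr
    · exact ⟨_, _, .ifZ hr, h' hr⟩
  · cases m
    · intro t σ' hb
      cases hb with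
      | ifNZ _ hb => exact h hr _ _ hb
      | ifZ h0 => exact absurd h0 hr
    · obtain ⟨t, σ', hb, hq⟩ := h hr
      exact ⟨_, _, .ifNZ hr hb, hq⟩

/-- One rule serves both modes. The descending rank gives termination, which the existential mode
needs in order to produce a result at all. -/
theorem loop (Inv : ℕ → St → Prop) (hs : ∀ k σ, Inv k σ → Tr inp m c σ fun σ' =>
      (σ'.mem r ≠ 0 ∧ Q σ') ∨ (σ'.mem r = 0 ∧ ∃ k' < k, Inv k' σ')) {k : ℕ} (h : Inv k σ) :
    Tr inp m (.loop c r) σ Q := by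
  induction k using Nat.strong_induction_on generalizing σ with
  | _ k ih =>
    have := hs k σ h
    cases m
    · intro t σ' hb
      cases hb with
      | last h1 h2 =>
        rcases this _ _ h1 with h3 | h3
        exacts [h3.2, absurd h3.1 h2]
      | again h1 h2 h3 =>
        rcases this _ _ h1 with h4 | ⟨-, k', hk, h4⟩
        exacts [absurd h2 h4.1, ih k' hk h4 _ _ h3]
    · obtain ⟨t, σ', h1, h3 | ⟨h2, k', hk, h4⟩⟩ := this
      · exact ⟨_, _, .last h1 h3.1, h3.2⟩
      · obtain ⟨t', σ'', h5, h6⟩ := ih k' hk h4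
        exact ⟨_, _, .again h1 h2 h5, h6⟩

/-- A check that may fail in a universal statement. -/
theorem check (h0 : σ.mem 0 = 0) (h : σ.mem r = 0 → Q σ) (h' : m = true → σ.mem r = 0) :
    Tr inp m (.ifNZ r (.loop .skip 0)) σ Q := by
  -- Register `0` holds `0`, so `loop skip 0` never ends. A computation with a wrong guess runs
  -- forever, yields no result, and satisfies the universal statement vacuously.
  have hdiv : ∀ (c : Cmd J U) (t : ℕ) (σ' : St), Big inp c σ t σ' → c ≠ .loop .skip 0 := by
    rintro _ t σ' hb rfl
    induction t using Nat.strong_induction_on with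
    | _ t ih =>
      cases hb with
      | last h1 h2 => cases h1; exact h2 h0
      | again h1 _ h3 => cases h1; exact ih _ (by omega) h3
  refine ifNZ (fun hne => ?_) h
  cases m
  · exact fun t σ' hb => absurd rfl (hdiv _ t σ' hb)
  · exact absurd (h' rfl) hne

/-- A check that register `r` is not `0`. -/
theorem require {d : ℕ} (h0 : σ.mem 0 = 0) (h1 : σ.mem 1 = 1) (hd : d ≠ 0)
    (h : σ.mem r ≠ 0 → Q (σ.put d 0)) (h' : m = true → σ.mem r ≠ 0) :
    Tr inp m (.seq (.instr (.minus d 1 r)) (.ifNZ d (.loop .skip 0))) σ Q := by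
  refine .seq (.minus (.check (by rw [St.put_mem_ne _ _ hd.symm, h0]) (fun h2 => ?_) fun hm => ?_))
  · rw [St.put_mem_same, h1] at h2
    rw [h1, h2]
    exact h (by omega)
  · have := h' hm
    rw [St.put_mem_same, h1]
    omega

end Tr

/-- The instruction does not increase the largest number beyond the sizes of the objects and the
constants of the program. -/
def Instr.Pure : Instr J U → Prop
  | plus _ _ _ | load _ _ | store _ _ | jumpZero _ _ | out _ _ => False
  | _ => True

theorem Instr.Pure.not_isJump {i : Instr J U} (h : i.Pure) : ¬ i.IsJump := by
  cases i <;> simp_all [Instr.Pure, Instr.IsJump]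

end Nondeterminism

/-! ### Functions computed in logarithmic space -/

section LogSpace

variable {J U : Type} [SmallCategory J] [DataDomain U] {ι κ : Type}

/-- The structured program `c` assigns `v` to register `ℓ` and changes no register below `ℓ`. -/
def Assigns (inp : Input J U) (m : Bool) (c : Cmd J U) (ℓ : ℕ) (σ : St) (v : ℕ) : Prop :=
  Tr inp m c σ fun σ' => (∀ x < ℓ, σ'.mem x = σ.mem x) ∧ σ'.mem ℓ = v

/-- On the domain `H`, the function `F` is computed by a nondeterministic program with a fixed number
of registers that hold numbers of elements. -/
def LogFun (H : ∀ I : Instance J U, Numbering I → (ι → ℕ) → Prop)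
    (F : ∀ I : Instance J U, Numbering I → (ι → ℕ) → ℕ) : Prop :=
  ∀ (r : ι → ℕ) (ℓ : ℕ), 2 ≤ ℓ → (∀ i, r i < ℓ) → ∃ c : Cmd J U, c.All Instr.Pure ∧
    ∀ (I : Instance J U) (ν : Numbering I) (a : List ℕ) (m : Bool) (σ : St),
      σ.mem 0 = 0 → σ.mem 1 = 1 → H I ν (fun i => σ.mem (r i)) →
        Assigns (I.input ν a) m c ℓ σ (F I ν fun i => σ.mem (r i))

/-- The predicate `P` is decided in logarithmic space. -/
abbrev LogDec (P : ∀ I : Instance J U, Numbering I → (ι → ℕ) → Prop) : Prop :=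
  LogFun (fun _ _ _ => True) fun I ν x => flag (P I ν x)

namespace LogFun

variable {H : ∀ I : Instance J U, Numbering I → (ι → ℕ) → Prop}
  {F G : ∀ I : Instance J U, Numbering I → (ι → ℕ) → ℕ}

theorem congr {H' : ∀ I : Instance J U, Numbering I → (ι → ℕ) → Prop} (h : LogFun H F)
    (hFG : ∀ I ν x, H' I ν x → H I ν x ∧ F I ν x = G I ν x) : LogFun H' G := by
  intro r ℓ hℓ hr
  obtain ⟨c, hc, h⟩ := h r ℓ hℓ hr
  refine ⟨c, hc, fun I ν a m σ h0 h1 hH => ?_⟩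
  obtain ⟨h2, h3⟩ := hFG _ _ _ hH
  rw [← h3]
  exact h I ν a m σ h0 h1 h2

theorem instr (i : (ι → ℕ) → ℕ → Instr J U) (hp : ∀ r ℓ, (i r ℓ).Pure)
    (hc : ∀ r ℓ d, i r ℓ ≠ .choose d)
    (h : ∀ I ν a r ℓ σ, (i r ℓ).eff (I.input ν a) false σ = σ.put ℓ (F I ν fun j => σ.mem (r j))) :
    LogFun H F := by
  intro r ℓ _ _
  refine ⟨.instr (i r ℓ), hp r ℓ, fun I ν a m σ _ _ _ => .instr (hp r ℓ).not_isJump (hc r ℓ) ?_⟩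
  rw [h]
  exact ⟨fun x hx => σ.put_mem_ne _ hx.ne, σ.put_mem_same _ _⟩

theorem var (i : ι) : LogFun H fun _ _ x => x i :=
  instr (fun r ℓ => .copy ℓ (r i)) (by simp [Instr.Pure]) (by simp) fun _ _ _ _ _ _ => rfl

theorem const (k : ℕ) : LogFun H fun _ _ _ => k :=
  instr (fun _ ℓ => .const ℓ k) (by simp [Instr.Pure]) (by simp) fun _ _ _ _ _ _ => rfl

theorem card (X : J) : LogFun H fun I _ _ => Fintype.card (I.F.obj X) :=
  instr (fun _ ℓ => .card ℓ X) (by simp [Instr.Pure]) (by simp) fun _ _ _ _ _ _ => rfl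

/-- A variable sent to `none` is read from register `0`, which holds `0` throughout, so it is
replaced by the constant `0`. -/
theorem subst (h : LogFun H F) (g : ι → Option κ) :
    LogFun (fun I ν (x : κ → ℕ) => H I ν fun i => (g i).elim 0 x)
      fun I ν x => F I ν fun i => (g i).elim 0 x := by
  intro r ℓ hℓ hr
  obtain ⟨c, hc, h⟩ := h (fun i => (g i).elim 0 r) ℓ hℓ fun i => by
    cases g i
    exacts [show 0 < ℓ by omega, hr _]
  refine ⟨c, hc, fun I ν a m σ h0 h1 hH => ?_⟩
  have : (fun i => σ.mem ((g i).elim 0 r)) = fun i => (g i).elim 0 fun i => σ.mem (r i) := by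
    funext i
    cases g i
    exacts [h0, rfl]
  simp only [← this] at hH ⊢
  exact h I ν a m σ h0 h1 hH

theorem rename (h : LogFun H F) (g : ι → κ) :
    LogFun (fun I ν (x : κ → ℕ) => H I ν fun i => x (g i)) fun I ν x => F I ν fun i => x (g i) :=
  h.subst fun i => some (g i)

/-- The second function may be correct only for certain values of its extra argument, as long as the
first one delivers such a value. Inductive counting depends on this: the next layer is counted
correctly only if the size of the current one is given. -/
theorem bind {H' : ∀ I : Instance J U, Numbering I → (ι → ℕ) → ℕ → Prop}
    {K : ∀ I : Instance J U, Numbering I → (ι → ℕ) → ℕ → ℕ} (hF : LogFun H F)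
    (hK : LogFun (fun I ν (y : Option ι → ℕ) => H' I ν (fun i => y (some i)) (y none))
      fun I ν y => K I ν (fun i => y (some i)) (y none))
    (hH : ∀ I ν x, H I ν x → H' I ν x (F I ν x)) :
    LogFun H fun I ν x => K I ν x (F I ν x) := by
  intro r ℓ hℓ hr
  obtain ⟨c, hc, h⟩ := hF r ℓ hℓ hr
  obtain ⟨c', hc', h'⟩ := hK (fun o => o.elim ℓ r) (ℓ + 1) (by omega) fun o => by
    cases o
    exacts [Nat.lt_succ_self ℓ, (hr _).trans (Nat.lt_succ_self ℓ)]
  refine ⟨.seq c (.seq c' (.instr (.copy ℓ (ℓ + 1)))), ⟨hc, hc', trivial⟩,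
    fun I ν a m σ h0 h1 hx => .seq ((h I ν a m σ h0 h1 hx).mono fun σ1 ⟨h2, h3⟩ => .seq ?_)⟩
  have hx' : (fun i => σ1.mem (r i)) = fun i => σ.mem (r i) := funext fun i => h2 _ (hr i)
  have := h' I ν a m σ1 (by rw [h2 0 (by omega), h0]) (by rw [h2 1 (by omega), h1])
    (by simp only [Option.elim, h3, hx']; exact hH _ _ _ hx)
  refine this.mono fun σ2 ⟨h4, h5⟩ => .copy ⟨?_, ?_⟩
  · intro x hx
    rw [St.put_mem_ne _ _ hx.ne, h4 x (by omega), h2 x hx]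
  · simp only [St.put_mem_same, h5, Option.elim, h3, hx']

theorem comp₂ {K : ∀ I : Instance J U, Numbering I → ℕ → ℕ → ℕ}
    (hK : LogFun (fun _ _ _ => True) fun I ν (y : Bool → ℕ) => K I ν (y false) (y true))
    (hF : LogFun H F) (hG : LogFun H G) : LogFun H fun I ν x => K I ν (F I ν x) (G I ν x) := by
  have h1 := hK.rename fun b : Bool => (if b then none else some none : Option (Option ι))
  have h2 := bind (H' := fun I ν x v => True)
    (K := fun I ν (x : Option ι → ℕ) v => K I ν (x none) v) (hG.rename (some : ι → Option ι))
    (by simpa using h1) fun _ _ _ _ => trivial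
  exact hF.bind (H' := fun I ν x v => H I ν x) (K := fun I ν x v => K I ν v (G I ν x)) h2
    fun _ _ _ h => h

theorem minus (hF : LogFun H F) (hG : LogFun H G) : LogFun H fun I ν x => F I ν x - G I ν x :=
  comp₂ (K := fun _ _ a b => a - b)
    (instr (fun r ℓ => .minus ℓ (r false) (r true)) (by simp [Instr.Pure]) (by simp)
      fun _ _ _ _ _ _ => rfl) hF hG

/-- Recursion over the elements of an object. -/
theorem fold {HB : ∀ I : Instance J U, Numbering I → (ι → ℕ) → ℕ → ℕ → Prop}
    {F : ∀ I : Instance J U, Numbering I → (ι → ℕ) → ℕ → ℕ}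
    {B : ∀ I : Instance J U, Numbering I → (ι → ℕ) → ℕ → ℕ → ℕ} (X : J)
    (hA : LogFun H fun I ν x => F I ν x (Fintype.card (I.F.obj X)))
    (hB : LogFun (fun I ν (y : Option (Option ι) → ℕ) =>
        HB I ν (fun i => y (some (some i))) (y (some none)) (y none))
      fun I ν y => B I ν (fun i => y (some (some i))) (y (some none)) (y none))
    (h : ∀ I ν x k, H I ν x → k < Fintype.card (I.F.obj X) → HB I ν x k (F I ν x (k + 1)) ∧
      B I ν x k (F I ν x (k + 1)) = F I ν x k) :
    LogFun H fun I ν x => F I ν x 0 := by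
  intro r ℓ hℓ hr
  obtain ⟨c, hc, hA⟩ := hA r ℓ hℓ hr
  obtain ⟨c', hc', hB⟩ := hB (fun o => o.elim ℓ fun o => o.elim (ℓ + 1) r) (ℓ + 2) (by omega)
    fun o => by
      rcases o with _ | _ | i
      exacts [show ℓ < ℓ + 2 by omega, show ℓ + 1 < ℓ + 2 by omega, (hr i).trans (by omega)]
  refine ⟨.seq c (.seq (.instr (.card (ℓ + 1) X)) (.ifNZ (ℓ + 1) (.loop
    (.seq (.instr (.minus (ℓ + 1) (ℓ + 1) 1)) (.seq c' (.seq (.instr (.copy ℓ (ℓ + 2)))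
      (.instr (.minus (ℓ + 2) 1 (ℓ + 1)))))) (ℓ + 2)))),
    ⟨hc, trivial, trivial, hc', trivial, trivial⟩, fun I ν a m σ h0 h1 hx =>
    .seq ((hA I ν a m σ h0 h1 hx).mono fun σ1 ⟨h2, h3⟩ =>
      .seq (.card (.ifNZ (fun hn => ?_) fun hn => ?_)))⟩
  · refine .loop (fun k σ' => (∀ x < ℓ, σ'.mem x = σ.mem x) ∧ σ'.mem (ℓ + 1) = k ∧ 0 < k ∧
      k ≤ Fintype.card (I.F.obj X) ∧ σ'.mem ℓ = F I ν (fun i => σ.mem (r i)) k) ?_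
      (k := Fintype.card (I.F.obj X)) ⟨?_, ?_, ?_, le_rfl, ?_⟩
    · rintro k σ2 ⟨h4, h5, h6, h7, h8⟩
      obtain ⟨k, rfl⟩ : ∃ k', k = k' + 1 := ⟨k - 1, by omega⟩
      refine .seq (.minus (.seq ?_))
      have e1 : σ2.mem 1 = 1 := by rw [h4 1 (by omega), h1]
      rw [h5, e1, Nat.add_sub_cancel]
      obtain ⟨h9, h10⟩ := h I ν _ k hx h7
      have hy : (fun i => (σ2.put (ℓ + 1) k).mem (r i)) = fun i => σ.mem (r i) := funext fun i => by
        have := hr i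
        rw [St.put_mem_ne _ _ (by omega), h4 _ this]
      have e8 : (σ2.put (ℓ + 1) k).mem ℓ = F I ν (fun i => σ.mem (r i)) (k + 1) := by
        rw [St.put_mem_ne _ _ (by omega), h8]
      have := hB I ν a m (σ2.put (ℓ + 1) k)
        (by rw [St.put_mem_ne _ _ (by omega), h4 0 (by omega), h0])
        (by rw [St.put_mem_ne _ _ (by omega), e1])
        (by simpa only [Option.elim, hy, e8, St.put_mem_same] using h9)
      refine this.mono fun σ3 ⟨h11, h12⟩ => .seq (.copy (.minus ?_))
      have e2 : σ3.mem 1 = 1 := by rw [h11 1 (by omega), St.put_mem_ne _ _ (by omega), e1]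
      have e3 : σ3.mem (ℓ + 1) = k := by rw [h11 _ (by omega), St.put_mem_same]
      have e4 : σ3.mem (ℓ + 2) = F I ν (fun i => σ.mem (r i)) k := by
        rw [h12, ← h10]; simp only [Option.elim, hy, e8, St.put_mem_same]
      have e5 : ∀ x < ℓ, σ3.mem x = σ.mem x := fun x hx => by
        rw [h11 x (by omega), St.put_mem_ne _ _ (by omega), h4 x hx]
      have e6 : ∀ x < ℓ, x ≠ ℓ ∧ x ≠ ℓ + 2 := fun x hx => by omega
      have e7 : (1 : ℕ) ≠ ℓ := by omega
      rcases Nat.eq_zero_or_pos k with rfl | hk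
      · refine .inl ⟨by simp [St.put_mem, e2, e3, e7], fun x hx => ?_, ?_⟩
        · simp [St.put_mem, e6 x hx, e5 x hx]
        · simp [St.put_mem, e4]
      · refine .inr ⟨by simp [St.put_mem, e2, e3, e7]; omega, k, by omega,
          fun x hx => ?_, ?_, hk, by omega, ?_⟩
        · simp [St.put_mem, e6 x hx, e5 x hx]
        · simp [St.put_mem, e3]
        · simp [St.put_mem, e4]
    · intro x hx
      rw [St.put_mem_ne _ _ (by omega), h2 x hx]
    · simp [Instance.input]
    · simp only [St.put_mem_same] at hn
      exact Nat.pos_of_ne_zero hn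
    · rw [St.put_mem_ne _ _ (by omega), h3]
  · simp only [St.put_mem_same] at hn
    have hn' : Fintype.card (I.F.obj X) = 0 := hn
    refine ⟨fun x hx => ?_, ?_⟩
    · rw [St.put_mem_ne _ _ (by omega), h2 x hx]
    · rw [St.put_mem_ne _ _ (by omega), h3]
      simp only [hn']

end LogFun

namespace LogDec

variable {P Q : ∀ I : Instance J U, Numbering I → (ι → ℕ) → Prop}

theorem congr (h : LogDec P) (hPQ : ∀ I ν x, P I ν x ↔ Q I ν x) : LogDec Q :=
  LogFun.congr h fun I ν x _ => ⟨trivial, flag_congr (hPQ I ν x)⟩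

/-- Complementation is a subtraction because both truth values are certified: every halting
computation yields the right flag, and one exists whether the predicate holds or not. -/
theorem not (h : LogDec P) : LogDec fun I ν x => ¬ P I ν x :=
  ((LogFun.const 1).minus h).congr fun I ν x _ => ⟨trivial, by
    by_cases hP : P I ν x <;> simp [flag, hP]⟩

theorem and (h : LogDec P) (h' : LogDec Q) : LogDec fun I ν x => P I ν x ∧ Q I ν x :=
  (LogFun.minus h h'.not).congr fun I ν x _ => ⟨trivial, by
    by_cases hP : P I ν x <;> by_cases hQ : Q I ν x <;> simp [flag, hP, hQ]⟩

theorem const (p : Prop) : LogDec fun (_ : Instance J U) _ (_ : ι → ℕ) => p :=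
  LogFun.const (flag p)

theorem forall_mem {α : Type} {P : α → ∀ I : Instance J U, Numbering I → (ι → ℕ) → Prop}
    (L : List α) (h : ∀ a ∈ L, LogDec (P a)) : LogDec fun I ν x => ∀ a ∈ L, P a I ν x := by
  induction L with
  | nil => exact (const True).congr (by simp)
  | cons a L ih =>
    exact ((h a (by simp)).and (ih fun b hb => h b (by simp [hb]))).congr (by simp)

theorem lt {F G : ∀ I : Instance J U, Numbering I → (ι → ℕ) → ℕ}
    (hF : LogFun (fun _ _ _ => True) F) (hG : LogFun (fun _ _ _ => True) G) :
    LogDec fun I ν x => F I ν x < G I ν x :=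
  ((LogFun.const 1).minus ((LogFun.const 1).minus (hG.minus hF))).congr fun I ν x _ =>
    ⟨trivial, by by_cases h : F I ν x < G I ν x <;> simp [flag, h] <;> omega⟩

/-- The state of the fold tells whether a witness occurs among the elements from `k` on. Disjunction
of flags is `1 - (1 - a - b)` with truncated subtraction, so no addition is needed. -/
theorem ex {P : ∀ I : Instance J U, Numbering I → (ι → ℕ) → ℕ → Prop} (X : J)
    (h : LogDec fun I ν (y : Option ι → ℕ) => P I ν (fun i => y (some i)) (y none)) :
    LogDec fun I ν x => ∃ k < Fintype.card (I.F.obj X), P I ν x k := by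
  have hB : LogFun (fun _ _ _ => True) fun I ν (y : Option (Option ι) → ℕ) =>
      1 - (1 - flag (P I ν (fun i => y (some (some i))) (y (some none))) - y none) :=
    (LogFun.const 1).minus (((LogFun.const 1).minus (LogFun.rename h some)).minus (LogFun.var none))
  refine (LogFun.fold (F := fun I ν x k =>
    flag (∃ k', k ≤ k' ∧ k' < Fintype.card (I.F.obj X) ∧ P I ν x k'))
    (HB := fun _ _ _ _ _ => True) (B := fun I ν x k v => 1 - (1 - flag (P I ν x k) - v)) X
    ((LogFun.const 0).congr fun I ν x _ => ⟨trivial, (flag_false ?_).symm⟩) hB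
    fun I ν x k _ hk => ⟨trivial, ?_⟩).congr fun I ν x _ => ⟨trivial, flag_congr (by simp)⟩
  · rintro ⟨k', h1, h2, -⟩; omega
  · have : (∃ k', k ≤ k' ∧ k' < Fintype.card (I.F.obj X) ∧ P I ν x k') ↔ P I ν x k ∨
        ∃ k', k + 1 ≤ k' ∧ k' < Fintype.card (I.F.obj X) ∧ P I ν x k' := by
      constructor
      · rintro ⟨k', h1, h2, h3⟩
        rcases h1.eq_or_lt with rfl | h1
        exacts [.inl h3, .inr ⟨k', h1, h2, h3⟩]
      · rintro (h | ⟨k', h1, h2, h3⟩)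
        exacts [⟨k, le_rfl, hk, h⟩, ⟨k', by omega, h2, h3⟩]
    rw [flag_congr this]
    generalize (∃ k', k + 1 ≤ k' ∧ k' < Fintype.card (I.F.obj X) ∧ P I ν x k') = p
    by_cases h1 : P I ν x k <;> by_cases h2 : p <;> simp [flag, h1, h2]

end LogDec

end LogSpace

end CatQuery
end
set_option linter.unusedSectionVars false
noncomputable section
namespace CatQuery

/-! ### Reachability by inductive counting -/

section Layers

variable (n : ℕ) (S : ℕ → Prop) (N : ℕ → ℕ → Prop)

/-- The vertex `v` is the end of a path with at most `i` vertices that starts in `S`. -/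
def Layer : ℕ → ℕ → Prop
  | 0, _ => False
  | i + 1, v => S v ∨ ∃ w < n, Layer i w ∧ N w v

open Classical in
/-- The vertices below `n` in a layer. -/
def layerSet (i : ℕ) : Finset ℕ := (Finset.range n).filter (Layer n S N i)

variable {n S N}

theorem mem_layerSet {i v : ℕ} : v ∈ layerSet n S N i ↔ v < n ∧ Layer n S N i v := by
  simp [layerSet]

theorem Layer.succ {i v : ℕ} (h : Layer n S N i v) : Layer n S N (i + 1) v := by
  induction i generalizing v with
  | zero => exact h.elim
  | succ i ih =>
    rcases h with h | ⟨w, hw, h, hN⟩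
    exacts [.inl h, .inr ⟨w, hw, ih h, hN⟩]

theorem layerSet_mono : Monotone (layerSet n S N) :=
  monotone_nat_of_le_succ fun _ _ h => by
    rw [mem_layerSet] at h ⊢
    exact ⟨h.1, h.2.succ⟩

/-- The parts of the layers below `n` increase, have at most `n` elements, and stay constant once
two consecutive ones have equal size. They are therefore stable from index `n` on. -/
theorem Layer.of_lt {i v : ℕ} (h : Layer n S N i v) (hv : v < n) : Layer n S N n v := by
  have step : ∀ i, (layerSet n S N i).card = (layerSet n S N (i + 1)).card →
      (layerSet n S N (i + 1)).card = (layerSet n S N (i + 2)).card := fun i hi => by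
    have h1 := Finset.eq_of_subset_of_card_le (layerSet_mono (S := S) (N := N) (n := n)
      (Nat.le_succ i)) hi.ge
    refine congrArg _ (Finset.ext fun v => ?_)
    rw [mem_layerSet, mem_layerSet]
    refine and_congr_right fun _ => or_congr_right (exists_congr fun w => ?_)
    rw [← and_assoc, ← and_assoc, ← mem_layerSet, ← mem_layerSet, h1]
  have hle : ∀ i, (layerSet n S N i).card ≤ n := fun i => by
    simpa using Finset.card_le_card (t := Finset.range n) fun v hv =>
      Finset.mem_range.2 (mem_layerSet.1 hv).1
  have h1 := Nat.stabilises_of_monotone (f := fun i => (layerSet n S N i).card)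
    (fun i j hij => Finset.card_le_card (layerSet_mono hij)) hle step (le_max_left n i)
  have h2 := Finset.eq_of_subset_of_card_le (layerSet_mono (S := S) (N := N) (n := n)
    (le_max_left n i)) h1.le
  have h3 := layerSet_mono (le_max_right n i) (mem_layerSet.2 ⟨hv, h⟩)
  rw [← h2] at h3
  exact (mem_layerSet.1 h3).2

/-- A layer is continued only from vertices below `n`; this loses nothing, because no edge leaves a
larger one. -/
theorem exists_layer_iff (hN : ∀ w v, N w v → w < n) {v : ℕ} :
    (∃ i, Layer n S N i v) ↔ ∃ u, S u ∧ Relation.ReflTransGen N u v := by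
  constructor
  · rintro ⟨i, h⟩
    induction i generalizing v with
    | zero => exact h.elim
    | succ i ih =>
      rcases h with h | ⟨w, hw, h, hN⟩
      · exact ⟨v, h, .refl⟩
      · obtain ⟨u, hu, h1⟩ := ih h
        exact ⟨u, hu, h1.tail hN⟩
  · rintro ⟨u, hu, h⟩
    induction h with
    | refl => exact ⟨1, .inl hu⟩
    | tail _ h ih =>
      obtain ⟨i, hi⟩ := ih
      exact ⟨i + 1, .inr ⟨_, hN _ _ h, hi, h⟩⟩

end Layers

/-! ### Guessing a number and certifying membership in a layer -/

section Counting

variable {J U : Type} [SmallCategory J] [DataDomain U] {ι : Type}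
  {S T : ∀ I : Instance J U, Numbering I → (ι → ℕ) → ℕ → Prop}
  {N : ∀ I : Instance J U, Numbering I → (ι → ℕ) → ℕ → ℕ → Prop}

/-- A number of an element can be guessed. -/
theorem exists_guess (X : J) {ℓ : ℕ} (hℓ : 2 ≤ ℓ) : ∃ c : Cmd J U, c.All Instr.Pure ∧
    ∀ (inp : Input J U) (m : Bool) (σ : St) (u : ℕ), σ.mem 0 = 0 → σ.mem 1 = 1 →
      (m = true → u < inp.card X) → Tr inp m c σ fun σ' => (∀ x < ℓ, σ'.mem x = σ.mem x) ∧
        σ'.mem ℓ < inp.card X ∧ (m = true → σ'.mem ℓ = u) := by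
  refine ⟨.seq (.instr (.card ℓ X)) (.loop (.seq
    (.seq (.instr (.minus (ℓ + 1) 1 ℓ)) (.ifNZ (ℓ + 1) (.loop .skip 0)))
    (.seq (.instr (.minus ℓ ℓ 1)) (.instr (.choose (ℓ + 1))))) (ℓ + 1)),
    ⟨trivial, ⟨trivial, trivial⟩, trivial, trivial⟩, fun inp m σ u h0 h1 hu => .seq (.card ?_)⟩
  -- A guess counts down from the number of elements and decides after each decrement whether to
  -- stop. The existential mode maintains `u < k`, so the target has not been passed.
  refine .loop (fun k σ' => (∀ x < ℓ, σ'.mem x = σ.mem x) ∧ σ'.mem ℓ = k ∧ k ≤ inp.card X ∧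
    (m = true → u < k)) ?_ ⟨fun x hx => St.put_mem_ne _ _ hx.ne, St.put_mem_same _ _ _, le_rfl, hu⟩
  rintro k σ1 ⟨h2, h3, h4, h5⟩
  have e1 : σ1.mem 1 = 1 := by rw [h2 1 (by omega), h1]
  -- Counting below `0` is a failed guess. The chosen bit is `1` exactly when the target `u = k - 1`
  -- is reached.
  refine .seq (.require (by rw [h2 0 (by omega), h0]) e1 (by omega) (fun hk => .seq (.minus
    (.choose (b₀ := flag (u = k - 1)) (flag_le_one _) fun b hb hm => ?_))) fun hm => ?_)
  · have e2 : ((σ1.put (ℓ + 1) 0).mem ℓ - (σ1.put (ℓ + 1) 0).mem 1) = k - 1 := by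
      rw [St.put_mem_ne _ _ (by omega), St.put_mem_ne _ _ (by omega), h3, e1]
    rw [e2]
    have e3 : ∀ x < ℓ, (((σ1.put (ℓ + 1) 0).put ℓ (k - 1)).put (ℓ + 1) b).mem x = σ.mem x :=
      fun x hx => by
        rw [St.put_mem_ne _ _ (by omega), St.put_mem_ne _ _ (by omega), St.put_mem_ne _ _ (by omega),
          h2 x hx]
    have e4 : (((σ1.put (ℓ + 1) 0).put ℓ (k - 1)).put (ℓ + 1) b).mem ℓ = k - 1 := by
      rw [St.put_mem_ne _ _ (by omega), St.put_mem_same]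
    rw [h3] at hk
    rw [St.put_mem_same]
    by_cases hb0 : b = 0
    · refine .inr ⟨hb0, k - 1, by omega, e3, e4, by omega, fun hm' => ?_⟩
      have := hm hm'
      rw [hb0, eq_comm, flag_eq_zero] at this
      have := h5 hm'
      omega
    · refine .inl ⟨hb0, e3, by rw [e4]; omega, fun hm' => ?_⟩
      have := hm hm'
      rw [e4]
      by_contra hne
      exact hb0 (this.trans (flag_false (Ne.symm hne)))
  · have := h5 hm
    omega

/-- Membership in a layer can be certified. -/
theorem exists_certify (X : J)
    (hS : LogDec fun I ν (y : Option ι → ℕ) => S I ν (fun i => y (some i)) (y none))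
    (hN : LogDec fun I ν (y : Option (Option ι) → ℕ) =>
      N I ν (fun i => y (some (some i))) (y (some none)) (y none)) (i w : ι)
    (r : ι → ℕ) {ℓ : ℕ} (hℓ : 2 ≤ ℓ) (hr : ∀ i, r i < ℓ) : ∃ c : Cmd J U, c.All Instr.Pure ∧
      ∀ (I : Instance J U) (ν : Numbering I) (a : List ℕ) (m : Bool) (σ : St) (x : ι → ℕ),
        σ.mem 0 = 0 → σ.mem 1 = 1 → (∀ i, σ.mem (r i) = x i) →
        (m = true → Layer (Fintype.card (I.F.obj X)) (S I ν x) (N I ν x) (x i) (x w)) →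
        Tr (I.input ν a) m c σ fun σ' => (∀ x < ℓ, σ'.mem x = σ.mem x) ∧
          Layer (Fintype.card (I.F.obj X)) (S I ν x) (N I ν x) (x i) (x w) := by
  obtain ⟨cS, pS, hS⟩ := hS (fun o => o.elim ℓ r) (ℓ + 2) (by omega) fun o => by
    rcases o with _ | i
    exacts [show ℓ < ℓ + 2 by omega, (hr i).trans (by omega)]
  obtain ⟨cN, pN, hN⟩ := hN (fun o => o.elim ℓ fun o => o.elim (ℓ + 3) r) (ℓ + 4) (by omega)
    fun o => by
      rcases o with _ | _ | i
      exacts [show ℓ < ℓ + 4 by omega, show ℓ + 3 < ℓ + 4 by omega, (hr i).trans (by omega)]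
  obtain ⟨cG, pG, hG⟩ := exists_guess (U := U) X (ℓ := ℓ + 3) (by omega)
  refine ⟨.seq (.instr (.copy ℓ (r w))) (.seq (.instr (.copy (ℓ + 1) (r i))) (.loop (.seq
    (.seq (.instr (.minus (ℓ + 2) 1 (ℓ + 1))) (.ifNZ (ℓ + 2) (.loop .skip 0)))
    (.seq (.instr (.minus (ℓ + 1) (ℓ + 1) 1)) (.seq cS (.seq (.instr (.minus (ℓ + 3) 1 (ℓ + 2)))
      (.ifNZ (ℓ + 3) (.seq cG (.seq cN (.seq
        (.seq (.instr (.minus (ℓ + 5) 1 (ℓ + 4))) (.ifNZ (ℓ + 5) (.loop .skip 0)))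
        (.instr (.copy ℓ (ℓ + 3)))))))))))  (ℓ + 2))),
    ⟨trivial, trivial, ⟨trivial, trivial⟩, trivial, pS, trivial, pG, pN, ⟨trivial, trivial⟩,
      trivial⟩, fun I ν a m σ x h0 h1 hx hm => .seq (.copy (.seq (.copy ?_)))⟩
  generalize hL : Layer (Fintype.card (I.F.obj X)) (S I ν x) (N I ν x) = L at hm ⊢
  have ew := hr w
  have ei := hr i
  -- The path is guessed backwards from `x w`, with `k` vertices still allowed. Soundness is kept as
  -- an implication from the current vertex to `x w`; in the existential mode the current vertex
  -- really is in layer `k`, so a continuation exists.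
  refine .loop (fun k σ' => (∀ x < ℓ, σ'.mem x = σ.mem x) ∧ σ'.mem (ℓ + 1) = k ∧
    (L k (σ'.mem ℓ) → L (x i) (x w)) ∧ (m = true → L k (σ'.mem ℓ))) ?_ (k := x i)
    ⟨fun y hy => ?_, ?_, ?_, ?_⟩
  · rintro k σ1 ⟨h2, h3, h4, h5⟩
    have e1 : σ1.mem 1 = 1 := by rw [h2 1 (by omega), h1]
    have e0 : σ1.mem 0 = 0 := by rw [h2 0 (by omega), h0]
    refine .seq (.require e0 e1 (by omega) (fun hk => .seq (.minus (.seq ?_))) fun hm' => ?_)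
    · obtain ⟨k, rfl⟩ : ∃ k', k = k' + 1 := ⟨k - 1, by omega⟩
      have e2 : (σ1.put (ℓ + 2) 0).mem (ℓ + 1) - (σ1.put (ℓ + 2) 0).mem 1 = k := by
        rw [St.put_mem_ne _ _ (by omega), St.put_mem_ne _ _ (by omega), h3, e1, Nat.add_sub_cancel]
      rw [e2]
      set σ2 := (σ1.put (ℓ + 2) 0).put (ℓ + 1) k with hσ2
      have k2 : ∀ y < ℓ + 1, σ2.mem y = σ1.mem y := fun y hy => by
        rw [hσ2, St.put_mem_ne _ _ (by omega), St.put_mem_ne _ _ (by omega)]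
      have k2' : σ2.mem (ℓ + 1) = k := St.put_mem_same _ _ _
      have hx2 : ∀ i, σ2.mem (r i) = x i := fun i => by
        have := hr i
        rw [k2 _ (by omega), h2 _ this, hx]
      refine (hS I ν a m σ2 (by rw [k2 0 (by omega), e0]) (by rw [k2 1 (by omega), e1])
        trivial).mono fun σ3 ⟨h6, h7⟩ => .seq (.minus (.ifNZ (fun hn => ?_) fun hn => ?_))
      · simp only [Option.elim, hx2, k2 ℓ (by omega)] at h7
        have f1 : σ3.mem 1 = 1 := by rw [h6 1 (by omega), k2 1 (by omega), e1]
        rw [St.put_mem_same, f1] at hn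
        have hf : σ3.mem (ℓ + 2) = 0 := by omega
        have hnS : ¬ S I ν x (σ1.mem ℓ) := by rwa [h7, flag_eq_zero] at hf
        have hex : m = true → ∃ u < Fintype.card (I.F.obj X), L k u ∧ N I ν x u (σ1.mem ℓ) :=
          fun hm' => by
            have := h5 hm'
            rw [← hL] at this ⊢
            exact this.resolve_left hnS
        -- A predecessor exists only in the existential mode; in the universal mode the number
        -- handed to the guess is irrelevant, and `0` is used.
        obtain ⟨u, hu⟩ : ∃ u, m = true → u < Fintype.card (I.F.obj X) ∧ L k u ∧
            N I ν x u (σ1.mem ℓ) := by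
          by_cases hm' : m = true
          · obtain ⟨u, hu⟩ := hex hm'
            exact ⟨u, fun _ => hu⟩
          · exact ⟨0, fun h => absurd h hm'⟩
        have k3 : ∀ y < ℓ + 3, (σ3.put (ℓ + 3) (σ3.mem 1 - σ3.mem (ℓ + 2))).mem y = σ3.mem y :=
          fun y hy => St.put_mem_ne _ _ (by omega)
        refine .seq ((hG (I.input ν a) m _ u
          (by rw [k3 0 (by omega), h6 0 (by omega), k2 0 (by omega), e0])
          (by rw [k3 1 (by omega), f1]) fun hm' => (hu hm').1).mono
          fun σ4 ⟨h8, h9, h10⟩ => .seq ?_)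
        have k4 : ∀ y < ℓ + 1, σ4.mem y = σ1.mem y := fun y hy => by
          rw [h8 y (by omega), k3 y (by omega), h6 y (by omega), k2 y hy]
        have k4' : σ4.mem (ℓ + 1) = k := by
          rw [h8 _ (by omega), k3 _ (by omega), h6 _ (by omega), k2']
        have k4'' : σ4.mem (ℓ + 2) = 0 := by rw [h8 _ (by omega), k3 _ (by omega), hf]
        have hx4 : ∀ i, σ4.mem (r i) = x i := fun i => by
          have := hr i
          rw [k4 _ (by omega), h2 _ this, hx]
        refine (hN I ν a m σ4 (by rw [k4 0 (by omega), e0]) (by rw [k4 1 (by omega), e1])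
          trivial).mono fun σ5 ⟨h11, h12⟩ => .seq ?_
        simp only [Option.elim, hx4, k4 ℓ (by omega)] at h12
        refine .require (by rw [h11 0 (by omega), k4 0 (by omega), e0])
          (by rw [h11 1 (by omega), k4 1 (by omega), e1]) (by omega) (fun hN' => .copy ?_)
          fun hm' => ?_
        · have hN'' : N I ν x (σ4.mem (ℓ + 3)) (σ1.mem ℓ) := by
            by_contra hc
            exact hN' (h12.trans (flag_false hc))
          have k5 : (σ5.put (ℓ + 5) 0).mem (ℓ + 3) = σ4.mem (ℓ + 3) := by
            rw [St.put_mem_ne _ _ (by omega), h11 _ (by omega)]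
          rw [k5]
          have k6 : ∀ y < ℓ + 3, y ≠ ℓ →
              ((σ5.put (ℓ + 5) 0).put ℓ (σ4.mem (ℓ + 3))).mem y = σ4.mem y := fun y hy hne => by
            rw [St.put_mem_ne _ _ hne, St.put_mem_ne _ _ (by omega), h11 y (by omega)]
          refine .inr ⟨by rw [k6 _ (by omega) (by omega), k4''], k, by omega, fun y hy => ?_, ?_,
            fun h => h4 ?_, fun hm' => ?_⟩
          · rw [k6 y (by omega) (by omega), k4 y (by omega), h2 y hy]
          · rw [k6 _ (by omega) (by omega), k4']
          · rw [St.put_mem_same] at h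
            rw [← hL] at h ⊢
            exact .inr ⟨_, h9, h, hN''⟩
          · rw [St.put_mem_same, h10 hm']
            exact (hu hm').2.1
        · rw [h12, h10 hm', flag_true (hu hm').2.2]
          omega
      · simp only [Option.elim, hx2, k2 ℓ (by omega)] at h7
        rw [St.put_mem_same, h6 1 (by omega), k2 1 (by omega), e1] at hn
        have hf : σ3.mem (ℓ + 2) ≠ 0 := by omega
        have hS' : S I ν x (σ1.mem ℓ) := by
          by_contra hc
          exact hf (h7.trans (flag_false hc))
        refine .inl ⟨by rwa [St.put_mem_ne _ _ (by omega)], fun y hy => ?_, h4 ?_⟩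
        · rw [St.put_mem_ne _ _ (by omega), h6 y (by omega), k2 y (by omega), h2 y hy]
        · rw [← hL]
          exact .inl hS'
    · have := h5 hm'
      rw [h3]
      rintro rfl
      rw [← hL] at this
      exact this
  · rw [St.put_mem_ne _ _ (by omega), St.put_mem_ne _ _ (by omega)]
  · rw [St.put_mem_same, St.put_mem_ne _ _ (by omega), hx]
  · rw [St.put_mem_ne _ _ (by omega), St.put_mem_same, hx]
    exact id
  · rw [St.put_mem_ne _ _ (by omega), St.put_mem_same, hx]
    exact hm

end Counting

end CatQuery
end
set_option linter.unusedSectionVars false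
noncomputable section
namespace CatQuery

/-! ### Inductive counting of layers -/

section Counting

variable {J U : Type} [SmallCategory J] [DataDomain U] {ι : Type}
  {S T : ∀ I : Instance J U, Numbering I → (ι → ℕ) → ℕ → Prop}
  {N : ∀ I : Instance J U, Numbering I → (ι → ℕ) → ℕ → ℕ → Prop}

open Classical in
/-- After the visit of the elements from `k` on, some elements of `L` among them are certified (all
of them if `m`), register `ℓ` tells whether one of these satisfies `T`, and register `ℓ + 2` contains
the number of the other elements of `L`. -/
structure Tally (σ : St) (L : Finset ℕ) (T : ℕ → Prop) (m : Bool) (ℓ k : ℕ) (σ' : St) : Prop where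
  keep : ∀ x < ℓ, σ'.mem x = σ.mem x
  pos : σ'.mem (ℓ + 1) = k
  count : ∃ D ⊆ L.filter (k ≤ ·), (m = true → D = L.filter (k ≤ ·)) ∧
    σ'.mem (ℓ + 2) = L.card - D.card ∧ σ'.mem ℓ = flag (∃ v ∈ D, T v)

theorem Tally.of_mem {σ σ₁ σ₂ : St} {L : Finset ℕ} {T : ℕ → Prop} {m : Bool} {ℓ k : ℕ}
    (h : Tally σ L T m ℓ k σ₁) (h' : ∀ x < ℓ + 3, σ₂.mem x = σ₁.mem x) :
    Tally σ L T m ℓ k σ₂ where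
  keep x hx := by rw [h' x (by omega), h.keep x hx]
  pos := by rw [h' _ (by omega), h.pos]
  count := by
    rw [h' _ (by omega), h' ℓ (by omega)]
    exact h.count

/-- Passing over an element of `L` is harmless in the universal mode: it then remains uncertified
and keeps the counter away from `0`. Only the existential mode must not do so. -/
theorem Tally.skip {σ σ₁ σ₂ : St} {L : Finset ℕ} {T : ℕ → Prop} {m : Bool} {ℓ k : ℕ}
    (h : Tally σ L T m ℓ (k + 1) σ₁) (h' : ∀ x < ℓ + 3, x ≠ ℓ + 1 → σ₂.mem x = σ₁.mem x)
    (hk : σ₂.mem (ℓ + 1) = k) (hm : m = true → k ∉ L) : Tally σ L T m ℓ k σ₂ where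
  keep x hx := by rw [h' x (by omega) (by omega), h.keep x hx]
  pos := hk
  count := by
    classical
    rw [h' _ (by omega) (by omega), h' ℓ (by omega) (by omega)]
    obtain ⟨D, h1, h2, h3⟩ := h.count
    refine ⟨D, fun v hv => ?_, fun hm' => ?_, h3⟩
    · have := Finset.mem_filter.1 (h1 hv)
      exact Finset.mem_filter.2 ⟨this.1, by omega⟩
    · rw [h2 hm']
      refine Finset.filter_congr fun v hv => ?_
      have : v ≠ k := fun h => hm hm' (h ▸ hv)
      omega

/-- Certification makes `k` a member of `L` in both modes, so decrementing the counter keeps it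
equal to the number of uncertified members. -/
theorem Tally.step {σ σ₁ σ₂ : St} {L : Finset ℕ} {T : ℕ → Prop} {m : Bool} {ℓ k : ℕ}
    (h : Tally σ L T m ℓ (k + 1) σ₁) (h' : ∀ x < ℓ, σ₂.mem x = σ₁.mem x)
    (hk : σ₂.mem (ℓ + 1) = k) (hc : σ₂.mem (ℓ + 2) = σ₁.mem (ℓ + 2) - 1)
    (hf : T k → σ₂.mem ℓ = 1) (hf' : ¬ T k → σ₂.mem ℓ = σ₁.mem ℓ) (hm : k ∈ L) : Tally σ L T m ℓ k σ₂ where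
  keep x hx := by rw [h' x hx, h.keep x hx]
  pos := hk
  count := by
    classical
    obtain ⟨D, h1, h2, h3, h4⟩ := h.count
    have hD : k ∉ D := fun hv => by
      have := (Finset.mem_filter.1 (h1 hv)).2
      omega
    refine ⟨insert k D, fun v hv => ?_, fun hm' => ?_, ?_, ?_⟩
    · rcases Finset.mem_insert.1 hv with rfl | hv
      · exact Finset.mem_filter.2 ⟨hm, le_rfl⟩
      · have := Finset.mem_filter.1 (h1 hv)
        exact Finset.mem_filter.2 ⟨this.1, by omega⟩
    · rw [h2 hm']
      ext v
      simp only [Finset.mem_insert, Finset.mem_filter]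
      constructor
      · rintro (rfl | ⟨h5, h6⟩)
        exacts [⟨hm, le_rfl⟩, ⟨h5, by omega⟩]
      · rintro ⟨h5, h6⟩
        rcases h6.eq_or_lt with rfl | h6
        exacts [.inl rfl, .inr ⟨h5, h6⟩]
    · rw [hc, h3, Finset.card_insert_of_notMem hD]
      omega
    · by_cases hT : T k
      · rw [hf hT, flag_true ⟨k, Finset.mem_insert_self _ _, hT⟩]
      · rw [hf' hT, h4]
        refine flag_congr ⟨fun ⟨v, hv, hT⟩ => ⟨v, Finset.mem_insert_of_mem hv, hT⟩, ?_⟩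
        rintro ⟨v, hv, hT'⟩
        rcases Finset.mem_insert.1 hv with rfl | hv
        exacts [absurd hT' hT, ⟨v, hv, hT'⟩]

/-- If the size of a layer is known, then one can decide whether an element of it satisfies `T`. -/
theorem LogFun.existsIn (X : J)
    (hS : LogDec fun I ν (y : Option ι → ℕ) => S I ν (fun i => y (some i)) (y none))
    (hN : LogDec fun I ν (y : Option (Option ι) → ℕ) =>
      N I ν (fun i => y (some (some i))) (y (some none)) (y none))
    (hT : LogDec fun I ν (y : Option ι → ℕ) => T I ν (fun i => y (some i)) (y none)) (i c : ι) :
    LogFun (fun I ν x =>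
        x c = (layerSet (Fintype.card (I.F.obj X)) (S I ν x) (N I ν x) (x i)).card)
      fun I ν x => flag (∃ v < Fintype.card (I.F.obj X),
        Layer (Fintype.card (I.F.obj X)) (S I ν x) (N I ν x) (x i) v ∧ T I ν x v) := by
  intro r ℓ hℓ hr
  obtain ⟨cC, pC, hC⟩ := exists_certify X (ι := Option ι)
    (S := fun I ν y => S I ν fun i => y (some i)) (N := fun I ν y => N I ν fun i => y (some i))
    (hS.rename (Option.map some)) (hN.rename (Option.map (Option.map some))) (some i) none
    (fun o => o.elim (ℓ + 1) r) (ℓ := ℓ + 4) (by omega) fun o => by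
      rcases o with _ | i
      exacts [show ℓ + 1 < ℓ + 4 by omega, (hr i).trans (by omega)]
  obtain ⟨cT, pT, hT⟩ := hT (fun o => o.elim (ℓ + 1) r) (ℓ + 4) (by omega) fun o => by
      rcases o with _ | i
      exacts [show ℓ + 1 < ℓ + 4 by omega, (hr i).trans (by omega)]
  refine ⟨.seq (.instr (.const ℓ 0)) (.seq (.instr (.card (ℓ + 1) X))
    (.seq (.instr (.copy (ℓ + 2) (r c))) (.seq (.ifNZ (ℓ + 1) (.loop
      (.seq (.instr (.minus (ℓ + 1) (ℓ + 1) 1)) (.seq (.instr (.choose (ℓ + 3)))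
        (.seq (.ifNZ (ℓ + 3) (.seq cC (.seq (.instr (.minus (ℓ + 2) (ℓ + 2) 1))
          (.seq cT (.ifNZ (ℓ + 4) (.instr (.const ℓ 1)))))))
        (.instr (.minus (ℓ + 3) 1 (ℓ + 1)))))) (ℓ + 3)))
      (.ifNZ (ℓ + 2) (.loop .skip 0))))),
    ⟨trivial, trivial, trivial, ⟨trivial, trivial, ⟨pC, trivial, pT, trivial⟩, trivial⟩, trivial⟩,
    fun I ν a m σ h0 h1 hx => .seq (.set (.seq (.card (.seq (.copy (.seq ?_))))))⟩
  generalize hxx : (fun i => σ.mem (r i)) = x at hx ⊢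
  replace hxx : ∀ i, σ.mem (r i) = x i := fun i => congrFun hxx i
  have hn : (I.input ν a).card X = Fintype.card (I.F.obj X) := rfl
  rw [hn]
  set n := Fintype.card (I.F.obj X)
  have hl := hr c
  rw [St.put_mem_ne _ _ (by omega), St.put_mem_ne _ _ (by omega), hxx c, hx]
  set L := layerSet n (S I ν x) (N I ν x) (x i) with hL
  set σ1 := ((σ.put ℓ 0).put (ℓ + 1) n).put (ℓ + 2) L.card with hσ1
  have t1 : Tally σ L (T I ν x) m ℓ n σ1 := by
    refine ⟨fun x hx => ?_, ?_, ∅, by simp, fun _ => ?_, ?_, ?_⟩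
    · rw [hσ1, St.put_mem_ne _ _ (by omega), St.put_mem_ne _ _ (by omega),
        St.put_mem_ne _ _ (by omega)]
    · rw [hσ1, St.put_mem_ne _ _ (by omega), St.put_mem_same]
    · refine (Finset.filter_eq_empty_iff.2 fun v hv => ?_).symm
      have := (mem_layerSet.1 hv).1
      omega
    · simp [hσ1]
    · rw [hσ1, St.put_mem_ne _ _ (by omega), St.put_mem_ne _ _ (by omega), St.put_mem_same]
      simp [flag]
  suffices hloop : Tr (I.input ν a) m (.ifNZ (ℓ + 1) (.loop
      (.seq (.instr (.minus (ℓ + 1) (ℓ + 1) 1)) (.seq (.instr (.choose (ℓ + 3)))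
        (.seq (.ifNZ (ℓ + 3) (.seq cC (.seq (.instr (.minus (ℓ + 2) (ℓ + 2) 1))
          (.seq cT (.ifNZ (ℓ + 4) (.instr (.const ℓ 1)))))))
        (.instr (.minus (ℓ + 3) 1 (ℓ + 1)))))) (ℓ + 3))) σ1 (Tally σ L (T I ν x) m ℓ 0) by
    refine hloop.mono fun σ2 t2 => ?_
    obtain ⟨D, d1, d2, d3, d4⟩ := t2.count
    simp only [Nat.zero_le, Finset.filter_true] at d1 d2
    refine .check (by rw [t2.keep 0 (by omega), h0]) (fun hz => ⟨t2.keep, ?_⟩) fun hm => ?_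
    -- This is the point of the count: the final check makes the counter `0`, so as many elements
    -- are certified as `L` has. As `D ⊆ L`, none was passed over, and a negative flag is
    -- trustworthy.
    · have hD : D = L := Finset.eq_of_subset_of_card_le d1 (by omega)
      rw [d4, hD]
      simp only [hL, mem_layerSet, and_assoc]
      rfl
    · rw [d3, d2 hm, Nat.sub_self]
  refine .ifNZ (fun hnz => ?_) fun hz => by rwa [← t1.pos, hz] at t1
  refine .loop (fun k σ' => Tally σ L (T I ν x) m ℓ k σ' ∧ 0 < k ∧ k ≤ n) ?_ (k := n)
    ⟨t1, by rw [← t1.pos]; omega, le_rfl⟩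
  rintro k σ2 ⟨t2, hk, hkn⟩
  obtain ⟨k, rfl⟩ : ∃ k', k = k' + 1 := ⟨k - 1, by omega⟩
  -- The bit guesses whether `k` belongs to the layer. A positive guess has to be certified, and a
  -- wrong negative one is discovered by the final count.
  refine .seq (.minus (.seq (.choose (b₀ := flag (k ∈ L)) (flag_le_one _) fun b hb hm =>
    .seq (Tr.mono (Q := Tally σ L (T I ν x) m ℓ k) ?_ fun σ3 t3 => .minus ?_))))
  · have e1 : σ2.mem 1 = 1 := by rw [t2.keep 1 (by omega), h1]
    have e2 : σ2.mem (ℓ + 1) - σ2.mem 1 = k := by rw [t2.pos, e1, Nat.add_sub_cancel]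
    rw [e2]
    set σ3 := (σ2.put (ℓ + 1) k).put (ℓ + 3) b with hσ3
    have k3 : ∀ x < ℓ + 3, x ≠ ℓ + 1 → σ3.mem x = σ2.mem x := fun x hx hne => by
      rw [hσ3, St.put_mem_ne _ _ (by omega), St.put_mem_ne _ _ hne]
    have k3' : σ3.mem (ℓ + 1) = k := by
      rw [hσ3, St.put_mem_ne _ _ (by omega), St.put_mem_same]
    have k3'' : σ3.mem (ℓ + 3) = b := by rw [hσ3, St.put_mem_same]
    refine .ifNZ (fun hb0 => .seq ?_) fun hb0 => t2.skip k3 k3' fun hm' => ?_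
    · have hbL : m = true → k ∈ L := fun hm' => by
        have := hm hm'
        rw [k3'', this] at hb0
        by_contra hc
        exact hb0 (flag_false hc)
      refine (hC I ν a m σ3 (fun o => o.elim k x) ?_ ?_ ?_ fun hm' => ?_).mono
        fun σ4 ⟨h2, h3⟩ => .seq (.minus (.seq ?_))
      · rw [k3 0 (by omega) (by omega), t2.keep 0 (by omega), h0]
      · rw [k3 1 (by omega) (by omega), e1]
      · rintro (_ | i)
        · exact k3'
        · have := hr i
          simp only [Option.elim]
          rw [k3 _ (by omega) (by omega), t2.keep _ this, hxx]
      · exact (mem_layerSet.1 (hbL hm')).2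
      · have hkL : k ∈ L := mem_layerSet.2 ⟨by omega, h3⟩
        have f1 : σ4.mem 1 = 1 := by rw [h2 1 (by omega), k3 1 (by omega) (by omega), e1]
        rw [f1, h2 (ℓ + 2) (by omega), k3 (ℓ + 2) (by omega) (by omega)]
        set σ5 := σ4.put (ℓ + 2) (σ2.mem (ℓ + 2) - 1) with hσ5
        have k5 : ∀ x < ℓ + 4, x ≠ ℓ + 2 → σ5.mem x = σ3.mem x := fun x hx hne => by
          rw [hσ5, St.put_mem_ne _ _ hne, h2 x hx]
        have k5' : ∀ x < ℓ + 1, σ5.mem x = σ2.mem x := fun x hx => by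
          rw [k5 x (by omega) (by omega), k3 x (by omega) (by omega)]
        refine (hT I ν a m σ5 ?_ ?_ trivial).mono fun σ6 ⟨h4, h5⟩ => ?_
        · rw [k5' 0 (by omega), t2.keep 0 (by omega), h0]
        · rw [k5' 1 (by omega), e1]
        · have h6 : ∀ i, σ5.mem (r i) = x i := fun i => by
            have := hr i
            rw [k5' _ (by omega), t2.keep _ this, hxx]
          simp only [Option.elim, h6] at h5
          rw [k5 _ (by omega) (by omega), k3'] at h5
          have k6 : ∀ x < ℓ + 1, σ6.mem x = σ2.mem x := fun x hx => by
            rw [h4 x (by omega), k5' x hx]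
          have k6' : σ6.mem (ℓ + 1) = k := by
            rw [h4 _ (by omega), k5 _ (by omega) (by omega), k3']
          have k6'' : σ6.mem (ℓ + 2) = σ2.mem (ℓ + 2) - 1 := by
            rw [h4 _ (by omega), hσ5, St.put_mem_same]
          refine .ifNZ (fun hf => .set (t2.step (fun x hx => ?_) ?_ ?_
            (fun _ => St.put_mem_same _ _ _) (fun h => ?_) hkL)) fun hf =>
            t2.step (fun x hx => ?_) ?_ ?_ (fun h => ?_) (fun _ => ?_) hkL
          · rw [St.put_mem_ne _ _ (by omega), k6 x (by omega)]
          · rw [St.put_mem_ne _ _ (by omega), k6']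
          · rw [St.put_mem_ne _ _ (by omega), k6'']
          · exact absurd (h5.trans (flag_false h)) hf
          · exact k6 x (by omega)
          · exact k6'
          · exact k6''
          · rw [h5, flag_eq_zero] at hf
            exact absurd h hf
          · exact k6 ℓ (by omega)
    · have := hm hm'
      rw [k3''] at hb0
      rwa [hb0, eq_comm, flag_eq_zero] at this
  · have f1 : σ3.mem 1 = 1 := by rw [t3.keep 1 (by omega), h1]
    rw [f1, t3.pos, St.put_mem_same]
    have t4 : Tally σ L (T I ν x) m ℓ k (σ3.put (ℓ + 3) (1 - k)) :=
      t3.of_mem fun x hx => St.put_mem_ne _ _ (by omega)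
    rcases Nat.eq_zero_or_pos k with rfl | hk0
    · exact .inl ⟨by simp, t4⟩
    · exact .inr ⟨by omega, k, by omega, t4, hk0, by omega⟩

/-- The size of the layer after one of known size can be computed. -/
theorem LogFun.card_layerSet_succ (X : J)
    (hS : LogDec fun I ν (y : Option ι → ℕ) => S I ν (fun i => y (some i)) (y none))
    (hN : LogDec fun I ν (y : Option (Option ι) → ℕ) =>
      N I ν (fun i => y (some (some i))) (y (some none)) (y none)) (i c : ι) :
    LogFun (fun I ν x =>
        x c = (layerSet (Fintype.card (I.F.obj X)) (S I ν x) (N I ν x) (x i)).card)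
      fun I ν x => (layerSet (Fintype.card (I.F.obj X)) (S I ν x) (N I ν x) (x i + 1)).card := by
  classical
  have h1 := (LogFun.existsIn (ι := Option ι) (S := fun I ν y => S I ν fun i => y (some i))
    (N := fun I ν y => N I ν fun i => y (some i))
    (T := fun I ν y v => N I ν (fun i => y (some i)) v (y none)) X
    (hS.rename (Option.map some)) (hN.rename (Option.map (Option.map some)))
    (hN.rename fun o => o.elim (some none) fun o => o.elim none fun i => some (some i))
    (some i) (some c))
  have h2 := LogFun.minus (LogFun.var (none : Option (Option ι)))
    ((LogFun.const 1).minus (((LogFun.const 1).minus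
      (LogFun.congr (LogFun.rename hS (some : Option ι → Option (Option ι)))
        fun I ν x h => ⟨trivial, rfl⟩)).minus (h1.rename (some : Option ι → Option (Option ι)))))
  -- Addition is not among the instructions allowed here, so the fold starts at the number of
  -- elements and subtracts one for each member of the next layer. A last subtraction from the
  -- number of elements gives the size.
  refine ((LogFun.card X).minus (LogFun.fold (F := fun I ν x k => Fintype.card (I.F.obj X) -
      ((layerSet (Fintype.card (I.F.obj X)) (S I ν x) (N I ν x) (x i + 1)).filter (k ≤ ·)).card) X
    ((LogFun.card X).congr fun I ν x hx => ⟨hx, ?_⟩)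
    (HB := fun I ν x _ _ => x c =
      (layerSet (Fintype.card (I.F.obj X)) (S I ν x) (N I ν x) (x i)).card)
    (B := fun I ν x k v => v - (1 - (1 - flag (S I ν x k) - flag (∃ w < Fintype.card (I.F.obj X),
      Layer (Fintype.card (I.F.obj X)) (S I ν x) (N I ν x) (x i) w ∧ N I ν x w k)))) h2
    fun I ν x k hx hk => ⟨hx, ?_⟩)).congr fun I ν x hx => ⟨hx, ?_⟩
  · rw [Finset.filter_eq_empty_iff.2 fun v hv => ?_]
    · simp
    · have := (mem_layerSet.1 hv).1
      omega
  · generalize hL : layerSet (Fintype.card (I.F.obj X)) (S I ν x) (N I ν x) (x i + 1) = L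
    have hkL : k ∈ L ↔ S I ν x k ∨ ∃ w < Fintype.card (I.F.obj X),
        Layer (Fintype.card (I.F.obj X)) (S I ν x) (N I ν x) (x i) w ∧ N I ν x w k := by
      rw [← hL, mem_layerSet, and_iff_right hk]; rfl
    have hsplit : (L.filter (k ≤ ·)).card = (L.filter (k + 1 ≤ ·)).card + flag (k ∈ L) := by
      by_cases hk' : k ∈ L
      · rw [flag_true hk', ← Finset.card_insert_of_notMem (a := k) (by simp)]
        congr 1
        ext v
        simp only [Finset.mem_insert, Finset.mem_filter]
        constructor
        · rintro ⟨h3, h4⟩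
          rcases h4.eq_or_lt with rfl | h4
          exacts [.inl rfl, .inr ⟨h3, h4⟩]
        · rintro (rfl | ⟨h3, h4⟩)
          exacts [⟨hk', le_rfl⟩, ⟨h3, by omega⟩]
      · rw [flag_false hk', Nat.add_zero]
        congr 1
        refine Finset.filter_congr fun v hv => ?_
        have : v ≠ k := fun h => hk' (h ▸ hv)
        omega
    rw [hsplit, flag_congr hkL, Nat.sub_sub]
    generalize (∃ w < Fintype.card (I.F.obj X), _) = p
    congr 2
    by_cases h3 : S I ν x k <;> by_cases h4 : p <;> simp [flag, h3, h4]
  · simp only [Nat.zero_le, Finset.filter_true]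
    refine Nat.sub_sub_self ?_
    simpa using Finset.card_le_card (t := Finset.range (Fintype.card (I.F.obj X))) fun v hv =>
      Finset.mem_range.2 (mem_layerSet.1 hv).1

/-- Reachability and its complement can be decided in nondeterministic logarithmic space. -/
theorem LogDec.reach (X : J)
    (hS : LogDec fun I ν (y : Option ι → ℕ) => S I ν (fun i => y (some i)) (y none))
    (hN : LogDec fun I ν (y : Option (Option ι) → ℕ) =>
      N I ν (fun i => y (some (some i))) (y (some none)) (y none))
    (hT : LogDec fun I ν (y : Option ι → ℕ) => T I ν (fun i => y (some i)) (y none))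
    (hlt : ∀ I ν x w v, N I ν x w v → w < Fintype.card (I.F.obj X))
    (hlt' : ∀ I ν x v, T I ν x v → v < Fintype.card (I.F.obj X)) :
    LogDec fun I ν x => ∃ u v, S I ν x u ∧ Relation.ReflTransGen (N I ν x) u v ∧ T I ν x v := by
  have hi : LogFun (fun _ _ _ => True) fun (I : Instance J U) ν (y : Option (Option ι) → ℕ) =>
      Fintype.card (I.F.obj X) - y (some none) - 1 :=
    ((LogFun.card X).minus (LogFun.var _)).minus (LogFun.const 1)
  have hstep := LogFun.card_layerSet_succ (ι := Option (Option (Option ι)))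
    (S := fun I ν y => S I ν fun i => y (some (some (some i))))
    (N := fun I ν y => N I ν fun i => y (some (some (some i)))) X
    (hS.rename (Option.map fun i => some (some (some i))))
    (hN.rename (Option.map (Option.map fun i => some (some (some i))))) none (some none)
  have hB := LogFun.bind (ι := Option (Option ι)) (H := fun I ν y => y none =
      (layerSet (Fintype.card (I.F.obj X)) (S I ν fun i => y (some (some i)))
        (N I ν fun i => y (some (some i))) (Fintype.card (I.F.obj X) - y (some none) - 1)).card)
    (H' := fun I ν y i => y none =
      (layerSet (Fintype.card (I.F.obj X)) (S I ν fun i => y (some (some i)))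
        (N I ν fun i => y (some (some i))) i).card)
    (K := fun I ν y i => (layerSet (Fintype.card (I.F.obj X)) (S I ν fun i => y (some (some i)))
        (N I ν fun i => y (some (some i))) (i + 1)).card)
    (hi.congr fun I ν x _ => ⟨trivial, rfl⟩) hstep fun I ν x hx => hx
  -- The fold runs downwards while layers are counted upwards, so state `k` is the size of the layer
  -- with index `card - k`. It begins with layer `0`, which is empty, and ends with the stable one.
  have hcount : LogFun (fun _ _ _ => True) fun I ν (x : ι → ℕ) =>
      (layerSet (Fintype.card (I.F.obj X)) (S I ν x) (N I ν x)
        (Fintype.card (I.F.obj X) - 0)).card := by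
    refine LogFun.fold (F := fun I ν x k => (layerSet (Fintype.card (I.F.obj X)) (S I ν x)
      (N I ν x) (Fintype.card (I.F.obj X) - k)).card) X
      ((LogFun.const 0).congr fun I ν x _ => ⟨trivial, ?_⟩) (HB := fun I ν x k v => v =
        (layerSet (Fintype.card (I.F.obj X)) (S I ν x) (N I ν x)
          (Fintype.card (I.F.obj X) - k - 1)).card)
      (B := fun I ν x k v => (layerSet (Fintype.card (I.F.obj X)) (S I ν x) (N I ν x)
          (Fintype.card (I.F.obj X) - k - 1 + 1)).card) hB fun I ν x k _ hk => ⟨rfl, ?_⟩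
    · rw [Nat.sub_self]
      exact (Finset.card_eq_zero.2 (Finset.eq_empty_of_forall_notMem fun v hv =>
        (mem_layerSet (i := 0).1 hv).2)).symm
    · congr 2
      omega
  have hfin := LogFun.existsIn (ι := Option (Option ι))
    (S := fun I ν y => S I ν fun i => y (some (some i)))
    (N := fun I ν y => N I ν fun i => y (some (some i)))
    (T := fun I ν y => T I ν fun i => y (some (some i))) X
    (hS.rename (Option.map fun i => some (some i)))
    (hN.rename (Option.map (Option.map fun i => some (some i))))
    (hT.rename (Option.map fun i => some (some i))) none (some none)
  have hi' : LogFun (fun (I : Instance J U) ν (y : Option ι → ℕ) => y none =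
      (layerSet (Fintype.card (I.F.obj X)) (S I ν fun i => y (some i))
        (N I ν fun i => y (some i)) (Fintype.card (I.F.obj X) - 0)).card)
      fun I ν y => Fintype.card (I.F.obj X) := LogFun.card X
  -- With the size of the last layer in the extra argument, `existsIn` decides whether this layer
  -- meets `T`, positively and negatively.
  have hfin' := LogFun.bind (ι := Option ι) (H' := fun I ν y i => y none =
      (layerSet (Fintype.card (I.F.obj X)) (S I ν fun i => y (some i))
        (N I ν fun i => y (some i)) i).card)
    (K := fun I ν y i => flag (∃ v < Fintype.card (I.F.obj X), Layer (Fintype.card (I.F.obj X))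
      (S I ν fun i => y (some i)) (N I ν fun i => y (some i)) i v ∧
        T I ν (fun i => y (some i)) v)) hi' hfin fun I ν x hx => hx
  refine (hcount.bind (H' := fun I ν x c => c = (layerSet (Fintype.card (I.F.obj X)) (S I ν x)
      (N I ν x) (Fintype.card (I.F.obj X) - 0)).card)
    (K := fun I ν x _ => flag (∃ v < Fintype.card (I.F.obj X), Layer (Fintype.card (I.F.obj X))
      (S I ν x) (N I ν x) (Fintype.card (I.F.obj X)) v ∧ T I ν x v)) hfin'
    fun _ _ _ _ => rfl).congr fun I ν x _ => ⟨trivial, flag_congr ?_⟩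
  constructor
  · rintro ⟨v, -, hL, hv⟩
    obtain ⟨u, hu, huv⟩ := (exists_layer_iff (hlt I ν x)).1 ⟨_, hL⟩
    exact ⟨u, v, hu, huv, hv⟩
  · rintro ⟨u, v, hu, huv, hv⟩
    obtain ⟨i, hL⟩ := (exists_layer_iff (hlt I ν x)).2 ⟨u, hu, huv⟩
    have := hlt' I ν x v hv
    exact ⟨v, this, hL.of_lt this, hv⟩

end Counting

end CatQuery
end
set_option linter.unusedSectionVars false
noncomputable section
namespace CatQuery

/-! ### The core language in nondeterministic logarithmic space -/

section CoreSpace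

variable {J U : Type} [SmallCategory J] [DecidableEq J] [Fintype J] [DataDomain U]
  {ι : Type}

theorem LogFun.app (f : Mor J) (i : ι) : LogFun (fun _ _ _ => True)
    fun (I : Instance J U) ν (x : ι → ℕ) => (I.input ν []).app f (x i) :=
  .instr (fun r ℓ => .app ℓ f (r i)) (by simp [Instr.Pure]) (by simp) fun _ _ _ _ _ _ => rfl

namespace LogDec

theorem lt_card (X : J) (i : ι) : LogDec fun (I : Instance J U) _ (x : ι → ℕ) =>
    x i < Fintype.card (I.F.obj X) := lt (LogFun.var i) (LogFun.card X)

/-- Validity of both numbers is tested separately, because the input maps invalid numbers to `0`;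
the comparison may then be meaningless, but it cannot produce a wrong positive answer. -/
theorem valRel (ρ : ValRel) (f g : Mor J) (i j : ι) :
    LogDec fun (I : Instance J U) ν (x : ι → ℕ) =>
      ∃ u v, fval ν f (x i) = some u ∧ fval ν g (x j) = some v ∧ ρ.Holds u v := by
  have hrel : LogFun (fun _ _ _ => True) fun (I : Instance J U) ν (y : Bool → ℕ) =>
      flag (∃ u v, (I.input ν []).value f.2.1 (y false) = some u ∧
        (I.input ν []).value g.2.1 (y true) = some v ∧ ρ.Holds u v) := by
    cases ρ with
    | cmp θ =>
      exact LogFun.instr (fun r ℓ => .cmp ℓ θ f.2.1 (r false) g.2.1 (r true))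
        (by simp [Instr.Pure]) (by simp) fun _ _ _ _ _ _ => rfl
    | tree τ =>
      exact LogFun.instr (fun r ℓ => .tree ℓ τ f.2.1 (r false) g.2.1 (r true))
        (by simp [Instr.Pure]) (by simp) fun _ _ _ _ _ _ => rfl
  refine congr (((lt_card f.1 i).and (lt_card g.1 j)).and
    (LogFun.comp₂ (K := fun (I : Instance J U) ν a b =>
      flag (∃ u v, (I.input ν []).value f.2.1 a = some u ∧
        (I.input ν []).value g.2.1 b = some v ∧ ρ.Holds u v)) hrel (LogFun.app f i)
          (LogFun.app g j))) fun I ν d => ?_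
  constructor
  · rintro ⟨⟨h1, h2⟩, h3⟩
    rwa [input_value ν [] h1, input_value ν [] h2] at h3
  · rintro ⟨u, v, h1, h2, h3⟩
    refine ⟨⟨lt_of_fval h1, lt_of_fval h2⟩, u, v, ?_, ?_, h3⟩
    · rw [input_value ν [] (lt_of_fval h1), h1]
    · rw [input_value ν [] (lt_of_fval h2), h2]

theorem valConst (f : Mor J) (θ : Cmp) (α : U) (i : ι) :
    LogDec fun (I : Instance J U) ν (x : ι → ℕ) => ∃ u, fval ν f (x i) = some u ∧ θ.Holds u α := by
  have hrel : LogFun (fun _ _ _ => True) fun (I : Instance J U) ν (y : Option ι → ℕ) =>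
      flag (∃ u, (I.input ν []).value f.2.1 (y none) = some u ∧ θ.Holds u α) :=
    LogFun.instr (fun r ℓ => .cmpConst ℓ θ f.2.1 (r none) α)
        (by simp [Instr.Pure]) (by simp) fun _ _ _ _ _ _ => rfl
  refine congr ((lt_card f.1 i).and ((LogFun.app f i).bind (H' := fun _ _ _ _ => True)
    (K := fun (I : Instance J U) ν d a =>
      flag (∃ u, (I.input ν []).value f.2.1 a = some u ∧ θ.Holds u α)) hrel
    fun _ _ _ _ => trivial)) fun I ν d => ?_
  constructor
  · rintro ⟨h1, h3⟩
    rwa [input_value ν [] h1] at h3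
  · rintro ⟨u, h1, h3⟩
    exact ⟨lt_of_fval h1, u, by rw [input_value ν [] (lt_of_fval h1), h1], h3⟩

theorem atom (a : Atom J U) : LogDec fun (I : Instance J U) ν (d : J → ℕ) => a.Sem ν d := by
  cases a with
  | bin ρ f g => exact valRel ρ f g f.1 g.1
  | const f θ α => exact valConst f θ α f.1

theorem veq (f g : Mor J) (i j : ι) :
    LogDec fun (I : Instance J U) ν (x : ι → ℕ) => CatQuery.veq ν f (x i) g (x j) :=
  (valRel (.cmp .eq) f g i j).congr fun I ν x => by
    constructor
    · rintro ⟨u, v, h, h', h''⟩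
      have : u = v := h''
      subst this
      exact ⟨u, h, h'⟩
    · rintro ⟨u, h, h'⟩
      exact ⟨u, u, h, h', rfl⟩

/-- Several components are quantified one at a time, the others being read from `y`. The number of
registers grows with the list only, so it is bounded in terms of `J`. -/
theorem exList {P : ∀ I : Instance J U, Numbering I → (ι → ℕ) → (J → ℕ) → Prop}
    (hP : LogDec fun I ν (y : ι ⊕ J → ℕ) => P I ν (fun i => y (.inl i)) fun Z => y (.inr Z))
    (L : List J) : LogDec fun I ν (y : ι ⊕ J → ℕ) => ∃ d : J → ℕ, (∀ Z ∉ L, d Z = y (.inr Z)) ∧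
      (∀ Z ∈ L, d Z < Fintype.card (I.F.obj Z)) ∧ P I ν (fun i => y (.inl i)) d := by
  induction L with
  | nil =>
    refine hP.congr fun I ν y => ⟨fun h => ⟨_, fun _ _ => rfl, by simp, h⟩, ?_⟩
    rintro ⟨d, h, -, hd⟩
    rwa [show d = fun Z => y (.inr Z) from funext fun Z => h Z (by simp)] at hd
  | cons X L ih =>
    have h1 := LogFun.rename ih (κ := Option (ι ⊕ J)) (Sum.elim (fun i => some (.inl i))
      fun Z => if Z = X then none else some (.inr Z))
    refine (LogDec.ex (P := fun I ν (y : ι ⊕ J → ℕ) k => ∃ d : J → ℕ,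
      (∀ Z ∉ L, d Z = if Z = X then k else y (.inr Z)) ∧
      (∀ Z ∈ L, d Z < Fintype.card (I.F.obj Z)) ∧ P I ν (fun i => y (.inl i)) d) X
      (LogDec.congr h1 fun I ν y => ?_)).congr fun I ν y => ?_
    · simp only [Sum.elim_inl, Sum.elim_inr, apply_ite y]
    · constructor
      · rintro ⟨k, hk, d, h2, h3, h4⟩
        refine ⟨d, fun Z hZ => ?_, fun Z hZ => ?_, h4⟩
        · simp only [List.mem_cons, not_or] at hZ
          rw [h2 Z hZ.2, if_neg hZ.1]
        · by_cases hL : Z ∈ L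
          · exact h3 Z hL
          · obtain rfl := (List.mem_cons.1 hZ).resolve_right hL
            rwa [h2 Z hL, if_pos rfl]
      · rintro ⟨d, h2, h3, h4⟩
        refine ⟨d X, h3 X (by simp), d, fun Z hZ => ?_, fun Z hZ => h3 Z (by simp [hZ]), h4⟩
        split_ifs with h
        · rw [h]
        · exact h2 Z (by simp [h, hZ])

theorem image {P : ∀ I : Instance J U, Numbering I → (J → ℕ) → Prop} (hP : LogDec P)
    (A B : Finset J) (lk : J → Mor J) : LogDec fun I ν d => Image ν A B lk (P I ν) d := by
  have h1 : LogDec fun I ν (y : J ⊕ J → ℕ) => P I ν (fun Z => y (.inr Z)) ∧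
      ∀ X ∈ B.toList, CatQuery.veq ν (lk X) (y (.inr (lk X).1)) (ident X) (y (.inl X)) :=
    LogDec.and (LogFun.rename hP Sum.inr) (forall_mem _ fun X _ => veq _ _ _ _)
  -- Sending the second copy of all components to `none` makes those outside of `A` equal to `0`, as
  -- `Image` demands; those in `A` are quantified.
  have h2 := LogFun.subst (exList (P := fun I ν d d' => P I ν d' ∧ ∀ X ∈ B.toList,
    CatQuery.veq ν (lk X) (d' (lk X).1) (ident X) (d X)) h1 A.toList) (κ := J)
    (Sum.elim some fun _ => none)
  exact LogDec.congr h2 fun I ν d => by simp [Image]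

variable {K : ∀ I : Instance J U, Numbering I → (J → ℕ) → Prop}

theorem single (hK : LogDec K) (E : J) (i : ι) :
    LogDec fun I ν (x : ι → ℕ) => K I ν (Pi.single E (x i)) :=
  LogDec.congr (LogFun.subst hK fun Z => if Z = E then some i else none) fun I ν x => by
    rw [show (fun Z => (if Z = E then some i else none : Option ι).elim 0 x) =
      Pi.single E (x i) from funext fun Z => by rw [Pi.single_apply]; split_ifs <;> rfl]

theorem start (hK : LogDec K) (w : WalkSpec J) (i j : ι) : LogDec fun I ν (x : ι → ℕ) =>
    w.start ν (fun k => K I ν (Pi.single w.E k)) (x i) (x j) :=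
  (single hK w.E j).and (veq _ _ _ _)

theorem next (hK : LogDec K) (w : WalkSpec J) (i j : ι) : LogDec fun I ν (x : ι → ℕ) =>
    w.next ν (fun k => K I ν (Pi.single w.E k)) (x i) (x j) :=
  (single hK w.E j).and (veq _ _ _ _)

/-- Since `h` is fixed by the query, each hop may be one more existential quantifier over an edge,
at the price of a fixed number of additional registers. -/
theorem hops (hK : LogDec K) (w : WalkSpec J) (h : ℕ) : LogDec fun I ν (y : Option J → ℕ) =>
    ∃ k, w.start ν (fun k => K I ν (Pi.single w.E k)) (y (some w.X)) k ∧
      Hops (w.next ν fun k => K I ν (Pi.single w.E k)) h k (y none) := by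
  induction h with
  | zero => exact (start hK w (some w.X) none).congr fun I ν y => by simp [Hops]
  | succ h ih =>
    have h1 := LogDec.and (LogFun.rename ih fun o => o.elim none fun Z => some (some Z))
      (next hK w none (some none))
    refine (LogDec.ex (ι := Option J) (P := fun I ν y v =>
      (∃ k, w.start ν (fun k => K I ν (Pi.single w.E k)) (y (some w.X)) k ∧
        Hops (w.next ν fun k => K I ν (Pi.single w.E k)) h k v) ∧
      w.next ν (fun k => K I ν (Pi.single w.E k)) v (y none)) w.E h1).congr fun I ν y => ?_
    constructor
    · rintro ⟨v, -, ⟨k, hk, h2⟩, h3⟩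
      exact ⟨k, hk, v, h2, h3⟩
    · rintro ⟨k, hk, v, h2, h3⟩
      exact ⟨v, h3.2.lt_left, ⟨k, hk, h2⟩, h3⟩

/-- All core operators reduce to Boolean operations and quantifiers over elements, except `reach`,
which is the only place where inductive counting is needed. -/
theorem core (e : Core J U) : LogDec fun (I : Instance J U) ν d => e.Sem ν d := by
  induction e with
  | atoms l => exact forall_mem l fun a _ => atom a
  | not e ih => exact ih.not
  | and e e' ih ih' => exact ih.and ih'
  | image A B lk e ih => exact ih.image A B lk
  | divide A B e e' ih ih' =>
    exact (ih.image A B ident).and ((ih'.and ih.not).image A B ident).not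
  | reach w K ih =>
    have hT : LogDec fun (I : Instance J U) ν (y : Option J → ℕ) =>
      w.fin ν (y none) (y (some w.Y)) := veq _ _ _ _
    exact LogDec.reach (ι := J)
      (S := fun I ν d k => w.start ν (fun k => K.Sem ν (Pi.single w.E k)) (d w.X) k)
      (N := fun I ν _ k k' => w.next ν (fun k => K.Sem ν (Pi.single w.E k)) k k')
      (T := fun I ν d k => w.fin ν k (d w.Y)) w.E (start ih w (some w.X) none)
      (next ih w (some none) none) hT (fun I ν d k k' h => h.2.lt_left)
      fun I ν d k h => veq.lt_left h
  | hop w h K ih =>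
    have hT : LogDec fun (I : Instance J U) ν (y : Option J → ℕ) =>
      w.fin ν (y none) (y (some w.Y)) := veq _ _ _ _
    refine (LogDec.ex (P := fun I ν d k' =>
      (∃ k, w.start ν (fun k => K.Sem ν (Pi.single w.E k)) (d w.X) k ∧
        Hops (w.next ν fun k => K.Sem ν (Pi.single w.E k)) h k k') ∧ w.fin ν k' (d w.Y)) w.E
      ((hops ih w h).and hT)).congr fun I ν d => ?_
    constructor
    · rintro ⟨k', -, ⟨k, hk, h1⟩, h2⟩
      exact ⟨k, k', hk, h1, h2⟩
    · rintro ⟨k, k', hk, h1, h2⟩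
      exact ⟨k', veq.lt_left h2, ⟨k, hk, h1⟩, h2⟩

end LogDec

end CoreSpace

end CatQuery
end
set_option linter.unusedSectionVars false
noncomputable section
namespace CatQuery

/-! ### Membership programs -/

section Membership

variable {J U : Type} [SmallCategory J]

/-- The register that an instruction sets, if the number of this register is fixed. -/
def Instr.dest : Instr J U → ℕ
  | const d _ | copy d _ | minus d _ _ | card d _ | app d _ _ | cmp d _ _ _ _ _ |
    cmpConst d _ _ _ _ | tree d _ _ _ _ _ | arg d _ | choose d => d
  | _ => 0

/-- The constant in an instruction. -/
def Instr.lit : Instr J U → ℕ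
  | const _ k => k
  | _ => 0

variable [DataDomain U]

/-- Subtraction, copying and input instructions never exceed the largest of the input numbers, the
constants of the program, and `1` for flags and guessed bits. Without indirect stores, a nonzero
register is the fixed destination of some instruction. This holds on all computations, including
those that never halt. -/
theorem Program.Reaches.mem_le {P : Program J U} {inp : Input J U} {N : ℕ} (h1 : 1 ≤ N)
    (hP : ∀ i ∈ P, (i.Pure ∨ i.IsJump) ∧ i.lit ≤ N) (hcard : ∀ X, inp.card X ≤ N)
    (happ : ∀ f k, inp.app f k ≤ N) (harg : ∀ k, inp.arg k ≤ N) {c : Config}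
    (h : P.Reaches inp c) (a : ℕ) :
    c.mem a ≤ N ∧ (c.mem a ≠ 0 → a ∈ (P.map Instr.dest).toFinset) := by
  induction h generalizing a with
  | refl => simp [Config.init]
  | @tail c c' _ hstep ih =>
    obtain ⟨b, rfl⟩ := hstep
    unfold Program.step
    split
    · exact ih a
    · rename_i i hi
      have hiP : i ∈ P := List.mem_of_getElem? hi
      obtain ⟨hpure, hlit⟩ := hP i hiP
      have hd : i.dest ∈ (P.map Instr.dest).toFinset :=
        List.mem_toFinset.2 (List.mem_map_of_mem hiP)
      have key : ∀ v ≤ N, (c.put i.dest v).mem a ≤ N ∧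
          ((c.put i.dest v).mem a ≠ 0 → a ∈ (P.map Instr.dest).toFinset) := fun v hv => by
        by_cases ha : a = i.dest
        · subst ha
          exact ⟨by simpa [Config.put, Finsupp.coe_update] using hv, fun _ => hd⟩
        · simpa [Config.put, Finsupp.coe_update, Function.update_of_ne ha] using ih a
      cases i with
      | const d k => exact key k hlit
      | copy d r => exact key _ (ih r).1
      | plus d r s => simp [Instr.Pure, Instr.IsJump] at hpure
      | minus d r s => exact key _ ((Nat.sub_le _ _).trans (ih r).1)
      | load d r => simp [Instr.Pure, Instr.IsJump] at hpure
      | store d r => simp [Instr.Pure, Instr.IsJump] at hpure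
      | jumpZero r l =>
        simp only [Instr.exec]
        split_ifs <;> exact ih a
      | card d X => exact key _ (hcard X)
      | app d f r => exact key _ (happ f _)
      | cmp d θ X r Y s => exact key _ (by split_ifs <;> omega)
      | cmpConst d θ X r α => exact key _ (by split_ifs <;> omega)
      | tree d τ X r Y s => exact key _ (by split_ifs <;> omega)
      | arg d k => exact key _ (harg k)
      | choose d => exact key _ ((Bool.toNat_le b).trans h1)
      | out ch r => simp [Instr.Pure, Instr.IsJump] at hpure

/-- The additive constant `k` of the program is absorbed into a factor, so that the bound has the
required form, a constant times `log n + 1`. -/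
theorem size_add_le (n k : ℕ) : Nat.size (n + k) ≤ (Nat.size k + 2) * (Nat.log 2 n + 1) := by
  have h1 : n < 2 ^ (Nat.log 2 n + 1) := Nat.lt_pow_succ_log_self (by norm_num) n
  have h2 : k < 2 ^ Nat.size k := Nat.lt_size_self k
  have h3 : Nat.size (n + k) ≤ Nat.log 2 n + 1 + (Nat.size k + 1) := by
    rw [Nat.size_le]
    have h4 : 2 ≤ 2 ^ (Nat.log 2 n + 1) := Nat.le_self_pow (by omega) 2
    have h5 : 2 ^ (Nat.size k + 1) = 2 * 2 ^ Nat.size k := by ring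
    rw [pow_add, h5]
    nlinarith [Nat.one_le_two_pow (n := Nat.size k)]
  nlinarith [Nat.zero_le (Nat.size k * Nat.log 2 n)]

/-- A program that only handles numbers of elements uses logarithmic space. -/
theorem Program.exists_space_le (P : Program J U) (hP : ∀ i ∈ P, i.Pure ∨ i.IsJump) :
    ∃ c : ℕ, ∀ (I : Instance J U) (ν : Numbering I) (T : Finset J) (t : Tuple I T) (n : ℕ),
      (∀ X, Fintype.card (I.F.obj X) ≤ n) → ∀ s, P.Reaches (I.input ν (t.code ν)) s →
        s.space ≤ c * (Nat.log 2 n + 1) := by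
  set D := (P.map Instr.dest).toFinset with hD
  set k := (P.map Instr.lit).sum + 1 with hk
  refine ⟨D.card * (Nat.size k + 2) + ∑ a ∈ D, Nat.size a, fun I ν T t n hn s hs => ?_⟩
  have hmem := fun a => Program.Reaches.mem_le (N := n + k) (by omega) (fun i hi => ⟨hP i hi, by
      have := List.single_le_sum (by simp) _ (List.mem_map_of_mem (f := Instr.lit) hi)
      omega⟩)
    (fun X => (hn X).trans (by omega)) (fun f l => by
      simp only [Instance.input]
      split_ifs
      · exact (Fin.is_lt _).le.trans ((hn _).trans (by omega))
      · omega)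
    (fun l => by
      simp only [Instance.input, Tuple.code, List.getD_eq_getElem?_getD, List.getElem?_map]
      cases T.attach.toList[l]? with
      | none => simp
      | some X => exact (Fin.is_lt _).le.trans ((hn _).trans (by omega))) hs a
  calc s.space ≤ ∑ a ∈ D, (Nat.size a + Nat.size (n + k)) := by
        refine (Finset.sum_le_sum fun a _ => Nat.add_le_add_left
          (Nat.size_le_size (hmem a).1) _).trans (Finset.sum_le_sum_of_subset fun a ha =>
            (hmem a).2 (Finsupp.mem_support_iff.1 ha))
    _ = ∑ a ∈ D, Nat.size a + D.card * Nat.size (n + k) := by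
        rw [Finset.sum_add_distrib, Finset.sum_const, smul_eq_mul]
    _ ≤ _ := by
        have := Nat.mul_le_mul_left D.card (size_add_le n k)
        nlinarith [Nat.zero_le ((∑ a ∈ D, Nat.size a) * Nat.log 2 n)]

theorem Program.Steps.eq_of_halted {P : Program J U} {inp : Input J U} {t : ℕ} {c c' : Config}
    (h : P.Steps inp t c c') (hc : P.Halted c) : c' = c := by
  induction t with
  | zero => exact h.symm
  | succ t ih =>
    obtain ⟨b, hb⟩ := h
    have : P.step inp b c = c := by
      rw [Program.step, List.getElem?_eq_none hc]
    rw [this] at hb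
    exact ih hb

/-- The universal mode shows that an accepting computation is right, by decomposing it with
`Program.Steps.big`. The existential mode provides an accepting computation when `p` holds. -/
theorem Cmd.accepts_iff {cmd : Cmd J U} (hp : cmd.All Instr.Pure) {inp : Input J U} {p : Prop}
    (h : ∀ m, Tr inp m cmd Config.init.toSt fun σ => σ.mem 0 = flag p) :
    Program.Accepts (cmd.compile 0) inp ↔ p := by
  have hP : Program.CodeAt (cmd.compile 0) 0 (cmd.compile 0) := ⟨[], [], by simp, rfl⟩
  constructor
  · rintro ⟨c, hr, hh, h1⟩
    obtain ⟨t, hs⟩ := hr.steps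
    obtain ⟨t1, t2, c1, hb, hpc, -, hs2⟩ :=
      hs.big (hp.mono fun i hi => hi.not_isJump) hP rfl hh
    have hc := hs2.eq_of_halted (by simp [Program.Halted, hpc])
    have h2 : c1.mem 0 = flag p := h false _ _ hb
    rwa [← hc, h1, eq_comm, flag_eq_one] at h2
  · intro hp'
    obtain ⟨t, σ, hb, h0⟩ := h true
    obtain ⟨c, hs, hpc, rfl⟩ := hb.steps hP rfl rfl
    exact ⟨c, hs.reaches, by simp [Program.Halted, hpc], h0.trans (flag_true hp')⟩

/-- Copy the first `k` numbers of the candidate answer to registers. -/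
def readArgs : ℕ → Cmd J U
  | 0 => .instr (.const 1 1)
  | k + 1 => .seq (readArgs k) (.instr (.arg (k + 2) k))

theorem readArgs_pure (k : ℕ) : (readArgs k : Cmd J U).All Instr.Pure := by
  induction k with
  | zero => trivial
  | succ k ih => exact ⟨ih, trivial⟩

theorem tr_readArgs (inp : Input J U) (m : Bool) (k : ℕ) :
    Tr inp m (readArgs k) Config.init.toSt fun σ => σ.mem 0 = 0 ∧ σ.mem 1 = 1 ∧
      ∀ i < k, σ.mem (i + 2) = inp.arg i := by
  induction k with
  | zero => exact .set ⟨by simp [St.put_mem, Config.toSt, Config.init], by simp, by simp⟩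
  | succ k ih =>
    refine .seq (ih.mono fun σ ⟨h0, h1, h2⟩ => .instr (by simp [Instr.IsJump]) (by simp) ?_)
    simp only [Instr.eff]
    refine ⟨by rw [St.put_mem_ne _ _ (by omega), h0], by rw [St.put_mem_ne _ _ (by omega), h1],
      fun i hi => ?_⟩
    rcases Nat.lt_succ_iff_lt_or_eq.1 hi with hi | rfl
    · rw [St.put_mem_ne _ _ (by omega), h2 i hi]
    · exact St.put_mem_same _ _ _

variable [DecidableEq J]

/-- A target that is decided in logarithmic space has a membership program. -/
theorem LogDec.inNSpaceLog {P : ∀ I : Instance J U, Numbering I → (J → ℕ) → Prop} (hP : LogDec P)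
    (Q : Target J U) (hQ : ∀ (I : Instance J U) (ν : Numbering I) (t : Tuple I Q.T) (d : J → ℕ),
      IsCode ν t d → (P I ν d ↔ t ∈ Q.answer I)) : InNSpaceLog Q := by
  set l := Q.T.attach.toList with hl
  have hlt : ∀ X, l.idxOf X < l.length := fun X => List.idxOf_lt_length_iff.2 (by simp [hl])
  -- The candidate answer is read into registers from `2` on, as `0` and `1` hold constants. Objects
  -- outside of `Q.T` are read from register `0`; their numbers do not matter, since `hQ` applies to
  -- every assignment that extends the code of the tuple.
  obtain ⟨c, hc, hP⟩ := hP (fun X => if h : X ∈ Q.T then l.idxOf ⟨X, h⟩ + 2 else 0)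
    (l.length + 2) (by omega) fun X => by
      split_ifs with h
      · have := hlt ⟨X, h⟩
        omega
      · omega
  have hpure : Cmd.All Instr.Pure
      (.seq (readArgs l.length) (.seq c (.instr (.copy 0 (l.length + 2)))) : Cmd J U) :=
    ⟨readArgs_pure _, hc, trivial⟩
  obtain ⟨k, hk⟩ := Program.exists_space_le (Cmd.compile
    (.seq (readArgs l.length) (.seq c (.instr (.copy 0 (l.length + 2))))) 0)
    (Cmd.All.compile (p := fun i => i.Pure ∨ i.IsJump) (fun _ _ => .inr trivial)
      (hpure.mono fun i hi => .inl hi) 0)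
  refine ⟨_, k, fun I ν t => ⟨Cmd.accepts_iff hpure fun m => ?_, fun n _ hn s hs =>
    hk I ν Q.T t n hn s hs⟩⟩
  refine .seq ((tr_readArgs _ m _).mono fun σ ⟨h0, h1, h2⟩ => .seq
    ((hP I ν _ m σ h0 h1 trivial).mono fun σ' ⟨_, h3⟩ => .copy ?_))
  rw [St.put_mem_same, h3]
  refine flag_congr (hQ I ν t _ fun X => ?_)
  rw [dif_pos X.2, h2 _ (hlt _)]
  simp only [Instance.input, Tuple.code]
  rw [List.getD_eq_getElem _ _ (by simpa [hl] using hlt X), List.getElem_map]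
  exact congrArg (fun Y : {X // X ∈ Q.T} => (ν Y.1 (t Y) : ℕ)) (List.getElem_idxOf (hlt X)).symm

variable [Fintype J]

/-- Membership in the answers of an algebra query is in nondeterministic logarithmic space. -/
theorem AlgebraQuery.inNSpaceLog (Q : AlgebraQuery J U) : ∀ T ∈ Q.targets, InNSpaceLog T := by
  intro T hT
  obtain ⟨e, -, rfl⟩ := List.mem_map.1 hT
  exact (LogDec.core e.2.core).inNSpaceLog _ fun I ν t d h =>
    (Alg.sem_core e.2 d).trans h.codeIn_iff

/-- Membership in the answers of a calculus query is in nondeterministic logarithmic space. -/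
theorem CalculusQuery.inNSpaceLog (Q : CalculusQuery J U) : ∀ T ∈ Q.targets, InNSpaceLog T := by
  intro T hT
  obtain ⟨T, -, rfl⟩ := List.mem_map.1 hT
  refine ((LogDec.core Q.body.core).image Q.A T.1 ident).inNSpaceLog _ fun I ν t d h => ?_
  exact (image_ident_codeIn (fun d => Formula.sem_core Q.body d) T.2).trans h.codeIn_iff

end Membership

end CatQuery
end
theorem mainTheorem3 :
    (∃ c : ℕ, ∀ (J U : Type) [CategoryTheory.SmallCategory J] [CategoryTheory.FinCategory J]
        [DecidableEq J] [Nonempty J] [CatQuery.DataDomain U],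
      (∀ Q : CatQuery.CalculusQuery J U, CatQuery.ComputableInTime Q.targets
        fun n => c * Q.size * (CatQuery.numMorphisms J * n ^ CatQuery.numObjects J)) ∧
      (∀ Q : CatQuery.AlgebraQuery J U, CatQuery.ComputableInTime Q.targets
        fun n => c * Q.size * (CatQuery.numMorphisms J * n ^ CatQuery.numObjects J))) ∧
    (∀ (J U : Type) [CategoryTheory.SmallCategory J] [CategoryTheory.FinCategory J]
        [DecidableEq J] [Nonempty J] [CatQuery.DataDomain U],
      (∀ Q : CatQuery.CalculusQuery J U, ∀ T ∈ Q.targets, CatQuery.InNSpaceLog T) ∧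
      (∀ Q : CatQuery.AlgebraQuery J U, ∀ T ∈ Q.targets, CatQuery.InNSpaceLog T)) :=
  ⟨⟨30000, fun _ _ => ⟨CatQuery.CalculusQuery.computableInTime,
      CatQuery.AlgebraQuery.computableInTime⟩⟩,
    fun _ _ => ⟨CatQuery.CalculusQuery.inNSpaceLog, CatQuery.AlgebraQuery.inNSpaceLog⟩⟩
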